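/- Let $k$ be a field of characteristic zero; all spaces are $\mathbb Z/2$-graded. Let $\mathcal O$ be a cyclic dg operad over $k$ with unit $\mathrm{Id}\in\mathcal O(1)$, all $\mathcal O(n)$, $n\ge 0$, finite-dimensional, which has an even weakly unital multiplication, i.e. an even element $m_2\in\mathcal O(2)$ such that the maps $m_2(-\otimes \mathrm{Id}),\,m_2(\mathrm{Id}\otimes -):\mathcal O(0)\to\mathcal O(1)$ have image in $k\cdot\mathrm{Id}$ and are not both zero. An inner product space is a finite-dimensional space with an even nondegenerate graded-symmetric bilinear form. For an inner product space $V$ with parity reversion $\Pi V$ let $$\hat C_{\mathcal O}(V)=\prod_{n\ge 0}\mathcal O(n)\otimes_{S_n}(\Pi V^*)^{\otimes n}$$ be the completed free $\mathcal O$-algebra on $\Pi V^*$, with the differential $d$ induced by that of $\mathcal O$. Continuous derivations of $\hat C_{\mathcal O}(V)$ are identified with $\operatorname{Hom}(\Pi V^*,\hat C_{\mathcal O}(V))$; let $\operatorname{CDer}(\hat C_{\mathcal O}(V))$ be the Lie superalgebra (with the graded commutator) of cyclic derivations, i.e. those whose component of each arity $n$, viewed by means of the inner product as a tensor in $\mathcal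 O(n)\otimes(\Pi V^*)^{\otimes (n+1)}$, is $S_{n+1}$-invariant, and let $\operatorname{CDer}^0(\hat C_{\mathcal O}(V))$ be the subalgebra of cyclic derivations without constant (arity $0$) term. A structure of an uncurved cyclic algebra over the cobar construction $C(\mathcal O)$ on $V$ is an odd $\xi\in\operatorname{CDer}^0(\hat C_{\mathcal O}(V))$ with $(d+\xi)^2=0$; it makes $\operatorname{CDer}^0\subseteq\operatorname{CDer}$ formal dg Lie algebras with differential $[d+\xi,-]$ (for $\xi=0$ the differential is the one induced by $\mathcal O$). For a formal dg Lie algebra $\mathfrak g$ let $\operatorname{CE}_\bullet(\mathfrak g)=(S\Pi\mathfrak g^*)^*=\hat S\Pi\mathfrak g$ be its Chevalley–Eilenberg complex of chains, and let $\overline{\operatorname{CE}}_\bullet(\mathfrak g)=\prod_{n\ge 1}\hat S^n\Pi\mathfrak g$ be the reduced complex, i.e. $\operatorname{CE}_\bullet(\mathfrak g)$ without the direct summand $\hat S^0=k$. Let $V$ be an uncurved cyclic $C(\mathcal O)$-algebra with structure $\xi$ (for instance $\xi=0$), let $W$ be an inner product space with $W_0\neq 0$, and let $V\oplus W$ be the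 orthogonal direct sum with the structure $\xi$ extended by zero. Then the composition $$\overline{\operatorname{CE}}_\bullet(\operatorname{CDer}^0(\hat C_{\mathcal O}(V)))\to \overline{\operatorname{CE}}_\bullet(\operatorname{CDer}(\hat C_{\mathcal O}(V)))\to \overline{\operatorname{CE}}_\bullet(\operatorname{CDer}(\hat C_{\mathcal O}(V\oplus W))),$$ where the second map is induced by extending derivations by zero on $\Pi W^*$, is zero on homology. -/

import Mathlib

/-! # Formal cyclic derivations over a cyclic dg operad and their Chevalley-Eilenberg chains

All vector spaces are `ℤ/2`-graded over a field `k` of characteristic zero. -/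

universe u v

namespace CyclicOperadCE

/-- The sign `(-1)^s` for a parity `s`. -/
def sgn (k : Type*) [Ring k] (s : ZMod 2) : k := (-1) ^ s.val

/-- Exponent of the Koszul sign: the sum of `q j * q l` over the inversions `j < l`, `σ l < σ j`. -/
def koszulExp {n : ℕ} (σ : Equiv.Perm (Fin n)) (q : Fin n → ZMod 2) : ZMod 2 :=
  ∑ j, ∑ l, if j < l ∧ σ l < σ j then q j * q l else 0

/-- Koszul sign of moving the letter in place `j` (of parity `q j`) to place `σ j`, for all `j`. -/
def koszul (k : Type*) [Ring k] {n : ℕ} (σ : Equiv.Perm (Fin n)) (q : Fin n → ZMod 2) : k :=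
  sgn k (koszulExp σ q)

theorem sgn_add (k : Type*) [Ring k] (s t : ZMod 2) : sgn k (s + t) = sgn k s * sgn k t := by
  have h2 : ∀ m n : ℕ, ((-1 : k)) ^ ((m + n) % 2) = (-1) ^ m * (-1) ^ n := by
    intro m n
    rw [← pow_add, neg_one_pow_eq_pow_mod_two (m + n)]
  unfold sgn
  rw [ZMod.val_add]
  exact h2 _ _

theorem koszulExp_mul {n : ℕ} (α β : Equiv.Perm (Fin n)) (q : Fin n → ZMod 2) :
    koszulExp (α * β) q = koszulExp β q + koszulExp α (fun j => q (β⁻¹ j)) := by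
  have hre : koszulExp α (fun j => q (β⁻¹ j)) =
      ∑ j, ∑ l, if β j < β l ∧ α (β l) < α (β j) then q j * q l else 0 := by
    unfold koszulExp
    rw [← Equiv.sum_comp β]
    refine Finset.sum_congr rfl fun j _ => ?_
    rw [← Equiv.sum_comp β]
    simp
  have hs : ∀ x y : ZMod 2, x + y = 0 → x = y := by decide
  apply hs
  rw [hre]
  unfold koszulExp
  simp only [← Finset.sum_add_distrib]
  rw [← Finset.sum_product']
  refine Finset.sum_involution (fun a _ => (a.2, a.1)) ?_ ?_ ?_ ?_
  · rintro ⟨j, l⟩ -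
    have h2 : ∀ x : ZMod 2, x + x = 0 := by decide
    rcases eq_or_ne j l with rfl | hjl
    · simp
    have hb : β j ≠ β l := fun h => hjl (β.injective h)
    have ha : α (β j) ≠ α (β l) := fun h => hb (α.injective h)
    have hc := mul_comm (q l) (q j)
    have hz := h2 (q j * q l)
    simp only [Equiv.Perm.mul_apply]
    rw [hc]
    rcases lt_or_gt_of_ne hjl with h1 | h1 <;> rcases lt_or_gt_of_ne hb with h3 | h3 <;>
      rcases lt_or_gt_of_ne ha with h4 | h4 <;>
      simp [h1, h3, h4, h1.not_gt, h3.not_gt, h4.not_gt, hz]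
  · rintro ⟨j, l⟩ - hne heq
    apply hne
    have : j = l := by simpa using (congrArg Prod.snd heq)
    subst this
    simp
  · simp
  · simp

theorem koszul_mul (k : Type*) [CommRing k] {n : ℕ} (α β : Equiv.Perm (Fin n))
    (q : Fin n → ZMod 2) :
    koszul k (α * β) q = koszul k β q * koszul k α (fun j => q (β⁻¹ j)) := by
  unfold koszul
  rw [koszulExp_mul, sgn_add]

/-! ## Chevalley-Eilenberg chains -/

/-- A `ℤ/2`-graded space with a linear topology (given by the neighbourhoods `fil M` of zero), an
operator `d` and a bracket `br`, both continuous.  The projections `proj 0`, `proj 1` are the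
projections onto the even and the odd part. -/
structure FormalSpace (k : Type u) [Field k] (X : Type v) [AddCommGroup X] [Module k X] where
  proj : ZMod 2 → X →ₗ[k] X
  proj_proj : ∀ s t x, proj s (proj t x) = if s = t then proj t x else 0
  fil : ℕ → Submodule k X
  fil_anti : ∀ M, fil (M + 1) ≤ fil M
  proj_fil : ∀ s M x, x ∈ fil M → proj s x ∈ fil M
  d : X →ₗ[k] X
  d_fil : ∀ M x, x ∈ fil (M + 1) → d x ∈ fil M
  br : X →ₗ[k] X →ₗ[k] X
  br_fil_left : ∀ M x y, x ∈ fil (M + 1) → br x y ∈ fil M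
  br_fil_right : ∀ M x y, y ∈ fil (M + 1) → br x y ∈ fil M

namespace FormalSpace

variable {k : Type u} [Field k] {X : Type v} [AddCommGroup X] [Module k X] (L : FormalSpace k X)

theorem fil_le {M N : ℕ} (h : M ≤ N) : L.fil N ≤ L.fil M :=
  antitone_nat_of_succ_le (f := L.fil) L.fil_anti h

/-- `n`-linear forms on `X`. -/
abbrev Form (k : Type u) [Field k] (X : Type v) [AddCommGroup X] [Module k X] (n : ℕ) : Type _ :=
  MultilinearMap k (fun _ : Fin n => X) k

/-- The form is continuous: it vanishes as soon as one argument is small. -/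
def IsContinuous {n : ℕ} (ω : Form k X n) : Prop :=
  ∃ M, ∀ x : Fin n → X, (∃ j, x j ∈ L.fil M) → ω x = 0

/-- Permutation of the arguments of a form on the parity reversion `ΠX`.  On homogeneous arguments
`x i` of parity `p i` in `ΠX` (that is, of parity `p i + 1` in `X`) it is
`± ω (x (σ 0), x (σ 1), …)`, with the Koszul sign of the rearrangement in `ΠX`. -/
noncomputable def permute {n : ℕ} (σ : Equiv.Perm (Fin n)) : Form k X n →ₗ[k] Form k X n :=
  ∑ p : Fin n → ZMod 2, koszul k σ⁻¹ p •
    (MultilinearMap.compLinearMapₗ (fun i => L.proj (p i + 1)) ∘ₗ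
      (MultilinearMap.domDomCongrLinearEquiv k k X k σ).toLinearMap)

theorem permute_apply {n : ℕ} (σ : Equiv.Perm (Fin n)) (ω : Form k X n) (x : Fin n → X) :
    L.permute σ ω x = ∑ p : Fin n → ZMod 2,
      koszul k σ⁻¹ p * ω (fun j => L.proj (p (σ j) + 1) (x (σ j))) := by
  simp [permute]

theorem permute_permute {n : ℕ} (τ σ : Equiv.Perm (Fin n)) (ω : Form k X n) :
    L.permute τ (L.permute σ ω) = L.permute (τ * σ) ω := by
  ext x
  rw [permute_apply, permute_apply]
  refine Finset.sum_congr rfl fun p _ => ?_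
  rw [permute_apply, Finset.sum_eq_single (fun j => p (τ j))]
  · rw [mul_inv_rev, koszul_mul]
    simp [L.proj_proj, mul_assoc]
  · intro p' _ hp'
    obtain ⟨j, hj⟩ := Function.ne_iff.mp hp'
    rw [ω.map_coord_zero (σ⁻¹ j), mul_zero]
    rw [L.proj_proj, if_neg]
    simpa using hj
  · simp

theorem isContinuous_permute {n : ℕ} (σ : Equiv.Perm (Fin n)) {ω : Form k X n}
    (h : L.IsContinuous ω) : L.IsContinuous (L.permute σ ω) := by
  obtain ⟨M, hM⟩ := h
  refine ⟨M, fun x ⟨j, hj⟩ => ?_⟩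
  rw [permute_apply]
  refine Finset.sum_eq_zero fun p _ => ?_
  rw [hM _ ⟨σ⁻¹ j, ?_⟩, mul_zero]
  simpa using L.proj_fil _ _ _ hj

/-- The space of continuous `n`-linear forms. -/
def contForms (n : ℕ) : Submodule k (Form k X n) where
  carrier := {ω | L.IsContinuous ω}
  zero_mem' := ⟨0, fun _ _ => rfl⟩
  add_mem' := by
    rintro a b ⟨M, hM⟩ ⟨N, hN⟩
    refine ⟨max M N, fun x ⟨j, hj⟩ => ?_⟩
    rw [add_apply, hM x ⟨j, L.fil_le (le_max_left _ _) hj⟩,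
      hN x ⟨j, L.fil_le (le_max_right _ _) hj⟩, add_zero]
  smul_mem' := by
    rintro c a ⟨M, hM⟩
    exact ⟨M, fun x hx => by rw [smul_apply, hM x hx, smul_zero]⟩

/-- `Sⁿ(ΠX*)`: the continuous supersymmetric `n`-linear forms on `ΠX`. -/
noncomputable def cochain (n : ℕ) : Submodule k (Form k X n) :=
  L.contForms n ⊓ ⨅ σ, LinearMap.eqLocus (L.permute σ) LinearMap.id

theorem mem_cochain {n : ℕ} (ω : Form k X n) :
    ω ∈ L.cochain n ↔ L.IsContinuous ω ∧ ∀ σ, L.permute σ ω = ω := by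
  have h : ω ∈ L.contForms n ↔ L.IsContinuous ω := Iff.rfl
  simp [cochain, h]

/-- The sum over all permutations of a form. -/
noncomputable def symm (n : ℕ) : Form k X n →ₗ[k] Form k X n := ∑ σ, L.permute σ

theorem symm_mem {n : ℕ} {ω : Form k X n} (h : L.IsContinuous ω) :
    L.symm n ω ∈ L.cochain n := by
  rw [mem_cochain]
  constructor
  · have : L.symm n ω = ∑ σ, L.permute σ ω := by simp [symm]
    rw [this]
    exact (L.contForms n).sum_mem fun σ _ => L.isContinuous_permute σ h
  · intro τ
    simp only [symm, LinearMap.sum_apply, map_sum, permute_permute]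
    exact Equiv.sum_comp (Equiv.mulLeft τ) (fun σ => L.permute σ ω)

/-- The odd bracket `Q₂(x, y) = (-1)^|x| [x, y]`, which is supersymmetric on `ΠX`. -/
noncomputable def shiftBr : X →ₗ[k] X →ₗ[k] X := ∑ s : ZMod 2, sgn k s • (L.br ∘ₗ L.proj s)

theorem shiftBr_apply (x y : X) :
    L.shiftBr x y = ∑ s : ZMod 2, sgn k s • L.br (L.proj s x) y := by
  simp [shiftBr]

/-- `ω ↦ ω (d x₀, x₁, …, xₙ)`. -/
noncomputable def insD (n : ℕ) : Form k X (n + 1) →ₗ[k] Form k X (n + 1) where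
  toFun ω := (ω.curryLeft ∘ₗ L.d).uncurryLeft
  map_add' a b := by ext x; simp
  map_smul' c a := by ext x; simp

theorem insD_apply (n : ℕ) (ω : Form k X (n + 1)) (x : Fin (n + 1) → X) :
    L.insD n ω x = ω (Fin.cons (L.d (x 0)) (Fin.tail x)) := rfl

/-- `ω ↦ ω (Q₂ (x₀, x₁), x₂, …, xₙ₊₁)`. -/
noncomputable def insBr (n : ℕ) : Form k X (n + 1) →ₗ[k] Form k X (n + 2) where
  toFun ω := ((multilinearCurryLeftEquiv k (fun _ : Fin (n + 1) => X) k).symm.toLinearMap ∘ₗ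
    L.shiftBr.compr₂ ω.curryLeft).uncurryLeft
  map_add' a b := by ext x; simp
  map_smul' c a := by ext x; simp

theorem insBr_apply (n : ℕ) (ω : Form k X (n + 1)) (x : Fin (n + 2) → X) :
    L.insBr n ω x = ω (Fin.cons (L.shiftBr (x 0) (x 1)) (Fin.tail (Fin.tail x))) := rfl

theorem isContinuous_insD (n : ℕ) {ω : Form k X (n + 1)} (h : L.IsContinuous ω) :
    L.IsContinuous (L.insD n ω) := by
  obtain ⟨M, hM⟩ := h
  refine ⟨M + 1, fun x ⟨j, hj⟩ => ?_⟩
  rw [insD_apply]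
  apply hM
  induction j using Fin.cases with
  | zero => exact ⟨0, by simpa using L.d_fil _ _ hj⟩
  | succ j => exact ⟨j.succ, by simpa [Fin.tail] using L.fil_anti _ hj⟩

theorem isContinuous_insBr (n : ℕ) {ω : Form k X (n + 1)} (h : L.IsContinuous ω) :
    L.IsContinuous (L.insBr n ω) := by
  obtain ⟨M, hM⟩ := h
  refine ⟨M + 1, fun x ⟨j, hj⟩ => ?_⟩
  rw [insBr_apply]
  apply hM
  induction j using Fin.cases with
  | zero =>
    refine ⟨0, ?_⟩
    simp only [Fin.cons_zero, shiftBr_apply]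
    exact Submodule.sum_mem _ fun s _ => Submodule.smul_mem _ _
      (L.br_fil_left _ _ _ (L.proj_fil _ _ _ hj))
  | succ j =>
    induction j using Fin.cases with
    | zero =>
      refine ⟨0, ?_⟩
      simp only [Fin.cons_zero, shiftBr_apply]
      exact Submodule.sum_mem _ fun s _ => Submodule.smul_mem _ _ (L.br_fil_right _ _ _ hj)
    | succ j => exact ⟨j.succ, by simpa [Fin.tail] using L.fil_anti _ hj⟩

/-- The part `d_I : Sⁿ(ΠX*) → Sⁿ(ΠX*)` of the differential of the Chevalley-Eilenberg cochains:
`(d_I ω)(x₀, …, xₙ) = ∑ i, ± ω (d xᵢ, x₀, …, x̂ᵢ, …, xₙ)` with Koszul signs. -/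
noncomputable def dI : (n : ℕ) → L.cochain n →ₗ[k] L.cochain n
  | 0 => 0
  | n + 1 => ((n.factorial : k)⁻¹ • (L.symm (n + 1) ∘ₗ L.insD n)).restrict fun _ h =>
      Submodule.smul_mem _ _ (L.symm_mem (L.isContinuous_insD n ((L.mem_cochain _).1 h).1))

/-- The part `d_CE : Sⁿ(ΠX*) → Sⁿ⁺¹(ΠX*)` of the differential of the Chevalley-Eilenberg cochains:
`(d_CE ω)(x₀, …, xₙ) = ∑ i < j, ± ω (Q₂ (xᵢ, xⱼ), x₀, …, x̂ᵢ, …, x̂ⱼ, …, xₙ)` with Koszul signs. -/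
noncomputable def dCE : (n : ℕ) → L.cochain n →ₗ[k] L.cochain (n + 1)
  | 0 => 0
  | n + 1 => (((2 : k) * n.factorial)⁻¹ • (L.symm (n + 2) ∘ₗ L.insBr n)).restrict fun _ h =>
      Submodule.smul_mem _ _ (L.symm_mem (L.isContinuous_insBr n ((L.mem_cochain _).1 h).1))

/-- Chevalley-Eilenberg chains: the linear dual of the space `⨁ₙ Sⁿ(ΠX*)` of cochains.  The component
`z n` is an element of the completed symmetric power `Ŝⁿ(ΠX)`. -/
abbrev Chain : Type _ := ∀ n, Module.Dual k (L.cochain n)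

/-- The differential of chains, dual to `d_I + d_CE`. -/
noncomputable def boundary : L.Chain →ₗ[k] L.Chain where
  toFun z n := z n ∘ₗ L.dI n + z (n + 1) ∘ₗ L.dCE n
  map_add' a b := by
    funext n
    ext ω
    simp only [Pi.add_apply, LinearMap.add_apply, LinearMap.comp_apply]
    ring
  map_smul' c a := by
    funext n
    ext ω
    simp

/-- The chains of a graded closed subspace `S` of `X`, as a subspace `Ŝ(ΠS)` of `Ŝ(ΠX)`: those chains
of `X` which only see the restrictions of the cochains to `S`.  If `S` is stable under `d` and `br`
then this is the subcomplex of Chevalley-Eilenberg chains of `S`. -/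
def chainsOn (S : Submodule k X) : Submodule k L.Chain where
  carrier := {z | ∀ n (ω : L.cochain n),
    (∀ x : Fin n → X, (∀ j, x j ∈ S) → (ω : Form k X n) x = 0) → z n ω = 0}
  zero_mem' := fun _ _ _ => rfl
  add_mem' := by
    intro a b ha hb n ω h
    simp [ha n ω h, hb n ω h]
  smul_mem' := by
    intro c a ha n ω h
    simp [ha n ω h]

/-- The chains of the subspace `S` in the reduced complex: those without component in `Ŝ⁰ = k`. -/
def reducedChainsOn (S : Submodule k X) : Submodule k L.Chain where
  carrier := {z | z ∈ L.chainsOn S ∧ z 0 = 0}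
  zero_mem' := ⟨Submodule.zero_mem _, rfl⟩
  add_mem' := by
    rintro a b ⟨ha, ha'⟩ ⟨hb, hb'⟩
    exact ⟨Submodule.add_mem _ ha hb, by simp [ha', hb']⟩
  smul_mem' := by
    rintro c a ⟨ha, ha'⟩
    exact ⟨Submodule.smul_mem _ _ ha, by simp [ha']⟩

end FormalSpace

/-- A continuous even linear map between formal spaces. -/
structure FormalHom {k : Type u} [Field k] {X Y : Type*} [AddCommGroup X] [Module k X]
    [AddCommGroup Y] [Module k Y] (L : FormalSpace k X) (L' : FormalSpace k Y) where
  toLin : X →ₗ[k] Y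
  proj_comm : ∀ s x, toLin (L.proj s x) = L'.proj s (toLin x)
  fil_map : ∀ M x, x ∈ L.fil M → toLin x ∈ L'.fil M

namespace FormalHom

variable {k : Type u} [Field k] {X Y : Type*} [AddCommGroup X] [Module k X]
    [AddCommGroup Y] [Module k Y] {L : FormalSpace k X} {L' : FormalSpace k Y} (f : FormalHom L L')

/-- Pull-back of cochains. -/
noncomputable def pullback (n : ℕ) : L'.cochain n →ₗ[k] L.cochain n :=
  (MultilinearMap.compLinearMapₗ (fun _ : Fin n => f.toLin)).restrict fun ω h => by
    obtain ⟨⟨M, hM⟩, hs⟩ := (L'.mem_cochain _).1 h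
    refine (L.mem_cochain _).2 ⟨⟨M, fun x ⟨j, hj⟩ => hM _ ⟨j, f.fil_map _ _ hj⟩⟩, fun σ => ?_⟩
    ext x
    have := DFunLike.congr_fun (hs σ) (fun i => f.toLin (x i))
    rw [FormalSpace.permute_apply] at this ⊢
    simpa [f.proj_comm] using this

/-- Push-forward of chains. -/
noncomputable def push : L.Chain →ₗ[k] L'.Chain where
  toFun z n := z n ∘ₗ f.pullback n
  map_add' a b := by funext n; ext ω; simp
  map_smul' c a := by funext n; ext ω; simp

end FormalHom

/-! ## Cyclic dg operads

The operation slots of an element of `O(n)` are numbered by `Fin (n + 1)`: the slots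
`0, …, n - 1` are the inputs and the slot `n = Fin.last n` is the output.  A permutation `σ` acts by
moving slot `j` to slot `σ j`. -/

/-- Place, in `a ∘ᵢ b`, of the slot `j ≠ i` of `a` (the output included), for `b` of arity `m`. -/
def outerSlot (i m j : ℕ) : ℕ := if j < i then j else j + m - 1

/-- Place, in `a ∘ᵢ b`, of the input `j` of `b`. -/
def innerSlot (i j : ℕ) : ℕ := i + j

/-- A cyclic dg operad in finite-dimensional `ℤ/2`-graded vector spaces over `k`, with all arities
`n ≥ 0` allowed, given by partial compositions `a ∘ᵢ b`. -/
structure CyclicDGOperad (k : Type u) [Field k] where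
  obj : ℕ → Type v
  [addCommGroup : ∀ n, AddCommGroup (obj n)]
  [module : ∀ n, Module k (obj n)]
  [finite : ∀ n, Module.Finite k (obj n)]
  /-- the even part `part n 0` and the odd part `part n 1` -/
  part : ∀ n, ZMod 2 → Submodule k (obj n)
  [decomposition : ∀ n, DirectSum.Decomposition (part n)]
  d : ∀ n, obj n →ₗ[k] obj n
  d_mem : ∀ n s a, a ∈ part n s → d n a ∈ part n (s + 1)
  d_d : ∀ n a, d n (d n a) = 0
  /-- the action of the symmetric group of all `n + 1` slots -/
  act : ∀ n, Representation k (Equiv.Perm (Fin (n + 1))) (obj n)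
  act_mem : ∀ n s σ a, a ∈ part n s → act n σ a ∈ part n s
  act_d : ∀ n σ a, act n σ (d n a) = d n (act n σ a)
  /-- the unit `Id ∈ O(1)` -/
  one : obj 1
  one_mem : one ∈ part 1 0
  act_one : ∀ σ, act 1 σ one = one
  /-- the partial composition `a ∘ᵢ b`, where the output of `b` is plugged into the input `i` of `a` -/
  comp : ∀ {n m N : ℕ} (_ : N + 1 = n + m) (_ : Fin n), obj n →ₗ[k] obj m →ₗ[k] obj N
  comp_mem : ∀ {n m N : ℕ} (h : N + 1 = n + m) (i : Fin n) (s t : ZMod 2) (a : obj n) (b : obj m),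
    a ∈ part n s → b ∈ part m t → comp h i a b ∈ part N (s + t)
  d_comp : ∀ {n m N : ℕ} (h : N + 1 = n + m) (i : Fin n) (s : ZMod 2) (a : obj n) (b : obj m),
    a ∈ part n s → d N (comp h i a b) = comp h i (d n a) b + sgn k s • comp h i a (d m b)
  one_comp : ∀ {m : ℕ} (h : m + 1 = 1 + m) (b : obj m), comp h 0 one b = b
  comp_one : ∀ {n : ℕ} (h : n + 1 = n + 1) (i : Fin n) (a : obj n), comp h i a one = a
  /-- sequential associativity `(a ∘ᵢ b) ∘ᵢ₊ⱼ c = a ∘ᵢ (b ∘ⱼ c)` -/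
  assoc : ∀ {n m r N₁ N₂ N : ℕ} (h₁ : N₁ + 1 = n + m) (h₂ : N + 1 = N₁ + r) (h₃ : N₂ + 1 = m + r)
    (h₄ : N + 1 = n + N₂) (i : Fin n) (j : Fin m) (l : Fin N₁), l.val = innerSlot i j →
    ∀ (a : obj n) (b : obj m) (c : obj r),
    comp h₂ l (comp h₁ i a b) c = comp h₄ i a (comp h₃ j b c)
  /-- parallel associativity `(a ∘ᵢ b) ∘ₗ₊ₘ₋₁ c = (-1)^(|b||c|) (a ∘ₗ c) ∘ᵢ b` for `i < l` -/
  comp_comm : ∀ {n m r N₁ N₂ N : ℕ} (h₁ : N₁ + 1 = n + m) (h₂ : N + 1 = N₁ + r)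
    (h₃ : N₂ + 1 = n + r) (h₄ : N + 1 = N₂ + m) (i l : Fin n) (i' : Fin N₂) (l' : Fin N₁), i < l →
    i'.val = i.val → l'.val = outerSlot i m l →
    ∀ (s t : ZMod 2) (a : obj n) (b : obj m) (c : obj r), b ∈ part m s → c ∈ part r t →
    comp h₂ l' (comp h₁ i a b) c = sgn k (s * t) • comp h₄ i' (comp h₃ l a c) b
  /-- equivariance: if `σ` moves the slot `i` of `a` to an input `i'` and `τ` fixes the output of `b`,
  then `(σ a) ∘ᵢ' (τ b)` is `a ∘ᵢ b` with its slots moved accordingly (by the permutation `ρ`) -/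
  comp_act : ∀ {n m N : ℕ} (h : N + 1 = n + m) (i i' : Fin n) (σ : Equiv.Perm (Fin (n + 1)))
    (τ : Equiv.Perm (Fin (m + 1))) (ρ : Equiv.Perm (Fin (N + 1))),
    σ i.castSucc = i'.castSucc → τ (Fin.last m) = Fin.last m →
    (∀ j, j ≠ i.castSucc → ∀ x, x.val = outerSlot i m j → (ρ x).val = outerSlot i' m (σ j)) →
    (∀ j, j ≠ Fin.last m → ∀ x, x.val = innerSlot i j → (ρ x).val = innerSlot i' (τ j)) →
    ∀ (a : obj n) (b : obj m),
    comp h i' (act n σ a) (act m τ b) = act N ρ (comp h i a b)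
  /-- exchange of the two factors: if `σ` moves the slot `i` of `a` to the output and `τ` moves the
  output of `b` to an input `j`, then `(τ b) ∘ⱼ (σ a)` is, up to the Koszul sign, `a ∘ᵢ b` with its
  slots moved accordingly -/
  comp_swap : ∀ {n m N : ℕ} (h : N + 1 = n + m) (h' : N + 1 = m + n) (i : Fin n) (j : Fin m)
    (σ : Equiv.Perm (Fin (n + 1))) (τ : Equiv.Perm (Fin (m + 1))) (ρ : Equiv.Perm (Fin (N + 1))),
    σ i.castSucc = Fin.last n → τ (Fin.last m) = j.castSucc →
    (∀ l, l ≠ i.castSucc → ∀ x, x.val = outerSlot i m l → (ρ x).val = innerSlot j (σ l)) →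
    (∀ l, l ≠ Fin.last m → ∀ x, x.val = innerSlot i l → (ρ x).val = outerSlot j n (τ l)) →
    ∀ (s t : ZMod 2) (a : obj n) (b : obj m), a ∈ part n s → b ∈ part m t →
    comp h' j (act m τ b) (act n σ a) = sgn k (s * t) • act N ρ (comp h i a b)

namespace CyclicDGOperad

attribute [instance] CyclicDGOperad.addCommGroup CyclicDGOperad.module CyclicDGOperad.finite
  CyclicDGOperad.decomposition

variable {k : Type u} [Field k] (O : CyclicDGOperad.{u, v} k)

/-- A weakly unital multiplication `m ∈ O(2)`: both `m(- ⊗ Id)` and `m(Id ⊗ -)` map `O(0)` to the line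
spanned by `Id ∈ O(1)`, and they are not both zero. -/
structure IsWeaklyUnital (m : O.obj 2) : Prop where
  mem_span : ∀ (i : Fin 2) (a : O.obj 0),
    O.comp (n := 2) (m := 0) (N := 1) rfl i m a ∈ Submodule.span k {O.one}
  ne_zero : ∃ (i : Fin 2) (a : O.obj 0), O.comp (n := 2) (m := 0) (N := 1) rfl i m a ≠ 0

/-- The projection of `O(n)` onto its part of parity `s`. -/
noncomputable def proj (n : ℕ) (s : ZMod 2) : O.obj n →ₗ[k] O.obj n :=
  (O.part n s).subtype ∘ₗ DirectSum.component k (ZMod 2) (fun t => O.part n t) s ∘ₗ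
    (DirectSum.decomposeLinearEquiv (O.part n)).toLinearMap

theorem proj_apply (n : ℕ) (s : ZMod 2) (a : O.obj n) :
    O.proj n s a = (DirectSum.decompose (O.part n) a s : O.obj n) := rfl

theorem proj_proj (n : ℕ) (s t : ZMod 2) (a : O.obj n) :
    O.proj n s (O.proj n t a) = if s = t then O.proj n t a else 0 := by
  simp only [proj_apply]
  split_ifs with h
  · subst h
    exact DirectSum.decompose_of_mem_same _ (SetLike.coe_mem _)
  · exact DirectSum.decompose_of_mem_ne _ (SetLike.coe_mem _) (Ne.symm h)

end CyclicDGOperad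

/-! ## Inner product spaces -/

/-- An inner product on a `ℤ/2`-graded space `V`: a nondegenerate even bilinear form which is symmetric
in the graded sense. -/
structure InnerProductSuperspace (k : Type u) [Field k] (V : Type*) [AddCommGroup V]
    [Module k V] where
  part : ZMod 2 → Submodule k V
  isInternal : DirectSum.IsInternal part
  form : LinearMap.BilinForm k V
  form_even : ∀ s t, s ≠ t → ∀ v ∈ part s, ∀ w ∈ part t, form v w = 0
  form_symm : ∀ s t, ∀ v ∈ part s, ∀ w ∈ part t, form v w = sgn k (s * t) * form w v
  nondegenerate : form.Nondegenerate

/-- A basis of a `ℤ/2`-graded space consisting of homogeneous vectors. -/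
structure InnerProductSuperspace.HomogeneousBasis {k : Type u} [Field k] {V : Type*}
    [AddCommGroup V] [Module k V] (A : InnerProductSuperspace k V) (ι : Type*) where
  basis : Module.Basis ι k V
  par : ι → ZMod 2
  basis_mem : ∀ a, basis a ∈ A.part (par a)

/-- An inner product space in coordinates: the parities of the vectors of a homogeneous basis and
their matrix of inner products. -/
structure GramData (k : Type u) (ι : Type*) where
  par : ι → ZMod 2
  gram : ι → ι → k

/-- The coordinates of an inner product space with respect to a homogeneous basis. -/
noncomputable def InnerProductSuperspace.HomogeneousBasis.gramData {k : Type u} [Field k] {V : Type*}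
    [AddCommGroup V] [Module k V] {A : InnerProductSuperspace k V} {ι : Type*}
    (e : A.HomogeneousBasis ι) : GramData k ι where
  par := e.par
  gram a b := A.form (e.basis a) (e.basis b)

namespace GramData

/-- Coordinates of the orthogonal direct sum `V ⊕ W`, in the union of the two bases. -/
def sum {k : Type u} [Zero k] {ι κ : Type*} (G : GramData k ι) (H : GramData k κ) :
    GramData k (ι ⊕ κ) where
  par := Sum.elim G.par H.par
  gram := Sum.elim (fun a => Sum.elim (fun b => G.gram a b) (fun _ => 0))
    (fun a => Sum.elim (fun _ => 0) (fun b => H.gram a b))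

/-- The parity, in `ΠV*`, of the coordinate function `xᵃ` of a basis vector. -/
def coordPar {k : Type u} {ι : Type*} (G : GramData k ι) (a : ι) : ZMod 2 := G.par a + 1

/-- The parity of the monomial `x^{K 0} ⊗ ⋯ ⊗ x^{K (n-1)}` in `(ΠV*)^{⊗ n}`. -/
def wordPar {k : Type u} {ι : Type*} (G : GramData k ι) {n : ℕ} (K : Fin n → ι) : ZMod 2 :=
  ∑ j, G.coordPar (K j)

end GramData

/-! ## Cyclic derivations of the completed free algebra -/

/-- Coefficients of derivations of the completed free algebra
`Ĉ_O(V) = ∏ₙ O(n) ⊗_{Sₙ} (ΠV*)^{⊗ n}`, in the coordinates `xᵃ ∈ ΠV*`, `a ∈ ι`: the family `D` stands for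
the continuous derivation with `D(xᵃ) = ∑ₙ ∑_K D n a K ⊗ x^{K 0} ⊗ ⋯ ⊗ x^{K (n-1)}`. -/
abbrev Coeffs {k : Type u} [Field k] (O : CyclicDGOperad.{u, v} k) (ι : Type*) : Type _ :=
  ∀ n : ℕ, ι → (Fin n → ι) → O.obj n

/-- A permutation of the inputs, as a permutation of all slots. -/
def extendLast {n : ℕ} (σ : Equiv.Perm (Fin n)) : Equiv.Perm (Fin (n + 1)) :=
  finSuccEquivLast.trans ((Equiv.optionCongr σ).trans finSuccEquivLast.symm)

/-- The word obtained from `K` by replacing the block of `m` letters starting at place `l` by the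
single letter `b`. -/
def outerWord {ι : Type*} {n m N : ℕ} (h : N + 1 = n + m) (l : Fin n) (b : ι) (K : Fin N → ι) :
    Fin n → ι := fun j =>
  if hj : j < l then K ⟨j, by have := l.2; omega⟩
  else if hl : l < j then K ⟨j + m - 1, by have := j.2; omega⟩ else b

/-- The block of `m` letters of the word `K` which starts at place `l`. -/
def innerWord {ι : Type*} {n m N : ℕ} (h : N + 1 = n + m) (l : Fin n) (K : Fin N → ι) :
    Fin m → ι := fun j => K ⟨l + j, by have := l.2; have := j.2; omega⟩

namespace GramData

variable {k : Type u} [Field k] {ι : Type*} [Fintype ι] (G : GramData k ι)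
  (O : CyclicDGOperad.{u, v} k)

/-- The projection of derivations onto the part of parity `s`: a derivation is of parity `s` if the
coefficients of `D(xᵃ)` have total parity `s + |xᵃ|`. -/
noncomputable def projDer (s : ZMod 2) : Coeffs O ι →ₗ[k] Coeffs O ι where
  toFun D n a K := O.proj n (s + G.coordPar a + G.wordPar K) (D n a K)
  map_add' D E := by funext n a K; simp
  map_smul' c D := by funext n a K; simp

/-- The differential induced on derivations by the differential of `O`. -/
def dDer : Coeffs O ι →ₗ[k] Coeffs O ι where
  toFun D n a K := O.d n (D n a K)
  map_add' D E := by funext n a K; simp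
  map_smul' c D := by funext n a K; simp

/-- The `Sₙ`-average of a tensor in `O(n) ⊗ (ΠV*)^{⊗ n}`; it has the same class in
`O(n) ⊗_{Sₙ} (ΠV*)^{⊗ n}`. -/
noncomputable def average {N : ℕ} (T : (Fin N → ι) → O.obj N) (K : Fin N → ι) : O.obj N :=
  (N.factorial : k)⁻¹ • ∑ σ : Equiv.Perm (Fin N),
    koszul k σ (fun j => G.coordPar (K (σ j))) • O.act N (extendLast σ) (T fun j => K (σ j))

/-- Coefficients of the part of `D(E(xᵃ))` where `D`, of parity `s`, is applied to the factor in place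
`l` of the component of arity `n` of `E(xᵃ)`, `E` of parity `t`, and produces `m` factors. -/
def compAt (s t : ZMod 2) (D E : Coeffs O ι) {n m N : ℕ} (h : N + 1 = n + m) (l : Fin n) (a : ι)
    (K : Fin N → ι) : O.obj N :=
  ∑ b : ι, sgn k
    (s * (t + G.coordPar a + G.wordPar (outerWord h l b K)) +
      (G.coordPar b + G.wordPar (innerWord h l K)) *
        ∑ j : Fin n, if j < l then G.coordPar (outerWord h l b K j) else 0) •
    O.comp h l (E n a (outerWord h l b K)) (D m b (innerWord h l K))

/-- Coefficients of the composite `xᵃ ↦ D(E(xᵃ))` of a derivation `D` of parity `s` and a derivation `E`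
of parity `t`. -/
noncomputable def compDer (s t : ZMod 2) : Coeffs O ι →ₗ[k] Coeffs O ι →ₗ[k] Coeffs O ι :=
  LinearMap.mk₂ k
    (fun D E N a => G.average O fun K => ∑ r : Fin (N + 1), ∑ l : Fin (r + 1),
      G.compAt O s t D E (n := r + 1) (m := N - r) (by omega) l a K)
    (by
      intro D D' E; funext N a K
      simp only [average, compAt, Pi.add_apply, map_add, smul_add, Finset.sum_add_distrib])
    (by
      intro c D E; funext N a K
      simp only [average, compAt, Pi.smul_apply, map_smul, smul_comm _ c, ← Finset.smul_sum,
        map_sum])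
    (by
      intro D E E'; funext N a K
      simp only [average, compAt, Pi.add_apply, map_add, smul_add, Finset.sum_add_distrib,
        LinearMap.add_apply])
    (by
      intro c D E; funext N a K
      simp only [average, compAt, Pi.smul_apply, map_smul, smul_comm _ c, ← Finset.smul_sum,
        map_sum, LinearMap.smul_apply])

theorem compDer_apply (s t : ZMod 2) (D E : Coeffs O ι) (N : ℕ) (a : ι) (K : Fin N → ι) :
    G.compDer O s t D E N a K = G.average O (fun K => ∑ r : Fin (N + 1), ∑ l : Fin (r + 1),
      G.compAt O s t D E (n := r + 1) (m := N - r) (by omega) l a K) K := by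
  rw [compDer, LinearMap.mk₂_apply]

/-- The graded commutator of derivations. -/
noncomputable def commutator : Coeffs O ι →ₗ[k] Coeffs O ι →ₗ[k] Coeffs O ι :=
  ∑ s : ZMod 2, ∑ t : ZMod 2,
    ((G.compDer O s t).compl₁₂ (G.projDer O s) (G.projDer O t) -
      sgn k (s * t) • ((G.compDer O t s).compl₁₂ (G.projDer O t) (G.projDer O s)).flip)

theorem commutator_apply (D E : Coeffs O ι) :
    G.commutator O D E = ∑ s : ZMod 2, ∑ t : ZMod 2,
      (G.compDer O s t (G.projDer O s D) (G.projDer O t E) -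
        sgn k (s * t) • G.compDer O t s (G.projDer O t E) (G.projDer O s D)) := by
  simp only [commutator, LinearMap.sum_apply, LinearMap.sub_apply, LinearMap.smul_apply,
    LinearMap.compl₁₂_apply, LinearMap.flip_apply]

/-- The continuous derivations of `Ĉ_O(V)`: each of them is given by a unique family of coefficients
which is invariant under the symmetric groups `Sₙ`. -/
noncomputable def der : Submodule k (Coeffs O ι) where
  carrier := {D | ∀ n a (K : Fin n → ι) (σ : Equiv.Perm (Fin n)),
    koszul k σ (fun j => G.coordPar (K (σ j))) • O.act n (extendLast σ) (D n a fun j => K (σ j)) =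
      D n a K}
  zero_mem' := by intro n a K σ; simp
  add_mem' := by
    intro D E hD hE n a K σ
    simp only [Pi.add_apply, map_add, smul_add, hD n a K σ, hE n a K σ]
  smul_mem' := by
    intro c D hD n a K σ
    simp only [Pi.smul_apply, map_smul, smul_comm _ c, hD n a K σ]

/-- The tensor in `O(n) ⊗ (ΠV*)^{⊗ n} ⊗ ΠV*` which corresponds to the component of arity `n` of a
derivation in `Hom(ΠV*, O(n) ⊗ (ΠV*)^{⊗ n})` under the identification of `V` and `V*` given by the inner
product.  The last letter belongs to the output slot. -/
noncomputable def lower (D : Coeffs O ι) (n : ℕ) (K : Fin (n + 1) → ι) : O.obj n :=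
  ∑ a : ι, G.gram a (K (Fin.last n)) • D n a fun j => K j.castSucc

/-- The cyclic derivations of `Ĉ_O(V)`: the corresponding tensors are invariant under all the
permutations of the `n + 1` slots, hence under `Sₙ` and under the cyclic rotations. -/
noncomputable def cDer : Submodule k (Coeffs O ι) where
  carrier := {D | D ∈ G.der O ∧ ∀ n (K : Fin (n + 1) → ι) (σ : Equiv.Perm (Fin (n + 1))),
    koszul k σ (fun j => G.coordPar (K (σ j))) • O.act n σ (G.lower O D n fun j => K (σ j)) =
      G.lower O D n K}
  zero_mem' := ⟨Submodule.zero_mem _, by intro n K σ; simp [lower]⟩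
  add_mem' := by
    rintro D E ⟨hD', hD⟩ ⟨hE', hE⟩
    refine ⟨Submodule.add_mem _ hD' hE', fun n K σ => ?_⟩
    have h : ∀ K', G.lower O (D + E) n K' = G.lower O D n K' + G.lower O E n K' := fun K' => by
      simp [lower, Finset.sum_add_distrib]
    rw [h, h, map_add, smul_add, hD, hE]
  smul_mem' := by
    rintro c D ⟨hD', hD⟩
    refine ⟨Submodule.smul_mem _ c hD', fun n K σ => ?_⟩
    have h : ∀ K', G.lower O (c • D) n K' = c • G.lower O D n K' := fun K' => by
      simp [lower, Finset.smul_sum, smul_comm c]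
    rw [h, h, map_smul, smul_comm, hD]

/-- The cyclic derivations without constant term. -/
noncomputable def cDer₀ : Submodule k (Coeffs O ι) where
  carrier := {D | D ∈ G.cDer O ∧ D 0 = 0}
  zero_mem' := ⟨Submodule.zero_mem _, rfl⟩
  add_mem' := by
    rintro D E ⟨hD, hD'⟩ ⟨hE, hE'⟩
    exact ⟨Submodule.add_mem _ hD hE, by simp [hD', hE']⟩
  smul_mem' := by
    rintro c D ⟨hD, hD'⟩
    exact ⟨Submodule.smul_mem _ c hD, by simp [hD']⟩

/-- The coefficients which vanish in all arities below `M`. -/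
def fil (ι : Type*) (O : CyclicDGOperad.{u, v} k) (M : ℕ) : Submodule k (Coeffs O ι) where
  carrier := {D | ∀ n < M, ∀ a K, D n a K = 0}
  zero_mem' := fun _ _ _ _ => rfl
  add_mem' := by
    intro D E hD hE n hn a K
    simp [hD n hn a K, hE n hn a K]
  smul_mem' := by
    intro c D hD n hn a K
    simp [hD n hn a K]

theorem projDer_fil (s : ZMod 2) (M : ℕ) (D : Coeffs O ι) (hD : D ∈ fil ι O M) :
    G.projDer O s D ∈ fil ι O M := fun n hn a K => by
  change O.proj n _ (D n a K) = 0
  rw [hD n hn a K, map_zero]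

theorem compDer_fil (s t : ZMod 2) (M : ℕ) (D E : Coeffs O ι)
    (h : D ∈ fil ι O (M + 1) ∨ E ∈ fil ι O (M + 1)) :
    G.compDer O s t D E ∈ fil ι O M := by
  intro N hN a K
  rw [compDer_apply]
  have hz : ∀ (K : Fin N → ι) (r : Fin (N + 1)) (l : Fin (r + 1)),
      G.compAt O s t D E (n := r + 1) (m := N - r) (by omega) l a K = 0 := by
    intro K r l
    refine Finset.sum_eq_zero fun b _ => ?_
    rcases h with h | h
    · rw [h (N - r) (by omega), map_zero, smul_zero]
    · rw [h (r + 1) (by omega), map_zero, LinearMap.zero_apply, smul_zero]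
  simp [average, hz]

theorem commutator_fil (M : ℕ) (D E : Coeffs O ι)
    (h : D ∈ fil ι O (M + 1) ∨ E ∈ fil ι O (M + 1)) :
    G.commutator O D E ∈ fil ι O M := by
  rw [commutator_apply]
  refine Submodule.sum_mem _ fun s _ => Submodule.sum_mem _ fun t _ => Submodule.sub_mem _ ?_ ?_
  · exact G.compDer_fil O s t M _ _ (h.imp (G.projDer_fil O _ _ _) (G.projDer_fil O _ _ _))
  · exact Submodule.smul_mem _ _ (G.compDer_fil O t s M _ _
      (h.symm.imp (G.projDer_fil O _ _ _) (G.projDer_fil O _ _ _)))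

/-- The graded space of (coefficients of) derivations of `Ĉ_O(V)`, with the commutator bracket and with
the differential `D ↦ d D + [ξ, D]`, where `d` is induced by the differential of `O`. -/
noncomputable def derSpace (ξ : Coeffs O ι) : FormalSpace k (Coeffs O ι) where
  proj := G.projDer O
  proj_proj s t D := by
    funext n a K
    change O.proj n _ (O.proj n _ (D n a K)) = _
    rw [O.proj_proj]
    by_cases h : s = t
    · subst h
      rw [if_pos rfl, if_pos rfl]
      rfl
    · rw [if_neg h, if_neg fun h' => h (add_right_cancel (add_right_cancel h'))]
      rfl
  fil := fil ι O
  fil_anti M D hD n hn a K := hD n (by omega) a K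
  proj_fil := G.projDer_fil O
  d := dDer O + G.commutator O ξ
  d_fil M D hD := Submodule.add_mem _
    (fun n hn a K => by
      change O.d n (D n a K) = 0
      rw [hD n (by omega) a K, map_zero])
    (G.commutator_fil O M _ _ (Or.inr hD))
  br := G.commutator O
  br_fil_left M D E hD := G.commutator_fil O M _ _ (Or.inl hD)
  br_fil_right M D E hE := G.commutator_fil O M _ _ (Or.inr hE)

/-- The structure of an uncurved cyclic `C(O)`-algebra on `V`: an odd cyclic derivation `ξ` of `Ĉ_O(V)`
without constant term such that `(d + ξ)² = 0`, where `d` is the differential of `Ĉ_O(V)` induced by that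
of `O`.  Up to suspension signs, applying `o* ∈ O(n)*` to the coefficients `ξ n` gives the `n`-ary
structure map of `V` labelled by `o*`, and `(d + ξ)² = 0` says that these maps are compatible with the
cobar differential of `C(O)`.  If `V` carries a differential, it is part of `ξ 1`. -/
structure UncurvedCyclicAlgebra where
  ξ : Coeffs O ι
  mem : ξ ∈ G.cDer₀ O
  odd : G.projDer O 1 ξ = ξ
  maurerCartan : dDer O ξ + (2 : k)⁻¹ • G.commutator O ξ ξ = 0

variable {κ : Type*} [Fintype κ] [DecidableEq κ] [DecidableEq ι] (H : GramData k κ)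

/-- The extension of a derivation of `Ĉ_O(V)` to the derivation of `Ĉ_O(V ⊕ W)` which vanishes on
`ΠW*`. -/
def extend (κ : Type*) [DecidableEq κ] : Coeffs O ι →ₗ[k] Coeffs O (ι ⊕ κ) where
  toFun D n a K := Sum.elim
    (fun a' => ∑ K' : Fin n → ι, if (fun j => Sum.inl (K' j)) = K then D n a' K' else 0)
    (fun _ => 0) a
  map_add' D E := by
    funext n a K
    rcases a with a | a
    · simp only [Sum.elim_inl, Pi.add_apply, ← Finset.sum_add_distrib]
      refine Finset.sum_congr rfl fun K' _ => ?_
      split_ifs <;> simp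
    · simp
  map_smul' c D := by
    funext n a K
    rcases a with a | a
    · simp only [Sum.elim_inl, Pi.smul_apply, Finset.smul_sum, RingHom.id_apply]
      refine Finset.sum_congr rfl fun K' _ => ?_
      split_ifs <;> simp
    · simp

/-- Extension of derivations, as an even continuous map. -/
noncomputable def extendHom (ξ : Coeffs O ι) :
    FormalHom (G.derSpace O ξ) ((G.sum H).derSpace O (extend O κ ξ)) where
  toLin := extend O κ
  proj_comm s D := by
    funext n a K
    rcases a with a | a
    · change (∑ K' : Fin n → ι, if (fun j => Sum.inl (K' j)) = K then
        O.proj n (s + G.coordPar a + G.wordPar K') (D n a K') else 0) =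
        O.proj n _ (∑ K' : Fin n → ι, if (fun j => Sum.inl (K' j)) = K then D n a K' else 0)
      rw [map_sum]
      refine Finset.sum_congr rfl fun K' _ => ?_
      split_ifs with h
      · subst h
        rfl
      · rw [map_zero]
    · exact (map_zero (O.proj n _)).symm
  fil_map M D hD n hn a K := by
    rcases a with a | a
    · refine Finset.sum_eq_zero fun K' _ => ?_
      rw [hD n hn, ite_self]
    · rfl

end GramData

end CyclicOperadCE

/-! ### Signs, supersymmetric forms and Chevalley–Eilenberg chains, without operads -/

namespace CyclicOperadCE

/-! ## Permutations and signs -/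

/-! The cycle is killed by a single extra element. Choose a letter `c` dual to an even vector of
$W$, so that the coordinate $x^c$ is odd, and an even closed constant $a\in\mathcal O(0)$ with
$m(a,-)=\mathrm{Id}$, where $m$ is the multiplication with its inputs exchanged if necessary
(`IsWeaklyUnital.exists_const`). The constant derivation $A\colon x^c\mapsto a$, zero on the other
coordinates, is odd and cyclic, since it has a single slot. It satisfies $dA=0$ and $[A,A]=0$, and
it commutes with every derivation extended from $V$, in particular with $\xi$, because these do not
involve $x^c$.

Give the letters of $V$ weight one and those of $W$ weight zero, and let $K$ be the space of cyclic
derivations all of whose words, output letter included, have weight at least two. A contraction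
removes two letters of weight at most one, so $K$ is a dg Lie subalgebra (`isLieOn_heavyDer`). It
contains the image of $\operatorname{CDer}^0$ for $V$, where a term of arity $n\ge 1$ has $n+1\ge 2$
letters of weight one, but it does not contain $A$. On $K$ the operator $\operatorname{ad}A$, which
inserts $a$ for $x^c$, is contractible: replacing a letter $x^b$ of $V$ by $m(x^c,x^b)$ and then
inserting $a$ for the new $x^c$ gives back $x^b$, so that the graded commutator of the two
operations counts the letters of $V$, and one divides by the weight (`contraction_commutator`). The
bound two disposes of the boundary case of arity one.

On chains, write $\lambda$ for the coderivation extending $Q_2(A,-)=-[A,-]$ and $\sigma$ for the one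
extending the contraction, divided by $n$ on $\hat S^n$. On reduced chains of $K$ killed by
$\lambda$ one has $\lambda\sigma=1$. The element $\Pi A$ is even, and
$\partial(A^{j+1}w)=A^{j+1}\partial w+(j+1)A^j\lambda w$ (`boundary_mulChain_pow`). For a cycle $z$
with $\lambda z=0$ put $u_0=z$ and $u_{j+1}=-\partial\sigma u_j$. All $u_j$ are cycles killed by
$\lambda$, and $$y=\sum_j \tfrac{1}{(j+1)!}A^{j+1}\sigma u_j$$ has boundary $z$, by telescoping. The
sum is infinite, but it converges because $A^{j}$ raises the symmetric degree by $j$; this is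
`exists_boundary_eq`. Division by $n$ is the reason for passing to reduced chains.

Two algebraic facts are needed on the way. The Jacobi identity (`commutator_jacobi`) holds because
the composition of derivations has a graded symmetric associator, that is, is of pre-Lie type.
Cyclic derivations are closed under the bracket (`commutator_mem_cDer`) because the commutator, with
its output lowered, is a full symmetrization of a contraction (`sum_tact_contract`). The identities
between operators on cochains are proved by induction on the arity, contracting with one homogeneous
argument (`curryLeft_derOp`, `curryLeft_ceOp`). They are only claimed on a subspace, since arbitrary
families of coefficients do not form a Lie algebra. -/

theorem sgn_zero (k : Type*) [Ring k] : sgn k 0 = 1 := by simp [sgn]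

theorem sgn_one (k : Type*) [Ring k] : sgn k 1 = -1 := by simp [sgn, ZMod.val_one]

theorem zmod_two_cases (s : ZMod 2) : s = 0 ∨ s = 1 := by revert s; decide

theorem sum_zmod_two {M : Type*} [AddCommMonoid M] (F : ZMod 2 → M) : ∑ s, F s = F 0 + F 1 :=
  Fin.sum_univ_two F

theorem zmod_two_add_self (s : ZMod 2) : s + s = 0 := by revert s; decide

theorem zmod_two_mul_self (s : ZMod 2) : s * s = s := by revert s; decide

theorem sgn_mul_self (k : Type*) [Ring k] (s : ZMod 2) : sgn k s * sgn k s = 1 := by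
  rw [← sgn_add, zmod_two_add_self, sgn_zero]

/-- Splitting of a sum over all permutations according to the place moved to `o`. -/
theorem sum_perm_eq_sum_cosets {n : ℕ} {M : Type*} [AddCommMonoid M] (o : Fin (n + 1))
    (e : Equiv.Perm (Fin n) → Equiv.Perm (Fin (n + 1))) (he : Function.Injective e)
    (heo : ∀ τ, e τ o = o) (g : Fin (n + 1) → Equiv.Perm (Fin (n + 1))) (hg : ∀ x, g x x = o)
    (F : Equiv.Perm (Fin (n + 1)) → M) :
    ∑ σ, F σ = ∑ x, ∑ τ, F (e τ * g x) := by
  have hb : Function.Bijective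
      (fun a : Fin (n + 1) × Equiv.Perm (Fin n) => e a.2 * g a.1) := by
    rw [Fintype.bijective_iff_injective_and_card]
    constructor
    · rintro ⟨x, τ⟩ ⟨x', τ'⟩ h
      have hx : x = x' := by
        have h1 : (e τ * g x) x = o := by simp [hg, heo]
        have h2 : (e τ' * g x') x' = o := by simp [hg, heo]
        simp only at h
        rw [h, ← h2] at h1
        exact (e τ' * g x').injective h1
      subst hx
      simp only [mul_left_inj] at h
      rw [he h]
    · simp [Fintype.card_perm, Nat.factorial_succ]
  rw [← hb.sum_comp, Fintype.sum_prod_type]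

/-- The permutation which fixes the first place and acts by `σ` on the others. -/
def extendFirst {n : ℕ} (σ : Equiv.Perm (Fin n)) : Equiv.Perm (Fin (n + 1)) :=
  (finSuccEquiv n).trans ((Equiv.optionCongr σ).trans (finSuccEquiv n).symm)

@[simp] theorem extendFirst_zero {n : ℕ} (σ : Equiv.Perm (Fin n)) : extendFirst σ 0 = 0 := by
  simp [extendFirst]

@[simp] theorem extendFirst_succ {n : ℕ} (σ : Equiv.Perm (Fin n)) (j : Fin n) :
    extendFirst σ j.succ = (σ j).succ := by
  simp [extendFirst]

theorem extendFirst_injective {n : ℕ} :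
    Function.Injective (extendFirst : Equiv.Perm (Fin n) → Equiv.Perm (Fin (n + 1))) := by
  intro σ τ h
  ext j
  have := congrArg (fun ρ => ρ j.succ) h
  simpa using congrArg Fin.val this

theorem extendFirst_inv {n : ℕ} (σ : Equiv.Perm (Fin n)) :
    (extendFirst σ)⁻¹ = extendFirst σ⁻¹ := by
  rw [inv_eq_iff_mul_eq_one]
  ext j
  induction j using Fin.cases <;> simp

theorem extendFirst_swap {n : ℕ} (i j : Fin n) :
    extendFirst (Equiv.swap i j) = Equiv.swap i.succ j.succ := by
  ext x
  induction x using Fin.cases with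
  | zero => rw [extendFirst_zero, Equiv.swap_apply_of_ne_of_ne] <;> simp [Fin.ext_iff]
  | succ x =>
    rw [extendFirst_succ]
    simp only [Equiv.swap_apply_def, Fin.succ_inj]
    split_ifs <;> rfl

theorem koszulExp_extendFirst {n : ℕ} (σ : Equiv.Perm (Fin n)) (q : Fin (n + 1) → ZMod 2) :
    koszulExp (extendFirst σ) q = koszulExp σ (Fin.tail q) := by
  simp [koszulExp, Fin.sum_univ_succ, Fin.tail]

theorem koszulExp_swap_zero_one {n : ℕ} (q : Fin (n + 2) → ZMod 2) :
    koszulExp (Equiv.swap 0 1) q = q 0 * q 1 := by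
  have h2 : ∀ j : Fin n, Equiv.swap (0 : Fin (n + 2)) 1 j.succ.succ = j.succ.succ := fun j =>
    Equiv.swap_apply_of_ne_of_ne (by simp [Fin.ext_iff]) (by simp [Fin.ext_iff])
  have h0 : Equiv.swap (0 : Fin (n + 2)) 1 0 = 1 := Equiv.swap_apply_left _ _
  have h1 : Equiv.swap (0 : Fin (n + 2)) 1 1 = 0 := Equiv.swap_apply_right _ _
  have hlt : ∀ j : Fin n, ¬ (j.succ.succ : Fin (n + 2)) < 1 := fun j h => by
    simp [Fin.lt_def] at h
  have hlt' : ∀ j l : Fin n, j < l → ¬ l < j := fun j l h => h.not_gt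
  have hz : ∀ j l : Fin n, ¬ (j < l ∧ l < j) := fun j l h => hlt' j l h.1 h.2
  unfold koszulExp
  simp [Fin.sum_univ_succ, h0, h1, h2, hlt, hz]

theorem koszul_extendFirst (k : Type*) [Ring k] {n : ℕ} (σ : Equiv.Perm (Fin n))
    (q : Fin (n + 1) → ZMod 2) :
    koszul k (extendFirst σ) q = koszul k σ (Fin.tail q) := by
  rw [koszul, koszulExp_extendFirst, koszul]

/-! ## Contractions of cochains -/

namespace FormalSpace

variable {k : Type u} [Field k] {X : Type v} [AddCommGroup X] [Module k X] (L : FormalSpace k X)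

/-- The axioms of a graded skew-symmetric bracket and an odd differential. -/
structure IsSuper : Prop where
  total : ∀ x, L.proj 0 x + L.proj 1 x = x
  d_odd : ∀ q x, L.proj q x = x → L.proj (q + 1) (L.d x) = L.d x
  br_even : ∀ q r x y, L.proj q x = x → L.proj r y = y → L.proj (q + r) (L.br x y) = L.br x y
  br_symm : ∀ q r x y, L.proj q x = x → L.proj r y = y →
    L.br y x = -(sgn k (q * r) • L.br x y)

/-- All entries are homogeneous and in `K`; the entry `r i` has parity `p i` in `ΠX`. -/
def HomIn (K : Submodule k X) {n : ℕ} (p : Fin n → ZMod 2) (r : Fin n → X) : Prop :=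
  ∀ i, r i ∈ K ∧ L.proj (p i + 1) (r i) = r i

variable {L}

theorem HomIn.tail {K : Submodule k X} {n : ℕ} {p : Fin (n + 1) → ZMod 2} {r : Fin (n + 1) → X}
    (h : L.HomIn K p r) : L.HomIn K (Fin.tail p) (Fin.tail r) := fun i => h i.succ

theorem HomIn.cons {K : Submodule k X} {n : ℕ} {p : Fin n → ZMod 2} {r : Fin n → X}
    (h : L.HomIn K p r) {q : ZMod 2} {x : X} (hx : x ∈ K) (hq : L.proj (q + 1) x = x) :
    L.HomIn K (Fin.cons q p : Fin (n + 1) → ZMod 2) (Fin.cons x r : Fin (n + 1) → X) := by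
  intro i
  induction i using Fin.cases with
  | zero => exact ⟨hx, hq⟩
  | succ i => simpa using h i

theorem proj_of_hom {q s : ZMod 2} {x : X} (h : L.proj q x = x) :
    L.proj s x = if s = q then x else 0 := by
  rw [← h, L.proj_proj, h]

/-- A multilinear form is the sum of its values on the parity components of the arguments, and a
graded subspace contains these components. Koszul signs therefore have to be handled on homogeneous
arguments only. -/
theorem apply_eq_of_homIn (hL : L.IsSuper) {K : Submodule k X}
    (hK : ∀ s x, x ∈ K → L.proj s x ∈ K) {n : ℕ} {ω ω' : Form k X n}
    (h : ∀ p r, L.HomIn K p r → ω r = ω' r) (r : Fin n → X) (hr : ∀ i, r i ∈ K) :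
    ω r = ω' r := by
  have hexp : r = fun i => ∑ s : ZMod 2, L.proj s (r i) := by
    funext i
    rw [← hL.total (r i)]
    rw [hL.total, sum_zmod_two, hL.total]
  rw [hexp, MultilinearMap.map_sum, MultilinearMap.map_sum]
  refine Finset.sum_congr rfl fun p _ => h (fun i => p i + 1) _ fun i => ⟨hK _ _ (hr i), ?_⟩
  rw [L.proj_proj, add_assoc, zmod_two_add_self, add_zero, if_pos rfl]

theorem form_ext_of_hom (hL : L.IsSuper) {n : ℕ} {ω ω' : Form k X n}
    (h : ∀ p r, L.HomIn ⊤ p r → ω r = ω' r) : ω = ω' := by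
  ext r
  exact apply_eq_of_homIn hL (fun _ _ _ => Submodule.mem_top) h r fun _ => Submodule.mem_top

theorem form_ext_of_curryLeft (hL : L.IsSuper) {n : ℕ} {ω ω' : Form k X (n + 1)}
    (h : ∀ q x, L.proj q x = x → ω.curryLeft x = ω'.curryLeft x) : ω = ω' := by
  refine form_ext_of_hom hL fun p r hr => ?_
  have := DFunLike.congr_fun (h _ (r 0) (hr 0).2) (Fin.tail r)
  simpa using this

variable (L) in
theorem permute_one (hL : L.IsSuper) {n : ℕ} (ω : Form k X n) : L.permute 1 ω = ω := by
  refine form_ext_of_hom hL fun p r hr => ?_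
  rw [permute_apply, Finset.sum_eq_single p]
  · have h0 : koszulExp (1 : Equiv.Perm (Fin n)) p = 0 :=
      Finset.sum_eq_zero fun j _ => Finset.sum_eq_zero fun l _ => by
        rw [if_neg]
        rintro ⟨h1, h2⟩
        exact h1.not_gt h2
    simp [koszul, h0, sgn_zero, fun j => (hr j).2]
  · intro p' _ hp'
    obtain ⟨j, hj⟩ := Function.ne_iff.mp hp'
    rw [ω.map_coord_zero j, mul_zero]
    rw [proj_of_hom (hr _).2, if_neg]
    simpa using hj
  · simp

/-- Of the sum over parity vectors in the definition of `permute` only the actual parities survive,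
the other projections being zero. -/
theorem permute_hom {n : ℕ} (σ : Equiv.Perm (Fin n)) (ω : Form k X n) {K : Submodule k X}
    {p : Fin n → ZMod 2} {r : Fin n → X} (hr : L.HomIn K p r) :
    L.permute σ ω r = koszul k σ⁻¹ p * ω (fun j => r (σ j)) := by
  rw [permute_apply, Finset.sum_eq_single p]
  · simp [fun j => (hr j).2]
  · intro p' _ hp'
    obtain ⟨j, hj⟩ := Function.ne_iff.mp hp'
    rw [ω.map_coord_zero (σ⁻¹ j), mul_zero]
    rw [proj_of_hom (hr _).2, if_neg]
    simpa using hj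
  · simp

/-- No sign appears because the first argument is not crossed by any other. This is what allows
inductions on the arity by contraction with the first argument. -/
theorem curryLeft_permute_extendFirst (hL : L.IsSuper) {n : ℕ} (σ : Equiv.Perm (Fin n))
    (Ω : Form k X (n + 1)) {q : ZMod 2} {x : X} (hx : L.proj q x = x) :
    (L.permute (extendFirst σ) Ω).curryLeft x = L.permute σ (Ω.curryLeft x) := by
  refine form_ext_of_hom hL fun p r hr => ?_
  have hx' : L.proj (q + 1 + 1) x = x := by rw [add_assoc, zmod_two_add_self, add_zero, hx]
  rw [MultilinearMap.curryLeft_apply, permute_hom _ _ (hr.cons Submodule.mem_top hx'), permute_hom _ _ hr,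
    MultilinearMap.curryLeft_apply, extendFirst_inv, koszul_extendFirst, Fin.tail_cons]
  congr 2
  funext j
  induction j using Fin.cases <;> simp

variable (L) in
/-- The form is supersymmetric. -/
def IsSymm {n : ℕ} (ω : Form k X n) : Prop := ∀ σ, L.permute σ ω = ω

theorem isSymm_symm (n : ℕ) (ω : Form k X n) : L.IsSymm (L.symm n ω) := by
  intro τ
  simp only [symm, LinearMap.sum_apply, map_sum, permute_permute]
  exact Equiv.sum_comp (Equiv.mulLeft τ) (fun σ => L.permute σ ω)

theorem symm_of_isSymm {n : ℕ} {ω : Form k X n} (h : L.IsSymm ω) :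
    L.symm n ω = (n.factorial : k) • ω := by
  simp only [symm, LinearMap.sum_apply, h _, Finset.sum_const, Finset.card_univ, Fintype.card_perm,
    Fintype.card_fin, Nat.cast_smul_eq_nsmul]

theorem IsSymm.curryLeft (hL : L.IsSuper) {n : ℕ} {ω : Form k X (n + 1)} (h : L.IsSymm ω)
    {q : ZMod 2} {x : X} (hx : L.proj q x = x) : L.IsSymm (ω.curryLeft x) := fun σ => by
  rw [← curryLeft_permute_extendFirst hL σ ω hx, h]

theorem IsSymm.smul {n : ℕ} {ω : Form k X n} (h : L.IsSymm ω) (c : k) : L.IsSymm (c • ω) :=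
  fun σ => by rw [map_smul, h]

theorem isSymm_zero {n : ℕ} : L.IsSymm (0 : Form k X n) := fun σ => by rw [map_zero]

/-- The symmetric group is cut into cosets of the stabilizer of the first place, and the stabilizer
sums up to the symmetrization of the contracted form. The representatives `g` are left free, so that
each application can choose those for which the permuted form is easy to compute. -/
theorem curryLeft_symm (hL : L.IsSuper) {n : ℕ} (Ω : Form k X (n + 1))
    (g : Fin (n + 1) → Equiv.Perm (Fin (n + 1))) (hg : ∀ i, g i i = 0)
    {q : ZMod 2} {x : X} (hx : L.proj q x = x) :
    (L.symm (n + 1) Ω).curryLeft x = ∑ i, L.symm n ((L.permute (g i) Ω).curryLeft x) := by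
  have h1 : L.symm (n + 1) Ω = ∑ σ, L.permute σ Ω := by simp [symm]
  rw [h1, sum_perm_eq_sum_cosets 0 extendFirst extendFirst_injective extendFirst_zero g hg]
  have h2 : ∀ (s : Finset (Fin (n + 1))) (F : Fin (n + 1) → Form k X (n + 1)),
      (∑ i ∈ s, F i).curryLeft x = ∑ i ∈ s, (F i).curryLeft x := fun s F => by
    ext r
    simp
  have h3 : ∀ (s : Finset (Equiv.Perm (Fin n))) (F : Equiv.Perm (Fin n) → Form k X (n + 1)),
      (∑ i ∈ s, F i).curryLeft x = ∑ i ∈ s, (F i).curryLeft x := fun s F => by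
    ext r
    simp
  rw [h2]
  refine Finset.sum_congr rfl fun i _ => ?_
  rw [h3, symm, LinearMap.sum_apply]
  refine Finset.sum_congr rfl fun τ _ => ?_
  rw [← permute_permute, curryLeft_permute_extendFirst hL _ _ hx]

theorem apply_swap_zero_one {n : ℕ} {ω : Form k X (n + 2)} (h : L.IsSymm ω) {p₀ p₁ : ZMod 2}
    {x₀ x₁ : X} (h₀ : L.proj (p₀ + 1) x₀ = x₀) (h₁ : L.proj (p₁ + 1) x₁ = x₁)
    {p : Fin n → ZMod 2} {r : Fin n → X} (hr : L.HomIn ⊤ p r) :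
    ω (Fin.cons x₀ (Fin.cons x₁ r : Fin (n + 1) → X)) =
      sgn k (p₀ * p₁) * ω (Fin.cons x₁ (Fin.cons x₀ r : Fin (n + 1) → X)) := by
  conv_lhs => rw [← h (Equiv.swap 0 1)]
  rw [permute_hom _ _ ((hr.cons Submodule.mem_top h₁).cons trivial h₀), Equiv.swap_inv, koszul,
    koszulExp_swap_zero_one]
  congr 2
  funext j
  induction j using Fin.cases with
  | zero => simp
  | succ j =>
    induction j using Fin.cases with
    | zero => simp
    | succ j =>
      rw [Equiv.swap_apply_of_ne_of_ne (by simp [Fin.ext_iff]) (by simp [Fin.ext_iff])]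
      simp

/-- `ω ↦ ω (f x₀, x₁, …, xₙ)`. -/
noncomputable def insMap (f : X →ₗ[k] X) (n : ℕ) : Form k X (n + 1) →ₗ[k] Form k X (n + 1) where
  toFun ω := (ω.curryLeft ∘ₗ f).uncurryLeft
  map_add' a b := by ext x; simp
  map_smul' c a := by ext x; simp

theorem insMap_apply (f : X →ₗ[k] X) (n : ℕ) (ω : Form k X (n + 1)) (x : Fin (n + 1) → X) :
    insMap f n ω x = ω (Fin.cons (f (x 0)) (Fin.tail x)) := rfl

theorem curryLeft_insMap (f : X →ₗ[k] X) (n : ℕ) (ω : Form k X (n + 1)) (x : X) :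
    (insMap f n ω).curryLeft x = ω.curryLeft (f x) := by
  ext r
  simp [insMap_apply]

variable (L) in
/-- The extension of `f` to a derivation of supersymmetric forms. -/
noncomputable def derOp (f : X →ₗ[k] X) : (n : ℕ) → Form k X n →ₗ[k] Form k X n
  | 0 => 0
  | n + 1 => (n.factorial : k)⁻¹ • (L.symm (n + 1) ∘ₗ insMap f n)

variable (L) in
/-- The Chevalley-Eilenberg operator on forms. -/
noncomputable def ceOp : (n : ℕ) → Form k X n →ₗ[k] Form k X (n + 1)
  | 0 => 0
  | n + 1 => ((2 : k) * n.factorial)⁻¹ • (L.symm (n + 2) ∘ₗ L.insBr n)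

theorem isSymm_derOp (f : X →ₗ[k] X) {n : ℕ} (ω : Form k X n) : L.IsSymm (L.derOp f n ω) := by
  cases n with
  | zero => exact isSymm_zero
  | succ n => exact (isSymm_symm _ _).smul _

theorem isSymm_ceOp {n : ℕ} (ω : Form k X n) : L.IsSymm (L.ceOp n ω) := by
  cases n with
  | zero => exact isSymm_zero
  | succ n => exact (isSymm_symm _ _).smul _

theorem coe_dI {n : ℕ} (ω : L.cochain n) : (L.dI n ω : Form k X n) = L.derOp L.d n ω := by
  cases n <;> rfl

theorem coe_dCE {n : ℕ} (ω : L.cochain n) : (L.dCE n ω : Form k X (n + 1)) = L.ceOp n ω := by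
  cases n <;> rfl

variable (L) in
/-- The linear map `f` is homogeneous of parity `s`. -/
def IsHom (s : ZMod 2) (f : X →ₗ[k] X) : Prop :=
  ∀ q x, L.proj q x = x → L.proj (q + s) (f x) = f x

theorem permute_insMap (hL : L.IsSuper) {s : ZMod 2} {f : X →ₗ[k] X} (hf : L.IsHom s f) {n : ℕ}
    {ω : Form k X (n + 1)} (hω : L.IsSymm ω) (σ : Equiv.Perm (Fin n)) :
    L.permute (extendFirst σ) (insMap f n ω) = insMap f n ω := by
  refine form_ext_of_curryLeft hL fun q x hx => ?_
  rw [curryLeft_permute_extendFirst hL _ _ hx, curryLeft_insMap,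
    IsSymm.curryLeft hL hω (hf q x hx)]

theorem curryLeft_derOp_zero (hL : L.IsSuper) (f : X →ₗ[k] X) (ω : Form k X 1) {q : ZMod 2} {x : X}
    (_ : L.proj q x = x) : (L.derOp f 1 ω).curryLeft x = ω.curryLeft (f x) := by
  have h1 : L.derOp f 1 ω = insMap f 0 ω := by
    simp [derOp, symm, permute_one L hL]
  rw [h1, curryLeft_insMap]

/-- Leibniz rule: `f` acts either on the contracted argument or, after passing it with the sign
$(-1)^{sp}$, on one of the others. Later identities use this recursion instead of the explicit
symmetrization. -/
theorem curryLeft_derOp [CharZero k] (hL : L.IsSuper) {s : ZMod 2} {f : X →ₗ[k] X}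
    (hf : L.IsHom s f) {n : ℕ} {ω : Form k X (n + 1)} (hω : L.IsSymm ω) {p : ZMod 2} {x : X}
    (hx : L.proj (p + 1) x = x) :
    (L.derOp f (n + 1) ω).curryLeft x =
      ω.curryLeft (f x) + sgn k (s * p) • L.derOp f n (ω.curryLeft x) := by
  cases n with
  | zero =>
    rw [curryLeft_derOp_zero hL f ω hx]
    simp [derOp]
  | succ n =>
    have hfac : (((n + 1).factorial : ℕ) : k) ≠ 0 := by exact_mod_cast Nat.factorial_ne_zero _
    have hfac' : ((n.factorial : ℕ) : k) ≠ 0 := by exact_mod_cast Nat.factorial_ne_zero _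
    have key : (L.symm (n + 2) (insMap f (n + 1) ω)).curryLeft x =
        ((n + 1).factorial : k) • ω.curryLeft (f x) +
          ((n + 1 : ℕ) : k) • sgn k (s * p) • L.symm (n + 1) (insMap f n (ω.curryLeft x)) := by
      -- The representative for place `j + 1` first exchanges it with place `1`, under which `insMap
      -- f _ ω` is invariant, and then places `1` and `0`. Hence all places but the first contribute
      -- the same term.
      rw [curryLeft_symm hL _ (Fin.cases 1 fun j => Equiv.swap 0 1 * Equiv.swap 1 j.succ) _ hx,
        Fin.sum_univ_succ]
      · congr 1
        · rw [Fin.cases_zero, permute_one L hL, curryLeft_insMap,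
            symm_of_isSymm (hω.curryLeft hL (hf _ x hx))]
        · have hj : ∀ j : Fin (n + 1), L.symm (n + 1) ((L.permute
              (Fin.cases (motive := fun _ => Equiv.Perm (Fin (n + 2))) 1
                (fun j => Equiv.swap 0 1 * Equiv.swap 1 j.succ) j.succ)
              (insMap f (n + 1) ω)).curryLeft x) =
              sgn k (s * p) • L.symm (n + 1) (insMap f n (ω.curryLeft x)) := by
            intro j
            rw [Fin.cases_succ, ← permute_permute]
            have h1 : Equiv.swap (1 : Fin (n + 2)) j.succ = extendFirst (Equiv.swap 0 j) := by
              rw [extendFirst_swap]; rfl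
            rw [h1, permute_insMap hL hf hω, ← map_smul]
            congr 1
            refine form_ext_of_hom hL fun p' r hr => ?_
            obtain ⟨x₁, r, rfl⟩ : ∃ x₁ r', r = Fin.cons x₁ r' := ⟨_, _, (Fin.cons_self_tail r).symm⟩
            obtain ⟨p₁, p', rfl⟩ : ∃ p₁ p'', p' = Fin.cons p₁ p'' :=
              ⟨_, _, (Fin.cons_self_tail p').symm⟩
            have hx₁ : L.proj (p₁ + 1) x₁ = x₁ := (hr 0).2
            have hr' : L.HomIn ⊤ p' r := hr.tail
            have hfx := hf _ _ hx₁
            rw [add_right_comm] at hfx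
            rw [MultilinearMap.curryLeft_apply, permute_hom _ _ (hr.cons Submodule.mem_top hx),
              Equiv.swap_inv, koszul, koszulExp_swap_zero_one, smul_apply,
              insMap_apply, insMap_apply, MultilinearMap.curryLeft_apply]
            have h2 : (fun j => (Fin.cons x (Fin.cons x₁ r : Fin (n + 1) → X) : Fin (n + 2) → X)
                (Equiv.swap 0 1 j)) = Fin.cons x₁ (Fin.cons x r : Fin (n + 1) → X) := by
              funext j
              induction j using Fin.cases with
              | zero => simp
              | succ j =>
                induction j using Fin.cases with
                | zero => simp
                | succ j =>
                  rw [Equiv.swap_apply_of_ne_of_ne (by simp [Fin.ext_iff]) (by simp [Fin.ext_iff])]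
                  simp
            rw [h2]
            rw [Equiv.swap_apply_left]
            simp only [Fin.cons_zero, Fin.tail_cons, Fin.cons_one]
            rw [apply_swap_zero_one hω hfx hx hr', ← mul_assoc, ← sgn_add, smul_eq_mul]
            congr 2
            have h3 : ∀ p p₁ s : ZMod 2, p * p₁ + (p₁ + s) * p = s * p := by decide
            exact h3 _ _ _
          simp only [hj, Finset.sum_const, Finset.card_univ, Fintype.card_fin,
            Nat.cast_smul_eq_nsmul]
      · intro i
        induction i using Fin.cases <;> simp
    have h0 : (L.derOp f (n + 2) ω).curryLeft x =
        (((n + 1).factorial : ℕ) : k)⁻¹ • (L.symm (n + 2) (insMap f (n + 1) ω)).curryLeft x := rfl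
    have h1 : L.derOp f (n + 1) (ω.curryLeft x) =
        ((n.factorial : ℕ) : k)⁻¹ • L.symm (n + 1) (insMap f n (ω.curryLeft x)) := rfl
    rw [h0, key, h1, smul_add, smul_smul, inv_mul_cancel₀ hfac, one_smul, smul_smul, smul_smul,
      smul_smul]
    congr 2
    rw [Nat.factorial_succ]
    push_cast
    have : ((n : k) + 1) ≠ 0 := by exact_mod_cast Nat.succ_ne_zero n
    field_simp

end FormalSpace
end CyclicOperadCE

/-! ### Cartan calculus for the Chevalley–Eilenberg operator -/

namespace CyclicOperadCE
namespace FormalSpace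

variable {k : Type u} [Field k] {X : Type v} [AddCommGroup X] [Module k X] {L : FormalSpace k X}

theorem shiftBr_of_hom {q : ZMod 2} {x : X} (hx : L.proj q x = x) (y : X) :
    L.shiftBr x y = sgn k q • L.br x y := by
  rw [shiftBr_apply, Finset.sum_eq_single q]
  · rw [hx]
  · intro s _ hs
    rw [proj_of_hom hx, if_neg hs, map_zero, LinearMap.zero_apply, smul_zero]
  · simp

theorem isHom_shiftBr (hL : L.IsSuper) {q : ZMod 2} {x : X} (hx : L.proj q x = x) :
    L.IsHom q (L.shiftBr x) := fun r y hy => by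
  rw [shiftBr_of_hom hx, map_smul, add_comm r q, hL.br_even _ _ _ _ hx hy]

theorem shiftBr_swap (hL : L.IsSuper) {p₀ p₁ : ZMod 2} {x₀ x₁ : X}
    (h₀ : L.proj (p₀ + 1) x₀ = x₀) (h₁ : L.proj (p₁ + 1) x₁ = x₁) :
    L.shiftBr x₀ x₁ = sgn k (p₀ * p₁) • L.shiftBr x₁ x₀ := by
  rw [shiftBr_of_hom h₀, shiftBr_of_hom h₁, hL.br_symm _ _ _ _ h₁ h₀, smul_smul, ← neg_smul,
    smul_smul]
  congr 1
  rw [← sgn_add, mul_neg, ← sgn_add]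
  have h : ∀ p q : ZMod 2, -(sgn k (p + 1 + (q + 1) * (p + 1))) = sgn k (p * q + (q + 1)) := by
    intro p q
    have e : (1 : ZMod 2) + 1 = 0 := rfl
    rcases zmod_two_cases p with rfl | rfl <;> rcases zmod_two_cases q with rfl | rfl <;>
      simp only [e, add_zero, zero_add, mul_zero, mul_one, sgn_zero, sgn_one, neg_neg]
  rw [← h p₀ p₁]

theorem cons_cons_swap {X : Type*} {n : ℕ} (x₀ x₁ : X) (r : Fin n → X) :
    (fun j => (Fin.cons x₀ (Fin.cons x₁ r : Fin (n + 1) → X) : Fin (n + 2) → X)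
      (Equiv.swap 0 1 j)) = Fin.cons x₁ (Fin.cons x₀ r : Fin (n + 1) → X) := by
  funext j
  induction j using Fin.cases with
  | zero => simp
  | succ j =>
    induction j using Fin.cases with
    | zero => simp
    | succ j =>
      rw [Equiv.swap_apply_of_ne_of_ne (by simp [Fin.ext_iff]) (by simp [Fin.ext_iff])]
      simp

theorem permute_swap_insBr (hL : L.IsSuper) {n : ℕ} (ω : Form k X (n + 1)) :
    L.permute (Equiv.swap 0 1) (L.insBr n ω) = L.insBr n ω := by
  refine form_ext_of_hom hL fun p r hr => ?_
  obtain ⟨x₀, r, rfl⟩ : ∃ x₁ r', r = Fin.cons x₁ r' := ⟨_, _, (Fin.cons_self_tail r).symm⟩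
  obtain ⟨x₁, r, rfl⟩ : ∃ x₁ r', r = Fin.cons x₁ r' := ⟨_, _, (Fin.cons_self_tail r).symm⟩
  rw [permute_hom _ _ hr, Equiv.swap_inv, koszul, koszulExp_swap_zero_one, cons_cons_swap,
    insBr_apply, insBr_apply]
  simp only [Fin.cons_zero, Fin.tail_cons, Fin.cons_one]
  have h₀ : L.proj (p 0 + 1) x₀ = x₀ := (hr 0).2
  have h₁ : L.proj (p 1 + 1) x₁ = x₁ := (hr 1).2
  have := ω.cons_smul r (sgn k (p 0 * p 1)) (L.shiftBr x₁ x₀)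
  rw [← shiftBr_swap hL h₀ h₁] at this
  rw [this, smul_eq_mul]

theorem curryLeft_insBr {n : ℕ} (ω : Form k X (n + 1)) (x : X) :
    (L.insBr n ω).curryLeft x = insMap (L.shiftBr x) n ω := by
  ext r
  rw [MultilinearMap.curryLeft_apply, insBr_apply, insMap_apply]
  simp

theorem permute_insBr (hL : L.IsSuper) {n : ℕ} {ω : Form k X (n + 1)} (hω : L.IsSymm ω)
    (σ : Equiv.Perm (Fin n)) :
    L.permute (extendFirst (extendFirst σ)) (L.insBr n ω) = L.insBr n ω := by
  refine form_ext_of_curryLeft hL fun q x hx => ?_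
  rw [curryLeft_permute_extendFirst hL _ _ hx, curryLeft_insBr,
    permute_insMap hL (isHom_shiftBr hL hx) hω]

/-- Cartan formula: the pairs which contain the contracted argument `x` give the derivation
extending $Q_2(x,-)$, the remaining pairs give $d_{CE}$ of the contracted form, with the sign of the
odd operator passing `x`. -/
theorem curryLeft_ceOp [CharZero k] (hL : L.IsSuper) {n : ℕ} {ω : Form k X (n + 1)}
    (hω : L.IsSymm ω) {p : ZMod 2} {x : X} (hx : L.proj (p + 1) x = x) :
    (L.ceOp (n + 1) ω).curryLeft x =
      L.derOp (L.shiftBr x) (n + 1) ω + sgn k p • L.ceOp n (ω.curryLeft x) := by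
  have hfac : ((n.factorial : ℕ) : k) ≠ 0 := by exact_mod_cast Nat.factorial_ne_zero _
  have h0 : (L.ceOp (n + 1) ω).curryLeft x =
      ((2 : k) * n.factorial)⁻¹ • (L.symm (n + 2) (L.insBr n ω)).curryLeft x := rfl
  have h1 : L.derOp (L.shiftBr x) (n + 1) ω =
      (n.factorial : k)⁻¹ • L.symm (n + 1) (insMap (L.shiftBr x) n ω) := rfl
  have key : (L.symm (n + 2) (L.insBr n ω)).curryLeft x =
      (2 : k) • L.symm (n + 1) (insMap (L.shiftBr x) n ω) +
        ((2 : k) * n.factorial) • sgn k p • L.ceOp n (ω.curryLeft x) := by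
    -- Places `0` and `1` both put `x` inside the bracket and agree by the supersymmetry of $Q_2$,
    -- which cancels the factor `2` of the normalization. Any other place is brought to `2` by a
    -- permutation that leaves `insBr` invariant, then to `1` and `0`.
    rw [curryLeft_symm hL _ (Fin.cases 1 (Fin.cases (Equiv.swap 0 1) fun j =>
      Equiv.swap 0 1 * (Equiv.swap 1 2 * Equiv.swap 2 j.succ.succ))) _ hx,
      Fin.sum_univ_succ, Fin.sum_univ_succ, ← add_assoc]
    · congr 1
      · rw [Fin.cases_zero, Fin.cases_succ, Fin.cases_zero, permute_one L hL, permute_swap_insBr hL,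
          curryLeft_insBr, two_smul]
      · cases n with
        | zero => simp [ceOp]
        | succ n =>
          have hj : ∀ j : Fin (n + 1), L.symm (n + 2) ((L.permute
              (Fin.cases (motive := fun _ => Equiv.Perm (Fin (n + 3))) 1
                (Fin.cases (motive := fun _ => Equiv.Perm (Fin (n + 3))) (Equiv.swap 0 1) fun j =>
                  Equiv.swap 0 1 * (Equiv.swap 1 2 * Equiv.swap 2 j.succ.succ)) j.succ.succ)
              (L.insBr (n + 1) ω)).curryLeft x) =
              sgn k p • L.symm (n + 2) (L.insBr n (ω.curryLeft x)) := by
            intro j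
            rw [Fin.cases_succ, Fin.cases_succ, ← permute_permute, ← permute_permute]
            have h1 : Equiv.swap (2 : Fin (n + 3)) j.succ.succ =
                extendFirst (extendFirst (Equiv.swap 0 j)) := by
              rw [extendFirst_swap, extendFirst_swap]; rfl
            have h12 : Equiv.swap (1 : Fin (n + 3)) 2 = extendFirst (Equiv.swap 0 1) := by
              rw [extendFirst_swap]; rfl
            rw [h1, permute_insBr hL hω, ← map_smul]
            congr 1
            refine form_ext_of_hom hL fun p' r hr => ?_
            obtain ⟨x₁, r, rfl⟩ : ∃ x₁ r', r = Fin.cons x₁ r' := ⟨_, _, (Fin.cons_self_tail r).symm⟩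
            obtain ⟨p₁, p', rfl⟩ : ∃ p₁ p'', p' = Fin.cons p₁ p'' :=
              ⟨_, _, (Fin.cons_self_tail p').symm⟩
            obtain ⟨x₂, r, rfl⟩ : ∃ x₁ r', r = Fin.cons x₁ r' := ⟨_, _, (Fin.cons_self_tail r).symm⟩
            obtain ⟨p₂, p', rfl⟩ : ∃ p₁ p'', p' = Fin.cons p₁ p'' :=
              ⟨_, _, (Fin.cons_self_tail p').symm⟩
            have hx₁ : L.proj (p₁ + 1) x₁ = x₁ := (hr 0).2
            have hx₂ : L.proj (p₂ + 1) x₂ = x₂ := (hr 1).2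
            have hr' : L.HomIn ⊤ p' r := hr.tail.tail
            have hQ : L.proj (p₁ + p₂ + 1 + 1) (L.shiftBr x₁ x₂) = L.shiftBr x₁ x₂ := by
              have := isHom_shiftBr hL hx₁ _ _ hx₂
              rwa [show p₂ + 1 + (p₁ + 1) = p₁ + p₂ + 1 + 1 by ring] at this
            have hr1 : L.HomIn ⊤ (Fin.cons p₁ (Fin.cons p (Fin.cons p₂ p' : Fin (n + 1) → ZMod 2) :
                Fin (n + 2) → ZMod 2) : Fin (n + 3) → ZMod 2)
                (Fin.cons x₁ (Fin.cons x (Fin.cons x₂ r : Fin (n + 1) → X) :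
                Fin (n + 2) → X) : Fin (n + 3) → X) :=
              ((hr'.cons Submodule.mem_top hx₂).cons Submodule.mem_top hx).cons Submodule.mem_top hx₁
            rw [MultilinearMap.curryLeft_apply, permute_hom _ _ (hr.cons Submodule.mem_top hx),
              Equiv.swap_inv, koszul, koszulExp_swap_zero_one, cons_cons_swap, h12,
              permute_hom _ _ hr1, extendFirst_inv, koszul_extendFirst, Equiv.swap_inv, koszul,
              koszulExp_swap_zero_one]
            have h2 : (fun j => (Fin.cons x₁ (Fin.cons x (Fin.cons x₂ r : Fin (n + 1) → X) :
                Fin (n + 2) → X) : Fin (n + 3) → X) (extendFirst (Equiv.swap 0 1) j)) =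
                Fin.cons x₁ (Fin.cons x₂ (Fin.cons x r : Fin (n + 1) → X) : Fin (n + 2) → X) := by
              funext j
              induction j using Fin.cases with
              | zero => rw [extendFirst_zero]; rfl
              | succ j =>
                rw [extendFirst_succ, Fin.cons_succ, Fin.cons_succ, ← cons_cons_swap x x₂ r]
            rw [h2, insBr_apply, smul_apply, insBr_apply, MultilinearMap.curryLeft_apply]
            simp only [Fin.cons_zero, Fin.tail_cons, Fin.cons_one]
            rw [apply_swap_zero_one hω hQ hx hr', smul_eq_mul, ← mul_assoc, ← mul_assoc, ← sgn_add,
              ← sgn_add]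
            congr 2
            have h3 : ∀ p p₁ p₂ : ZMod 2, p * p₁ + p * p₂ + (p₁ + p₂ + 1) * p = p := by decide
            exact h3 _ _ _
          simp only [hj, Finset.sum_const, Finset.card_univ, Fintype.card_fin]
          have h4 : L.ceOp (n + 1) (ω.curryLeft x) =
            ((2 : k) * n.factorial)⁻¹ • L.symm (n + 2) (L.insBr n (ω.curryLeft x)) := rfl
          have hfac' : ((n.factorial : ℕ) : k) ≠ 0 := by exact_mod_cast Nat.factorial_ne_zero _
          rw [h4, ← Nat.cast_smul_eq_nsmul k, smul_smul, smul_smul, smul_smul]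
          congr 1
          rw [Nat.factorial_succ]
          push_cast
          have : ((n : k) + 1) ≠ 0 := by exact_mod_cast Nat.succ_ne_zero n
          field_simp
    · intro i
      induction i using Fin.cases with
      | zero => simp
      | succ i =>
        induction i using Fin.cases with
        | zero =>
          rw [Fin.cases_succ, Fin.cases_zero]
          simp
        | succ i => simp
  rw [h0, key, h1, smul_add, smul_smul, smul_smul (2 * (n.factorial : k))⁻¹,
    inv_mul_cancel₀ (mul_ne_zero two_ne_zero hfac), one_smul]
  congr 2
  field_simp

/-! ## Identities of operators on the restrictions of cochains to a subspace -/

theorem curryLeft_smul {n : ℕ} (c : k) (ω : Form k X (n + 1)) (x : X) :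
    (c • ω).curryLeft x = c • ω.curryLeft x := rfl

theorem apply_eq_curryLeft {n : ℕ} (ω : Form k X (n + 1)) (r : Fin (n + 1) → X) :
    ω r = ω.curryLeft (r 0) (Fin.tail r) := by
  rw [MultilinearMap.curryLeft_apply, Fin.cons_self_tail]

theorem IsHom.apply {s p : ZMod 2} {f : X →ₗ[k] X} (hf : L.IsHom s f) {x : X}
    (hx : L.proj (p + 1) x = x) : L.proj (p + s + 1) (f x) = f x := by
  rw [add_right_comm, hf _ _ hx]

/-- The commutator of two derivations is determined by its effect on one argument. The order of
composition is reversed, since forms are contravariant. Induction contracts with arguments in `K`,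
so the relation between the maps is needed on `K` only. -/
theorem derOp_commutator [CharZero k] (hL : L.IsSuper) {K : Submodule k X} {s t u : ZMod 2}
    {f g h : X →ₗ[k] X} (hf : L.IsHom s f) (hg : L.IsHom t g) (hh : L.IsHom u h) (hu : u = s + t)
    (hfg : ∀ p x, x ∈ K → L.proj (p + 1) x = x → h x = g (f x) - sgn k (s * t) • f (g x)) {n : ℕ}
    {ω : Form k X n} (hω : L.IsSymm ω) {p : Fin n → ZMod 2} {r : Fin n → X} (hr : L.HomIn K p r) :
    L.derOp f n (L.derOp g n ω) r - sgn k (s * t) * L.derOp g n (L.derOp f n ω) r =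
      L.derOp h n ω r := by
  induction n with
  | zero => simp [derOp]
  | succ n ih =>
    obtain ⟨hx₀, hx⟩ := hr 0
    have hfx := hf.apply hx
    have hgx := hg.apply hx
    have ih' := ih (hω.curryLeft hL hx) hr.tail
    rw [apply_eq_curryLeft, apply_eq_curryLeft (L.derOp g _ _), apply_eq_curryLeft (L.derOp h _ _),
      curryLeft_derOp hL hf (isSymm_derOp _ _) hx, curryLeft_derOp hL hg (isSymm_derOp _ _) hx,
      curryLeft_derOp hL hh hω hx, curryLeft_derOp hL hg hω hfx, curryLeft_derOp hL hf hω hgx,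
      curryLeft_derOp hL hf hω hx, curryLeft_derOp hL hg hω hx, hfg _ _ hx₀ hx]
    simp only [map_add, map_sub, map_smul, add_apply, sub_apply, smul_apply, smul_eq_mul]
    rw [← ih']
    simp only [hu, mul_add, add_mul, sgn_add]
    have hs : sgn k (s * t) = sgn k (t * s) := by rw [mul_comm]
    have h1 := sgn_mul_self k (t * s)
    rw [hs]
    linear_combination (-(sgn k (s * p 0) *
      ((L.derOp f n) (ω.curryLeft (g (r 0)))) (Fin.tail r))) * h1

variable (L) in
/-- On `K` the homogeneous map `f` of parity `s` is a derivation of the odd bracket of `ΠX`. -/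
def IsDerOn (K : Submodule k X) (s : ZMod 2) (f : X →ₗ[k] X) : Prop :=
  ∀ p q x y, x ∈ K → y ∈ K → L.proj (p + 1) x = x → L.proj (q + 1) y = y →
    f (L.shiftBr x y) =
      sgn k s • (L.shiftBr (f x) y + sgn k (s * p) • L.shiftBr x (f y))

/-- After contraction with `x`, the Cartan formula reduces the claim to lower arity and to the
commutator of `f` with $Q_2(x,-)$, which is a multiple of $Q_2(f x,-)$ because `f` is a derivation
of the bracket. -/
theorem derOp_ceOp [CharZero k] (hL : L.IsSuper) {K : Submodule k X} {s : ZMod 2}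
    {f : X →ₗ[k] X} (hf : L.IsHom s f) (hfK : L.IsDerOn K s f) {n : ℕ}
    {ω : Form k X n} (hω : L.IsSymm ω) {p : Fin (n + 1) → ZMod 2} {r : Fin (n + 1) → X}
    (hr : L.HomIn K p r) :
    L.derOp f (n + 1) (L.ceOp n ω) r = sgn k s * L.ceOp n (L.derOp f n ω) r := by
  induction n with
  | zero => simp [ceOp]
  | succ n ih =>
    obtain ⟨hx₀, hx⟩ := hr 0
    have hfx := hf.apply hx
    have hQ := isHom_shiftBr hL hx
    -- The map $y\mapsto Q_2(x,fy)-(-1)^{s(p_0+1)}fQ_2(x,y)$; by the derivation property the two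
    -- terms with $fy$ cancel.
    have hQf : L.IsHom (s + (p 0 + 1)) (-sgn k (s * p 0) • L.shiftBr (f (r 0))) := fun q y hy => by
      have := isHom_shiftBr hL hfx q y hy
      rw [show q + (s + (p 0 + 1)) = q + (p 0 + s + 1) by ring, LinearMap.smul_apply, map_smul, this]
    have ih' := ih (hω.curryLeft hL hx) hr.tail
    have hC := derOp_commutator hL (K := K) (h := -sgn k (s * p 0) • L.shiftBr (f (r 0))) hf hQ hQf rfl
      (fun q y hy hqy => by
        rw [hfK _ _ _ _ hx₀ hy hx hqy]
        simp only [LinearMap.smul_apply, smul_add, smul_smul, mul_add, mul_one, sgn_add]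
        have h1 := sgn_mul_self k s
        have h2 := sgn_mul_self k (s * p 0)
        have e1 : sgn k (s * p 0) * sgn k s * sgn k s = sgn k (s * p 0) := by
          rw [mul_assoc, h1, mul_one]
        have e2 : sgn k (s * p 0) * sgn k s * (sgn k s * sgn k (s * p 0)) = 1 := by
          rw [mul_assoc, ← mul_assoc (sgn k s), h1, one_mul, h2]
        rw [e1, e2, one_smul, neg_smul]
        abel) hω hr.tail
    rw [apply_eq_curryLeft, apply_eq_curryLeft (L.ceOp _ _),
      curryLeft_derOp hL hf (isSymm_ceOp _) hx, curryLeft_ceOp hL hω hfx, curryLeft_ceOp hL hω hx,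
      curryLeft_ceOp hL (isSymm_derOp _ _) hx, curryLeft_derOp hL hf hω hx]
    simp only [map_add, map_smul, add_apply, smul_apply, smul_eq_mul]
    rw [ih']
    have hC' : L.derOp (-sgn k (s * p 0) • L.shiftBr (f (r 0))) (n + 1) ω =
        -sgn k (s * p 0) • L.derOp (L.shiftBr (f (r 0))) (n + 1) ω := by
      have : insMap (-sgn k (s * p 0) • L.shiftBr (f (r 0))) n ω =
          -sgn k (s * p 0) • insMap (L.shiftBr (f (r 0))) n ω := by
        ext y
        simp only [insMap_apply, LinearMap.smul_apply, smul_apply]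
        exact ω.cons_smul _ _ _
      simp only [derOp, LinearMap.smul_apply, LinearMap.comp_apply, this, map_smul]
      rw [smul_comm]
    rw [hC', smul_apply, smul_eq_mul] at hC
    simp only [mul_add, mul_one, sgn_add] at hC ⊢
    have h1 := sgn_mul_self k (s * p 0)
    have h2 := sgn_mul_self k s
    linear_combination sgn k (s * p 0) * hC +
      (sgn k s * L.derOp (L.shiftBr (r 0)) (n + 1) (L.derOp f (n + 1) ω) (Fin.tail r) -
        L.derOp (L.shiftBr (f (r 0))) (n + 1) ω (Fin.tail r)) * h1

/-- The Jacobi identity enters in the form that $Q_2(x,-)$ is a derivation of $Q_2$. Then $d_{CE}$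
commutes with the corresponding derivation of forms up to sign, and the two mixed terms of the twice
applied Cartan formula cancel. -/
theorem ceOp_ceOp [CharZero k] (hL : L.IsSuper) {K : Submodule k X}
    (hK : ∀ p x, x ∈ K → L.proj (p + 1) x = x → L.IsDerOn K (p + 1) (L.shiftBr x)) {n : ℕ}
    {ω : Form k X n} (hω : L.IsSymm ω) {p : Fin (n + 2) → ZMod 2} {r : Fin (n + 2) → X}
    (hr : L.HomIn K p r) :
    L.ceOp (n + 1) (L.ceOp n ω) r = 0 := by
  induction n with
  | zero => simp [ceOp]
  | succ n ih =>
    obtain ⟨hx₀, hx⟩ := hr 0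
    have ih' := ih (hω.curryLeft hL hx) hr.tail
    rw [apply_eq_curryLeft, curryLeft_ceOp hL (isSymm_ceOp _) hx, curryLeft_ceOp hL hω hx]
    simp only [map_add, map_smul, add_apply, smul_apply, smul_eq_mul]
    rw [derOp_ceOp hL (isHom_shiftBr hL hx) (hK _ _ hx₀ hx) hω hr.tail, ih', sgn_add, sgn_one]
    ring

/-- The Euler operator counts the arguments. It turns a contraction of the Lie algebra into a
contraction of its symmetric powers of positive degree. -/
theorem derOp_id [CharZero k] (hL : L.IsSuper) {n : ℕ} {ω : Form k X n} (hω : L.IsSymm ω) :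
    L.derOp LinearMap.id n ω = (n : k) • ω := by
  induction n with
  | zero => simp [derOp]
  | succ n ih =>
    refine form_ext_of_curryLeft hL fun q x hx => ?_
    have hx' : L.proj (q + 1 + 1) x = x := by rw [add_assoc, zmod_two_add_self, add_zero, hx]
    have hid : L.IsHom 0 (LinearMap.id : X →ₗ[k] X) := fun q x hx => by simpa using hx
    rw [curryLeft_derOp hL hid hω hx', ih (hω.curryLeft hL hx), curryLeft_smul, zero_mul, sgn_zero,
      one_smul, LinearMap.id_apply]
    push_cast
    rw [add_smul, one_smul, add_comm]

theorem derOp_apply_of_map_eq_zero {K : Submodule k X}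
    {f : X →ₗ[k] X} (hK : ∀ s x, x ∈ K → L.proj s x ∈ K) (hf : ∀ x ∈ K, f x = 0) {n : ℕ}
    (ω : Form k X n) {r : Fin n → X} (hr : ∀ i, r i ∈ K) :
    L.derOp f n ω r = 0 := by
  cases n with
  | zero => simp [derOp]
  | succ n =>
    have : ∀ σ, L.permute σ (insMap f n ω) r = 0 := fun σ => by
      rw [permute_apply]
      refine Finset.sum_eq_zero fun p _ => ?_
      rw [insMap_apply, hf _ (hK _ _ (hr _)), ω.map_coord_zero 0 (by simp), mul_zero]
    simp [derOp, symm, sum_apply, this]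

theorem derOp_eq_zero_of_vanishing {K : Submodule k X} {f : X →ₗ[k] X}
    (hK : ∀ s x, x ∈ K → L.proj s x ∈ K) (hf : ∀ x ∈ K, f x ∈ K) {n : ℕ}
    {ω : Form k X n} (hω : ∀ r, (∀ i, r i ∈ K) → ω r = 0) {r : Fin n → X} (hr : ∀ i, r i ∈ K) :
    L.derOp f n ω r = 0 := by
  cases n with
  | zero => simp [derOp]
  | succ n =>
    have : ∀ σ, L.permute σ (insMap f n ω) r = 0 := fun σ => by
      rw [permute_apply]
      refine Finset.sum_eq_zero fun p _ => ?_
      rw [insMap_apply, hω, mul_zero]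
      intro i
      induction i using Fin.cases with
      | zero => exact hf _ (hK _ _ (hr _))
      | succ i => exact hK _ _ (hr _)
    simp [derOp, symm, sum_apply, this]

theorem ceOp_eq_zero_of_vanishing {K : Submodule k X}
    (hK : ∀ s x, x ∈ K → L.proj s x ∈ K) (hbr : ∀ x ∈ K, ∀ y ∈ K, L.br x y ∈ K) {n : ℕ}
    {ω : Form k X n} (hω : ∀ r, (∀ i, r i ∈ K) → ω r = 0) {r : Fin (n + 1) → X}
    (hr : ∀ i, r i ∈ K) :
    L.ceOp n ω r = 0 := by
  cases n with
  | zero => simp [ceOp]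
  | succ n =>
    have : ∀ σ, L.permute σ (L.insBr n ω) r = 0 := fun σ => by
      rw [permute_apply]
      refine Finset.sum_eq_zero fun p _ => ?_
      rw [insBr_apply, hω, mul_zero]
      intro i
      induction i using Fin.cases with
      | zero =>
        rw [Fin.cons_zero, shiftBr_apply]
        exact K.sum_mem fun s _ => K.smul_mem _ (hbr _ (hK _ _ (hK _ _ (hr _))) _ (hK _ _ (hr _)))
      | succ i => exact hK _ _ (hr _)
    simp [ceOp, symm, sum_apply, this]

end FormalSpace
end CyclicOperadCE

namespace CyclicOperadCE
namespace FormalSpace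

variable {k : Type u} [Field k] {X : Type v} [AddCommGroup X] [Module k X] (L : FormalSpace k X)

/-! ## Operators on chains -/

theorem isContinuous_derOp {f : X →ₗ[k] X} (hf : ∀ M x, x ∈ L.fil (M + 1) → f x ∈ L.fil M) {n : ℕ}
    {ω : Form k X n} (h : L.IsContinuous ω) : L.IsContinuous (L.derOp f n ω) := by
  cases n with
  | zero => exact (L.contForms 0).zero_mem
  | succ n =>
    have h1 : L.IsContinuous (insMap f n ω) := by
      obtain ⟨M, hM⟩ := h
      refine ⟨M + 1, fun x ⟨j, hj⟩ => ?_⟩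
      rw [insMap_apply]
      apply hM
      induction j using Fin.cases with
      | zero => exact ⟨0, by simpa using hf _ _ hj⟩
      | succ j => exact ⟨j.succ, by simpa [Fin.tail] using L.fil_anti _ hj⟩
    exact (L.contForms _).smul_mem _ ((L.mem_cochain _).1 (L.symm_mem h1)).1

/-- The derivation of cochains which extends a continuous map. -/
noncomputable def derC (f : X →ₗ[k] X) (hf : ∀ M x, x ∈ L.fil (M + 1) → f x ∈ L.fil M) (n : ℕ) :
    L.cochain n →ₗ[k] L.cochain n :=
  (L.derOp f n).restrict fun ω h => (L.mem_cochain _).2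
    ⟨L.isContinuous_derOp hf ((L.mem_cochain ω).1 h).1, isSymm_derOp f ω⟩

@[simp] theorem coe_derC (f : X →ₗ[k] X) (hf : ∀ M x, x ∈ L.fil (M + 1) → f x ∈ L.fil M) (n : ℕ)
    (ω : L.cochain n) : (L.derC f hf n ω : Form k X n) = L.derOp f n ω := rfl

theorem isSymm_coe {n : ℕ} (ω : L.cochain n) : L.IsSymm (ω : Form k X n) :=
  ((L.mem_cochain _).1 ω.2).2

variable {L}

/-- Contraction of cochains with a homogeneous element. -/
noncomputable def contr (hL : L.IsSuper) {q : ZMod 2} {A : X} (hA : L.proj q A = A) (n : ℕ) :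
    L.cochain (n + 1) →ₗ[k] L.cochain n where
  toFun ω := ⟨(ω : Form k X (n + 1)).curryLeft A, (L.mem_cochain _).2 ⟨by
    obtain ⟨M, hM⟩ := ((L.mem_cochain _).1 ω.2).1
    exact ⟨M, fun x ⟨j, hj⟩ => hM _ ⟨j.succ, by simpa using hj⟩⟩,
    (L.isSymm_coe ω).curryLeft hL hA⟩⟩
  map_add' a b := by ext; rfl
  map_smul' c a := by ext; rfl

@[simp] theorem coe_contr (hL : L.IsSuper) {q : ZMod 2} {A : X} (hA : L.proj q A = A) (n : ℕ)
    (ω : L.cochain (n + 1)) :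
    (contr hL hA n ω : Form k X n) = (ω : Form k X (n + 1)).curryLeft A := rfl

/-- Multiplication of chains by `A`. -/
noncomputable def mulChain (hL : L.IsSuper) {q : ZMod 2} {A : X} (hA : L.proj q A = A) :
    L.Chain →ₗ[k] L.Chain where
  toFun z n := match n with
    | 0 => 0
    | n + 1 => z n ∘ₗ contr hL hA n
  map_add' a b := by
    funext n
    cases n <;> ext <;> simp
  map_smul' c a := by
    funext n
    cases n <;> ext <;> simp

theorem mulChain_zero (hL : L.IsSuper) {q : ZMod 2} {A : X} (hA : L.proj q A = A) (z : L.Chain) :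
    mulChain hL hA z 0 = 0 := rfl

theorem mulChain_succ (hL : L.IsSuper) {q : ZMod 2} {A : X} (hA : L.proj q A = A) (z : L.Chain)
    (n : ℕ) : mulChain hL hA z (n + 1) = z n ∘ₗ contr hL hA n := rfl

theorem boundary_apply (z : L.Chain) (n : ℕ) (ω : L.cochain n) :
    L.boundary z n ω = z n (L.dI n ω) + z (n + 1) (L.dCE n ω) := rfl

variable (L) in
/-- The coderivation of chains which extends a continuous map. -/
noncomputable def coderC (f : X →ₗ[k] X) (hf : ∀ M x, x ∈ L.fil (M + 1) → f x ∈ L.fil M) :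
    L.Chain →ₗ[k] L.Chain where
  toFun z n := z n ∘ₗ L.derC f hf n
  map_add' a b := by funext n; ext; simp
  map_smul' c a := by funext n; ext; simp

theorem coderC_apply (f : X →ₗ[k] X) (hf : ∀ M x, x ∈ L.fil (M + 1) → f x ∈ L.fil M) (z : L.Chain)
    (n : ℕ) (ω : L.cochain n) : L.coderC f hf z n ω = z n (L.derC f hf n ω) := rfl

/-- The passage from forms to chains: an identity of cochains that holds on homogeneous arguments in
`K` may be used inside a chain of `K`, although it can fail on the ambient space. -/
theorem eq_of_mem_chainsOn (hL : L.IsSuper) {K : Submodule k X}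
    (hK : ∀ s x, x ∈ K → L.proj s x ∈ K) {z : L.Chain} (hz : z ∈ L.chainsOn K) {n : ℕ}
    {ω ω' : L.cochain n}
    (h : ∀ p r, L.HomIn K p r → (ω : Form k X n) r = (ω' : Form k X n) r) : z n ω = z n ω' := by
  rw [← sub_eq_zero, ← map_sub]
  refine hz n _ fun r hr => ?_
  have := apply_eq_of_homIn hL hK h r hr
  simpa [sub_eq_zero] using this

theorem coderC_mem_chainsOn {K : Submodule k X} (hK : ∀ s x, x ∈ K → L.proj s x ∈ K)
    {f : X →ₗ[k] X} (hf : ∀ M x, x ∈ L.fil (M + 1) → f x ∈ L.fil M) (hfK : ∀ x ∈ K, f x ∈ K)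
    {z : L.Chain} (hz : z ∈ L.chainsOn K) : L.coderC f hf z ∈ L.chainsOn K := fun n _ hω =>
  hz n _ fun _ hr => derOp_eq_zero_of_vanishing hK hfK hω hr

theorem boundary_mem_chainsOn {K : Submodule k X} (hK : ∀ s x, x ∈ K → L.proj s x ∈ K)
    (hd : ∀ x ∈ K, L.d x ∈ K) (hbr : ∀ x ∈ K, ∀ y ∈ K, L.br x y ∈ K)
    {z : L.Chain} (hz : z ∈ L.chainsOn K) : L.boundary z ∈ L.chainsOn K := fun n ω hω => by
  rw [boundary_apply, hz, hz, add_zero]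
  · intro r hr
    rw [coe_dCE]
    exact ceOp_eq_zero_of_vanishing hK hbr hω hr
  · intro r hr
    rw [coe_dI]
    exact derOp_eq_zero_of_vanishing hK hd hω hr

theorem chainsOn_mono {K K' : Submodule k X} (h : K ≤ K') : L.chainsOn K ≤ L.chainsOn K' :=
  fun _ hz n ω hω => hz n ω fun x hx => hω x fun j => h (hx j)

theorem mulChain_mem_chainsOn (hL : L.IsSuper) {q : ZMod 2} {A : X} (hA : L.proj q A = A)
    {K : Submodule k X} (hAK : A ∈ K) {z : L.Chain} (hz : z ∈ L.chainsOn K) :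
    mulChain hL hA z ∈ L.chainsOn K := fun n ω hω => by
  cases n with
  | zero => rfl
  | succ n =>
    refine hz n _ fun x hx => hω _ fun j => ?_
    induction j using Fin.cases with
    | zero => simpa using hAK
    | succ j => simpa using hx j

theorem mulChain_pow_apply_of_lt (hL : L.IsSuper) {q : ZMod 2} {A : X} (hA : L.proj q A = A)
    (j n : ℕ) (h : n < j) (z : L.Chain) : ((mulChain hL hA) ^ j) z n = 0 := by
  induction j generalizing n with
  | zero => omega
  | succ j ih =>
    rw [pow_succ', Module.End.mul_apply]
    cases n with
    | zero => rfl
    | succ n => rw [mulChain_succ, ih n (by omega), LinearMap.zero_comp]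

variable (L) in
/-- `K` is a dg Lie subalgebra. -/
structure IsLieOn (K : Submodule k X) : Prop where
  proj_mem : ∀ s x, x ∈ K → L.proj s x ∈ K
  d_mem : ∀ x ∈ K, L.d x ∈ K
  br_mem : ∀ x ∈ K, ∀ y ∈ K, L.br x y ∈ K
  d_d : ∀ x ∈ K, L.d (L.d x) = 0
  d_der : L.IsDerOn K 1 L.d
  br_der : ∀ p x, x ∈ K → L.proj (p + 1) x = x → L.IsDerOn K (p + 1) (L.shiftBr x)

theorem isHom_d (hL : L.IsSuper) : L.IsHom 1 L.d := hL.d_odd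

theorem isHom_zero (s : ZMod 2) : L.IsHom s (0 : X →ₗ[k] X) := fun q x _ => by simp

theorem derOp_zero (n : ℕ) : L.derOp (0 : X →ₗ[k] X) n = 0 := by
  cases n with
  | zero => rfl
  | succ n =>
    have : insMap (0 : X →ₗ[k] X) n = 0 := by
      ext ω r
      simp only [insMap_apply, LinearMap.zero_apply]
      exact ω.map_coord_zero 0 (by simp)
    simp [derOp, this]

/-- The square splits by arity into $d_I^2$, $d_{CE}^2$ and the anticommutator of $d_I$ and
$d_{CE}$; on `K` these vanish by $d^2=0$, the Jacobi identity and the Leibniz rule, respectively. -/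
theorem boundary_boundary [CharZero k] (hL : L.IsSuper) {K : Submodule k X} (hK : L.IsLieOn K)
    {z : L.Chain} (hz : z ∈ L.chainsOn K) : L.boundary (L.boundary z) = 0 := by
  funext n
  ext ω
  have hω := L.isSymm_coe ω
  have h1 : z n (L.dI n (L.dI n ω)) = z n 0 := eq_of_mem_chainsOn hL hK.proj_mem hz
    fun p r hr => by
      -- For an odd map the graded commutator with itself is twice the square, so the square
      -- vanishes in characteristic zero.
      have := derOp_commutator hL (isHom_d hL) (isHom_d hL) (isHom_zero 0) rfl (K := K)
        (fun p x hx _ => by simp [hK.d_d x hx]) hω hr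
      rw [derOp_zero, mul_one, sgn_one, neg_one_mul, sub_neg_eq_add, ← two_mul] at this
      rw [coe_dI, coe_dI]
      simpa using this
  have h2 : z (n + 2) (L.dCE (n + 1) (L.dCE n ω)) = z (n + 2) 0 :=
    eq_of_mem_chainsOn hL hK.proj_mem hz fun p r hr => by
      rw [coe_dCE, coe_dCE, ceOp_ceOp hL hK.br_der hω hr]
      rfl
  have h3 : z (n + 1) (L.dI (n + 1) (L.dCE n ω) + L.dCE n (L.dI n ω)) = z (n + 1) 0 :=
    eq_of_mem_chainsOn hL hK.proj_mem hz fun p r hr => by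
      have := derOp_ceOp hL (isHom_d hL) hK.d_der hω hr
      simp only [Submodule.coe_add, add_apply, coe_dI, coe_dCE, this, sgn_one]
      simp
  simp only [map_zero, map_add] at h1 h2 h3
  simp only [boundary_apply, h1, h2, Pi.zero_apply, LinearMap.zero_apply, zero_add, add_zero]
  exact (add_comm _ _).trans h3

theorem shiftBr_fil (x : X) (M : ℕ) (y : X) (h : y ∈ L.fil (M + 1)) :
    L.shiftBr x y ∈ L.fil M := by
  rw [shiftBr_apply]
  exact Submodule.sum_mem _ fun s _ => Submodule.smul_mem _ _ (L.br_fil_right _ _ _ h)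

/-- The anticommutation with $d_I$ comes from that of `f` and `d` on `K`, the anticommutation with
$d_{CE}$ from `f` being a derivation of the bracket. -/
theorem boundary_coderC [CharZero k] (hL : L.IsSuper) {K : Submodule k X} (hK : L.IsLieOn K)
    {f : X →ₗ[k] X} (hf : ∀ M x, x ∈ L.fil (M + 1) → f x ∈ L.fil M) (hf1 : L.IsHom 1 f)
    (hfK : L.IsDerOn K 1 f) (hfd : ∀ x ∈ K, L.d (f x) + f (L.d x) = 0) {z : L.Chain}
    (hz : z ∈ L.chainsOn K) : L.coderC f hf (L.boundary z) = -L.boundary (L.coderC f hf z) := by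
  rw [eq_neg_iff_add_eq_zero]
  funext n
  ext ω
  have hω := L.isSymm_coe ω
  have h1 : z n (L.derC f hf n (L.dI n ω) + L.dI n (L.derC f hf n ω)) = z n 0 :=
    eq_of_mem_chainsOn hL hK.proj_mem hz fun p r hr => by
      have := derOp_commutator hL hf1 (isHom_d hL) (isHom_zero 0) rfl (K := K)
        (fun p x hx _ => by simp [sgn_one, hfd x hx]) hω hr
      rw [derOp_zero, mul_one, sgn_one, neg_one_mul, sub_neg_eq_add] at this
      simpa [coe_dI] using this
  have h3 : z (n + 1) (L.derC f hf (n + 1) (L.dCE n ω) + L.dCE n (L.derC f hf n ω)) = z (n + 1) 0 :=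
    eq_of_mem_chainsOn hL hK.proj_mem hz fun p r hr => by
      have := derOp_ceOp hL hf1 hfK hω hr
      simp only [Submodule.coe_add, add_apply, coe_derC, coe_dCE, this, sgn_one]
      simp
  simp only [map_zero, map_add] at h1 h3
  simp only [Pi.add_apply, LinearMap.add_apply, coderC_apply, boundary_apply, Pi.zero_apply,
    LinearMap.zero_apply]
  linear_combination h1 + h3

/-! ### Filling a cycle with the help of an adjoined odd element -/

section NullHomotopy

variable [CharZero k] {A : X}

/-- Multiplication by $\Pi A$ is even. The boundary of a product with `A` differs from the product
with the boundary by $dA=0$ and by the brackets of `A` with the other factors. -/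
theorem boundary_mulChain (hL : L.IsSuper) (hA : L.proj 1 A = A) (hdA : L.d A = 0)
    (z : L.Chain) :
    L.boundary (mulChain hL hA z) =
      mulChain hL hA (L.boundary z) + L.coderC (L.shiftBr A) (shiftBr_fil A) z := by
  funext n
  ext ω
  have hω := L.isSymm_coe ω
  have hA' : L.proj (0 + 1) A = A := by simpa using hA
  cases n with
  | zero =>
    have h1 : L.derC (L.shiftBr A) (shiftBr_fil A) 0 ω = 0 := by ext; rfl
    have h2 : L.dCE 0 ω = 0 := rfl
    simp [boundary_apply, mulChain_zero, coderC_apply, h1, h2]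
  | succ n =>
    have h1 : contr hL hA n (L.dI (n + 1) ω) = L.dI n (contr hL hA n ω) := by
      apply Subtype.ext
      rw [coe_contr, coe_dI, coe_dI, curryLeft_derOp hL (isHom_d hL) hω hA', hdA, map_zero,
        zero_add, mul_zero, sgn_zero, one_smul, coe_contr]
    have h2 : contr hL hA (n + 1) (L.dCE (n + 1) ω) =
        L.derC (L.shiftBr A) (shiftBr_fil A) (n + 1) ω + L.dCE n (contr hL hA n ω) := by
      apply Subtype.ext
      rw [coe_contr, coe_dCE, curryLeft_ceOp hL hω hA', sgn_zero, one_smul, Submodule.coe_add,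
        coe_derC, coe_dCE, coe_contr]
    simp only [boundary_apply, mulChain_succ, Pi.add_apply, LinearMap.add_apply,
      LinearMap.comp_apply, h1, h2, map_add, coderC_apply]
    ring

theorem coderC_mulChain (hL : L.IsSuper) (hA : L.proj 1 A = A) (hAA : L.br A A = 0)
    (z : L.Chain) :
    L.coderC (L.shiftBr A) (shiftBr_fil A) (mulChain hL hA z) =
      mulChain hL hA (L.coderC (L.shiftBr A) (shiftBr_fil A) z) := by
  funext n
  cases n with
  | zero => rfl
  | succ n =>
    ext ω
    have hω := L.isSymm_coe ω
    have hA' : L.proj (0 + 1) A = A := by simpa using hA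
    have h1 : contr hL hA n (L.derC (L.shiftBr A) (shiftBr_fil A) (n + 1) ω) =
        L.derC (L.shiftBr A) (shiftBr_fil A) n (contr hL hA n ω) := by
      apply Subtype.ext
      rw [coe_contr, coe_derC, curryLeft_derOp hL (isHom_shiftBr hL hA) hω hA', shiftBr_of_hom hA,
        hAA, smul_zero, map_zero, zero_add, mul_zero, sgn_zero, one_smul, coe_derC, coe_contr]
    simp only [coderC_apply, mulChain_succ, LinearMap.comp_apply, h1]

/-- Since $[A,A]=0$, the operator `coderC (shiftBr A)` commutes with multiplication by `A`.
Commuting the boundary past a power thus acts like differentiation of the power. -/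
theorem boundary_mulChain_pow (hL : L.IsSuper) (hA : L.proj 1 A = A) (hdA : L.d A = 0)
    (hAA : L.br A A = 0) (j : ℕ) (z : L.Chain) :
    L.boundary ((mulChain hL hA ^ (j + 1)) z) =
      (mulChain hL hA ^ (j + 1)) (L.boundary z) +
        ((j : k) + 1) • (mulChain hL hA ^ j) (L.coderC (L.shiftBr A) (shiftBr_fil A) z) := by
  have hcomm : ∀ j, L.coderC (L.shiftBr A) (shiftBr_fil A) ((mulChain hL hA ^ j) z) =
      (mulChain hL hA ^ j) (L.coderC (L.shiftBr A) (shiftBr_fil A) z) := by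
    intro j
    induction j with
    | zero => rfl
    | succ j ih =>
      rw [pow_succ', Module.End.mul_apply, coderC_mulChain hL hA hAA, ih, Module.End.mul_apply]
  induction j with
  | zero => simp [boundary_mulChain hL hA hdA]
  | succ j ih =>
    rw [pow_succ', Module.End.mul_apply, boundary_mulChain hL hA hdA, ih, hcomm, map_add, map_smul,
      Module.End.mul_apply, ← Module.End.mul_apply _ _ (L.coderC _ _ z), ← pow_succ']
    push_cast
    module

/-- A cycle of a dg Lie subalgebra `K` on which `ad A` acts with a contraction, and which is killed by
`ad A`, is a boundary after adjoining `A`. -/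
theorem exists_boundary_eq (hL : L.IsSuper) (hA : L.proj 1 A = A) {K K' : Submodule k X} (hK : L.IsLieOn K) (hKK' : K ≤ K') (hAK' : A ∈ K')
    (hdA : L.d A = 0) (hAA : L.br A A = 0)
    (hAder : L.IsDerOn K 1 (L.shiftBr A))
    (hAd : ∀ x ∈ K, L.d (L.shiftBr A x) + L.shiftBr A (L.d x) = 0)
    {S : X →ₗ[k] X} (hS : ∀ M x, x ∈ L.fil (M + 1) → S x ∈ L.fil M) (hS1 : L.IsHom 1 S)
    (hSK : ∀ x ∈ K, S x ∈ K) (hSA : ∀ x ∈ K, S (L.shiftBr A x) + L.shiftBr A (S x) = x)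
    (z : L.Chain) (hz : z ∈ L.chainsOn K) (hz0 : z 0 = 0) (hdz : L.boundary z = 0)
    (hAz : L.coderC (L.shiftBr A) (shiftBr_fil A) z = 0) :
    ∃ y ∈ L.reducedChainsOn K', L.boundary y = z := by
  set lam := L.coderC (L.shiftBr A) (shiftBr_fil A) with hlam
  -- On $\hat S^n$ the coderivations of `S` and of $Q_2(A,-)$ anticommute to multiplication by `n`,
  -- hence the division. For `n = 0` the inverse is `0`, which is harmless as the chains to be
  -- divided have no component there.
  let sig : L.Chain → L.Chain := fun w n => ((n : k))⁻¹ • L.coderC S hS w n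
  have hsig : ∀ w ∈ L.chainsOn K, sig w ∈ L.chainsOn K := fun w hw n ω hω => by
    have := coderC_mem_chainsOn hK.proj_mem hS hSK hw n ω hω
    simp [sig, this]
  have hlamsig : ∀ w ∈ L.chainsOn K, w 0 = 0 → lam w = 0 → lam (sig w) = w := by
    intro w hw hw0 hlw
    funext n
    ext ω
    have hω := L.isSymm_coe ω
    have h1 : w n (L.derC S hS n (L.derC (L.shiftBr A) (shiftBr_fil A) n ω) +
        L.derC (L.shiftBr A) (shiftBr_fil A) n (L.derC S hS n ω)) = w n ((n : k) • ω) :=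
      eq_of_mem_chainsOn hL hK.proj_mem hw fun p r hr => by
        have hid : L.IsHom 0 (LinearMap.id : X →ₗ[k] X) := fun q x hx => by simpa using hx
        have := derOp_commutator hL hS1 (isHom_shiftBr hL hA) hid rfl (K := K)
          (fun p x hx _ => by
            rw [mul_one, sgn_one, neg_one_smul, sub_neg_eq_add, add_comm, hSA x hx]
            rfl) hω hr
        rw [derOp_id hL hω, mul_one, sgn_one, neg_one_mul, sub_neg_eq_add] at this
        simpa using this
    have h2 : w n (L.derC (L.shiftBr A) (shiftBr_fil A) n (L.derC S hS n ω)) = 0 :=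
      LinearMap.congr_fun (congrFun hlw n) _
    rw [map_add, h2, add_zero, map_smul] at h1
    have h3 : lam (sig w) n ω =
        (n : k)⁻¹ • w n (L.derC S hS n (L.derC (L.shiftBr A) (shiftBr_fil A) n ω)) := rfl
    rw [h3, h1]
    rcases Nat.eq_zero_or_pos n with rfl | hn
    · simp [hw0]
    · rw [smul_smul, inv_mul_cancel₀ (by exact_mod_cast hn.ne'), one_smul]
  -- The error left by the `j`-th correction: $\lambda\sigma$ reproduces `u j`, and $\partial\sigma
  -- u_j$ is what the next power of `A` has to compensate.
  let u : ℕ → L.Chain := fun j => Nat.rec z (fun _ w => -L.boundary (sig w)) j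
  have hu_succ : ∀ j, u (j + 1) = -L.boundary (sig (u j)) := fun _ => rfl
  have hu : ∀ j, u j ∈ L.chainsOn K ∧ u j 0 = 0 ∧ lam (u j) = 0 ∧ L.boundary (u j) = 0 := by
    intro j
    induction j with
    | zero => exact ⟨hz, hz0, hAz, hdz⟩
    | succ j ih =>
      obtain ⟨h1, h2, h3, h4⟩ := ih
      have h5 := hsig _ h1
      rw [hu_succ]
      refine ⟨Submodule.neg_mem _ (boundary_mem_chainsOn hK.proj_mem hK.d_mem hK.br_mem h5), ?_, ?_,
        ?_⟩
      -- Both parts of the differential vanish on cochains of arity zero, so a boundary is always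
      -- reduced and the division by `n` remains legitimate.
      · ext ω
        have e1 : L.dI 0 ω = 0 := rfl
        have e2 : L.dCE 0 ω = 0 := rfl
        simp [boundary_apply, e1, e2]
      · rw [map_neg, hlam, boundary_coderC hL hK _ (isHom_shiftBr hL hA) hAder hAd h5, ← hlam,
          hlamsig _ h1 h2 h3, h4, neg_zero, neg_zero]
      · rw [map_neg, boundary_boundary hL hK h5, neg_zero]
  -- Partial sums of the series $\sum_j A^{j+1}\sigma(u_j)/(j+1)!$.
  let Y : ℕ → L.Chain := fun M => ∑ j ∈ Finset.range M,
    (((j + 1).factorial : k))⁻¹ • (mulChain hL hA ^ (j + 1)) (sig (u j))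
  have hYsucc : ∀ M, Y (M + 1) = Y M +
      (((M + 1).factorial : k))⁻¹ • (mulChain hL hA ^ (M + 1)) (sig (u M)) := fun M =>
    Finset.sum_range_succ _ _
  -- Telescoping: the term $\lambda\sigma u_M=u_M$ cancels the previous remainder, and
  -- $\partial\sigma u_M=-u_{M+1}$ produces the next one.
  have hdY : ∀ M, L.boundary (Y M) =
      z - ((M.factorial : k))⁻¹ • (mulChain hL hA ^ M) (u M) := by
    intro M
    induction M with
    | zero => simp [Y, u]
    | succ M ih =>
      obtain ⟨h1, h2, h3, -⟩ := hu M
      have h4 : L.boundary (sig (u M)) = -u (M + 1) := by rw [hu_succ, neg_neg]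
      rw [hYsucc, map_add, ih, map_smul, boundary_mulChain_pow hL hA hdA hAA, ← hlam,
        hlamsig _ h1 h2 h3, h4, map_neg, Nat.factorial_succ]
      have hM : (M.factorial : k) ≠ 0 := by exact_mod_cast M.factorial_ne_zero
      have hM' : ((M : k) + 1) ≠ 0 := by exact_mod_cast M.succ_ne_zero
      push_cast
      rw [mul_inv, smul_add, smul_smul (((M : k) + 1)⁻¹ * _),
        show ((M : k) + 1)⁻¹ * (M.factorial : k)⁻¹ * ((M : k) + 1) = (M.factorial : k)⁻¹ by
          field_simp]
      rw [smul_neg]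
      abel
  have hYmem : ∀ M, Y M ∈ L.chainsOn K' := fun M => Submodule.sum_mem _ fun j _ =>
    Submodule.smul_mem _ _ (by
      have : ∀ i, (mulChain hL hA ^ i) (sig (u j)) ∈ L.chainsOn K' := by
        intro i
        induction i with
        | zero => exact chainsOn_mono hKK' (hsig _ (hu j).1)
        | succ i ih =>
          rw [pow_succ', Module.End.mul_apply]
          exact mulChain_mem_chainsOn hL hA hAK' ih
      exact this _)
  -- The factor $A^{M+1}$ has no component in degrees below $M+1$, so each component of the partial
  -- sums stabilizes and the diagonal `Y n n` is their limit.
  have hYstable : ∀ n M, n ≤ M → Y M n = Y n n := by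
    intro n M hM
    induction M, hM using Nat.le_induction with
    | base => rfl
    | succ M hM ih =>
      rw [hYsucc, Pi.add_apply, Pi.smul_apply, mulChain_pow_apply_of_lt hL hA _ _ (by omega),
        smul_zero, add_zero, ih]
  refine ⟨fun n => Y n n, ⟨fun n ω hω => hYmem n n ω hω, rfl⟩, ?_⟩
  funext n
  -- The component `n` of a boundary involves the components `n` and `n + 1` of the chain, so the
  -- limit may be replaced by the partial sum `Y (n + 1)`, whose remainder vanishes in degree `n`.
  have h1 : L.boundary (fun n => Y n n) n = L.boundary (Y (n + 1)) n := by
    ext ω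
    rw [boundary_apply, boundary_apply, hYstable n (n + 1) (by omega)]
  rw [h1, hdY, Pi.sub_apply, Pi.smul_apply, mulChain_pow_apply_of_lt hL hA _ _ (by omega), smul_zero,
    sub_zero]

end NullHomotopy

end FormalSpace
end CyclicOperadCE

/-! ### Partial compositions and their Koszul signs -/

namespace CyclicOperadCE

/-! ## Slots of a partial composition -/

section Slots

variable {n m N : ℕ}

/-- The place in `a ∘ᵢ b` of the slot `j` of `a`. -/
def oIdx (h : N + 1 = n + m) (i : Fin n) (j : Fin (n + 1)) : Fin (N + 1) :=
  ⟨outerSlot i m j, by have := i.2; have := j.2; unfold outerSlot; split_ifs <;> omega⟩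

/-- The place in `a ∘ᵢ b` of the slot `u` of `b`. -/
def iIdx (h : N + 1 = n + m) (i : Fin n) (u : Fin (m + 1)) : Fin (N + 1) :=
  ⟨innerSlot i u, by have := i.2; have := u.2; unfold innerSlot; omega⟩

variable (h : N + 1 = n + m) (i : Fin n)

theorem oIdx_lt_oIdx {j l : Fin (n + 1)} (hj : j ≠ i.castSucc) (hl : l ≠ i.castSucc) :
    oIdx h i j < oIdx h i l ↔ j < l := by
  simp only [Fin.ne_iff_vne, Fin.val_castSucc] at hj hl
  simp only [Fin.lt_def, oIdx, outerSlot]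
  split_ifs <;> omega

theorem oIdx_lt_iIdx {j : Fin (n + 1)} {u : Fin (m + 1)}
    (hu : u ≠ Fin.last m) : oIdx h i j < iIdx h i u ↔ j < i.castSucc := by
  simp only [Fin.ne_iff_vne, Fin.val_last] at hu
  have := u.2
  simp only [Fin.lt_def, oIdx, iIdx, outerSlot, innerSlot, Fin.val_castSucc]
  split_ifs <;> omega

theorem iIdx_lt_oIdx {j : Fin (n + 1)} {u : Fin (m + 1)} (hj : j ≠ i.castSucc)
    (hu : u ≠ Fin.last m) : iIdx h i u < oIdx h i j ↔ i.castSucc < j := by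
  simp only [Fin.ne_iff_vne, Fin.val_castSucc, Fin.val_last] at hj hu
  have := u.2
  simp only [Fin.lt_def, oIdx, iIdx, outerSlot, innerSlot, Fin.val_castSucc]
  split_ifs <;> omega

theorem iIdx_lt_iIdx {u w : Fin (m + 1)} : iIdx h i u < iIdx h i w ↔ u < w := by
  simp only [Fin.lt_def, iIdx, innerSlot]
  omega

/-- The slots of a partial composition. -/
noncomputable def slotEquiv :
    {j : Fin (n + 1) // j ≠ i.castSucc} ⊕ {u : Fin (m + 1) // u ≠ Fin.last m} ≃ Fin (N + 1) :=
  Equiv.ofBijective (Sum.elim (fun j => oIdx h i j) (fun u => iIdx h i u)) (by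
    rw [Fintype.bijective_iff_injective_and_card]
    constructor
    · rintro (⟨j, hj⟩ | ⟨u, hu⟩) (⟨l, hl⟩ | ⟨w, hw⟩) he
      · simp only [Sum.elim_inl] at he
        rcases lt_trichotomy j l with h1 | rfl | h1
        · exact absurd he ((oIdx_lt_oIdx h i hj hl).2 h1).ne
        · rfl
        · exact absurd he ((oIdx_lt_oIdx h i hl hj).2 h1).ne'
      · simp only [Sum.elim_inl, Sum.elim_inr] at he
        rcases lt_or_gt_of_ne hj with h1 | h1
        · exact absurd he ((oIdx_lt_iIdx h i hw).2 h1).ne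
        · exact absurd he ((iIdx_lt_oIdx h i hj hw).2 h1).ne'
      · simp only [Sum.elim_inl, Sum.elim_inr] at he
        rcases lt_or_gt_of_ne hl with h1 | h1
        · exact absurd he ((oIdx_lt_iIdx h i hu).2 h1).ne'
        · exact absurd he ((iIdx_lt_oIdx h i hl hu).2 h1).ne
      · simp only [Sum.elim_inr] at he
        rcases lt_trichotomy u w with h1 | rfl | h1
        · exact absurd he ((iIdx_lt_iIdx h i).2 h1).ne
        · rfl
        · exact absurd he ((iIdx_lt_iIdx h i).2 h1).ne'
    · simp [h])

theorem slotEquiv_inl (j : {j : Fin (n + 1) // j ≠ i.castSucc}) :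
    slotEquiv h i (Sum.inl j) = oIdx h i j := rfl

theorem slotEquiv_inr (u : {u : Fin (m + 1) // u ≠ Fin.last m}) :
    slotEquiv h i (Sum.inr u) = iIdx h i u := rfl

theorem slot_cases (x : Fin (N + 1)) :
    (∃ j, j ≠ i.castSucc ∧ x = oIdx h i j) ∨ (∃ u, u ≠ Fin.last m ∧ x = iIdx h i u) := by
  obtain ⟨y, rfl⟩ := (slotEquiv h i).surjective x
  rcases y with ⟨j, hj⟩ | ⟨u, hu⟩
  · exact Or.inl ⟨j, hj, rfl⟩
  · exact Or.inr ⟨u, hu, rfl⟩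

theorem sum_slots {M : Type*} [AddCommMonoid M] (F : Fin (N + 1) → M) :
    ∑ x, F x = (∑ j, if j = i.castSucc then 0 else F (oIdx h i j)) +
      ∑ u, if u = Fin.last m then 0 else F (iIdx h i u) := by
  rw [← (slotEquiv h i).sum_comp, Fintype.sum_sum_type]
  congr 1
  · simp only [slotEquiv_inl]
    rw [← Finset.sum_subtype_eq_sum_filter (s := Finset.univ) (p := fun j => j ≠ i.castSucc)
      (f := fun j => F (oIdx h i j)) |>.trans (Finset.sum_filter _ _) |>.trans
      (Finset.sum_congr rfl fun j _ => by simp only [ne_eq, ite_not])]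
    simp [Finset.subtype_univ]
  · simp only [slotEquiv_inr]
    rw [← Finset.sum_subtype_eq_sum_filter (s := Finset.univ) (p := fun u => u ≠ Fin.last m)
      (f := fun u => F (iIdx h i u)) |>.trans (Finset.sum_filter _ _) |>.trans
      (Finset.sum_congr rfl fun j _ => by simp only [ne_eq, ite_not])]
    simp [Finset.subtype_univ]

theorem oIdx_last : oIdx h i (Fin.last n) = Fin.last N := by
  have := i.2
  ext
  simp only [oIdx, outerSlot, Fin.val_last]
  split_ifs <;> omega

/-- `ρ` is the permutation of the slots of `a ∘ᵢ b` which is induced by `σ` and `τ`. -/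
structure IsPlug (h : N + 1 = n + m) (i i' : Fin n) (σ : Equiv.Perm (Fin (n + 1)))
    (τ : Equiv.Perm (Fin (m + 1))) (ρ : Equiv.Perm (Fin (N + 1))) : Prop where
  left : σ i.castSucc = i'.castSucc
  right : τ (Fin.last m) = Fin.last m
  outer : ∀ j, j ≠ i.castSucc → ρ (oIdx h i j) = oIdx h i' (σ j)
  inner : ∀ u, u ≠ Fin.last m → ρ (iIdx h i u) = iIdx h i' (τ u)

/-- Equivariance of a partial composition is stated for any `ρ` compatible with the slots; such a
`ρ` exists because the slots of a composite are those of the factors minus the two that are joined.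
-/
theorem exists_isPlug (i' : Fin n) (σ : Equiv.Perm (Fin (n + 1)))
    (τ : Equiv.Perm (Fin (m + 1))) (hσ : σ i.castSucc = i'.castSucc)
    (hτ : τ (Fin.last m) = Fin.last m) : ∃ ρ, IsPlug h i i' σ τ ρ := by
  let e₁ : {j : Fin (n + 1) // j ≠ i.castSucc} ≃ {j : Fin (n + 1) // j ≠ i'.castSucc} :=
    σ.subtypeEquiv fun j => by rw [← hσ, ne_eq, ne_eq, σ.injective.eq_iff]
  let e₂ : {u : Fin (m + 1) // u ≠ Fin.last m} ≃ {u : Fin (m + 1) // u ≠ Fin.last m} :=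
    τ.subtypeEquiv fun j => by
      nth_rewrite 2 [← hτ]
      rw [ne_eq, ne_eq, τ.injective.eq_iff]
  refine ⟨(slotEquiv h i).symm.trans ((Equiv.sumCongr e₁ e₂).trans (slotEquiv h i')), hσ, hτ, ?_, ?_⟩
  · intro j hj
    rw [← slotEquiv_inl h i ⟨j, hj⟩]
    simp only [Equiv.trans_apply, Equiv.symm_apply_apply]
    rfl
  · intro u hu
    rw [← slotEquiv_inr h i ⟨u, hu⟩]
    simp only [Equiv.trans_apply, Equiv.symm_apply_apply]
    rfl

theorem IsPlug.last {h : N + 1 = n + m} {i i' : Fin n} {σ : Equiv.Perm (Fin (n + 1))}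
    {τ : Equiv.Perm (Fin (m + 1))} {ρ : Equiv.Perm (Fin (N + 1))} (H : IsPlug h i i' σ τ ρ)
    (hσ : σ (Fin.last n) = Fin.last n) : ρ (Fin.last N) = Fin.last N := by
  rw [← oIdx_last h i, H.outer _ (Fin.castSucc_lt_last i).ne', hσ, oIdx_last, oIdx_last]

/-- `ρ` is the permutation of the slots of `a ∘ᵢ b` which is induced by `σ` and `τ` and exchanges
the two factors. -/
structure IsSwapPlug (h : N + 1 = n + m) (h' : N + 1 = m + n) (i : Fin n) (j : Fin m)
    (σ : Equiv.Perm (Fin (n + 1))) (τ : Equiv.Perm (Fin (m + 1)))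
    (ρ : Equiv.Perm (Fin (N + 1))) : Prop where
  left : σ i.castSucc = Fin.last n
  right : τ (Fin.last m) = j.castSucc
  outer : ∀ l, l ≠ i.castSucc → ρ (oIdx h i l) = iIdx h' j (σ l)
  inner : ∀ u, u ≠ Fin.last m → ρ (iIdx h i u) = oIdx h' j (τ u)

theorem exists_isSwapPlug (h' : N + 1 = m + n) (j : Fin m) (σ : Equiv.Perm (Fin (n + 1)))
    (τ : Equiv.Perm (Fin (m + 1))) (hσ : σ i.castSucc = Fin.last n)
    (hτ : τ (Fin.last m) = j.castSucc) : ∃ ρ, IsSwapPlug h h' i j σ τ ρ := by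
  let e₁ : {j : Fin (n + 1) // j ≠ i.castSucc} ≃ {j : Fin (n + 1) // j ≠ Fin.last n} :=
    σ.subtypeEquiv fun j => by rw [← hσ, ne_eq, ne_eq, σ.injective.eq_iff]
  let e₂ : {u : Fin (m + 1) // u ≠ Fin.last m} ≃ {u : Fin (m + 1) // u ≠ j.castSucc} :=
    τ.subtypeEquiv fun j => by rw [← hτ, ne_eq, ne_eq, τ.injective.eq_iff]
  refine ⟨(slotEquiv h i).symm.trans ((Equiv.sumCongr e₁ e₂).trans
    ((Equiv.sumComm _ _).trans (slotEquiv h' j))), hσ, hτ, ?_, ?_⟩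
  · intro j hj
    rw [← slotEquiv_inl h i ⟨j, hj⟩]
    simp only [Equiv.trans_apply, Equiv.symm_apply_apply]
    rfl
  · intro u hu
    rw [← slotEquiv_inr h i ⟨u, hu⟩]
    simp only [Equiv.trans_apply, Equiv.symm_apply_apply]
    rfl

/-! ## Koszul signs of the permutations of slots -/

/-- Separates the inversions that involve the place `i`. The joined slot carries a contracted
letter, which occurs in the words of the factors but not in the word of the composite. -/
theorem koszulExp_ite {n : ℕ} (σ : Equiv.Perm (Fin n)) (i : Fin n) (β : ZMod 2)
    (a : Fin n → ZMod 2) :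
    koszulExp σ (fun j => if j = i then β else a j) =
      koszulExp σ (fun j => if j = i then 0 else a j) +
      β * (∑ j, if j < i ∧ σ i < σ j then a j else 0) +
      β * (∑ j, if i < j ∧ σ j < σ i then a j else 0) := by
  have h1 : ∀ j l : Fin n, (if j < l ∧ σ l < σ j then
      (if j = i then β else a j) * (if l = i then β else a l) else 0) =
      (if j < l ∧ σ l < σ j then
        (if j = i then 0 else a j) * (if l = i then 0 else a l) else 0) +
      (if l = i then (if j < i ∧ σ i < σ j then β * a j else 0) else 0) +
      (if j = i then (if i < l ∧ σ l < σ i then β * a l else 0) else 0) := by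
    intro j l
    by_cases hj : j = i <;> by_cases hl : l = i <;> simp [hj, hl, mul_comm]
  simp only [koszulExp, h1, Finset.sum_add_distrib, Finset.mul_sum]
  congr 1
  · congr 1
    refine Finset.sum_congr rfl fun j _ => ?_
    rw [Finset.sum_ite_eq' Finset.univ i, if_pos (Finset.mem_univ i)]
    split_ifs <;> simp
  · rw [Finset.sum_comm]
    refine Finset.sum_congr rfl fun j _ => ?_
    rw [Finset.sum_ite_eq' Finset.univ i, if_pos (Finset.mem_univ i)]
    split_ifs <;> simp

/-- Inversions of the composite sorted by the factors to which their two slots belong. The summand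
is passed as `t` so that the four sums can be rearranged without opening its conditions. -/
theorem koszulExp_slots (ρ : Equiv.Perm (Fin (N + 1))) (a : Fin (N + 1) → ZMod 2)
    (t : Fin (N + 1) → Fin (N + 1) → ZMod 2)
    (ht : ∀ x y, t x y = if x < y ∧ ρ y < ρ x then a x * a y else 0) :
    koszulExp ρ a =
      (∑ j, ∑ l, if j = i.castSucc then 0 else if l = i.castSucc then 0 else
        t (oIdx h i j) (oIdx h i l)) +
      (∑ j, ∑ u, if j = i.castSucc then 0 else if u = Fin.last m then 0 else
        t (oIdx h i j) (iIdx h i u)) +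
      (∑ j, ∑ u, if j = i.castSucc then 0 else if u = Fin.last m then 0 else
        t (iIdx h i u) (oIdx h i j)) +
      (∑ u, ∑ w, if u = Fin.last m then 0 else if w = Fin.last m then 0 else
        t (iIdx h i u) (iIdx h i w)) := by
  have h1 : koszulExp ρ a = ∑ x, ∑ y, t x y := by simp only [ht]; rfl
  have h2 : ∀ (p : Prop) [Decidable p] {α : Type} (s : Finset α) (F : α → ZMod 2),
      (if p then 0 else ∑ l ∈ s, F l) = ∑ l ∈ s, if p then 0 else F l := by
    intro p _ α s F
    split_ifs <;> simp
  have h3 : ∀ (p : Prop) [Decidable p] (x y : ZMod 2),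
      (if p then 0 else x + y) = (if p then 0 else x) + if p then 0 else y := by
    intro p _ x y
    split_ifs <;> simp
  rw [h1, sum_slots h i]
  simp only [sum_slots h i, h3, h2, Finset.sum_add_distrib]
  rw [Finset.sum_comm (f := fun (u : Fin (m + 1)) (l : Fin (n + 1)) => if u = Fin.last m then 0 else
    if l = i.castSucc then 0 else t (iIdx h i u) (oIdx h i l))]
  have h4 : ∀ (p q : Prop) [Decidable p] [Decidable q] (x : ZMod 2),
      (if p then 0 else if q then 0 else x) = if q then 0 else if p then 0 else x := by
    intro p q _ _ x
    split_ifs <;> rfl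
  simp only [h4 (_ = Fin.last m) (_ = i.castSucc)]
  ring

/-- Inversions within one factor give the signs of `σ` and `τ`. A mixed inversion means that an
outer letter changes sides relative to the inner block, and these account for the change of the sign
with which the block, together with its contracted letter, is moved into its slot. -/
theorem koszulExp_isPlug {h : N + 1 = n + m} {i i' : Fin n} {σ : Equiv.Perm (Fin (n + 1))}
    {τ : Equiv.Perm (Fin (m + 1))} {ρ : Equiv.Perm (Fin (N + 1))} (H : IsPlug h i i' σ τ ρ)
    (a : Fin (N + 1) → ZMod 2) (β β' : ZMod 2) :
    koszulExp ρ a + (β + ∑ u, if u = Fin.last m then 0 else a (iIdx h i u)) *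
        (∑ j, if j < i.castSucc then a (oIdx h i j) else 0) =
      (β + ∑ u, if u = Fin.last m then 0 else a (iIdx h i u)) *
        (∑ j, if σ j < i'.castSucc then a (oIdx h i j) else 0) +
      (koszulExp σ (fun j => if j = i.castSucc then β else a (oIdx h i j)) +
        koszulExp τ (fun u => if u = Fin.last m then β' else a (iIdx h i u))) := by
  have hσ : ∀ j, j ≠ i.castSucc → σ j ≠ i'.castSucc := fun j hj => by
    rw [← H.left]
    exact fun h => hj (σ.injective h)
  have hτ : ∀ u, u ≠ Fin.last m → τ u ≠ Fin.last m := fun u hu => by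
    intro h
    rw [← H.right] at h
    exact hu (τ.injective h)
  rw [koszulExp_slots h i ρ a _ fun _ _ => rfl, koszulExp_ite σ, koszulExp_ite τ, H.left, H.right]
  have e1 : (∑ j, ∑ l, if j = i.castSucc then 0 else if l = i.castSucc then 0 else
      if oIdx h i j < oIdx h i l ∧ ρ (oIdx h i l) < ρ (oIdx h i j) then
        a (oIdx h i j) * a (oIdx h i l) else 0) =
      koszulExp σ (fun j => if j = i.castSucc then 0 else a (oIdx h i j)) := by
    refine Finset.sum_congr rfl fun j _ => Finset.sum_congr rfl fun l _ => ?_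
    by_cases hj : j = i.castSucc
    · simp [hj]
    by_cases hl : l = i.castSucc
    · simp [hl]
    simp only [hj, hl, if_false, H.outer _ hj, H.outer _ hl, oIdx_lt_oIdx h i hj hl,
      oIdx_lt_oIdx h i' (hσ l hl) (hσ j hj)]
  have e2 : (∑ u, ∑ w, if u = Fin.last m then 0 else if w = Fin.last m then 0 else
      if iIdx h i u < iIdx h i w ∧ ρ (iIdx h i w) < ρ (iIdx h i u) then
        a (iIdx h i u) * a (iIdx h i w) else 0) =
      koszulExp τ (fun u => if u = Fin.last m then 0 else a (iIdx h i u)) := by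
    refine Finset.sum_congr rfl fun j _ => Finset.sum_congr rfl fun l _ => ?_
    by_cases hj : j = Fin.last m
    · simp [hj]
    by_cases hl : l = Fin.last m
    · simp [hl]
    simp only [hj, hl, if_false, H.inner _ hj, H.inner _ hl, iIdx_lt_iIdx]
  have e3 : (∑ j, ∑ u, if j = i.castSucc then 0 else if u = Fin.last m then 0 else
      if oIdx h i j < iIdx h i u ∧ ρ (iIdx h i u) < ρ (oIdx h i j) then
        a (oIdx h i j) * a (iIdx h i u) else 0) =
      (∑ j, if j < i.castSucc ∧ i'.castSucc < σ j then a (oIdx h i j) else 0) *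
        ∑ u, if u = Fin.last m then 0 else a (iIdx h i u) := by
    rw [Finset.sum_mul_sum]
    refine Finset.sum_congr rfl fun j _ => Finset.sum_congr rfl fun u _ => ?_
    by_cases hj : j = i.castSucc
    · simp [hj]
    by_cases hu : u = Fin.last m
    · simp [hu]
    simp only [hj, hu, if_false, H.outer _ hj, H.inner _ hu, oIdx_lt_iIdx h i hu,
      iIdx_lt_oIdx h i' (hσ j hj) (hτ u hu), ite_mul, zero_mul]
  have e4 : (∑ j, ∑ u, if j = i.castSucc then 0 else if u = Fin.last m then 0 else
      if iIdx h i u < oIdx h i j ∧ ρ (oIdx h i j) < ρ (iIdx h i u) then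
        a (iIdx h i u) * a (oIdx h i j) else 0) =
      (∑ j, if i.castSucc < j ∧ σ j < i'.castSucc then a (oIdx h i j) else 0) *
        ∑ u, if u = Fin.last m then 0 else a (iIdx h i u) := by
    rw [Finset.sum_mul_sum]
    refine Finset.sum_congr rfl fun j _ => Finset.sum_congr rfl fun u _ => ?_
    by_cases hj : j = i.castSucc
    · simp [hj]
    by_cases hu : u = Fin.last m
    · simp [hu]
    simp only [hj, hu, if_false, H.outer _ hj, H.inner _ hu, iIdx_lt_oIdx h i hj hu,
      oIdx_lt_iIdx h i' (hτ u hu)]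
    split_ifs <;> ring1
  have e5 : (∑ u, if u < Fin.last m ∧ Fin.last m < τ u then a (iIdx h i u) else 0) = 0 :=
    Finset.sum_eq_zero fun u _ => if_neg fun hu => (Fin.le_last _).not_gt hu.2
  have e6 : (∑ u, if Fin.last m < u ∧ τ u < Fin.last m then a (iIdx h i u) else 0) = 0 :=
    Finset.sum_eq_zero fun u _ => if_neg fun hu => (Fin.le_last _).not_gt hu.1
  -- A letter crosses the block exactly when it precedes it on one side of the move and not on the
  -- other; modulo two this is the sum of both conditions.
  have e7 : (∑ j, if j < i.castSucc ∧ i'.castSucc < σ j then a (oIdx h i j) else 0) +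
      (∑ j, if i.castSucc < j ∧ σ j < i'.castSucc then a (oIdx h i j) else 0) =
      (∑ j, if j < i.castSucc then a (oIdx h i j) else 0) +
      (∑ j, if σ j < i'.castSucc then a (oIdx h i j) else 0) := by
    simp only [← Finset.sum_add_distrib]
    refine Finset.sum_congr rfl fun j _ => ?_
    by_cases hj : j = i.castSucc
    · simp [hj, H.left]
    rcases lt_or_gt_of_ne hj with h1 | h1 <;> rcases lt_or_gt_of_ne (hσ j hj) with h2 | h2 <;>
      simp [h1, h2, h1.not_gt, h2.not_gt, zmod_two_add_self]
  rw [e1, e2, e3, e4, e5, e6]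
  have key : ∀ s t x₁ x₂ y₁ y₂ b β β' : ZMod 2, x₁ + x₂ = y₁ + y₂ →
      s + x₁ * b + x₂ * b + t + (β + b) * y₁ =
        (β + b) * y₂ + (s + β * x₁ + β * x₂ + (t + β' * 0 + β' * 0)) := by decide
  exact key _ _ _ _ _ _ _ _ _ e7

/-- Exchanging the factors costs the product of the parities of their words, contracted letters
included. The further `β` comes from the contracted pair, which then appears in the opposite order.
-/
theorem koszulExp_isSwapPlug {h : N + 1 = n + m} {h' : N + 1 = m + n} {i : Fin n} {j : Fin m}
    {σ : Equiv.Perm (Fin (n + 1))} {τ : Equiv.Perm (Fin (m + 1))} {ρ : Equiv.Perm (Fin (N + 1))}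
    (H : IsSwapPlug h h' i j σ τ ρ) (a : Fin (N + 1) → ZMod 2) (β : ZMod 2) :
    (koszulExp ρ a + (β + ∑ u, if u = Fin.last m then 0 else a (iIdx h i u)) *
        (∑ l, if l < i.castSucc then a (oIdx h i l) else 0)) +
      ((β + ∑ l, if l = i.castSucc then 0 else a (oIdx h i l)) *
        (∑ u, if τ u < j.castSucc then a (iIdx h i u) else 0) +
      (koszulExp σ (fun l => if l = i.castSucc then β else a (oIdx h i l)) +
        koszulExp τ (fun u => if u = Fin.last m then β else a (iIdx h i u)))) =
      (β + ∑ l, if l = i.castSucc then 0 else a (oIdx h i l)) *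
        (β + ∑ u, if u = Fin.last m then 0 else a (iIdx h i u)) + β := by
  have hσ : ∀ l, l ≠ i.castSucc → σ l ≠ Fin.last n := fun j hj => by
    rw [← H.left]
    exact fun h => hj (σ.injective h)
  have hτ : ∀ u, u ≠ Fin.last m → τ u ≠ j.castSucc := fun u hu => by
    rw [← H.right]
    exact fun h => hu (τ.injective h)
  rw [koszulExp_slots h i ρ a _ fun _ _ => rfl, koszulExp_ite σ, koszulExp_ite τ, H.left, H.right]
  have e1 : (∑ j, ∑ l, if j = i.castSucc then 0 else if l = i.castSucc then 0 else
      if oIdx h i j < oIdx h i l ∧ ρ (oIdx h i l) < ρ (oIdx h i j) then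
        a (oIdx h i j) * a (oIdx h i l) else 0) =
      koszulExp σ (fun j => if j = i.castSucc then 0 else a (oIdx h i j)) := by
    refine Finset.sum_congr rfl fun j _ => Finset.sum_congr rfl fun l _ => ?_
    by_cases hj : j = i.castSucc
    · simp [hj]
    by_cases hl : l = i.castSucc
    · simp [hl]
    simp only [hj, hl, if_false, H.outer _ hj, H.outer _ hl, oIdx_lt_oIdx h i hj hl,
      iIdx_lt_iIdx]
  have e2 : (∑ u, ∑ w, if u = Fin.last m then 0 else if w = Fin.last m then 0 else
      if iIdx h i u < iIdx h i w ∧ ρ (iIdx h i w) < ρ (iIdx h i u) then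
        a (iIdx h i u) * a (iIdx h i w) else 0) =
      koszulExp τ (fun u => if u = Fin.last m then 0 else a (iIdx h i u)) := by
    refine Finset.sum_congr rfl fun j _ => Finset.sum_congr rfl fun l _ => ?_
    by_cases hj : j = Fin.last m
    · simp [hj]
    by_cases hl : l = Fin.last m
    · simp [hl]
    simp only [hj, hl, if_false, H.inner _ hj, H.inner _ hl, iIdx_lt_iIdx,
      oIdx_lt_oIdx h' _ (hτ _ hl) (hτ _ hj)]
  have e3 : (∑ l, ∑ u, if l = i.castSucc then 0 else if u = Fin.last m then 0 else
      if oIdx h i l < iIdx h i u ∧ ρ (iIdx h i u) < ρ (oIdx h i l) then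
        a (oIdx h i l) * a (iIdx h i u) else 0) =
      (∑ l, if l < i.castSucc then a (oIdx h i l) else 0) *
        ∑ u, if τ u < j.castSucc then a (iIdx h i u) else 0 := by
    rw [Finset.sum_mul_sum]
    refine Finset.sum_congr rfl fun l _ => Finset.sum_congr rfl fun u _ => ?_
    by_cases hl : l = i.castSucc
    · simp [hl]
    by_cases hu : u = Fin.last m
    · simp [hu, H.right]
    simp only [hl, hu, if_false, H.outer _ hl, H.inner _ hu, oIdx_lt_iIdx h i hu,
      oIdx_lt_iIdx h' j (hσ l hl)]
    split_ifs <;> first | ring1 | (exfalso; tauto)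
  have e4 : (∑ l, ∑ u, if l = i.castSucc then 0 else if u = Fin.last m then 0 else
      if iIdx h i u < oIdx h i l ∧ ρ (oIdx h i l) < ρ (iIdx h i u) then
        a (iIdx h i u) * a (oIdx h i l) else 0) =
      (∑ l, if i.castSucc < l then a (oIdx h i l) else 0) *
        ∑ u, if j.castSucc < τ u then a (iIdx h i u) else 0 := by
    rw [Finset.sum_mul_sum]
    refine Finset.sum_congr rfl fun l _ => Finset.sum_congr rfl fun u _ => ?_
    by_cases hl : l = i.castSucc
    · simp [hl]
    by_cases hu : u = Fin.last m
    · simp [hu, H.right]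
    simp only [hl, hu, if_false, H.outer _ hl, H.inner _ hu, iIdx_lt_oIdx h i hl hu,
      iIdx_lt_oIdx h' j (hτ u hu) (hσ l hl)]
    split_ifs <;> first | ring1 | (exfalso; tauto)
  have e5 : (∑ u, if u < Fin.last m ∧ j.castSucc < τ u then a (iIdx h i u) else 0) =
      ∑ u, if j.castSucc < τ u then a (iIdx h i u) else 0 := by
    refine Finset.sum_congr rfl fun u _ => ?_
    by_cases hu : u = Fin.last m
    · simp [hu, H.right]
    · simp [(Fin.le_last u).lt_of_ne hu]
  have e6 : (∑ u, if Fin.last m < u ∧ τ u < j.castSucc then a (iIdx h i u) else 0) = 0 :=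
    Finset.sum_eq_zero fun u _ => if_neg fun hu => (Fin.le_last _).not_gt hu.1
  have e7 : (∑ l, if l < i.castSucc ∧ Fin.last n < σ l then a (oIdx h i l) else 0) = 0 :=
    Finset.sum_eq_zero fun u _ => if_neg fun hu => (Fin.le_last _).not_gt hu.2
  have e8 : (∑ l, if i.castSucc < l ∧ σ l < Fin.last n then a (oIdx h i l) else 0) =
      ∑ l, if i.castSucc < l then a (oIdx h i l) else 0 := by
    refine Finset.sum_congr rfl fun l _ => ?_
    by_cases hl : l = i.castSucc
    · simp [hl]
    · simp [(Fin.le_last _).lt_of_ne (hσ l hl)]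
  have e9 : (∑ l, if l = i.castSucc then 0 else a (oIdx h i l)) =
      (∑ l, if l < i.castSucc then a (oIdx h i l) else 0) +
      ∑ l, if i.castSucc < l then a (oIdx h i l) else 0 := by
    rw [← Finset.sum_add_distrib]
    refine Finset.sum_congr rfl fun l _ => ?_
    rcases lt_trichotomy l i.castSucc with hl | rfl | hl
    · simp [hl, hl.ne, hl.not_gt]
    · simp
    · simp [hl, hl.ne', hl.not_gt]
  have e10 : (∑ u, if u = Fin.last m then 0 else a (iIdx h i u)) =
      (∑ u, if τ u < j.castSucc then a (iIdx h i u) else 0) +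
      ∑ u, if j.castSucc < τ u then a (iIdx h i u) else 0 := by
    rw [← Finset.sum_add_distrib]
    refine Finset.sum_congr rfl fun u _ => ?_
    by_cases hu : u = Fin.last m
    · simp [hu, H.right]
    rcases lt_or_gt_of_ne (hτ u hu) with h1 | h1 <;> simp [hu, h1, h1.not_gt]
  rw [e1, e2, e3, e4, e5, e6, e7, e8, e9, e10]
  have key : ∀ s t A B C D β : ZMod 2,
      s + A * C + B * D + t + (β + (C + D)) * A + ((β + (A + B)) * C +
        (s + β * 0 + β * B + (t + β * D + β * 0))) = (β + (A + B)) * (β + (C + D)) + β := by decide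
  exact key _ _ _ _ _ _ _

end Slots
end CyclicOperadCE

/-! ### Tensors with operadic coefficients: equivariance, exchange and associativity -/

namespace CyclicOperadCE

namespace CyclicDGOperad

variable {k : Type u} [Field k] (O : CyclicDGOperad.{u, v} k)

theorem proj_of_mem {n : ℕ} {s t : ZMod 2} {x : O.obj n} (hx : x ∈ O.part n s) :
    O.proj n t x = if t = s then x else 0 := by
  rw [proj_apply]
  split_ifs with h
  · rw [h, DirectSum.decompose_of_mem_same _ hx]
  · rw [DirectSum.decompose_of_mem_ne _ hx (Ne.symm h)]

theorem proj_mem {n : ℕ} (s : ZMod 2) (x : O.obj n) : O.proj n s x ∈ O.part n s :=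
  SetLike.coe_mem _

theorem proj_total {n : ℕ} (x : O.obj n) : O.proj n 0 x + O.proj n 1 x = x := by
  classical
  conv_rhs => rw [← DirectSum.sum_support_decompose (O.part n) x]
  rw [Finset.sum_subset (Finset.subset_univ _), sum_zmod_two]
  · rfl
  · intro s _ hs
    simpa using hs

theorem ext_hom {n : ℕ} {M : Type*} [AddCommMonoid M] [Module k M] {f g : O.obj n →ₗ[k] M}
    (h : ∀ s, ∀ x ∈ O.part n s, f x = g x) : f = g := by
  ext x
  rw [← O.proj_total x, map_add, map_add, h _ _ (O.proj_mem 0 x), h _ _ (O.proj_mem 1 x)]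

theorem proj_act {n : ℕ} (s : ZMod 2) (σ : Equiv.Perm (Fin (n + 1))) (x : O.obj n) :
    O.proj n s (O.act n σ x) = O.act n σ (O.proj n s x) := by
  have : O.proj n s ∘ₗ O.act n σ = O.act n σ ∘ₗ O.proj n s := O.ext_hom fun t x hx => by
    simp only [LinearMap.comp_apply, O.proj_of_mem hx, O.proj_of_mem (O.act_mem n t σ x hx)]
    split_ifs <;> simp
  exact LinearMap.congr_fun this x

/-- The operator which multiplies the elements of parity `t` by the sign `(-1)^(s t)`. -/
noncomputable def signOp (n : ℕ) (s : ZMod 2) : O.obj n →ₗ[k] O.obj n :=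
  O.proj n 0 + sgn k s • O.proj n 1

theorem signOp_of_mem {n : ℕ} (s : ZMod 2) {t : ZMod 2} {x : O.obj n} (hx : x ∈ O.part n t) :
    O.signOp n s x = sgn k (s * t) • x := by
  simp only [signOp, LinearMap.add_apply, LinearMap.smul_apply, O.proj_of_mem hx]
  rcases zmod_two_cases t with rfl | rfl <;> simp [sgn_zero]

theorem signOp_act {n : ℕ} (s : ZMod 2) (σ : Equiv.Perm (Fin (n + 1))) (x : O.obj n) :
    O.signOp n s (O.act n σ x) = O.act n σ (O.signOp n s x) := by
  simp [signOp, proj_act]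

theorem signOp_signOp {n : ℕ} (s t : ZMod 2) (x : O.obj n) :
    O.signOp n s (O.signOp n t x) = O.signOp n (s + t) x := by
  have : O.signOp n s ∘ₗ O.signOp n t = O.signOp n (s + t) := O.ext_hom fun r x hx => by
    rw [LinearMap.comp_apply, O.signOp_of_mem _ hx, map_smul, O.signOp_of_mem _ hx, smul_smul,
      O.signOp_of_mem _ hx, add_mul, sgn_add, mul_comm]
  exact LinearMap.congr_fun this x

theorem signOp_zero {n : ℕ} (x : O.obj n) : O.signOp n 0 x = x := by
  rw [signOp, sgn_zero, one_smul, LinearMap.add_apply, proj_total]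

theorem signOp_comp {n m N : ℕ} (h : N + 1 = n + m) (i : Fin n) (s : ZMod 2) (x : O.obj n)
    (y : O.obj m) :
    O.signOp N s (O.comp h i x y) = O.comp h i (O.signOp n s x) (O.signOp m s y) := by
  have : (O.comp h i).compr₂ (O.signOp N s) =
      (O.comp h i).compl₁₂ (O.signOp n s) (O.signOp m s) := O.ext_hom fun r x hx =>
    O.ext_hom fun t y hy => by
      simp only [LinearMap.compr₂_apply, LinearMap.compl₁₂_apply, O.signOp_of_mem _ hx,
        O.signOp_of_mem _ hy, O.signOp_of_mem _ (O.comp_mem h i r t x y hx hy), map_smul,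
        LinearMap.smul_apply, smul_smul, mul_add, sgn_add, mul_comm]
  exact LinearMap.congr_fun₂ this x y

theorem signOp_mem {n : ℕ} (s : ZMod 2) {t : ZMod 2} {x : O.obj n} (hx : x ∈ O.part n t) :
    O.signOp n s x ∈ O.part n t := by
  rw [O.signOp_of_mem _ hx]
  exact Submodule.smul_mem _ _ hx

theorem signOp_d {n : ℕ} (s : ZMod 2) (x : O.obj n) :
    O.d n (O.signOp n s x) = sgn k s • O.signOp n s (O.d n x) := by
  have : O.d n ∘ₗ O.signOp n s = sgn k s • (O.signOp n s ∘ₗ O.d n) := O.ext_hom fun r x hx => by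
    simp only [LinearMap.comp_apply, LinearMap.smul_apply, O.signOp_of_mem _ hx, map_smul,
      O.signOp_of_mem _ (O.d_mem n r x hx), smul_smul, ← sgn_add]
    congr 2
    rw [mul_add, mul_one, add_comm, add_assoc, zmod_two_add_self, add_zero]
  exact LinearMap.congr_fun this x

end CyclicDGOperad

/-! ## Tensors -/

section Tensors

variable {k : Type u} [Field k] (O : CyclicDGOperad.{u, v} k) {ι : Type*}

/-- Coefficients of elements of `O(n) ⊗ (ΠV*)^{⊗ (n + 1)}`, the last letter belonging to the
output. -/
abbrev Tens (ι : Type*) (n : ℕ) : Type _ := (Fin (n + 1) → ι) → O.obj n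

variable (q : ι → ZMod 2)

/-- The action of the permutations of all slots on tensors. -/
noncomputable def tact {n : ℕ} (σ : Equiv.Perm (Fin (n + 1))) : Tens O ι n →ₗ[k] Tens O ι n where
  toFun T K := koszul k σ (fun j => q (K (σ j))) • O.act n σ (T fun j => K (σ j))
  map_add' T U := by funext K; simp
  map_smul' c T := by funext K; simp [smul_comm c]

theorem tact_apply {n : ℕ} (σ : Equiv.Perm (Fin (n + 1))) (T : Tens O ι n) (K : Fin (n + 1) → ι) :
    tact O q σ T K = koszul k σ (fun j => q (K (σ j))) • O.act n σ (T fun j => K (σ j)) := rfl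

theorem tact_mul {n : ℕ} (σ τ : Equiv.Perm (Fin (n + 1))) (T : Tens O ι n) :
    tact O q (σ * τ) T = tact O q σ (tact O q τ T) := by
  funext K
  simp only [tact_apply, map_mul, Module.End.mul_apply, Equiv.Perm.mul_apply, map_smul, smul_smul,
    koszul_mul]
  congr 1
  simp [mul_comm]

theorem tact_one {n : ℕ} (T : Tens O ι n) : tact O q 1 T = T := by
  funext K
  have h0 : koszulExp (1 : Equiv.Perm (Fin (n + 1))) (fun j => q (K j)) = 0 :=
    Finset.sum_eq_zero fun j _ => Finset.sum_eq_zero fun l _ => by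
      rw [if_neg]
      rintro ⟨h1, h2⟩
      exact h1.not_gt h2
  simp [tact_apply, koszul, h0, sgn_zero]

/-- The word of the first factor of a partial composition. -/
def ow {n m N : ℕ} (h : N + 1 = n + m) (i : Fin n) (b : ι) (K : Fin (N + 1) → ι) :
    Fin (n + 1) → ι := fun j => if j = i.castSucc then b else K (oIdx h i j)

/-- The word of the second factor of a partial composition. -/
def iw {n m N : ℕ} (h : N + 1 = n + m) (i : Fin n) (b : ι) (K : Fin (N + 1) → ι) :
    Fin (m + 1) → ι := fun u => if u = Fin.last m then b else K (iIdx h i u)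

/-- Exponent of the sign of a partial composition. -/
def compExp {n m N : ℕ} (h : N + 1 = n + m) (i : Fin n) (b : ι) (K : Fin (N + 1) → ι) : ZMod 2 :=
  (q b + ∑ u, if u = Fin.last m then 0 else q (K (iIdx h i u))) *
    ∑ j, if j < i.castSucc then q (K (oIdx h i j)) else 0

/-- The partial composition of tensors, with the letters `b` of the slot `i` and `b'` of the output
contracted; `s` is the parity of the second factor. -/
noncomputable def ecomp (s : ZMod 2) {n m N : ℕ} (h : N + 1 = n + m) (i : Fin n) (b b' : ι) :
    Tens O ι n →ₗ[k] Tens O ι m →ₗ[k] Tens O ι N :=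
  LinearMap.mk₂ k (fun T U K => sgn k (compExp q h i b K) •
      O.comp h i (O.signOp n s (T (ow h i b K))) (U (iw h i b' K)))
    (by intros; funext K; simp)
    (by intro c T U; funext K; simp only [Pi.smul_apply, map_smul, LinearMap.smul_apply, smul_comm c])
    (by intros; funext K; simp)
    (by intro c T U; funext K; simp only [Pi.smul_apply, map_smul, smul_comm c])

theorem ecomp_apply (s : ZMod 2) {n m N : ℕ} (h : N + 1 = n + m) (i : Fin n) (b b' : ι)
    (T : Tens O ι n) (U : Tens O ι m) (K : Fin (N + 1) → ι) :
    ecomp O q s h i b b' T U K = sgn k (compExp q h i b K) •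
      O.comp h i (O.signOp n s (T (ow h i b K))) (U (iw h i b' K)) := rfl

/-- The operadic axiom `comp_act` moves the coefficients and `koszulExp_isPlug` matches the signs of
the words. The parity `q b'` of the letter at the output of the second factor plays no role, as `τ`
fixes that slot. -/
theorem ecomp_equivariant (s : ZMod 2) {n m N : ℕ} {h : N + 1 = n + m} {i i' : Fin n}
    {σ : Equiv.Perm (Fin (n + 1))} {τ : Equiv.Perm (Fin (m + 1))} {ρ : Equiv.Perm (Fin (N + 1))}
    (H : IsPlug h i i' σ τ ρ) (b b' : ι) (T : Tens O ι n) (U : Tens O ι m) :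
    ecomp O q s h i' b b' (tact O q σ T) (tact O q τ U) =
      tact O q ρ (ecomp O q s h i b b' T U) := by
  funext K
  have how : (fun j => ow h i' b K (σ j)) = ow h i b fun x => K (ρ x) := by
    funext j
    by_cases hj : j = i.castSucc
    · simp [ow, hj, H.left]
    · have : σ j ≠ i'.castSucc := by
        rw [← H.left]
        exact fun h => hj (σ.injective h)
      simp [ow, hj, this, H.outer j hj]
  have hiw : (fun u => iw h i' b' K (τ u)) = iw h i b' fun x => K (ρ x) := by
    funext u
    by_cases hu : u = Fin.last m
    · simp [iw, hu, H.right]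
    · have : τ u ≠ Fin.last m := by
        intro h
        rw [← H.right] at h
        exact hu (τ.injective h)
      simp [iw, hu, this, H.inner u hu]
  have hc : compExp q h i' b K =
      (q b + ∑ u, if u = Fin.last m then 0 else q (K (ρ (iIdx h i u)))) *
        (∑ j, if σ j < i'.castSucc then q (K (ρ (oIdx h i j))) else 0) := by
    unfold compExp
    refine congrArg₂ _ (congrArg _ ?_) ?_
    · rw [← Equiv.sum_comp τ]
      refine Finset.sum_congr rfl fun u _ => ?_
      by_cases hu : u = Fin.last m
      · simp [hu, H.right]
      · have : τ u ≠ Fin.last m := by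
          intro h
          rw [← H.right] at h
          exact hu (τ.injective h)
        simp [hu, this, H.inner u hu]
    · rw [← Equiv.sum_comp σ]
      refine Finset.sum_congr rfl fun j _ => ?_
      by_cases hj : j = i.castSucc
      · simp [hj, H.left]
      · simp [H.outer j hj]
  have hS := koszulExp_isPlug H (fun x => q (K (ρ x))) (q b) (q b')
  have hA := O.comp_act h i i' σ τ ρ H.left H.right
    (fun j hj x hx => by
      rw [show x = oIdx h i j from Fin.ext hx, H.outer j hj]; rfl)
    (fun j hj x hx => by
      rw [show x = iIdx h i j from Fin.ext hx, H.inner j hj]; rfl)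
  rw [ecomp_apply, tact_apply, tact_apply, tact_apply, ecomp_apply]
  have how' : ∀ j, ow h i' b K (σ j) = ow h i b (fun x => K (ρ x)) j := fun j => congrFun how j
  have hiw' : ∀ j, iw h i' b' K (τ j) = iw h i b' (fun x => K (ρ x)) j := fun j => congrFun hiw j
  simp only [how', hiw']
  simp only [map_smul, LinearMap.smul_apply, smul_smul, O.signOp_act, hA]
  congr 1
  rw [hc, koszul, koszul, koszul, ← sgn_add, ← sgn_add, ← sgn_add]
  congr 1
  have e1 : (fun j => q (ow h i b (fun x => K (ρ x)) j)) =
      fun j => if j = i.castSucc then q b else q (K (ρ (oIdx h i j))) := by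
    funext j
    exact apply_ite q _ _ _
  have e2 : (fun j => q (iw h i b' (fun x => K (ρ x)) j)) =
      fun u => if u = Fin.last m then q b' else q (K (ρ (iIdx h i u))) := by
    funext j
    exact apply_ite q _ _ _
  rw [e1, e2]
  unfold compExp
  rw [hS]
  ring

/-- The tensor is homogeneous of parity `t`. -/
def IsHomT (t : ZMod 2) {n : ℕ} (T : Tens O ι n) : Prop :=
  ∀ K, T K ∈ O.part n (t + ∑ j, q (K j))

theorem sum_ow {n m N : ℕ} (h : N + 1 = n + m) (i : Fin n) (b : ι) (K : Fin (N + 1) → ι) :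
    ∑ j, q (ow h i b K j) = q b + ∑ j, if j = i.castSucc then 0 else q (K (oIdx h i j)) := by
  have h1 : ∀ j, q (ow h i b K j) = (if j = i.castSucc then q b else 0) +
      if j = i.castSucc then 0 else q (K (oIdx h i j)) := fun j => by
    unfold ow
    split_ifs <;> simp
  simp only [h1, Finset.sum_add_distrib, Finset.sum_ite_eq', Finset.mem_univ, if_true]

theorem sum_iw {n m N : ℕ} (h : N + 1 = n + m) (i : Fin n) (b : ι) (K : Fin (N + 1) → ι) :
    ∑ j, q (iw h i b K j) = q b + ∑ u, if u = Fin.last m then 0 else q (K (iIdx h i u)) := by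
  have h1 : ∀ j, q (iw h i b K j) = (if j = Fin.last m then q b else 0) +
      if j = Fin.last m then 0 else q (K (iIdx h i j)) := fun j => by
    unfold iw
    split_ifs <;> simp
  simp only [h1, Finset.sum_add_distrib, Finset.sum_ite_eq', Finset.mem_univ, if_true]

variable {O q}

theorem IsHomT.ecomp {s t : ZMod 2} {n m N : ℕ} {T : Tens O ι n} {U : Tens O ι m}
    (hT : IsHomT O q t T) (hU : IsHomT O q s U) (h : N + 1 = n + m) (i : Fin n) {b b' : ι}
    (hb : q b = q b') : IsHomT O q (t + s) (ecomp O q s h i b b' T U) := by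
  intro K
  rw [ecomp_apply]
  have := O.comp_mem h i _ _ _ _ (O.signOp_mem s (hT (ow h i b K))) (hU (iw h i b' K))
  have e : t + s + ∑ j, q (K j) =
      t + ∑ j, q (ow h i b K j) + (s + ∑ j, q (iw h i b' K j)) := by
    rw [sum_ow, sum_iw, sum_slots h i fun x => q (K x), ← hb]
    have key : ∀ s t a b c : ZMod 2, t + s + (a + b) = t + (c + a) + (s + (c + b)) := by decide
    exact key _ _ _ _ _
  rw [e]
  exact Submodule.smul_mem _ _ this

theorem IsHomT.tact {t : ZMod 2} {n : ℕ} {T : Tens O ι n} (hT : IsHomT O q t T)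
    (σ : Equiv.Perm (Fin (n + 1))) : IsHomT O q t (tact O q σ T) := by
  intro K
  rw [tact_apply]
  have := O.act_mem n _ σ _ (hT fun j => K (σ j))
  rw [Equiv.sum_comp σ fun j => q (K j)] at this
  exact Submodule.smul_mem _ _ this

/-- Coefficients and words are exchanged at the same time. Their mixed signs combine to $(-1)^{st}$,
and the reversed contracted pair contributes the sign of $q_b$, to be absorbed later by the symmetry
of the inverse Gram matrix. -/
theorem ecomp_swap {s t : ZMod 2} {n m N : ℕ} {h : N + 1 = n + m} {h' : N + 1 = m + n} {i : Fin n}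
    {j : Fin m} {σ : Equiv.Perm (Fin (n + 1))} {τ : Equiv.Perm (Fin (m + 1))}
    {ρ : Equiv.Perm (Fin (N + 1))} (H : IsSwapPlug h h' i j σ τ ρ) {b b' : ι} (hb : q b = q b')
    {T : Tens O ι n} {U : Tens O ι m} (hT : IsHomT O q t T) (hU : IsHomT O q s U) :
    ecomp O q t h' j b' b (tact O q τ U) (tact O q σ T) =
      sgn k (s * t + q b) • tact O q ρ (ecomp O q s h i b b' T U) := by
  funext K
  have how : (fun u => ow h' j b' K (τ u)) = iw h i b' fun x => K (ρ x) := by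
    funext u
    by_cases hu : u = Fin.last m
    · simp [iw, ow, hu, H.right]
    · have : τ u ≠ j.castSucc := by
        rw [← H.right]
        exact fun h => hu (τ.injective h)
      simp [ow, iw, hu, this, H.inner u hu]
  have hiw : (fun l => iw h' j b K (σ l)) = ow h i b fun x => K (ρ x) := by
    funext l
    by_cases hl : l = i.castSucc
    · simp [iw, ow, hl, H.left]
    · have : σ l ≠ Fin.last n := by
        rw [← H.left]
        exact fun h => hl (σ.injective h)
      simp [iw, ow, hl, this, H.outer l hl]
  have hc : compExp q h' j b' K =
      (q b + ∑ l, if l = i.castSucc then 0 else q (K (ρ (oIdx h i l)))) *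
        (∑ u, if τ u < j.castSucc then q (K (ρ (iIdx h i u))) else 0) := by
    unfold compExp
    rw [← hb]
    refine congrArg₂ _ (congrArg _ ?_) ?_
    · rw [← Equiv.sum_comp σ]
      refine Finset.sum_congr rfl fun u _ => ?_
      by_cases hu : u = i.castSucc
      · simp [hu, H.left]
      · have : σ u ≠ Fin.last n := by
          rw [← H.left]
          exact fun h => hu (σ.injective h)
        simp [hu, this, H.outer u hu]
    · rw [← Equiv.sum_comp τ]
      refine Finset.sum_congr rfl fun u _ => ?_
      by_cases hu : u = Fin.last m
      · simp [hu, H.right]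
      · simp [H.inner u hu]
  have hS := koszulExp_isSwapPlug H (fun x => q (K (ρ x))) (q b)
  have hT' := hT (ow h i b fun x => K (ρ x))
  have hU' := hU (iw h i b' fun x => K (ρ x))
  have hA := O.comp_swap h h' i j σ τ ρ H.left H.right
    (fun j hj x hx => by
      rw [show x = oIdx h i j from Fin.ext hx, H.outer j hj]; rfl)
    (fun j hj x hx => by
      rw [show x = iIdx h i j from Fin.ext hx, H.inner j hj]; rfl) _ _ _ _ hT' hU'
  have how' : ∀ u, ow h' j b' K (τ u) = iw h i b' (fun x => K (ρ x)) u := fun j => congrFun how j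
  have hiw' : ∀ l, iw h' j b K (σ l) = ow h i b (fun x => K (ρ x)) l := fun j => congrFun hiw j
  rw [ecomp_apply, tact_apply, tact_apply, Pi.smul_apply, tact_apply, ecomp_apply]
  simp only [how', hiw']
  simp only [map_smul, LinearMap.smul_apply, smul_smul, O.signOp_act, O.signOp_of_mem _ hT',
    O.signOp_of_mem _ hU', hA]
  congr 1
  rw [hc, koszul, koszul, koszul]
  simp only [← sgn_add]
  congr 1
  have e1 : (fun j => q (ow h i b (fun x => K (ρ x)) j)) =
      fun j => if j = i.castSucc then q b else q (K (ρ (oIdx h i j))) := by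
    funext j
    exact apply_ite q _ _ _
  have e2 : (fun j => q (iw h i b' (fun x => K (ρ x)) j)) =
      fun u => if u = Fin.last m then q b else q (K (ρ (iIdx h i u))) := by
    funext j
    rw [hb]
    exact apply_ite q _ _ _
  rw [sum_ow, sum_iw, e1, e2, ← hb]
  unfold compExp
  revert hS
  have key : ∀ kρ c cs kσ kτ A B β s t : ZMod 2,
      kρ + (β + B) * c + (cs + (kσ + kτ)) = (β + A) * (β + B) + β →
      cs + kτ + kσ + t * (s + (β + B)) + (t + (β + A)) * (s + (β + B)) =
        s * t + β + kρ + ((β + B) * c + s * (t + (β + A))) := by decide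
  intro hS
  have := key _ _ _ _ _ _ _ _ s t hS
  linear_combination this

theorem compExp_zero {n m N : ℕ} (h : N + 1 = n + m) {i : Fin n} (hi : i.val = 0) (b : ι)
    (K : Fin (N + 1) → ι) : compExp q h i b K = 0 := by
  unfold compExp
  have : (∑ j, if j < i.castSucc then q (K (oIdx h i j)) else 0) = 0 :=
    Finset.sum_eq_zero fun j _ => if_neg (by simp [Fin.lt_def, hi])
  rw [this, mul_zero]

/-- Only first inputs are considered: nothing precedes them, so no letter has to be crossed and all
`compExp` vanish. Other positions are reduced to this one after averaging over the inputs. -/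
theorem ecomp_assoc {s r : ZMod 2} {n m p N₁ N₂ N : ℕ} (h₁ : N₁ + 1 = n + m) (h₂ : N + 1 = N₁ + p)
    (h₃ : N₂ + 1 = m + p) (h₄ : N + 1 = n + N₂) {i : Fin n} {j : Fin m} {l : Fin N₁}
    (hi : i.val = 0) (hj : j.val = 0) (hl : l.val = 0) (b b' c c' : ι)
    (T : Tens O ι n) (U : Tens O ι m) (R : Tens O ι p) :
    ecomp O q r h₂ l c c' (ecomp O q s h₁ i b b' T U) R =
      ecomp O q (s + r) h₄ i b b' T (ecomp O q r h₃ j c c' U R) := by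
  funext K
  have hn := i.2
  have hm := j.2
  simp only [ecomp_apply, compExp_zero _ hi, compExp_zero _ hj, compExp_zero _ hl, sgn_zero, one_smul]
  rw [O.signOp_comp, O.signOp_signOp, O.assoc h₁ h₂ h₃ h₄ i j l (by simp [innerSlot, hi, hj, hl])]
  have e1 : ow h₁ i b (ow h₂ l c K) = ow h₄ i b K := by
    funext x
    simp only [ow, Fin.ext_iff, oIdx, outerSlot, Fin.val_castSucc, hi, hl]
    have := x.2
    (repeat' split) <;> first | rfl | omega | (refine congrArg K (Fin.ext ?_); simp only; omega)
  have e2 : iw h₁ i b' (ow h₂ l c K) = ow h₃ j c (iw h₄ i b' K) := by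
    funext x
    simp only [ow, iw, Fin.ext_iff, oIdx, iIdx, innerSlot, outerSlot, Fin.val_castSucc, Fin.val_last,
      hi, hj, hl, Nat.not_lt_zero, if_false]
    have := x.2
    (repeat' split) <;> first | rfl | omega | (refine congrArg K (Fin.ext ?_); simp only; omega)
  have e3 : iw h₂ l c' K = iw h₃ j c' (iw h₄ i b' K) := by
    funext x
    simp only [iw, Fin.ext_iff, iIdx, innerSlot, Fin.val_last, hi, hj, hl]
    have := x.2
    (repeat' split) <;> first | rfl | omega | (refine congrArg K (Fin.ext ?_); simp only; omega)
  rw [e1, e2, e3, add_comm s r]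

/-- Plugging into the inputs `0` and `1` of `T` in either order. The slot `1` becomes the slot `m`
once a factor with `m` inputs occupies the slot `0`; up to averaging this is the general case. -/
theorem ecomp_comm {s r : ZMod 2} {n m p N₁ N₂ N : ℕ} (h₁ : N₁ + 1 = n + m) (h₂ : N + 1 = N₁ + p)
    (h₃ : N₂ + 1 = n + p) (h₄ : N + 1 = N₂ + m) {i l : Fin n} {i' : Fin N₂} {l' : Fin N₁}
    (hi : i.val = 0) (hl : l.val = 1) (hi' : i'.val = 0) (hl' : l'.val = m) {b b' c c' : ι}
    (hb : q b = q b') (hc : q c = q c')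
    (T : Tens O ι n) {U : Tens O ι m} {R : Tens O ι p} (hU : IsHomT O q s U) (hR : IsHomT O q r R) :
    ecomp O q r h₂ l' c c' (ecomp O q s h₁ i b b' T U) R =
      sgn k (s * r) • ecomp O q s h₄ i' b b' (ecomp O q r h₃ l c c' T R) U := by
  funext K
  have hn := l.2
  have e1 : ow h₁ i b (ow h₂ l' c K) = ow h₃ l c (ow h₄ i' b K) := by
    funext x
    simp only [ow, Fin.ext_iff, oIdx, outerSlot, Fin.val_castSucc, hi, hl, hi', hl',
      Nat.not_lt_zero, if_false]
    have := x.2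
    by_cases hx : x.val < 1 <;> simp only [hx, if_true, if_false] <;> (repeat' split) <;> first | rfl | omega | (refine congrArg K (Fin.ext ?_); simp only; omega)
  have e2 : iw h₁ i b' (ow h₂ l' c K) = iw h₄ i' b' K := by
    funext x
    simp only [ow, iw, Fin.ext_iff, oIdx, iIdx, innerSlot, outerSlot, Fin.val_castSucc, Fin.val_last,
      hi, hi', hl']
    have := x.2
    (repeat' split) <;> first | rfl | omega | (refine congrArg K (Fin.ext ?_); simp only; omega)
  have e3 : iw h₃ l c' (ow h₄ i' b K) = iw h₂ l' c' K := by
    funext x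
    simp only [ow, iw, Fin.ext_iff, oIdx, iIdx, innerSlot, outerSlot, Fin.val_castSucc, Fin.val_last,
      hl, hi', hl']
    have := x.2
    (repeat' split) <;> first | rfl | omega | (refine congrArg K (Fin.ext ?_); simp only; omega)
  have hU' := hU (iw h₄ i' b' K)
  have hR' := hR (iw h₂ l' c' K)
  simp only [ecomp_apply, Pi.smul_apply, compExp_zero _ hi, compExp_zero _ hi', sgn_zero, one_smul]
  rw [map_smul, O.signOp_comp, O.signOp_comp, O.signOp_signOp, O.signOp_signOp, e1, e2, e3,
    O.signOp_of_mem _ hU', O.signOp_of_mem _ hR']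
  simp only [map_smul, LinearMap.smul_apply]
  rw [O.comp_comm h₁ h₂ h₃ h₄ i l i' l' (by rw [Fin.lt_def, hi, hl]; exact one_pos) (by rw [hi, hi'])
      (by simp [outerSlot, hi, hl, hl']) _ _ _ _ _ hU' hR', add_comm s r]
  simp only [LinearMap.smul_apply, smul_smul, ← sgn_add]
  congr 2
  -- On the left the block of `R` passes all inputs of `U`; on the right it only passes the
  -- contracted letter `b`, as computed in the next claim.
  have f1 : compExp q h₂ l' c K = (∑ j, q (iw h₂ l' c' K j)) *
      (q b + ∑ j, q (iw h₄ i' b' K j)) := by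
    rw [sum_iw, sum_iw, ← hc, ← hb, ← add_assoc, zmod_two_add_self, zero_add]
    unfold compExp
    congr 1
    rw [sum_slots h₁ i, Finset.sum_eq_zero, zero_add]
    · refine Finset.sum_congr rfl fun u _ => ?_
      by_cases hu : u = Fin.last m
      · simp [hu]
      · rw [if_neg hu, if_neg hu]
        have hu' : u.val < m := by
          have := u.2
          rw [Fin.ext_iff, Fin.val_last] at hu
          omega
        have : iIdx h₁ i u < l'.castSucc := by
          simp only [Fin.lt_def, iIdx, innerSlot, hi, hl', Fin.val_castSucc]
          omega
        rw [if_pos this]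
        congr 2
        ext
        simp only [oIdx, outerSlot, iIdx, innerSlot, hi, hi', hl']
        rw [if_pos (by omega)]
    · intro j _
      split_ifs with h1 h2
      · rfl
      · exfalso
        have := j.2
        rw [Fin.ext_iff, Fin.val_castSucc, hi] at h1
        simp only [Fin.lt_def, oIdx, outerSlot, Fin.val_castSucc, hi, hl'] at h2
        split_ifs at h2 <;> omega
      · rfl
  have f2 : compExp q h₃ l c (ow h₄ i' b K) = (∑ j, q (iw h₂ l' c' K j)) * q b := by
    have : ∑ j, q (iw h₂ l' c' K j) = ∑ j, q (iw h₃ l c (ow h₄ i' b K) j) := by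
      rw [← e3, sum_iw, sum_iw, hc]
    rw [this, sum_iw]
    unfold compExp
    congr 1
    rw [Finset.sum_eq_single (0 : Fin (n + 1))]
    · rw [if_pos (by rw [Fin.lt_def, Fin.val_castSucc, hl]; exact one_pos)]
      congr 1
      rw [ow, if_pos]
      ext
      simp [oIdx, outerSlot, hl, hi']
    · intro j _ hj
      rw [if_neg]
      rw [Fin.lt_def, Fin.val_castSucc, hl]
      have : j.val ≠ 0 := fun h => hj (Fin.ext h)
      omega
    · simp
  rw [f1, f2]
  generalize ∑ j, q (iw h₂ l' c' K j) = A
  generalize ∑ j, q (iw h₄ i' b' K j) = B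
  generalize q b = β
  clear hU' hR' hU hR
  have key : ∀ A B β s r : ZMod 2, A * (β + B) + (r * (s + B) + (s + B) * (r + A)) =
      s * r + (A * β + s * (r + A)) := by decide
  have := key A B β s r
  linear_combination this

end Tensors
end CyclicOperadCE

namespace CyclicOperadCE

/-! ## Averages over the permutations of the inputs -/

section ExtendLast

variable {n : ℕ}

theorem extendLast_castSucc (σ : Equiv.Perm (Fin n)) (j : Fin n) :
    extendLast σ j.castSucc = (σ j).castSucc := by simp [extendLast]

theorem extendLast_last (σ : Equiv.Perm (Fin n)) : extendLast σ (Fin.last n) = Fin.last n := by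
  simp [extendLast]

theorem extendLast_mul (σ τ : Equiv.Perm (Fin n)) :
    extendLast (σ * τ) = extendLast σ * extendLast τ := by
  ext x
  induction x using Fin.lastCases <;>
    simp [extendLast_castSucc, extendLast_last, Equiv.Perm.mul_apply]

theorem extendLast_injective :
    Function.Injective (extendLast : Equiv.Perm (Fin n) → Equiv.Perm (Fin (n + 1))) := by
  intro σ τ h
  ext j
  have := congrArg (fun ρ : Equiv.Perm (Fin (n + 1)) => (ρ j.castSucc).val) h
  simpa [extendLast_castSucc] using this

theorem exists_extendLast {ρ : Equiv.Perm (Fin (n + 1))} (hρ : ρ (Fin.last n) = Fin.last n) :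
    ∃ σ, extendLast σ = ρ := by
  have h1 : ∀ j : Fin n, ρ j.castSucc ≠ Fin.last n := fun j h =>
    (Fin.castSucc_lt_last j).ne (ρ.injective (h.trans hρ.symm))
  have hρ' : ρ.symm (Fin.last n) = Fin.last n := by rw [Equiv.symm_apply_eq, hρ]
  have h2 : ∀ j : Fin n, ρ.symm j.castSucc ≠ Fin.last n := fun j h =>
    (Fin.castSucc_lt_last j).ne (ρ.symm.injective (h.trans hρ'.symm))
  refine ⟨⟨fun j => (ρ j.castSucc).castPred (h1 j), fun j => (ρ.symm j.castSucc).castPred (h2 j),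
    fun j => by simp, fun j => by simp⟩, ?_⟩
  ext x
  induction x using Fin.lastCases with
  | last => rw [extendLast_last, hρ]
  | cast j => rw [extendLast_castSucc]; rfl

theorem koszulExp_extendLast (σ : Equiv.Perm (Fin n)) (q : Fin (n + 1) → ZMod 2) :
    koszulExp (extendLast σ) q = koszulExp σ fun j => q j.castSucc := by
  unfold koszulExp
  rw [Fin.sum_univ_castSucc, Finset.sum_eq_zero (s := Finset.univ)
    (f := fun l => if Fin.last n < l ∧ _ then _ else _), add_zero]
  · refine Finset.sum_congr rfl fun j _ => ?_
    rw [Fin.sum_univ_castSucc, if_neg, add_zero]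
    · simp [extendLast_castSucc]
    · rintro ⟨-, h⟩
      rw [extendLast_last] at h
      exact (Fin.le_last _).not_gt h
  · intro l _
    rw [if_neg]
    rintro ⟨h, -⟩
    exact (Fin.le_last _).not_gt h

/-- Every place is the preimage of a given place under the same number of permutations. -/
theorem sum_perm_inv_apply {M : Type*} [AddCommMonoid M] (f : Fin n → M) (o : Fin n) :
    n • ∑ σ : Equiv.Perm (Fin n), f (σ⁻¹ o) = n.factorial • ∑ l, f l := by
  have h1 : ∀ o', ∑ σ : Equiv.Perm (Fin n), f (σ⁻¹ o') = ∑ σ : Equiv.Perm (Fin n), f (σ⁻¹ o) := by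
    intro o'
    rw [← Equiv.sum_comp (Equiv.mulLeft (Equiv.swap o o'))]
    refine Finset.sum_congr rfl fun σ _ => ?_
    simp [mul_inv_rev, Equiv.Perm.mul_apply]
  have h2 : ∑ o', ∑ σ : Equiv.Perm (Fin n), f (σ⁻¹ o') = n.factorial • ∑ l, f l := by
    rw [Finset.sum_comm, Finset.sum_congr rfl fun σ _ => Equiv.sum_comp σ⁻¹ f]
    simp [Fintype.card_perm]
  rw [← h2, Finset.sum_congr rfl fun o' _ => h1 o']
  simp

end ExtendLast

section Avg

variable {k : Type u} [Field k] (O : CyclicDGOperad.{u, v} k) {ι : Type*} (q : ι → ZMod 2)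

/-- The average over the permutations of the inputs. -/
noncomputable def avg {N : ℕ} : Tens O ι N →ₗ[k] Tens O ι N :=
  (N.factorial : k)⁻¹ • ∑ σ : Equiv.Perm (Fin N), tact O q (extendLast σ)

theorem avg_eq {N : ℕ} (T : Tens O ι N) :
    avg O q T = (N.factorial : k)⁻¹ • ∑ σ : Equiv.Perm (Fin N), tact O q (extendLast σ) T := by
  simp [avg]

/-- The tensor is invariant under the permutations of the inputs. -/
def InputInv {n : ℕ} (T : Tens O ι n) : Prop :=
  ∀ σ : Equiv.Perm (Fin n), tact O q (extendLast σ) T = T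

variable {O q}

theorem InputInv.tact_eq {n : ℕ} {T : Tens O ι n} (hT : InputInv O q T)
    {ρ : Equiv.Perm (Fin (n + 1))} (hρ : ρ (Fin.last n) = Fin.last n) : tact O q ρ T = T := by
  obtain ⟨σ, rfl⟩ := exists_extendLast hρ
  exact hT σ

theorem avg_tact {N : ℕ} {ρ : Equiv.Perm (Fin (N + 1))} (hρ : ρ (Fin.last N) = Fin.last N)
    (T : Tens O ι N) : avg O q (tact O q ρ T) = avg O q T := by
  obtain ⟨σ, rfl⟩ := exists_extendLast hρ
  rw [avg_eq, avg_eq]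
  congr 1
  simp only [← tact_mul, ← extendLast_mul]
  exact Equiv.sum_comp (Equiv.mulRight σ) fun τ => tact O q (extendLast τ) T

theorem inputInv_avg {N : ℕ} (T : Tens O ι N) : InputInv O q (avg O q T) := by
  intro σ
  rw [avg_eq, map_smul, map_sum]
  congr 1
  simp only [← tact_mul, ← extendLast_mul]
  exact Equiv.sum_comp (Equiv.mulLeft σ) fun τ => tact O q (extendLast τ) T

theorem InputInv.avg_eq [CharZero k] {N : ℕ} {T : Tens O ι N} (hT : InputInv O q T) :
    avg O q T = T := by
  rw [CyclicOperadCE.avg_eq, Finset.sum_congr rfl fun σ _ => hT σ, Finset.sum_const,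
    Finset.card_univ, Fintype.card_perm, Fintype.card_fin, ← Nat.cast_smul_eq_nsmul k, smul_smul,
    inv_mul_cancel₀ (by exact_mod_cast Nat.factorial_ne_zero N), one_smul]

theorem IsHomT.smul {t : ZMod 2} {n : ℕ} {T : Tens O ι n} (hT : IsHomT O q t T) (c : k) :
    IsHomT O q t (c • T) := fun K => Submodule.smul_mem _ _ (hT K)

theorem IsHomT.sum {t : ZMod 2} {n : ℕ} {α : Type*} (s : Finset α) {T : α → Tens O ι n}
    (hT : ∀ a ∈ s, IsHomT O q t (T a)) : IsHomT O q t (∑ a ∈ s, T a) := fun K => by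
  rw [Finset.sum_apply]
  exact Submodule.sum_mem _ fun a ha => hT a ha K

theorem IsHomT.avg {t : ZMod 2} {n : ℕ} {T : Tens O ι n} (hT : IsHomT O q t T) :
    IsHomT O q t (avg O q T) := by
  rw [avg_eq]
  exact (IsHomT.sum _ fun σ _ => hT.tact _).smul _

/-- The composite changes by a permutation fixing the output, which the average does not see. Inputs
can therefore be relabelled before plugging. -/
theorem avg_ecomp_tact_left {s : ZMod 2} {n m N : ℕ} (h : N + 1 = n + m) {l l' : Fin n}
    {σ : Equiv.Perm (Fin (n + 1))} (hσ : σ (Fin.last n) = Fin.last n)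
    (hl : σ l.castSucc = l'.castSucc) (b b' : ι) (T : Tens O ι n) (U : Tens O ι m) :
    avg O q (ecomp O q s h l' b b' (tact O q σ T) U) = avg O q (ecomp O q s h l b b' T U) := by
  obtain ⟨ρ, H⟩ := exists_isPlug h l l' σ (1 : Equiv.Perm (Fin (m + 1))) hl rfl
  have := ecomp_equivariant O q s H b b' T U
  rw [tact_one] at this
  rw [this, avg_tact (H.last hσ)]

theorem avg_ecomp_tact_right {s : ZMod 2} {n m N : ℕ} (h : N + 1 = n + m) (l : Fin n)
    {τ : Equiv.Perm (Fin (m + 1))} (hτ : τ (Fin.last m) = Fin.last m) (b b' : ι)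
    (T : Tens O ι n) (U : Tens O ι m) :
    avg O q (ecomp O q s h l b b' T (tact O q τ U)) = avg O q (ecomp O q s h l b b' T U) := by
  obtain ⟨ρ, H⟩ := exists_isPlug h l l (1 : Equiv.Perm (Fin (n + 1))) τ rfl hτ
  have := ecomp_equivariant O q s H b b' T U
  rw [tact_one] at this
  rw [this, avg_tact (H.last rfl)]

theorem avg_ecomp_avg_right [CharZero k] {s : ZMod 2} {n m N : ℕ} (h : N + 1 = n + m) (l : Fin n)
    (b b' : ι) (T : Tens O ι n) (U : Tens O ι m) :
    avg O q (ecomp O q s h l b b' T (avg O q U)) = avg O q (ecomp O q s h l b b' T U) := by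
  rw [avg_eq O q U, map_smul, map_smul, map_sum, map_sum,
    Finset.sum_congr rfl fun σ _ => avg_ecomp_tact_right h l (extendLast_last σ) b b' T U,
    Finset.sum_const, Finset.card_univ, Fintype.card_perm, Fintype.card_fin,
    ← Nat.cast_smul_eq_nsmul k, smul_smul,
    inv_mul_cancel₀ (by exact_mod_cast Nat.factorial_ne_zero m), one_smul]

/-- Averaging the first factor spreads the chosen input uniformly over all inputs, so `n` times a
single plugging is the whole Leibniz sum. -/
theorem avg_ecomp_avg_left [CharZero k] {s : ZMod 2} {n m N : ℕ} (h : N + 1 = n + m) (o : Fin n)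
    (b b' : ι) (T : Tens O ι n) (U : Tens O ι m) :
    (n : k) • avg O q (ecomp O q s h o b b' (avg O q T) U) =
      ∑ l, avg O q (ecomp O q s h l b b' T U) := by
  have h1 : ∀ σ : Equiv.Perm (Fin n),
      avg O q (ecomp O q s h o b b' (tact O q (extendLast σ) T) U) =
        avg O q (ecomp O q s h (σ⁻¹ o) b b' T U) := fun σ =>
    avg_ecomp_tact_left h (extendLast_last σ) (by simp [extendLast_castSucc]) b b' T U
  have h2 := sum_perm_inv_apply (fun l => avg O q (ecomp O q s h l b b' T U)) o
  rw [avg_eq O q T, map_smul, LinearMap.smul_apply, map_smul, map_sum, LinearMap.sum_apply, map_sum,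
    Finset.sum_congr rfl fun σ _ => h1 σ, smul_comm, Nat.cast_smul_eq_nsmul k, h2,
    ← Nat.cast_smul_eq_nsmul k, smul_smul,
    inv_mul_cancel₀ (by exact_mod_cast Nat.factorial_ne_zero n), one_smul]

end Avg

/-! ## Derivations as families of tensors -/

section Tens

variable {k : Type u} [Field k] {O : CyclicDGOperad.{u, v} k} {ι : Type*}

/-- The component of arity `n` of a derivation, as a tensor. -/
def tens (n : ℕ) : Coeffs O ι →ₗ[k] Tens O ι n where
  toFun D K := D n (K (Fin.last n)) fun j => K j.castSucc
  map_add' _ _ := rfl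
  map_smul' _ _ := rfl

theorem tens_apply (n : ℕ) (D : Coeffs O ι) (K : Fin (n + 1) → ι) :
    tens n D K = D n (K (Fin.last n)) fun j => K j.castSucc := rfl

theorem apply_eq_tens (D : Coeffs O ι) (n : ℕ) (a : ι) (K : Fin n → ι) :
    D n a K = tens n D (Fin.snoc K a : Fin (n + 1) → ι) := by
  simp [tens_apply]

theorem coeffs_ext {D E : Coeffs O ι} (h : ∀ n, tens n D = tens n E) : D = E := by
  funext n a K
  rw [apply_eq_tens D, apply_eq_tens E, h]

variable (O) in
/-- The derivation with the given components. -/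
def ofTens : (∀ n, Tens O ι n) →ₗ[k] Coeffs O ι where
  toFun T n a K := T n (Fin.snoc K a : Fin (n + 1) → ι)
  map_add' _ _ := rfl
  map_smul' _ _ := rfl

theorem tens_ofTens (T : ∀ n, Tens O ι n) (n : ℕ) : tens n (ofTens O T) = T n := by
  funext K
  change T n (Fin.snoc (Fin.init K) (K (Fin.last n)) : Fin (n + 1) → ι) = T n K
  rw [Fin.snoc_init_self]

variable (O) in
/-- The derivation with a single component. -/
def single (n : ℕ) : Tens O ι n →ₗ[k] Coeffs O ι := ofTens O ∘ₗ LinearMap.single k _ n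

theorem tens_single_self (n : ℕ) (T : Tens O ι n) : tens n (single O n T) = T := by
  rw [single, LinearMap.comp_apply, tens_ofTens]
  simp

theorem tens_single_of_ne {n m : ℕ} (h : m ≠ n) (T : Tens O ι n) : tens m (single O n T) = 0 := by
  rw [single, LinearMap.comp_apply, tens_ofTens]
  simp [h]

theorem eq_single {n : ℕ} {D : Coeffs O ι} {T : Tens O ι n} (h : tens n D = T)
    (h' : ∀ m, m ≠ n → tens m D = 0) : D = single O n T := by
  refine coeffs_ext fun m => ?_
  by_cases hm : m = n
  · subst hm
    rw [h, tens_single_self]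
  · rw [h' m hm, tens_single_of_ne hm]

theorem mem_fil_iff [Fintype ι] (M : ℕ) (D : Coeffs O ι) :
    D ∈ GramData.fil ι O M ↔ ∀ n < M, tens n D = 0 := by
  constructor
  · intro h n hn
    funext K
    exact h n hn _ _
  · intro h n hn a K
    rw [apply_eq_tens D, h n hn, Pi.zero_apply]

/-- A continuous map vanishes on a derivation if it vanishes on its components. -/
theorem map_eq_zero_of_single [Fintype ι] {Y : Type*} [AddCommGroup Y] [Module k Y]
    (F : ℕ → Submodule k Y) (hF : ∀ y, (∀ M, y ∈ F M) → y = 0) {c : ℕ} {f : Coeffs O ι →ₗ[k] Y}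
    (hf : ∀ M D, D ∈ GramData.fil ι O (M + c) → f D ∈ F M) {D : Coeffs O ι}
    (h : ∀ n, f (single O n (tens n D)) = 0) : f D = 0 := by
  refine hF _ fun M => ?_
  have h1 : D - ∑ n ∈ Finset.range (M + c), single O n (tens n D) ∈ GramData.fil ι O (M + c) := by
    rw [mem_fil_iff]
    intro n hn
    rw [map_sub, map_sum, Finset.sum_eq_single n, tens_single_self, sub_self]
    · intro m _ hm
      exact tens_single_of_ne hm.symm _
    · intro hn'
      exact absurd (Finset.mem_range.2 hn) hn'
  have := hf M _ h1
  rwa [map_sub, map_sum, Finset.sum_eq_zero fun n _ => h n, sub_zero] at this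

theorem eq_zero_of_forall_mem_fil [Fintype ι] (D : Coeffs O ι)
    (h : ∀ M, D ∈ GramData.fil ι O M) : D = 0 := by
  funext n a K
  exact h (n + 1) n (Nat.lt_succ_self n) a K

end Tens
end CyclicOperadCE

/-! ### Composition of derivations through pluggings of tensors -/

namespace CyclicOperadCE
namespace GramData

variable {k : Type u} [Field k] {O : CyclicDGOperad.{u, v} k} {ι : Type*} [Fintype ι]
  (G : GramData k ι)

theorem tens_average {N : ℕ} (T : Tens O ι N) (a : ι) (K : Fin N → ι) :
    G.average O (fun K' => T (Fin.snoc K' a : Fin (N + 1) → ι)) K =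
      avg O G.coordPar T (Fin.snoc K a : Fin (N + 1) → ι) := by
  rw [average, avg_eq, Pi.smul_apply, Finset.sum_apply]
  congr 1
  refine Finset.sum_congr rfl fun σ _ => ?_
  have h1 : (fun j => (Fin.snoc K a : Fin (N + 1) → ι) (extendLast σ j)) =
      (Fin.snoc (fun j => K (σ j)) a : Fin (N + 1) → ι) := by
    funext j
    induction j using Fin.lastCases with
    | last => rw [extendLast_last, Fin.snoc_last, Fin.snoc_last]
    | cast j => rw [extendLast_castSucc, Fin.snoc_castSucc, Fin.snoc_castSucc]
  rw [tact_apply, h1]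
  congr 1
  rw [koszul, koszul, koszulExp_extendLast]
  congr 2
  funext j
  rw [extendLast_castSucc, Fin.snoc_castSucc]

theorem mem_der_iff (D : Coeffs O ι) :
    D ∈ G.der O ↔ ∀ n, InputInv O G.coordPar (tens n D) := by
  have key : ∀ (n : ℕ) (σ : Equiv.Perm (Fin n)) (K : Fin (n + 1) → ι),
      tact O G.coordPar (extendLast σ) (tens n D) K =
      koszul k σ (fun j => G.coordPar (K (σ j).castSucc)) •
        O.act n (extendLast σ) (D n (K (Fin.last n)) fun j => K (σ j).castSucc) := by
    intro n σ K
    rw [tact_apply, tens_apply, koszul, koszulExp_extendLast, extendLast_last]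
    simp only [extendLast_castSucc]
    rfl
  constructor
  · intro h n σ
    funext K
    rw [key]
    exact h n _ (fun j => K j.castSucc) σ
  · intro h n a K σ
    have := congrFun (h n σ) (Fin.snoc K a : Fin (n + 1) → ι)
    rw [key, tens_apply] at this
    simpa using this

theorem isHomT_tens {t : ZMod 2} {D : Coeffs O ι} (hD : G.projDer O t D = D) (n : ℕ) :
    IsHomT O G.coordPar t (tens n D) := by
  intro K
  have := congrFun (congrFun (congrFun hD n) (K (Fin.last n))) fun j => K j.castSucc
  rw [tens_apply, ← this, Fin.sum_univ_castSucc]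
  have e : t + (∑ i : Fin n, G.coordPar (K i.castSucc) + G.coordPar (K (Fin.last n))) =
      t + G.coordPar (K (Fin.last n)) + G.wordPar (fun j : Fin n => K j.castSucc) := by
    rw [wordPar]; ring
  rw [e]
  exact O.proj_mem _ _

theorem projDer_of_isHomT {t : ZMod 2} {D : Coeffs O ι}
    (hD : ∀ n, IsHomT O G.coordPar t (tens n D)) : G.projDer O t D = D := by
  funext n a K
  change O.proj n (t + G.coordPar a + G.wordPar K) (D n a K) = D n a K
  have := hD n (Fin.snoc K a : Fin (n + 1) → ι)
  rw [← apply_eq_tens, Fin.sum_univ_castSucc, Fin.snoc_last] at this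
  simp only [Fin.snoc_castSucc] at this
  rw [O.proj_of_mem this, if_pos]
  rw [wordPar]
  ring

/-- Homogeneity of `E` identifies the parity of its coefficient with the exponent multiplied by `s`
in `compAt`, which is thus the sign of `signOp`; the rest is the sign of moving the inner block into
its place. The output letter `a`, being last, is not crossed. -/
theorem compAt_eq {s t : ZMod 2} (D : Coeffs O ι) {E : Coeffs O ι} (hE : G.projDer O t E = E)
    {n m N : ℕ} (h : N + 1 = n + m) (l : Fin n) (a : ι) (K : Fin N → ι) :
    G.compAt O s t D E h l a K =
      ∑ b, ecomp O G.coordPar s h l b b (tens n E) (tens m D)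
        (Fin.snoc K a : Fin (N + 1) → ι) := by
  refine Finset.sum_congr rfl fun b _ => ?_
  set K' : Fin (N + 1) → ι := Fin.snoc K a with hK'
  have ho : ow h l b K' = (Fin.snoc (outerWord h l b K) a : Fin (n + 1) → ι) := by
    funext j
    induction j using Fin.lastCases with
    | last =>
      rw [Fin.snoc_last, ow, if_neg (Fin.castSucc_lt_last l).ne', oIdx_last, hK', Fin.snoc_last]
    | cast j =>
      rw [Fin.snoc_castSucc, ow, outerWord]
      have := j.2
      have := l.2
      have hs : ∀ (x : ℕ) (hx : x < N) (hx' : x < N + 1), K' ⟨x, hx'⟩ = K ⟨x, hx⟩ :=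
        fun x hx hx' => by
          rw [hK', show (⟨x, hx'⟩ : Fin (N + 1)) = Fin.castSucc ⟨x, hx⟩ from rfl, Fin.snoc_castSucc]
      rcases lt_trichotomy j l with hj | hj | hj
      · rw [if_neg (fun e => hj.ne (Fin.castSucc_injective _ e)), dif_pos hj, ← hs _ _ (by omega)]
        congr 1
        ext
        simp only [oIdx, outerSlot, Fin.val_castSucc]
        rw [if_pos (Fin.lt_def.1 hj)]
      · rw [if_pos (congrArg _ hj), dif_neg hj.not_lt, dif_neg hj.not_gt]
      · rw [if_neg (fun e => hj.ne' (Fin.castSucc_injective _ e)), dif_neg hj.not_gt, dif_pos hj,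
          ← hs _ _ (by omega)]
        congr 1
        ext
        simp only [oIdx, outerSlot, Fin.val_castSucc]
        rw [if_neg (Fin.lt_def.1 hj).not_gt]
  have hi : iw h l b K' = (Fin.snoc (innerWord h l K) b : Fin (m + 1) → ι) := by
    funext u
    induction u using Fin.lastCases with
    | last => rw [Fin.snoc_last, iw, if_pos rfl]
    | cast u =>
      rw [Fin.snoc_castSucc, iw, if_neg (Fin.castSucc_lt_last u).ne, innerWord, hK',
        show iIdx h l u.castSucc = Fin.castSucc ⟨l + u, by have := l.2; have := u.2; omega⟩ from rfl,
        Fin.snoc_castSucc]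
  have hsum : ∑ j, G.coordPar (iw h l b K' j) = G.wordPar (innerWord h l K) + G.coordPar b := by
    rw [hi, Fin.sum_univ_castSucc, Fin.snoc_last]
    simp [wordPar]
  have hc : compExp G.coordPar h l b K' =
      (G.coordPar b + G.wordPar (innerWord h l K)) *
        ∑ j : Fin n, if j < l then G.coordPar (outerWord h l b K j) else 0 := by
    have h1 := sum_iw (q := G.coordPar) h l b K'
    rw [hsum, add_comm] at h1
    rw [compExp, ← h1]
    congr 1
    rw [Fin.sum_univ_castSucc, if_neg (Fin.castSucc_lt_last l).not_gt, add_zero]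
    refine Finset.sum_congr rfl fun j _ => ?_
    by_cases hj : j < l
    · rw [if_pos hj, if_pos (Fin.castSucc_lt_castSucc_iff.2 hj)]
      have h2 := congrFun ho j.castSucc
      rw [ow, if_neg (fun e => hj.ne (Fin.castSucc_injective _ e)), Fin.snoc_castSucc] at h2
      rw [h2]
    · rw [if_neg hj, if_neg (fun h => hj (Fin.castSucc_lt_castSucc_iff.1 h))]
  have hEm := G.isHomT_tens hE n (ow h l b K')
  rw [ecomp_apply, hc, O.signOp_of_mem _ hEm, ho, hi, map_smul, LinearMap.smul_apply, smul_smul,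
    ← sgn_add, ← apply_eq_tens, ← apply_eq_tens]
  congr 2
  rw [Fin.sum_univ_castSucc, Fin.snoc_last]
  simp only [Fin.snoc_castSucc, wordPar]
  ring

theorem tens_compDer {s t : ZMod 2} (D : Coeffs O ι) {E : Coeffs O ι} (hE : G.projDer O t E = E)
    (N : ℕ) :
    tens N (G.compDer O s t D E) = avg O G.coordPar (∑ r : Fin (N + 1), ∑ l : Fin (r + 1), ∑ b,
      ecomp O G.coordPar s (n := r + 1) (m := N - r) (by omega) l b b (tens (r + 1) E)
        (tens (N - r) D)) := by
  funext K
  rw [tens_apply, compDer_apply]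
  have hK : (Fin.snoc (fun j : Fin N => K j.castSucc) (K (Fin.last N)) : Fin (N + 1) → ι) = K :=
    Fin.snoc_init_self K
  conv_rhs => rw [← hK, ← G.tens_average]
  congr 1
  funext K'
  simp only [Finset.sum_apply, G.compAt_eq D hE]

/-- The first factor of the partial composition receives the second one in its first input. -/
noncomputable def plug (s : ZMod 2) {n m N : ℕ} (h : N + 1 = n + m) (hn : 0 < n) :
    Tens O ι n →ₗ[k] Tens O ι m →ₗ[k] Tens O ι N :=
  ∑ b, ecomp O G.coordPar s h ⟨0, hn⟩ b b

theorem plug_apply (s : ZMod 2) {n m N : ℕ} (h : N + 1 = n + m) (hn : 0 < n) (T : Tens O ι n)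
    (U : Tens O ι m) :
    G.plug s h hn T U = ∑ b, ecomp O G.coordPar s h ⟨0, hn⟩ b b T U := by
  simp [plug]

theorem isHomT_plug {s t : ZMod 2} {n m N : ℕ} (h : N + 1 = n + m) (hn : 0 < n) {T : Tens O ι n}
    {U : Tens O ι m} (hT : IsHomT O G.coordPar t T) (hU : IsHomT O G.coordPar s U) :
    IsHomT O G.coordPar (t + s) (G.plug s h hn T U) := by
  rw [plug_apply]
  exact IsHomT.sum _ fun b _ => hT.ecomp hU h _ rfl

theorem projDer_single {t : ZMod 2} {n : ℕ} {T : Tens O ι n} (hT : IsHomT O G.coordPar t T) :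
    G.projDer O t (single O n T) = single O n T := by
  refine G.projDer_of_isHomT fun m => ?_
  by_cases hm : m = n
  · subst hm
    rwa [tens_single_self]
  · rw [tens_single_of_ne hm]
    exact fun K => Submodule.zero_mem _

theorem tens_projDer (t : ZMod 2) (D : Coeffs O ι) (n : ℕ) (K : Fin (n + 1) → ι) :
    tens n (G.projDer O t D) K =
      O.proj n (t + G.coordPar (K (Fin.last n)) + G.wordPar fun j : Fin n => K j.castSucc)
        (tens n D K) := rfl

/-- A derivation annihilates constants, hence the images of the coordinates under a derivation of
arity zero. -/
theorem compDer_single_zero {s t : ZMod 2} (D : Coeffs O ι) {T : Tens O ι 0}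
    (hT : IsHomT O G.coordPar t T) : G.compDer O s t D (single O 0 T) = 0 := by
  refine coeffs_ext fun N => ?_
  rw [G.tens_compDer D (G.projDer_single hT), map_zero]
  refine (congrArg _ ?_).trans (map_zero _)
  refine Finset.sum_eq_zero fun r _ => Finset.sum_eq_zero fun l _ => Finset.sum_eq_zero fun b _ => ?_
  rw [tens_single_of_ne (by omega), map_zero, LinearMap.zero_apply]

/-- By the symmetry of `T` the `n` terms of the Leibniz rule agree after averaging, so plugging into
the first input suffices. -/
theorem compDer_single [CharZero k] {s t : ZMod 2} {n m N : ℕ} (h : N + 1 = n + m) (hn : 0 < n)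
    {T : Tens O ι n} (hT : IsHomT O G.coordPar t T) (hT' : InputInv O G.coordPar T)
    (U : Tens O ι m) :
    G.compDer O s t (single O m U) (single O n T) =
      single O N ((n : k) • avg O G.coordPar (G.plug s h hn T U)) := by
  obtain ⟨n, rfl⟩ : ∃ n', n = n' + 1 := ⟨n - 1, by omega⟩
  refine eq_single ?_ fun M hM => ?_
  · rw [G.tens_compDer _ (G.projDer_single hT), Finset.sum_eq_single ⟨n, by omega⟩]
    · have key : ∀ m' (h' : N + 1 = n + 1 + m'), avg O G.coordPar
          (∑ l : Fin (n + 1), ∑ b, ecomp O G.coordPar s h' l b b T (tens m' (single O m U))) =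
          (((n + 1 : ℕ) : k)) • avg O G.coordPar (G.plug s h hn T U) := by
        intro m' h'
        obtain rfl : m' = m := by omega
        rw [tens_single_self, plug_apply, map_sum, map_sum, Finset.smul_sum,
          Finset.sum_congr rfl fun l _ => map_sum _ _ _, Finset.sum_comm]
        refine Finset.sum_congr rfl fun b _ => ?_
        rw [← avg_ecomp_avg_left, hT'.avg_eq]
      rw [← key (N - n) (by omega)]
      simp only [tens_single_self]
    · intro r _ hr
      refine Finset.sum_eq_zero fun l _ => Finset.sum_eq_zero fun b _ => ?_
      rw [tens_single_of_ne (fun e => hr (Fin.ext (by simpa using e))), map_zero,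
        LinearMap.zero_apply]
    · simp
  · rw [G.tens_compDer _ (G.projDer_single hT)]
    refine (congrArg _ ?_).trans (map_zero _)
    refine Finset.sum_eq_zero fun r _ => Finset.sum_eq_zero fun l _ =>
      Finset.sum_eq_zero fun b _ => ?_
    by_cases hr : r.val = n
    · rw [tens_single_of_ne (n := m) (by omega), map_zero]
    · rw [tens_single_of_ne (n := n + 1) (by omega), map_zero, LinearMap.zero_apply]

end GramData
end CyclicOperadCE

namespace CyclicOperadCE
namespace GramData

variable {k : Type u} [Field k] {O : CyclicDGOperad.{u, v} k} {ι : Type*} [Fintype ι]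
  (G : GramData k ι)

/-! ## The associator -/

theorem avg_plug_avg_right [CharZero k] {s : ZMod 2} {n m N : ℕ} (h : N + 1 = n + m) (hn : 0 < n)
    (T : Tens O ι n) (U : Tens O ι m) :
    avg O G.coordPar (G.plug s h hn T (avg O G.coordPar U)) =
      avg O G.coordPar (G.plug s h hn T U) := by
  rw [plug_apply, plug_apply, map_sum, map_sum]
  exact Finset.sum_congr rfl fun b _ => avg_ecomp_avg_right h _ b b T U

theorem compDer_compDer_single_left [CharZero k] {s r t : ZMod 2} {n m p M N : ℕ}
    (hM : M + 1 = p + m) (hN : N + 1 = n + M) (hn : 0 < n) (hp : 0 < p)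
    {T : Tens O ι n} (hT : IsHomT O G.coordPar t T) (hT' : InputInv O G.coordPar T)
    {R : Tens O ι p} (hR : IsHomT O G.coordPar r R) (hR' : InputInv O G.coordPar R)
    (U : Tens O ι m) :
    G.compDer O (s + r) t (G.compDer O s r (single O m U) (single O p R)) (single O n T) =
      single O N (((n : k) * p) • avg O G.coordPar
        (G.plug (s + r) hN hn T (G.plug s hM hp R U))) := by
  rw [G.compDer_single hM hp hR hR', G.compDer_single hN hn hT hT',
    map_smul (G.plug _ _ _ T), map_smul (avg O G.coordPar), smul_smul,
    avg_plug_avg_right]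

theorem compDer_compDer_single_right [CharZero k] {s r t : ZMod 2} {n m p N₁ N : ℕ}
    (h₁ : N₁ + 1 = n + p) (h₂ : N + 1 = N₁ + m) (hn : 0 < n) (hN₁ : 0 < N₁)
    {T : Tens O ι n} (hT : IsHomT O G.coordPar t T) (hT' : InputInv O G.coordPar T)
    {R : Tens O ι p} (hR : IsHomT O G.coordPar r R) (U : Tens O ι m) :
    G.compDer O s (t + r) (single O m U) (G.compDer O r t (single O p R) (single O n T)) =
      single O N ((n : k) • ∑ l : Fin N₁, avg O G.coordPar (∑ c, ∑ b,
        ecomp O G.coordPar s h₂ l c c (ecomp O G.coordPar r h₁ ⟨0, hn⟩ b b T R) U)) := by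
  have hinv : InputInv O G.coordPar ((n : k) • avg O G.coordPar (G.plug r h₁ hn T R)) := fun σ => by
    rw [map_smul, inputInv_avg]
  rw [G.compDer_single h₁ hn hT hT', G.compDer_single h₂ hN₁ ((G.isHomT_plug h₁ hn hT hR).avg.smul _)
    hinv, map_smul (G.plug s h₂ hN₁), LinearMap.smul_apply, map_smul (avg O G.coordPar), smul_comm]
  congr 2
  rw [plug_apply, map_sum, Finset.smul_sum, Finset.sum_congr rfl fun c _ => avg_ecomp_avg_left _ _ _ _ _ _,
    Finset.sum_comm]
  refine Finset.sum_congr rfl fun l _ => ?_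
  rw [map_sum]
  refine Finset.sum_congr rfl fun c _ => ?_
  rw [plug_apply, map_sum, LinearMap.sum_apply]

theorem exists_perm_two {n : ℕ} {a b c d : Fin n} (h : a ≠ b) (h' : c ≠ d) :
    ∃ σ : Equiv.Perm (Fin n), σ a = c ∧ σ b = d := by
  have h1 : c ≠ Equiv.swap a c b := fun e =>
    h ((Equiv.swap a c).injective (by rw [Equiv.swap_apply_left, ← e]))
  refine ⟨Equiv.swap (Equiv.swap a c b) d * Equiv.swap a c, ?_, ?_⟩
  · rw [Equiv.Perm.mul_apply, Equiv.swap_apply_left, Equiv.swap_apply_of_ne_of_ne h1 h']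
  · rw [Equiv.Perm.mul_apply, Equiv.swap_apply_left]

/-- Inputs which stem from `R` can be exchanged by the symmetry of `R`, without disturbing `T`. -/
theorem avg_ecomp_ecomp_inner {s r : ZMod 2} {n m p N₁ N : ℕ} (h₁ : N₁ + 1 = n + p)
    (h₂ : N + 1 = N₁ + m) {i : Fin n} (hi : i.val = 0) (b c : ι) {l l' : Fin N₁}
    (hl : l.val < p) (hl' : l'.val < p)
    (T : Tens O ι n) {R : Tens O ι p} (hR : InputInv O G.coordPar R) (U : Tens O ι m) :
    avg O G.coordPar (ecomp O G.coordPar s h₂ l' c c (ecomp O G.coordPar r h₁ i b b T R) U) =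
      avg O G.coordPar (ecomp O G.coordPar s h₂ l c c (ecomp O G.coordPar r h₁ i b b T R) U) := by
  set τ : Equiv.Perm (Fin (p + 1)) := extendLast (Equiv.swap ⟨l, hl⟩ ⟨l', hl'⟩) with hτ
  obtain ⟨ρ, H⟩ := exists_isPlug h₁ i i (1 : Equiv.Perm (Fin (n + 1))) τ rfl (extendLast_last _)
  have e := ecomp_equivariant O G.coordPar r H b b T R
  rw [tact_one, hR] at e
  conv_lhs => rw [e]
  refine avg_ecomp_tact_left h₂ (H.last rfl) ?_ c c _ U
  have h3 := H.inner (Fin.castSucc ⟨l, hl⟩) (Fin.castSucc_lt_last _).ne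
  rw [hτ, extendLast_castSucc, Equiv.swap_apply_left] at h3
  have h4 : ∀ x : Fin N₁, ∀ hx : x.val < p, iIdx h₁ i (Fin.castSucc ⟨x, hx⟩) = x.castSucc :=
    fun x hx => Fin.ext (by simp [iIdx, innerSlot, hi])
  rwa [h4, h4] at h3

/-- The remaining inputs stem from `T` and are exchanged by permutations of its inputs that fix the
occupied one. -/
theorem avg_ecomp_ecomp_outer {s r : ZMod 2} {n m p N₁ N : ℕ} (h₁ : N₁ + 1 = n + p)
    (h₂ : N + 1 = N₁ + m) {i : Fin n} (hi : i.val = 0) (b c : ι) {l l' : Fin N₁}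
    (hl : p ≤ l.val) (hl' : p ≤ l'.val)
    {T : Tens O ι n} (hT : InputInv O G.coordPar T) (R : Tens O ι p) (U : Tens O ι m) :
    avg O G.coordPar (ecomp O G.coordPar s h₂ l' c c (ecomp O G.coordPar r h₁ i b b T R) U) =
      avg O G.coordPar (ecomp O G.coordPar s h₂ l c c (ecomp O G.coordPar r h₁ i b b T R) U) := by
  have hn : ∀ x : Fin N₁, p ≤ x.val → x.val - p + 1 < n := fun x hx => by have := x.2; omega
  set σ : Equiv.Perm (Fin (n + 1)) :=
    extendLast (Equiv.swap ⟨l - p + 1, hn l hl⟩ ⟨l' - p + 1, hn l' hl'⟩) with hσ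
  have hσi : σ i.castSucc = i.castSucc := by
    rw [hσ, extendLast_castSucc, Equiv.swap_apply_of_ne_of_ne] <;>
    · rw [ne_eq, Fin.ext_iff]
      simp [hi]
  obtain ⟨ρ, H⟩ := exists_isPlug h₁ i i σ (1 : Equiv.Perm (Fin (p + 1))) hσi rfl
  have e := ecomp_equivariant O G.coordPar r H b b T R
  rw [tact_one, hT] at e
  conv_lhs => rw [e]
  refine avg_ecomp_tact_left h₂ (H.last (extendLast_last _)) ?_ c c _ U
  have h3 := H.outer (Fin.castSucc ⟨l - p + 1, hn l hl⟩) (by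
    rw [ne_eq, Fin.ext_iff]
    simp [hi])
  rw [hσ, extendLast_castSucc, Equiv.swap_apply_left] at h3
  have h4 : ∀ x : Fin N₁, ∀ hx : p ≤ x.val,
      oIdx h₁ i (Fin.castSucc ⟨x - p + 1, hn x hx⟩) = x.castSucc :=
    fun x hx => Fin.ext (by
      simp only [oIdx, outerSlot, hi, Fin.val_castSucc]
      rw [if_neg (by omega)]
      omega)
  rwa [h4 l hl, h4 l' hl'] at h3

theorem sum_fin_split {M : Type*} [AddCommMonoid M] {n p q : ℕ} (h : n = p + q) (f : Fin n → M) {X Y : M}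
    (hX : ∀ l, l.val < p → f l = X) (hY : ∀ l, p ≤ l.val → f l = Y) :
    ∑ l, f l = p • X + q • Y := by
  subst h
  rw [Fin.sum_univ_add, Finset.sum_congr rfl fun l _ => hX (Fin.castAdd q l) (by simp),
    Finset.sum_congr rfl fun l _ => hY (Fin.natAdd p l) (by simp)]
  simp

/-- The tensor which measures the failure of associativity. -/
noncomputable def doublePlug (r s : ZMod 2) {n m p N₁ N : ℕ} (h₁ : N₁ + 1 = n + p)
    (h₂ : N + 1 = N₁ + m) (hn : 2 ≤ n) (T : Tens O ι n) (R : Tens O ι p) (U : Tens O ι m) :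
    Tens O ι N :=
  ∑ c, ∑ b, ecomp O G.coordPar s h₂ ⟨p, by omega⟩ c c
    (ecomp O G.coordPar r h₁ ⟨0, by omega⟩ b b T R) U

/-- With at most one input in `T` there is no place for a second, parallel plugging, and only the
sequential terms remain. -/
theorem associator_of_lt_two [CharZero k] {s r t : ZMod 2} {n m p : ℕ} (hn : n < 2)
    {T : Tens O ι n} (hT : IsHomT O G.coordPar t T) (hT' : InputInv O G.coordPar T)
    {R : Tens O ι p} (hR : IsHomT O G.coordPar r R) (hR' : InputInv O G.coordPar R)
    (U : Tens O ι m) :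
    G.compDer O s (t + r) (single O m U) (G.compDer O r t (single O p R) (single O n T)) =
      G.compDer O (s + r) t (G.compDer O s r (single O m U) (single O p R)) (single O n T) := by
  rcases Nat.eq_zero_or_pos n with rfl | hn0
  · rw [G.compDer_single_zero _ hT, map_zero, G.compDer_single_zero _ hT]
  obtain rfl : n = 1 := by omega
  rcases Nat.eq_zero_or_pos p with rfl | hp
  · rw [G.compDer_single_zero _ hR, map_zero, LinearMap.zero_apply,
      G.compDer_single (n := 1) (m := 0) (N := 0) rfl hn0 hT hT']
    exact G.compDer_single_zero _ ((G.isHomT_plug _ _ hT hR).avg.smul _)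
  · obtain ⟨M, hM⟩ : ∃ M, M + 1 = p + m := ⟨p + m - 1, by omega⟩
    have h₁ : p + 1 = 1 + p := add_comm _ _
    rw [G.compDer_compDer_single_left hM (add_comm _ _) hn0 hp hT hT' hR hR',
      G.compDer_compDer_single_right h₁ hM hn0 hp hT hT' hR,
      sum_fin_split (n := p) (p := p) (q := 0) rfl _ (X := avg O G.coordPar
        (G.plug (s + r) (add_comm _ _) hn0 T (G.plug s hM hp R U))) (Y := 0), smul_zero, add_zero,
      ← Nat.cast_smul_eq_nsmul k, smul_smul]
    · intro l hl
      rw [plug_apply, plug_apply, map_sum]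
      simp only [map_sum]
      rw [Finset.sum_comm]
      refine Finset.sum_congr rfl fun b _ => Finset.sum_congr rfl fun c _ => ?_
      rw [G.avg_ecomp_ecomp_inner h₁ hM rfl b c (l := ⟨0, hp⟩) (l' := l) hp hl T hR',
        ecomp_assoc h₁ hM hM (add_comm _ _) (i := ⟨0, hn0⟩) (j := ⟨0, hp⟩) rfl rfl rfl, add_comm r s]
    · intro l hl
      exact absurd l.2 (by omega)

/-- Among the inputs of `T ∘ R`, the `p` inputs of `R` reproduce the other bracketing by sequential
associativity; the `n - 1` free inputs of `T` give the associator. -/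
theorem associator_of_two_le [CharZero k] {s r t : ZMod 2} {n m p N₁ N : ℕ} (hn : 2 ≤ n)
    (h₁ : N₁ + 1 = n + p) (h₂ : N + 1 = N₁ + m)
    {T : Tens O ι n} (hT : IsHomT O G.coordPar t T) (hT' : InputInv O G.coordPar T)
    {R : Tens O ι p} (hR : IsHomT O G.coordPar r R) (hR' : InputInv O G.coordPar R)
    (U : Tens O ι m) :
    G.compDer O s (t + r) (single O m U) (G.compDer O r t (single O p R) (single O n T)) =
      G.compDer O (s + r) t (G.compDer O s r (single O m U) (single O p R)) (single O n T) +
      single O N (((n : k) * (n - 1 : ℕ)) • avg O G.coordPar (G.doublePlug r s h₁ h₂ hn T R U)) := by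
  have hn0 : 0 < n := by omega
  have hN₁ : 0 < N₁ := by omega
  have hY : ∀ l : Fin N₁, p ≤ l.val → avg O G.coordPar (∑ c, ∑ b,
        ecomp O G.coordPar s h₂ l c c (ecomp O G.coordPar r h₁ ⟨0, hn0⟩ b b T R) U) =
        avg O G.coordPar (G.doublePlug r s h₁ h₂ hn T R U) := by
    intro l hl
    simp only [doublePlug, map_sum]
    exact Finset.sum_congr rfl fun c _ => Finset.sum_congr rfl fun b _ =>
      G.avg_ecomp_ecomp_outer h₁ h₂ rfl b c (le_refl p) hl hT' R U
  rw [G.compDer_compDer_single_right h₁ h₂ hn0 hN₁ hT hT' hR]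
  -- For `p = 0` the derivation `R` is constant: it has no inputs of its own, and the composite of
  -- `U` with it vanishes.
  rcases Nat.eq_zero_or_pos p with rfl | hp
  · rw [G.compDer_single_zero _ hR, map_zero, LinearMap.zero_apply,
      sum_fin_split (p := 0) (q := n - 1) (by omega) _ (X := 0) (fun l hl => absurd hl (by omega)) hY,
      smul_zero]
    refine Eq.trans ?_ (zero_add _).symm
    rw [← Nat.cast_smul_eq_nsmul k, ← smul_smul]
    congr 2
    exact zero_add _
  · obtain ⟨M, hM⟩ : ∃ M, M + 1 = p + m := ⟨p + m - 1, by omega⟩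
    have hN : N + 1 = n + M := by omega
    rw [G.compDer_compDer_single_left hM hN hn0 hp hT hT' hR hR',
      sum_fin_split (p := p) (q := n - 1) (by omega) _ (X := avg O G.coordPar
        (G.plug (s + r) hN hn0 T (G.plug s hM hp R U))) _ hY, ← Nat.cast_smul_eq_nsmul k,
      ← Nat.cast_smul_eq_nsmul k, smul_add, smul_smul, smul_smul, map_add]
    intro l hl
    rw [plug_apply, plug_apply, map_sum]
    simp only [map_sum]
    rw [Finset.sum_comm]
    refine Finset.sum_congr rfl fun b _ => Finset.sum_congr rfl fun c _ => ?_
    rw [G.avg_ecomp_ecomp_inner h₁ h₂ rfl b c (l := ⟨0, hN₁⟩) (l' := l) hp hl T hR',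
      ecomp_assoc h₁ h₂ hM hN (i := ⟨0, hn0⟩) (j := ⟨0, hp⟩) rfl rfl rfl, add_comm r s]

/-- Two parallel pluggings commute up to the Koszul sign, and the symmetry of `T` exchanges the two
inputs used. -/
theorem avg_doublePlug_swap {s r : ZMod 2} {n m p N₁ N₂ N : ℕ} (hn : 2 ≤ n)
    (h₁ : N₁ + 1 = n + p) (h₂ : N + 1 = N₁ + m) (h₃ : N₂ + 1 = n + m) (h₄ : N + 1 = N₂ + p)
    {T : Tens O ι n} (hT : InputInv O G.coordPar T)
    {R : Tens O ι p} (hR : IsHomT O G.coordPar r R) {U : Tens O ι m} (hU : IsHomT O G.coordPar s U) :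
    avg O G.coordPar (G.doublePlug r s h₁ h₂ hn T R U) =
      sgn k (s * r) • avg O G.coordPar (G.doublePlug s r h₃ h₄ hn T U R) := by
  simp only [doublePlug, map_sum, Finset.smul_sum]
  rw [Finset.sum_comm]
  refine Finset.sum_congr rfl fun b _ => Finset.sum_congr rfl fun c _ => ?_
  rw [ecomp_comm h₁ h₂ h₃ h₄ (i := ⟨0, by omega⟩) (l := ⟨1, by omega⟩) (i' := ⟨0, by omega⟩) rfl rfl rfl rfl rfl rfl T
    hR hU, map_smul, mul_comm r s]
  congr 1
  set σ : Equiv.Perm (Fin (n + 1)) :=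
    extendLast (Equiv.swap ⟨0, by omega⟩ ⟨1, by omega⟩) with hσ
  have hσ0 : σ (Fin.castSucc ⟨0, by omega⟩) = Fin.castSucc ⟨1, by omega⟩ := by
    rw [hσ, extendLast_castSucc, Equiv.swap_apply_left]
  have hσ1 : σ (Fin.castSucc ⟨1, by omega⟩) = Fin.castSucc ⟨0, by omega⟩ := by
    rw [hσ, extendLast_castSucc, Equiv.swap_apply_right]
  obtain ⟨ρ, H⟩ := exists_isPlug h₃ ⟨0, by omega⟩ ⟨1, by omega⟩ σ
    (1 : Equiv.Perm (Fin (m + 1))) hσ0 rfl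
  have e := ecomp_equivariant O G.coordPar s H c c T U
  rw [tact_one, hT] at e
  rw [e]
  refine avg_ecomp_tact_left h₄ (H.last (extendLast_last _)) ?_ b b _ R
  have h5 := H.outer _ (show Fin.castSucc (⟨1, by omega⟩ : Fin n) ≠ _ from by
    rw [ne_eq, Fin.ext_iff]; simp)
  rw [hσ1] at h5
  have h6 : oIdx h₃ ⟨0, by omega⟩ (Fin.castSucc (⟨1, by omega⟩ : Fin n)) =
      Fin.castSucc ⟨m, by omega⟩ := Fin.ext (by simp [oIdx, outerSlot])
  have h7 : oIdx h₃ ⟨1, by omega⟩ (Fin.castSucc (⟨0, by omega⟩ : Fin n)) =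
      Fin.castSucc ⟨0, by omega⟩ := Fin.ext (by simp [oIdx, outerSlot])
  rwa [h6, h7] at h5

theorem associator_single_symm [CharZero k] {s r t : ZMod 2} {n m p : ℕ}
    {T : Tens O ι n} (hT : IsHomT O G.coordPar t T) (hT' : InputInv O G.coordPar T)
    {R : Tens O ι p} (hR : IsHomT O G.coordPar r R) (hR' : InputInv O G.coordPar R)
    {U : Tens O ι m} (hU : IsHomT O G.coordPar s U) (hU' : InputInv O G.coordPar U) :
    G.compDer O s (t + r) (single O m U) (G.compDer O r t (single O p R) (single O n T)) -
      G.compDer O (s + r) t (G.compDer O s r (single O m U) (single O p R)) (single O n T) =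
    sgn k (s * r) •
      (G.compDer O r (t + s) (single O p R) (G.compDer O s t (single O m U) (single O n T)) -
      G.compDer O (r + s) t (G.compDer O r s (single O p R) (single O m U)) (single O n T)) := by
  rcases lt_or_ge n 2 with hn | hn
  · rw [G.associator_of_lt_two hn hT hT' hR hR', G.associator_of_lt_two hn hT hT' hU hU', sub_self,
      sub_self, smul_zero]
  · rw [G.associator_of_two_le (N₁ := n + p - 1) (N := n + p + m - 2) hn (by omega) (by omega)
        hT hT' hR hR',
      G.associator_of_two_le (N₁ := n + m - 1) (N := n + p + m - 2) hn (by omega) (by omega)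
        hT hT' hU hU', add_sub_cancel_left, add_sub_cancel_left,
      G.avg_doublePlug_swap (N₂ := n + m - 1) hn _ _ (by omega) (by omega) hT' hR hU, ← map_smul (single O _),
      smul_comm (sgn k _)]

end GramData
end CyclicOperadCE

namespace CyclicOperadCE
namespace GramData

variable {k : Type u} [Field k] {O : CyclicDGOperad.{u, v} k} {ι : Type*} [Fintype ι]
  (G : GramData k ι)

/-! ## The Lie superalgebra of derivations -/

theorem projDer_projDer (s t : ZMod 2) (D : Coeffs O ι) :
    G.projDer O s (G.projDer O t D) = if s = t then G.projDer O t D else 0 :=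
  (G.derSpace O (0 : Coeffs O ι)).proj_proj s t D

theorem projDer_of_hom {s t : ZMod 2} {D : Coeffs O ι} (hD : G.projDer O t D = D) :
    G.projDer O s D = if s = t then D else 0 := by
  rw [← hD, projDer_projDer, hD]

theorem projDer_self (t : ZMod 2) (D : Coeffs O ι) :
    G.projDer O t (G.projDer O t D) = G.projDer O t D := by rw [projDer_projDer, if_pos rfl]

theorem projDer_total (D : Coeffs O ι) : G.projDer O 0 D + G.projDer O 1 D = D := by
  funext n a K
  change O.proj n (0 + G.coordPar a + G.wordPar K) (D n a K) +
    O.proj n (1 + G.coordPar a + G.wordPar K) (D n a K) = D n a K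
  rw [add_assoc, add_assoc, zero_add]
  have e : (1 : ZMod 2) + 1 = 0 := rfl
  rcases zmod_two_cases (G.coordPar a + G.wordPar K) with h | h
  · rw [h, add_zero, O.proj_total]
  · rw [h, e, add_comm, O.proj_total]

theorem projDer_compDer {s t : ZMod 2} {D E : Coeffs O ι} (hD : G.projDer O s D = D)
    (hE : G.projDer O t E = E) :
    G.projDer O (s + t) (G.compDer O s t D E) = G.compDer O s t D E := by
  refine G.projDer_of_isHomT fun N => ?_
  rw [G.tens_compDer D hE, add_comm s t]
  exact (IsHomT.sum _ fun r _ => IsHomT.sum _ fun l _ => IsHomT.sum _ fun b _ =>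
    (G.isHomT_tens hE _).ecomp (G.isHomT_tens hD _) _ _ rfl).avg

theorem compDer_mem_der {s t : ZMod 2} (D : Coeffs O ι) {E : Coeffs O ι}
    (hE : G.projDer O t E = E) : G.compDer O s t D E ∈ G.der O := by
  rw [mem_der_iff]
  intro N
  rw [G.tens_compDer D hE]
  exact inputInv_avg _

theorem commutator_of_hom {s t : ZMod 2} {D E : Coeffs O ι} (hD : G.projDer O s D = D)
    (hE : G.projDer O t E = E) :
    G.commutator O D E = G.compDer O s t D E - sgn k (s * t) • G.compDer O t s E D := by
  rw [commutator_apply, Finset.sum_eq_single s, Finset.sum_eq_single t, hD, hE]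
  · intro t' _ ht'
    rw [G.projDer_of_hom hE, if_neg ht', map_zero, map_zero, LinearMap.zero_apply, smul_zero,
      sub_zero]
  · simp
  · intro s' _ hs'
    refine Finset.sum_eq_zero fun t' _ => ?_
    rw [G.projDer_of_hom hD, if_neg hs', map_zero, map_zero, LinearMap.zero_apply, smul_zero,
      sub_zero]
  · simp

theorem commutator_mem_der (D E : Coeffs O ι) : G.commutator O D E ∈ G.der O := by
  rw [commutator_apply]
  exact Submodule.sum_mem _ fun s _ => Submodule.sum_mem _ fun t _ => Submodule.sub_mem _
    (G.compDer_mem_der _ (G.projDer_self _ _))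
    (Submodule.smul_mem _ _ (G.compDer_mem_der _ (G.projDer_self _ _)))

theorem projDer_commutator {s t : ZMod 2} {D E : Coeffs O ι} (hD : G.projDer O s D = D)
    (hE : G.projDer O t E = E) :
    G.projDer O (s + t) (G.commutator O D E) = G.commutator O D E := by
  rw [G.commutator_of_hom hD hE, map_sub, map_smul, G.projDer_compDer hD hE]
  have := G.projDer_compDer hE hD
  rw [add_comm t s] at this
  rw [this]

theorem commutator_symm {s t : ZMod 2} {D E : Coeffs O ι} (hD : G.projDer O s D = D)
    (hE : G.projDer O t E = E) :
    G.commutator O E D = -(sgn k (s * t) • G.commutator O D E) := by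
  rw [G.commutator_of_hom hD hE, G.commutator_of_hom hE hD, smul_sub, smul_smul, sgn_mul_self,
    one_smul, neg_sub, mul_comm t s]

theorem tact_tens_projDer {t : ZMod 2} {n : ℕ} (σ : Equiv.Perm (Fin (n + 1))) {T U : Tens O ι n}
    (hU : ∀ K, U K = O.proj n (t + ∑ j, G.coordPar (K j)) (T K)) (K : Fin (n + 1) → ι) :
    tact O G.coordPar σ U K =
      O.proj n (t + ∑ j, G.coordPar (K j)) (tact O G.coordPar σ T K) := by
  rw [tact_apply, tact_apply, map_smul, O.proj_act, hU]
  rw [Equiv.sum_comp σ fun j => G.coordPar (K j)]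

theorem tens_projDer_sum (t : ZMod 2) (D : Coeffs O ι) (n : ℕ) (K : Fin (n + 1) → ι) :
    tens n (G.projDer O t D) K = O.proj n (t + ∑ j, G.coordPar (K j)) (tens n D K) := by
  rw [tens_projDer, Fin.sum_univ_castSucc, wordPar, add_assoc, add_comm (G.coordPar _)]

theorem projDer_mem_der (t : ZMod 2) {D : Coeffs O ι} (hD : D ∈ G.der O) :
    G.projDer O t D ∈ G.der O := by
  rw [mem_der_iff] at hD ⊢
  intro n σ
  funext K
  rw [G.tact_tens_projDer _ (G.tens_projDer_sum t D n), hD, tens_projDer_sum]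

/-- Continuity reduces trilinear identities to derivations with one component. Each composition can
lower the arity by one, through the insertion of constants, whence the shift by two. -/
theorem trilinear_eq_zero {Φ : Coeffs O ι → Coeffs O ι → Coeffs O ι → Coeffs O ι}
    (h₁ : ∀ E F, IsLinearMap k fun D => Φ D E F) (h₂ : ∀ D F, IsLinearMap k fun E => Φ D E F)
    (h₃ : ∀ D E, IsLinearMap k fun F => Φ D E F)
    (hΦ : ∀ M D E F, D ∈ fil ι O (M + 2) ∨ E ∈ fil ι O (M + 2) ∨ F ∈ fil ι O (M + 2) →
      Φ D E F ∈ fil ι O M) {D E F : Coeffs O ι}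
    (h : ∀ m p n, Φ (single O m (tens m D)) (single O p (tens p E)) (single O n (tens n F)) = 0) :
    Φ D E F = 0 :=
  map_eq_zero_of_single (c := 2) (fil ι O) eq_zero_of_forall_mem_fil (f := (h₁ E F).mk')
    (fun M D hD => hΦ M D E F (Or.inl hD)) fun m =>
  map_eq_zero_of_single (c := 2) (fil ι O) eq_zero_of_forall_mem_fil (f := (h₂ _ F).mk')
    (fun M E hE => hΦ M _ E F (Or.inr (Or.inl hE))) fun p =>
  map_eq_zero_of_single (c := 2) (fil ι O) eq_zero_of_forall_mem_fil (f := (h₃ _ _).mk')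
    (fun M F hF => hΦ M _ _ F (Or.inr (Or.inr hF))) fun n => h m p n

/-- The associator of the composition of derivations of parities `s`, `r`, `t`. -/
noncomputable def associator (s r t : ZMod 2) (D E F : Coeffs O ι) : Coeffs O ι :=
  G.compDer O s (t + r) D (G.compDer O r t E F) - G.compDer O (s + r) t (G.compDer O s r D E) F

theorem associator_mem_fil (s r t : ZMod 2) (M : ℕ) (D E F : Coeffs O ι)
    (h : D ∈ fil ι O (M + 2) ∨ E ∈ fil ι O (M + 2) ∨ F ∈ fil ι O (M + 2)) :
    G.associator s r t D E F ∈ fil ι O M := by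
  have hanti : ∀ {D : Coeffs O ι}, D ∈ fil ι O (M + 2) → D ∈ fil ι O (M + 1) :=
    fun {D} h => (G.derSpace O (0 : Coeffs O ι)).fil_anti _ h
  refine Submodule.sub_mem _ (G.compDer_fil O _ _ _ _ _ ?_) (G.compDer_fil O _ _ _ _ _ ?_)
  · rcases h with h | h | h
    · exact Or.inl (hanti h)
    · exact Or.inr (G.compDer_fil O _ _ _ _ _ (Or.inl h))
    · exact Or.inr (G.compDer_fil O _ _ _ _ _ (Or.inr h))
  · rcases h with h | h | h
    · exact Or.inl (G.compDer_fil O _ _ _ _ _ (Or.inl h))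
    · exact Or.inl (G.compDer_fil O _ _ _ _ _ (Or.inr h))
    · exact Or.inr (hanti h)

theorem isLinearMap_associator₁ (s r t : ZMod 2) (E F : Coeffs O ι) :
    IsLinearMap k fun D => G.associator s r t D E F := by
  constructor
  · intro D D'
    simp only [associator, map_add, LinearMap.add_apply]
    abel
  · intro c D
    simp only [associator, map_smul, LinearMap.smul_apply, smul_sub]

theorem isLinearMap_associator₂ (s r t : ZMod 2) (D F : Coeffs O ι) :
    IsLinearMap k fun E => G.associator s r t D E F := by
  constructor
  · intro D D'
    simp only [associator, map_add, LinearMap.add_apply]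
    abel
  · intro c D
    simp only [associator, map_smul, LinearMap.smul_apply, smul_sub]

theorem isLinearMap_associator₃ (s r t : ZMod 2) (D E : Coeffs O ι) :
    IsLinearMap k fun F => G.associator s r t D E F := by
  constructor
  · intro D D'
    simp only [associator, map_add]
    abel
  · intro c D
    simp only [associator, map_smul, smul_sub]

theorem isLinearMap_sub_smul {X Y : Type*} [AddCommGroup X] [Module k X] [AddCommGroup Y]
    [Module k Y] {f g : X → Y} (hf : IsLinearMap k f) (hg : IsLinearMap k g) (c : k) :
    IsLinearMap k fun x => f x - c • g x :=
  (hf.mk' - c • hg.mk').isLinear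

/-- The associator of the composition of derivations is symmetric. -/
theorem associator_symm [CharZero k] {s r t : ZMod 2} {D E F : Coeffs O ι}
    (hD : G.projDer O s D = D) (hE : G.projDer O r E = E) (hF : G.projDer O t F = F)
    (hD' : D ∈ G.der O) (hE' : E ∈ G.der O) (hF' : F ∈ G.der O) :
    G.associator s r t D E F = sgn k (s * r) • G.associator r s t E D F := by
  rw [mem_der_iff] at hD' hE' hF'
  rw [← sub_eq_zero]
  exact trilinear_eq_zero
    (Φ := fun D E F => G.associator s r t D E F - sgn k (s * r) • G.associator r s t E D F)
    (fun E F => isLinearMap_sub_smul (G.isLinearMap_associator₁ s r t E F)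
      (G.isLinearMap_associator₂ r s t E F) _)
    (fun D F => isLinearMap_sub_smul (G.isLinearMap_associator₂ s r t D F)
      (G.isLinearMap_associator₁ r s t D F) _)
    (fun D E => isLinearMap_sub_smul (G.isLinearMap_associator₃ s r t D E)
      (G.isLinearMap_associator₃ r s t E D) _)
    (fun M D E F h => Submodule.sub_mem _ (G.associator_mem_fil s r t M D E F h)
      (Submodule.smul_mem _ _ (G.associator_mem_fil r s t M E D F (or_left_comm.1 h))))
    fun m p n => sub_eq_zero.2 (G.associator_single_symm (G.isHomT_tens hF n) (hF' n)
      (G.isHomT_tens hE p) (hE' p) (G.isHomT_tens hD m) (hD' m))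

theorem sgn_eq_or (s : ZMod 2) : sgn k s = 1 ∨ sgn k s = -1 := by
  rcases zmod_two_cases s with rfl | rfl
  · exact Or.inl (sgn_zero k)
  · exact Or.inr (sgn_one k)

/-- In the Jacobi expression the products of three derivations combine into differences of
associators, which vanish by `associator_symm` applied to each of the three pairs. Invariance under
the inputs is essential, because the associator was computed by symmetrizing. -/
theorem commutator_jacobi [CharZero k] {s r t : ZMod 2} {D E F : Coeffs O ι}
    (hD : G.projDer O s D = D) (hE : G.projDer O r E = E) (hF : G.projDer O t F = F)
    (hD' : D ∈ G.der O) (hE' : E ∈ G.der O) (hF' : F ∈ G.der O) :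
    G.commutator O D (G.commutator O E F) = G.commutator O (G.commutator O D E) F +
      sgn k (s * r) • G.commutator O E (G.commutator O D F) := by
  have h1 := G.associator_symm hD hE hF hD' hE' hF'
  have h2 := G.associator_symm hD hF hE hD' hF' hE'
  have h3 := G.associator_symm hE hF hD hE' hF' hD'
  unfold associator at h1 h2 h3
  rw [G.commutator_of_hom hD (G.projDer_commutator hE hF),
    G.commutator_of_hom (G.projDer_commutator hD hE) hF,
    G.commutator_of_hom hE (G.projDer_commutator hD hF),
    G.commutator_of_hom hE hF, G.commutator_of_hom hD hE, G.commutator_of_hom hD hF]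
  simp only [map_sub, map_smul, LinearMap.sub_apply, LinearMap.smul_apply, mul_add, add_mul, sgn_add]
  simp only [add_comm r s, add_comm t s, add_comm t r, mul_comm r s, mul_comm t s, mul_comm t r]
    at h1 h2 h3 ⊢
  -- With the three signs fixed, the identity is linear in the associators.
  rcases sgn_eq_or (k := k) (s * r) with ha | ha <;>
  rcases sgn_eq_or (k := k) (s * t) with hb | hb <;>
  rcases sgn_eq_or (k := k) (r * t) with hc | hc <;>
  · rw [ha] at h1
    rw [hb] at h2
    rw [hc] at h3
    rw [ha, hb, hc]
    simp only [one_smul, neg_smul, mul_one, mul_neg, neg_neg] at h1 h2 h3 ⊢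
    rw [sub_eq_iff_eq_add] at h1 h2 h3
    rw [h1, h2, h3]
    abel

/-! ## The differential -/

theorem d_ecomp (s : ZMod 2) {n m N : ℕ} (h : N + 1 = n + m) (i : Fin n) (b b' : ι)
    (T : Tens O ι n) (U : Tens O ι m) (K : Fin (N + 1) → ι) :
    O.d N (ecomp O G.coordPar s h i b b' T U K) =
      sgn k s • ecomp O G.coordPar s h i b b' (fun K => O.d n (T K)) U K +
        ecomp O G.coordPar (s + 1) h i b b' T (fun K => O.d m (U K)) K := by
  have hd : ∀ x y, O.d N (O.comp h i x y) =
      O.comp h i (O.d n x) y + O.comp h i (O.signOp n 1 x) (O.d m y) := by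
    intro x y
    have : (O.comp h i).compr₂ (O.d N) = (O.comp h i).comp (O.d n) +
        (O.comp h i).compl₁₂ (O.signOp n 1) (O.d m) := O.ext_hom fun t x hx => by
      ext y
      simp only [LinearMap.compr₂_apply, LinearMap.add_apply, LinearMap.comp_apply,
        LinearMap.compl₁₂_apply, O.d_comp h i t x y hx, O.signOp_of_mem 1 hx, one_mul, map_smul,
        LinearMap.smul_apply]
    exact LinearMap.congr_fun₂ this x y
  simp only [ecomp_apply, map_smul, hd, O.signOp_d, LinearMap.smul_apply, O.signOp_signOp]
  rw [smul_add, smul_comm, add_comm 1 s]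

theorem dDer_avg {N : ℕ} (T : Tens O ι N) (K : Fin (N + 1) → ι) :
    O.d N (avg O G.coordPar T K) = avg O G.coordPar (fun K => O.d N (T K)) K := by
  simp only [avg_eq, Pi.smul_apply, Finset.sum_apply, map_smul, map_sum, tact_apply, O.act_d]

theorem tens_dDer (D : Coeffs O ι) (n : ℕ) (K : Fin (n + 1) → ι) :
    tens n (dDer O D) K = O.d n (tens n D K) := rfl

theorem projDer_dDer {t : ZMod 2} {D : Coeffs O ι} (hD : G.projDer O t D = D) :
    G.projDer O (t + 1) (dDer O D) = dDer O D := by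
  refine G.projDer_of_isHomT fun n K => ?_
  rw [tens_dDer, add_right_comm]
  exact O.d_mem _ _ _ (G.isHomT_tens hD n K)

theorem dDer_mem_der {D : Coeffs O ι} (hD : D ∈ G.der O) : dDer O D ∈ G.der O := by
  rw [mem_der_iff] at hD ⊢
  intro n σ
  funext K
  rw [tens_dDer, ← hD n σ, tact_apply, tact_apply, map_smul, ← O.act_d]
  rfl

theorem dDer_compDer {s t : ZMod 2} (D : Coeffs O ι) {E : Coeffs O ι} (hE : G.projDer O t E = E) :
    dDer O (G.compDer O s t D E) =
      G.compDer O (s + 1) t (dDer O D) E + sgn k s • G.compDer O s (t + 1) D (dDer O E) := by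
  refine coeffs_ext fun N => ?_
  rw [map_add, map_smul, G.tens_compDer _ hE, G.tens_compDer _ (G.projDer_dDer hE), ← map_smul,
    ← map_add]
  funext K
  rw [tens_dDer, G.tens_compDer _ hE, G.dDer_avg]
  refine congrFun (congrArg _ ?_) K
  funext K
  simp only [Finset.sum_apply, map_sum, Pi.add_apply, Pi.smul_apply, G.d_ecomp,
    Finset.sum_add_distrib, Finset.smul_sum]
  rw [add_comm]
  rfl

theorem dDer_commutator {s t : ZMod 2} {D E : Coeffs O ι} (hD : G.projDer O s D = D)
    (hE : G.projDer O t E = E) :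
    dDer O (G.commutator O D E) =
      G.commutator O (dDer O D) E + sgn k s • G.commutator O D (dDer O E) := by
  rw [G.commutator_of_hom hD hE, G.commutator_of_hom (G.projDer_dDer hD) hE,
    G.commutator_of_hom hD (G.projDer_dDer hE), map_sub, map_smul, G.dDer_compDer D hE,
    G.dDer_compDer E hD]
  simp only [mul_add, add_mul, one_mul, mul_one, sgn_add]
  have h1 := sgn_mul_self k s
  have h2 := sgn_mul_self k t
  have h3 : sgn k s * (sgn k (s * t) * sgn k s) = sgn k (s * t) := by
    rw [mul_comm (sgn k (s * t)), ← mul_assoc, h1, one_mul]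
  simp only [smul_sub, smul_add, smul_smul, h3]
  abel

theorem dDer_dDer (D : Coeffs O ι) : dDer O (dDer O D) = 0 := by
  funext n a K
  exact O.d_d n _

/-! ## The axioms of a dg Lie algebra -/

variable {G}

theorem isSuper_derSpace {ξ : Coeffs O ι} (hξ : G.projDer O 1 ξ = ξ) : (G.derSpace O ξ).IsSuper where
  total := G.projDer_total
  d_odd q x hx := by
    change G.projDer O (q + 1) (dDer O x + G.commutator O ξ x) = dDer O x + G.commutator O ξ x
    rw [map_add, G.projDer_dDer hx, add_comm q 1, G.projDer_commutator hξ hx]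
  br_even q r x y hx hy := G.projDer_commutator hx hy
  br_symm q r x y hx hy := G.commutator_symm hx hy

/-- Translates the Leibniz rule from the bracket to the odd bracket $Q_2$; the extra factor $(-1)^s$
is the sign of `f` passing $Q_2$. -/
theorem isDerOn_of_bracket {ξ : Coeffs O ι} {K : Submodule k (Coeffs O ι)} {s : ZMod 2}
    {f : Coeffs O ι →ₗ[k] Coeffs O ι} (hf : ∀ q D, G.projDer O q D = D → G.projDer O (q + s) (f D) = f D)
    (h : ∀ q r D E, D ∈ K → E ∈ K → G.projDer O q D = D → G.projDer O r E = E →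
      f (G.commutator O D E) = G.commutator O (f D) E + sgn k (s * q) • G.commutator O D (f E)) :
    (G.derSpace O ξ).IsDerOn K s f := by
  intro p q x y hx hy hx' hy'
  rw [FormalSpace.shiftBr_of_hom hx', FormalSpace.shiftBr_of_hom hx',
    FormalSpace.shiftBr_of_hom (hf _ _ hx'), map_smul]
  change sgn k (p + 1) • f (G.commutator O x y) = sgn k s • (sgn k (p + 1 + s) • G.commutator O (f x) y +
    sgn k (s * p) • sgn k (p + 1) • G.commutator O x (f y))
  rw [h _ _ x y hx hy hx' hy', smul_add, smul_add, smul_smul, smul_smul, smul_smul, smul_smul,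
    ← sgn_add, ← sgn_add, ← sgn_add, ← sgn_add]
  have h1 : ∀ p s : ZMod 2, p + 1 = s + (p + 1 + s) := by decide
  have h2 : ∀ p s : ZMod 2, p + 1 + s * (p + 1) = s + s * p + (p + 1) := by decide
  rw [← h1, ← h2]

theorem isLieOn_der [CharZero k] {ξ : Coeffs O ι} (hξ : G.projDer O 1 ξ = ξ) (hξ' : ξ ∈ G.der O)
    (hMC : dDer O ξ + (2 : k)⁻¹ • G.commutator O ξ ξ = 0) :
    (G.derSpace O ξ).IsLieOn (G.der O) where
  proj_mem s x hx := G.projDer_mem_der s hx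
  d_mem x hx := Submodule.add_mem _ (G.dDer_mem_der hx) (G.commutator_mem_der _ _)
  br_mem x _ y _ := G.commutator_mem_der x y
  d_d := by
    have h : ∀ q x, x ∈ G.der O → G.projDer O q x = x →
        (G.derSpace O ξ).d ((G.derSpace O ξ).d x) = 0 := by
      intro q x hx hx'
      change dDer O (dDer O x + G.commutator O ξ x) +
        G.commutator O ξ (dDer O x + G.commutator O ξ x) = 0
      have hJ := G.commutator_jacobi hξ hξ hx' hξ' hξ' hx
      have h1 : sgn k ((1 : ZMod 2) * 1) = -1 := by rw [mul_one, sgn_one]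
      have hd := G.dDer_commutator hξ hx'
      rw [sgn_one] at hd
      -- The Jacobi identity for $\xi,\xi,x$ with $\xi$ odd reads $2[\xi,[\xi,x]]=[[\xi,\xi],x]$.
      -- Together with $[d\xi,x]$ this vanishes by the Maurer–Cartan equation.
      rw [h1, neg_smul, one_smul, ← sub_eq_add_neg, eq_sub_iff_add_eq, ← two_smul k] at hJ
      have hJ' : G.commutator O ξ (G.commutator O ξ x) =
          (2 : k)⁻¹ • G.commutator O (G.commutator O ξ ξ) x := by
        rw [← hJ, smul_smul, inv_mul_cancel₀ two_ne_zero, one_smul]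
      have h0 : G.commutator O (dDer O ξ) x + (2 : k)⁻¹ • G.commutator O (G.commutator O ξ ξ) x = 0 := by
        rw [← LinearMap.smul_apply, ← map_smul, ← LinearMap.add_apply, ← map_add, hMC, map_zero,
          LinearMap.zero_apply]
      rw [map_add, map_add, dDer_dDer, hd, hJ', zero_add, neg_smul, one_smul]
      rw [← h0]
      abel
    intro x hx
    have := h 0 _ (G.projDer_mem_der 0 hx) (G.projDer_self 0 x)
    have h' := h 1 _ (G.projDer_mem_der 1 hx) (G.projDer_self 1 x)
    rw [← G.projDer_total x, map_add, map_add, this, h', add_zero]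
  d_der := isDerOn_of_bracket (isSuper_derSpace hξ).d_odd fun q r D E hD hE hD' hE' => by
    change dDer O (G.commutator O D E) + G.commutator O ξ (G.commutator O D E) =
      G.commutator O (dDer O D + G.commutator O ξ D) E +
        sgn k (1 * q) • G.commutator O D (dDer O E + G.commutator O ξ E)
    rw [G.dDer_commutator hD' hE', G.commutator_jacobi hξ hD' hE' hξ' hD hE, map_add, map_add,
      LinearMap.add_apply, smul_add, one_mul]
    abel
  br_der p x hx hx' := isDerOn_of_bracket
    (FormalSpace.isHom_shiftBr (isSuper_derSpace hξ) hx') fun q r D E hD hE hD' hE' => by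
    rw [FormalSpace.shiftBr_of_hom hx', FormalSpace.shiftBr_of_hom hx',
      FormalSpace.shiftBr_of_hom hx']
    change sgn k (p + 1) • G.commutator O x (G.commutator O D E) = G.commutator O
      (sgn k (p + 1) • G.commutator O x D) E +
      sgn k ((p + 1) * q) • G.commutator O D (sgn k (p + 1) • G.commutator O x E)
    rw [G.commutator_jacobi hx' hD' hE' hx hD hE, map_smul, map_smul, LinearMap.smul_apply, smul_add,
      smul_comm (sgn k (p + 1))]

end GramData
end CyclicOperadCE

/-! ### Cyclic invariance as invariance under all slots -/

namespace CyclicOperadCE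

section

variable {k : Type u} [Field k] {O : CyclicDGOperad.{u, v} k} {ι : Type*} {q : ι → ZMod 2}

/-! ## Full symmetrization -/

variable (O q) in
/-- The tensor is invariant under the permutations of all slots. -/
def FullInv {n : ℕ} (T : Tens O ι n) : Prop :=
  ∀ σ : Equiv.Perm (Fin (n + 1)), tact O q σ T = T

theorem FullInv.inputInv {n : ℕ} {T : Tens O ι n} (hT : FullInv O q T) : InputInv O q T :=
  fun σ => hT _

theorem FullInv.smul {n : ℕ} {T : Tens O ι n} (hT : FullInv O q T) (c : k) :
    FullInv O q (c • T) := fun σ => by rw [map_smul, hT]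

theorem fullInv_zero {n : ℕ} : FullInv O q (0 : Tens O ι n) := fun σ => map_zero _

theorem fullInv_sum_tact {n : ℕ} (T : Tens O ι n) : FullInv O q (∑ σ, tact O q σ T) := by
  intro σ
  rw [map_sum]
  simp only [← tact_mul]
  exact Equiv.sum_comp (Equiv.mulLeft σ) fun τ => tact O q τ T

theorem avg_tact_eq_swap {n : ℕ} {g : Equiv.Perm (Fin (n + 1))} {x : Fin (n + 1)}
    (hg : g x = Fin.last n) (T : Tens O ι n) :
    avg O q (tact O q g T) = avg O q (tact O q (Equiv.swap x (Fin.last n)) T) := by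
  have h1 : g = g * Equiv.swap x (Fin.last n) * Equiv.swap x (Fin.last n) := by
    rw [mul_assoc, Equiv.swap_mul_self, mul_one]
  conv_lhs => rw [h1, tact_mul]
  exact avg_tact (by rw [Equiv.Perm.mul_apply, Equiv.swap_apply_right, hg]) _

/-- A permutation of all slots amounts to the choice of the slot that becomes the output, followed
by a permutation of the inputs. This relates cyclic symmetrization to the averages occurring in
compositions. -/
theorem sum_tact_eq_sum_avg [CharZero k] {n : ℕ} (T : Tens O ι n) :
    (n.factorial : k)⁻¹ • ∑ σ, tact O q σ T =
      ∑ x, avg O q (tact O q (Equiv.swap x (Fin.last n)) T) := by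
  rw [sum_perm_eq_sum_cosets (Fin.last n) extendLast extendLast_injective extendLast_last
    (fun x => Equiv.swap x (Fin.last n)) (fun x => Equiv.swap_apply_left _ _), Finset.smul_sum]
  refine Finset.sum_congr rfl fun x _ => ?_
  rw [avg_eq]
  simp only [tact_mul]

/-! ## Operations on the last letter -/

variable [Fintype ι] (A : ι → ι → k)

/-- The action of a matrix on the last letter. -/
def lastMul (n : ℕ) : Tens O ι n →ₗ[k] Tens O ι n where
  toFun T K := ∑ a, A a (K (Fin.last n)) • T (Function.update K (Fin.last n) a)
  map_add' T U := by funext K; simp [Finset.sum_add_distrib]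
  map_smul' c T := by funext K; simp [Finset.smul_sum, smul_comm c]

theorem lastMul_apply (n : ℕ) (T : Tens O ι n) (K : Fin (n + 1) → ι) :
    lastMul A n T K = ∑ a, A a (K (Fin.last n)) • T (Function.update K (Fin.last n) a) := rfl

theorem lastMul_lastMul [DecidableEq ι] (B : ι → ι → k)
    (h : ∀ a b, ∑ c, A a c * B c b = if a = b then 1 else 0) (n : ℕ) (T : Tens O ι n) :
    lastMul B n (lastMul A n T) = T := by
  funext K
  simp only [lastMul_apply, Function.update_self, Function.update_idem, Finset.smul_sum, smul_smul]
  rw [Finset.sum_comm]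
  simp only [← Finset.sum_smul]
  have h' : ∀ a, ∑ c, B c (K (Fin.last n)) * A a c = if a = K (Fin.last n) then 1 else 0 :=
    fun a => by rw [← h]; exact Finset.sum_congr rfl fun c _ => mul_comm _ _
  simp only [h', ite_smul, one_smul, zero_smul, Finset.sum_ite_eq', Finset.mem_univ, if_true,
    Function.update_eq_self]

variable {A}

theorem tact_lastMul (hA : ∀ a b, A a b ≠ 0 → q a = q b) {n : ℕ} {ρ : Equiv.Perm (Fin (n + 1))}
    (hρ : ρ (Fin.last n) = Fin.last n) (T : Tens O ι n) :
    tact O q ρ (lastMul A n T) = lastMul A n (tact O q ρ T) := by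
  funext K
  rw [tact_apply, lastMul_apply, lastMul_apply, map_sum, Finset.smul_sum, hρ]
  refine Finset.sum_congr rfl fun a _ => ?_
  by_cases ha : A a (K (Fin.last n)) = 0
  · rw [ha, zero_smul, zero_smul, map_zero, smul_zero]
  · have h1 : (fun j => Function.update K (Fin.last n) a (ρ j)) =
        Function.update (fun j => K (ρ j)) (Fin.last n) a := by
      funext j
      by_cases hj : j = Fin.last n
      · subst hj
        rw [hρ, Function.update_self, Function.update_self]
      · rw [Function.update_of_ne hj, Function.update_of_ne]
        intro h
        exact hj (ρ.injective (h.trans hρ.symm))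
    have h2 : (fun j => q (Function.update K (Fin.last n) a (ρ j))) = fun j => q (K (ρ j)) := by
      funext j
      by_cases hj : ρ j = Fin.last n
      · rw [hj, Function.update_self, hA _ _ ha]
      · rw [Function.update_of_ne hj]
    rw [tact_apply, h1, h2, map_smul, smul_comm]

theorem avg_lastMul (hA : ∀ a b, A a b ≠ 0 → q a = q b) {n : ℕ} (T : Tens O ι n) :
    avg O q (lastMul A n T) = lastMul A n (avg O q T) := by
  rw [avg_eq, avg_eq, map_smul, map_sum]
  congr 1
  exact Finset.sum_congr rfl fun σ _ => tact_lastMul hA (extendLast_last σ) T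

theorem InputInv.lastMul (hA : ∀ a b, A a b ≠ 0 → q a = q b) {n : ℕ} {T : Tens O ι n}
    (hT : InputInv O q T) : InputInv O q (lastMul A n T) := fun σ => by
  rw [tact_lastMul hA (extendLast_last σ), hT]

theorem IsHomT.lastMul (hA : ∀ a b, A a b ≠ 0 → q a = q b) {n : ℕ} {t : ZMod 2} {T : Tens O ι n}
    (hT : IsHomT O q t T) : IsHomT O q t (lastMul A n T) := by
  intro K
  rw [lastMul_apply]
  refine Submodule.sum_mem _ fun a _ => ?_
  by_cases ha : A a (K (Fin.last n)) = 0
  · rw [ha, zero_smul]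
    exact Submodule.zero_mem _
  · have := hT (Function.update K (Fin.last n) a)
    have h2 : ∀ j, q (Function.update K (Fin.last n) a j) = q (K j) := by
      intro j
      by_cases hj : j = Fin.last n
      · rw [hj, Function.update_self, hA _ _ ha]
      · rw [Function.update_of_ne hj]
    simp only [h2] at this
    exact Submodule.smul_mem _ _ this

theorem iIdx_ne_last {n m N : ℕ} (h : N + 1 = n + m) (i : Fin n) {u : Fin (m + 1)}
    (hu : u ≠ Fin.last m) : iIdx h i u ≠ Fin.last N := by
  rw [← oIdx_last h i]
  exact ((iIdx_lt_oIdx h i (Fin.castSucc_lt_last i).ne' hu).2 (Fin.castSucc_lt_last i)).ne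

theorem oIdx_ne_last {n m N : ℕ} (h : N + 1 = n + m) (i : Fin n) {j : Fin (n + 1)}
    (hj : j ≠ i.castSucc) (hj' : j ≠ Fin.last n) : oIdx h i j ≠ Fin.last N := by
  rw [← oIdx_last h i]
  exact ((oIdx_lt_oIdx h i hj (Fin.castSucc_lt_last i).ne').2 (Fin.lt_last_iff_ne_last.2 hj')).ne

theorem lastMul_ecomp {s : ZMod 2} {n m N : ℕ} (h : N + 1 = n + m) (i : Fin n) (b b' : ι)
    (T : Tens O ι n) (U : Tens O ι m) :
    lastMul A N (ecomp O q s h i b b' T U) = ecomp O q s h i b b' (lastMul A n T) U := by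
  funext K
  have h1 : ∀ a, ow h i b (Function.update K (Fin.last N) a) =
      Function.update (ow h i b K) (Fin.last n) a := by
    intro a
    funext j
    by_cases hj : j = i.castSucc
    · have : j ≠ Fin.last n := by rw [hj]; exact (Fin.castSucc_lt_last i).ne
      rw [Function.update_of_ne this, ow, if_pos hj, ow, if_pos hj]
    · by_cases hj' : j = Fin.last n
      · rw [hj', Function.update_self, ow, if_neg (Fin.castSucc_lt_last i).ne', oIdx_last,
          Function.update_self]
      · rw [Function.update_of_ne hj', ow, if_neg hj, ow, if_neg hj,
          Function.update_of_ne (oIdx_ne_last h i hj hj')]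
  have h2 : ∀ a, iw h i b' (Function.update K (Fin.last N) a) = iw h i b' K := by
    intro a
    funext u
    by_cases hu : u = Fin.last m
    · rw [iw, if_pos hu, iw, if_pos hu]
    · rw [iw, if_neg hu, iw, if_neg hu, Function.update_of_ne (iIdx_ne_last h i hu)]
  have h3 : ∀ a, compExp q h i b (Function.update K (Fin.last N) a) = compExp q h i b K := by
    intro a
    unfold compExp
    congr 1
    · congr 1
      refine Finset.sum_congr rfl fun u _ => ?_
      by_cases hu : u = Fin.last m
      · rw [if_pos hu, if_pos hu]
      · rw [if_neg hu, if_neg hu, Function.update_of_ne (iIdx_ne_last h i hu)]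
    · refine Finset.sum_congr rfl fun j _ => ?_
      by_cases hj : j < i.castSucc
      · rw [if_pos hj, if_pos hj, Function.update_of_ne (oIdx_ne_last h i hj.ne
          (hj.trans (Fin.castSucc_lt_last i)).ne)]
      · rw [if_neg hj, if_neg hj]
  have h4 : ow h i b K (Fin.last n) = K (Fin.last N) := by
    rw [ow, if_neg (Fin.castSucc_lt_last i).ne', oIdx_last]
  simp only [lastMul_apply, ecomp_apply, h1, h2, h3, h4, map_sum, LinearMap.sum_apply,
    Finset.smul_sum, map_smul, LinearMap.smul_apply]
  refine Finset.sum_congr rfl fun a _ => ?_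
  rw [smul_comm]

theorem ecomp_lastMul {s : ZMod 2} {n m N : ℕ} (h : N + 1 = n + m) (i : Fin n) (b b₀ : ι)
    (T : Tens O ι n) (U : Tens O ι m) :
    ecomp O q s h i b b₀ T (lastMul A m U) = ∑ b', A b' b₀ • ecomp O q s h i b b' T U := by
  funext K
  have h1 : ∀ b', Function.update (iw h i b₀ K) (Fin.last m) b' = iw h i b' K := by
    intro b'
    funext u
    by_cases hu : u = Fin.last m
    · rw [hu, Function.update_self, iw, if_pos rfl]
    · rw [Function.update_of_ne hu, iw, if_neg hu, iw, if_neg hu]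
  have h2 : iw h i b₀ K (Fin.last m) = b₀ := by rw [iw, if_pos rfl]
  simp only [ecomp_apply, lastMul_apply, h1, h2, map_sum, map_smul, Finset.smul_sum,
    Finset.sum_apply, Pi.smul_apply]
  exact Finset.sum_congr rfl fun b' _ => smul_comm _ _ _

end

namespace GramData

variable {k : Type u} [Field k] {O : CyclicDGOperad.{u, v} k} {ι : Type*} [Fintype ι]
  [DecidableEq ι] {G : GramData k ι} {P : ι → ι → k}

/-! ## Contraction with the inverse inner product -/

/-- `P` is the inverse of an even graded-symmetric Gram matrix. -/
structure IsInverse (G : GramData k ι) (P : ι → ι → k) : Prop where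
  even : ∀ a b, G.gram a b ≠ 0 → G.par a = G.par b
  symm : ∀ a b, G.gram a b = sgn k (G.par a * G.par b) * G.gram b a
  mul_inv : ∀ a b, ∑ c, G.gram a c * P c b = if a = b then 1 else 0
  inv_mul : ∀ a b, ∑ c, P a c * G.gram c b = if a = b then 1 else 0

namespace IsInverse

variable (hP : G.IsInverse P)

theorem inv_unique {f : ι → k} {b : ι} {c : k} (hP : G.IsInverse P)
    (h : ∀ a, ∑ x, G.gram a x * f x = if a = b then c else 0) (x : ι) : f x = P x b * c := by
  have h1 : ∑ a, P x a * ∑ y, G.gram a y * f y = f x := by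
    simp only [Finset.mul_sum, ← mul_assoc]
    rw [Finset.sum_comm]
    simp only [← Finset.sum_mul, hP.inv_mul, ite_mul, one_mul, zero_mul, Finset.sum_ite_eq,
      Finset.mem_univ, if_true]
  rw [← h1]
  simp only [h, mul_ite, mul_zero, Finset.sum_ite_eq', Finset.mem_univ, if_true]

/-- An even graded-symmetric Gram matrix differs from its transpose by a sign depending only on the
common parity of the two letters. Its inverse has the same property, by uniqueness of the inverse.
-/
theorem inv_symm (hP : G.IsInverse P) (a b : ι) : P a b = sgn k (G.par b) * P b a := by
  have h4 := hP.inv_unique (f := fun y => P b y) (b := b) (c := sgn k (G.par b)) ?_ a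
  · have h5 : P b a = P a b * sgn k (G.par b) := h4
    rw [h5, mul_comm, mul_assoc, sgn_mul_self, mul_one]
  · intro x
    have h2 : ∀ y, G.gram x y * P b y = sgn k (G.par x) * (P b y * G.gram y x) := by
      intro y
      by_cases hxy : G.gram x y = 0
      · have : G.gram y x = 0 := by rw [hP.symm, hxy, mul_zero]
        rw [hxy, this]
        ring
      · rw [hP.symm x y, ← hP.even _ _ hxy, zmod_two_mul_self]
        ring
    simp only [h2, ← Finset.mul_sum, hP.inv_mul]
    by_cases hx : x = b
    · rw [hx, if_pos rfl, if_pos rfl, mul_one]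
    · rw [if_neg hx, if_neg (Ne.symm hx), mul_zero]

/-- The part of `P` between letters of equal parity already satisfies the equations of an inverse of
the even Gram matrix, so it is all of `P`. -/
theorem inv_even (hP : G.IsInverse P) (a b : ι) (h : P a b ≠ 0) : G.par a = G.par b := by
  have h1 := hP.inv_unique (f := fun x => if G.par x = G.par b then P x b else 0) (b := b) (c := 1)
    (fun y => by
      by_cases hy : G.par y = G.par b
      · rw [← hP.mul_inv]
        refine Finset.sum_congr rfl fun x _ => ?_
        by_cases hx : G.par x = G.par b
        · rw [if_pos hx]
        · rw [if_neg hx, mul_zero]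
          by_cases h0 : G.gram y x = 0
          · rw [h0, zero_mul]
          · exact absurd ((hP.even _ _ h0).symm.trans hy) hx
      · rw [if_neg (fun h => hy (by rw [h]))]
        refine Finset.sum_eq_zero fun x _ => ?_
        by_cases hx : G.par x = G.par b
        · by_cases h0 : G.gram y x = 0
          · rw [h0, zero_mul]
          · exact absurd ((hP.even _ _ h0).trans hx) hy
        · rw [if_neg hx, mul_zero]) a
  by_contra hab
  rw [mul_one] at h1
  rw [if_neg hab] at h1
  exact h h1.symm

theorem gram_coordPar (hP : G.IsInverse P) (a b : ι) (h : G.gram a b ≠ 0) :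
    G.coordPar a = G.coordPar b := by rw [coordPar, coordPar, hP.even _ _ h]

theorem inv_coordPar (hP : G.IsInverse P) (a b : ι) (h : P a b ≠ 0) :
    G.coordPar a = G.coordPar b := by rw [coordPar, coordPar, hP.inv_even _ _ h]

theorem raise_lower (hP : G.IsInverse P) {n : ℕ} (T : Tens O ι n) :
    lastMul P n (lastMul G.gram n T) = T := lastMul_lastMul _ _ hP.mul_inv n T

theorem lower_raise (hP : G.IsInverse P) {n : ℕ} (T : Tens O ι n) :
    lastMul G.gram n (lastMul P n T) = T := lastMul_lastMul _ _ hP.inv_mul n T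

end IsInverse

theorem lower_eq (D : Coeffs O ι) (n : ℕ) (K : Fin (n + 1) → ι) :
    G.lower O D n K = lastMul G.gram n (tens n D) K := by
  rw [lower, lastMul_apply]
  refine Finset.sum_congr rfl fun a _ => ?_
  rw [tens_apply, Function.update_self]
  congr 2
  funext j
  rw [Function.update_of_ne (Fin.castSucc_lt_last j).ne]

/-- Invariance of the lowered tensor under all slots implies `InputInv` for the derivation itself:
raising the output back commutes with the permutations of the inputs. -/
theorem mem_cDer_iff (hP : G.IsInverse P) (D : Coeffs O ι) :
    D ∈ G.cDer O ↔ ∀ n, FullInv O G.coordPar (lastMul G.gram n (tens n D)) := by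
  have hl : ∀ n, G.lower O D n = lastMul G.gram n (tens n D) := fun n => funext (G.lower_eq D n)
  constructor
  · rintro ⟨-, h⟩ n σ
    funext K
    rw [tact_apply, ← hl]
    exact h n K σ
  · intro h
    refine ⟨(G.mem_der_iff D).2 fun n => ?_, fun n K σ => ?_⟩
    · have := (h n).inputInv.lastMul hP.inv_coordPar
      rwa [hP.raise_lower] at this
    · rw [hl]
      exact congrFun (h n σ) K

variable (G P) in
/-- The partial composition of tensors with all slots on equal footing. -/
noncomputable def contract (s : ZMod 2) {n m N : ℕ} (h : N + 1 = n + m) (hn : 0 < n)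
    (T : Tens O ι n) (U : Tens O ι m) : Tens O ι N :=
  ∑ b, ∑ b', P b' b • ecomp O G.coordPar s h ⟨0, hn⟩ b b' T U

theorem lower_plug {s : ZMod 2} {n m N : ℕ} (h : N + 1 = n + m) (hn : 0 < n)
    (T : Tens O ι n) (U : Tens O ι m) :
    lastMul G.gram N (G.plug s h hn T (lastMul P m U)) =
      G.contract P s h hn (lastMul G.gram n T) U := by
  rw [plug_apply, map_sum]
  refine Finset.sum_congr rfl fun b _ => ?_
  rw [lastMul_ecomp, ecomp_lastMul]

/-- Declaring another free slot of `T` to be the output is a permutation of the slots of `T` alone,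
and `T` is invariant. -/
theorem avg_tact_contract_outer {s : ZMod 2} {n m N : ℕ} (h : N + 1 = n + m) (hn : 0 < n)
    {T : Tens O ι n} (hT : FullInv O G.coordPar T) (U : Tens O ι m) {j : Fin (n + 1)}
    (hj : j ≠ Fin.castSucc ⟨0, hn⟩) :
    avg O G.coordPar (tact O G.coordPar (Equiv.swap (oIdx h ⟨0, hn⟩ j) (Fin.last N))
      (G.contract P s h hn T U)) = avg O G.coordPar (G.contract P s h hn T U) := by
  obtain ⟨ρ, H⟩ := exists_isPlug h ⟨0, hn⟩ ⟨0, hn⟩ (Equiv.swap j (Fin.last n))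
    (1 : Equiv.Perm (Fin (m + 1)))
    (Equiv.swap_apply_of_ne_of_ne hj.symm (Fin.castSucc_lt_last _).ne) rfl
  have hρ : ρ (oIdx h ⟨0, hn⟩ j) = Fin.last N := by
    rw [H.outer j hj, Equiv.swap_apply_left, oIdx_last]
  rw [← avg_tact_eq_swap hρ]
  congr 1
  simp only [contract, map_sum, map_smul]
  refine Finset.sum_congr rfl fun b _ => Finset.sum_congr rfl fun b' _ => ?_
  rw [← ecomp_equivariant O G.coordPar s H, hT, tact_one]

/-- If the output is to be a slot of `U`, then `U` becomes the outer factor and `T` is plugged into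
it. This produces the second term of the commutator. -/
theorem avg_tact_contract_inner (hP : G.IsInverse P) {s t : ZMod 2} {n m N : ℕ} (h : N + 1 = n + m)
    (h' : N + 1 = m + n) (hn : 0 < n) (hm : 0 < m)
    {T : Tens O ι n} (hT : FullInv O G.coordPar T) (hT' : IsHomT O G.coordPar t T)
    {U : Tens O ι m} (hU : FullInv O G.coordPar U) (hU' : IsHomT O G.coordPar s U)
    {u : Fin (m + 1)} (hu : u ≠ Fin.last m) :
    avg O G.coordPar (tact O G.coordPar (Equiv.swap (iIdx h ⟨0, hn⟩ u) (Fin.last N))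
      (G.contract P s h hn T U)) =
      -(sgn k (s * t) • avg O G.coordPar (G.contract P t h' hm U T)) := by
  set z : Fin (m + 1) := Fin.castSucc ⟨0, hm⟩ with hz
  have hzl : z ≠ Fin.last m := (Fin.castSucc_lt_last _).ne
  have hτ : (Equiv.swap z (Fin.last m) * Equiv.swap z u) (Fin.last m) = z := by
    rw [Equiv.Perm.mul_apply, Equiv.swap_apply_of_ne_of_ne hzl.symm hu.symm, Equiv.swap_apply_right]
  have hτu : (Equiv.swap z (Fin.last m) * Equiv.swap z u) u = Fin.last m := by
    rw [Equiv.Perm.mul_apply, Equiv.swap_apply_right, Equiv.swap_apply_left]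
  obtain ⟨ρ, H⟩ := exists_isSwapPlug h ⟨0, hn⟩ h' ⟨0, hm⟩
    (Equiv.swap (Fin.castSucc ⟨0, hn⟩) (Fin.last n)) _ (Equiv.swap_apply_left _ _) hτ
  have hρ : ρ (iIdx h ⟨0, hn⟩ u) = Fin.last N := by rw [H.inner u hu, hτu, oIdx_last]
  rw [← avg_tact_eq_swap hρ, ← map_smul, ← map_neg]
  congr 1
  simp only [contract, map_sum, map_smul, Finset.smul_sum, ← Finset.sum_neg_distrib]
  rw [Finset.sum_comm]
  refine Finset.sum_congr rfl fun b' _ => Finset.sum_congr rfl fun b _ => ?_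
  by_cases hb : P b' b = 0
  · have hb' : P b b' = 0 := by rw [hP.inv_symm, hb, mul_zero]
    rw [hb, hb', zero_smul, zero_smul, smul_zero, neg_zero]
  · have hq := hP.inv_coordPar _ _ hb
    have e := ecomp_swap H hq.symm hT' hU'
    rw [hT, hU] at e
    have e2 : tact O G.coordPar ρ (ecomp O G.coordPar s h ⟨0, hn⟩ b b' T U) =
        sgn k (s * t + G.coordPar b) • ecomp O G.coordPar t h' ⟨0, hm⟩ b' b U T := by
      rw [e, smul_smul, sgn_mul_self, one_smul]
    rw [e2, smul_smul, smul_smul, ← neg_smul]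
    congr 1
    -- Exchanging the factors gives $(-1)^{st+|b|+1}$, as coordinates have the parity opposite to
    -- vectors; the symmetry of `P` gives $(-1)^{|b|}$. What remains is $-(-1)^{st}$.
    rw [hP.inv_symm b' b, coordPar, sgn_add, sgn_add, sgn_one]
    have := sgn_mul_self k (G.par b)
    linear_combination (-(P b b' * sgn k (s * t))) * this

/-- The composite has `n` free slots from `T`, its output included, and `m` from `U`; each class
contributes one of the two composites. The tensor `Y` stands for the exchanged contraction, which
exists only for `m > 0`; otherwise its coefficient is zero. -/
theorem sum_tact_contract [CharZero k] (hP : G.IsInverse P) {s t : ZMod 2} {n m N : ℕ}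
    (h : N + 1 = n + m) (hn : 0 < n)
    {T : Tens O ι n} (hT : FullInv O G.coordPar T) (hT' : IsHomT O G.coordPar t T)
    {U : Tens O ι m} (hU : FullInv O G.coordPar U) (hU' : IsHomT O G.coordPar s U)
    {Y : Tens O ι N}
    (hY : ∀ (h' : N + 1 = m + n) (hm : 0 < m), Y = avg O G.coordPar (G.contract P t h' hm U T)) :
    (N.factorial : k)⁻¹ • ∑ σ, tact O G.coordPar σ (G.contract P s h hn T U) =
      (n : k) • avg O G.coordPar (G.contract P s h hn T U) -
        sgn k (s * t) • (m : k) • Y := by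
  rw [sum_tact_eq_sum_avg, sum_slots h ⟨0, hn⟩]
  have h1 : ∀ j : Fin (n + 1), (if j = Fin.castSucc ⟨0, hn⟩ then (0 : Tens O ι N) else
      avg O G.coordPar (tact O G.coordPar (Equiv.swap (oIdx h ⟨0, hn⟩ j) (Fin.last N))
      (G.contract P s h hn T U))) = avg O G.coordPar (G.contract P s h hn T U) -
        if j = Fin.castSucc ⟨0, hn⟩ then avg O G.coordPar (G.contract P s h hn T U) else 0 := by
    intro j
    by_cases hj : j = Fin.castSucc ⟨0, hn⟩
    · rw [if_pos hj, if_pos hj, sub_self]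
    · rw [if_neg hj, if_neg hj, sub_zero, avg_tact_contract_outer h hn hT U hj]
  have h2 : ∀ u : Fin (m + 1), (if u = Fin.last m then (0 : Tens O ι N) else
      avg O G.coordPar (tact O G.coordPar (Equiv.swap (iIdx h ⟨0, hn⟩ u) (Fin.last N))
      (G.contract P s h hn T U))) = (if u = Fin.last m then sgn k (s * t) • Y else 0) -
        sgn k (s * t) • Y := by
    intro u
    by_cases hu : u = Fin.last m
    · rw [if_pos hu, if_pos hu, sub_self]
    · have hm : 0 < m := by
        rcases Nat.eq_zero_or_pos m with rfl | hm
        · exact absurd (Subsingleton.elim (α := Fin 1) u (Fin.last 0)) hu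
        · exact hm
      rw [if_neg hu, if_neg hu, zero_sub, hY (by omega) hm,
        avg_tact_contract_inner hP h (by omega) hn hm hT hT' hU hU' hu]
  simp only [h1, h2, Finset.sum_sub_distrib, Finset.sum_ite_eq', Finset.mem_univ, if_true,
    Finset.sum_const, Finset.card_univ, Fintype.card_fin, ← Nat.cast_smul_eq_nsmul k]
  push_cast
  module

end GramData
end CyclicOperadCE

namespace CyclicOperadCE

/-! ## Cyclic derivations form a Lie subalgebra -/

section

variable {k : Type u} [Field k] {O : CyclicDGOperad.{u, v} k} {ι : Type*} [Fintype ι]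

/-- A continuous map sends a derivation to a closed subspace if it does so with the components. -/
theorem map_mem_of_single {C : Submodule k (Coeffs O ι)}
    (hC : ∀ y, (∀ M, ∃ c ∈ C, y - c ∈ GramData.fil ι O M) → y ∈ C) {c : ℕ}
    {f : Coeffs O ι →ₗ[k] Coeffs O ι}
    (hf : ∀ M D, D ∈ GramData.fil ι O (M + c) → f D ∈ GramData.fil ι O M) {D : Coeffs O ι}
    (h : ∀ n, f (single O n (tens n D)) ∈ C) : f D ∈ C := by
  refine hC _ fun M => ⟨∑ n ∈ Finset.range (M + c), f (single O n (tens n D)),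
    Submodule.sum_mem _ fun n _ => h n, ?_⟩
  rw [← map_sum, ← map_sub]
  refine hf M _ ((mem_fil_iff _ _).2 fun n hn => ?_)
  rw [map_sub, map_sum, Finset.sum_eq_single n, tens_single_self, sub_self]
  · intro m _ hm
    exact tens_single_of_ne hm.symm _
  · intro hn'
    exact absurd (Finset.mem_range.2 hn) hn'

theorem tens_eq_of_sub_mem_fil {y c : Coeffs O ι} {n : ℕ}
    (h : y - c ∈ GramData.fil ι O (n + 1)) : tens n y = tens n c := by
  rw [← sub_eq_zero, ← map_sub]
  exact (mem_fil_iff _ _).1 h n (Nat.lt_succ_self n)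

end

namespace GramData

variable {k : Type u} [Field k] {O : CyclicDGOperad.{u, v} k} {ι : Type*} [Fintype ι]
  [DecidableEq ι] {G : GramData k ι} {P : ι → ι → k}

theorem cDer_closed (hP : G.IsInverse P) (y : Coeffs O ι)
    (h : ∀ M, ∃ c ∈ G.cDer O, y - c ∈ GramData.fil ι O M) : y ∈ G.cDer O := by
  rw [mem_cDer_iff hP]
  intro n
  obtain ⟨c, hc, hyc⟩ := h (n + 1)
  rw [tens_eq_of_sub_mem_fil hyc]
  exact (mem_cDer_iff hP c).1 hc n

theorem single_mem_cDer (hP : G.IsInverse P) {n : ℕ} {T : Tens O ι n}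
    (hT : FullInv O G.coordPar (lastMul G.gram n T)) : single O n T ∈ G.cDer O := by
  rw [mem_cDer_iff hP]
  intro m
  by_cases hm : m = n
  · subst hm
    rwa [tens_single_self]
  · rw [tens_single_of_ne hm, map_zero]
    exact fullInv_zero

theorem lower_compDer_single [CharZero k] (hP : G.IsInverse P) {n m N : ℕ} (h : N + 1 = n + m)
    (hn : 0 < n) (s : ZMod 2) (T : Tens O ι n) (U : Tens O ι m) :
    lastMul G.gram N ((n : k) • avg O G.coordPar (G.plug s h hn T U)) =
      (n : k) • avg O G.coordPar (G.contract P s h hn (lastMul G.gram n T) (lastMul G.gram m U)) := by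
  rw [map_smul, ← avg_lastMul hP.gram_coordPar, ← lower_plug, hP.raise_lower]

/-- The lowered commutator is a multiple of the sum of the contraction over all permutations of the
slots, hence invariant. For `m = 0` the second composite vanishes on both sides of this comparison.
-/
theorem commutator_single_mem_cDer [CharZero k] (hP : G.IsInverse P) {s t : ZMod 2} {n m : ℕ}
    (hn : 0 < n) {T : Tens O ι n} {U : Tens O ι m}
    (hT : FullInv O G.coordPar (lastMul G.gram n T)) (hT' : IsHomT O G.coordPar t T)
    (hU : FullInv O G.coordPar (lastMul G.gram m U)) (hU' : IsHomT O G.coordPar s U) :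
    G.commutator O (single O m U) (single O n T) ∈ G.cDer O := by
  have hTi : InputInv O G.coordPar T := by
    have := hT.inputInv.lastMul hP.inv_coordPar
    rwa [hP.raise_lower] at this
  have hUi : InputInv O G.coordPar U := by
    have := hU.inputInv.lastMul hP.inv_coordPar
    rwa [hP.raise_lower] at this
  obtain ⟨N, h⟩ : ∃ N, N + 1 = n + m := ⟨n + m - 1, by omega⟩
  rw [G.commutator_of_hom (G.projDer_single hU') (G.projDer_single hT'),
    G.compDer_single h hn hT' hTi U]
  have hTl := hT'.lastMul hP.gram_coordPar
  have hUl := hU'.lastMul hP.gram_coordPar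
  rcases Nat.eq_zero_or_pos m with rfl | hm
  · rw [G.compDer_single_zero _ hU', smul_zero, sub_zero]
    refine single_mem_cDer hP ?_
    rw [lower_compDer_single hP]
    have e := sum_tact_contract hP h hn hT hTl hU hUl (Y := 0) (fun _ hm => absurd hm (by omega))
    rw [Nat.cast_zero, zero_smul, smul_zero, sub_zero] at e
    rw [← e]
    exact (fullInv_sum_tact _).smul _
  · have h' : N + 1 = m + n := by omega
    rw [G.compDer_single h' hm hU' hUi T, ← map_smul (single O N) (sgn k _), ← map_sub]
    refine single_mem_cDer hP ?_
    rw [map_sub, map_smul (lastMul G.gram N) (sgn k _), lower_compDer_single hP, lower_compDer_single hP,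
      ← sum_tact_contract hP h hn hT hTl hU hUl (fun _ _ => rfl)]
    exact (fullInv_sum_tact _).smul _

theorem commutator_mem_cDer_of_hom [CharZero k] (hP : G.IsInverse P) {s t : ZMod 2}
    {D E : Coeffs O ι} (hD : G.projDer O s D = D) (hE : G.projDer O t E = E)
    (hD' : D ∈ G.cDer O) (hE' : E ∈ G.cDer O) : G.commutator O D E ∈ G.cDer O := by
  rw [mem_cDer_iff hP] at hD' hE'
  refine map_mem_of_single (c := 1) (cDer_closed hP) (f := (G.commutator O).flip E)
    (fun M D hD => G.commutator_fil O M D E (Or.inl hD)) fun m => ?_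
  refine map_mem_of_single (c := 1) (cDer_closed hP) (f := G.commutator O (single O m (tens m D)))
    (fun M E hE => G.commutator_fil O M _ E (Or.inr hE)) fun n => ?_
  have hT := G.isHomT_tens hE n
  have hU := G.isHomT_tens hD m
  rcases Nat.eq_zero_or_pos n with rfl | hn
  · rcases Nat.eq_zero_or_pos m with rfl | hm
    · rw [G.commutator_of_hom (G.projDer_single hU) (G.projDer_single hT),
        G.compDer_single_zero _ hU, G.compDer_single_zero _ hT, smul_zero, sub_zero]
      exact Submodule.zero_mem _
    · rw [G.commutator_symm (G.projDer_single hT) (G.projDer_single hU)]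
      exact Submodule.neg_mem _ (Submodule.smul_mem _ _
        (commutator_single_mem_cDer hP hm (hD' m) hU (hE' 0) hT))
  · exact commutator_single_mem_cDer hP hn (hE' n) hT (hD' m) hU

theorem lower_projDer (hP : G.IsInverse P) (t : ZMod 2) (D : Coeffs O ι) (n : ℕ)
    (K : Fin (n + 1) → ι) :
    lastMul G.gram n (tens n (G.projDer O t D)) K =
      O.proj n (t + ∑ j, G.coordPar (K j)) (lastMul G.gram n (tens n D) K) := by
  rw [lastMul_apply, lastMul_apply, map_sum]
  refine Finset.sum_congr rfl fun a _ => ?_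
  by_cases ha : G.gram a (K (Fin.last n)) = 0
  · rw [ha, zero_smul, zero_smul, map_zero]
  · rw [map_smul, tens_projDer_sum]
    congr 3
    congr 1
    refine Finset.sum_congr rfl fun j _ => ?_
    by_cases hj : j = Fin.last n
    · rw [hj, Function.update_self, hP.gram_coordPar _ _ ha]
    · rw [Function.update_of_ne hj]

theorem projDer_mem_cDer (hP : G.IsInverse P) (t : ZMod 2) {D : Coeffs O ι} (hD : D ∈ G.cDer O) :
    G.projDer O t D ∈ G.cDer O := by
  rw [mem_cDer_iff hP] at hD ⊢
  intro n σ
  funext K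
  rw [G.tact_tens_projDer _ (lower_projDer hP t D n), hD, lower_projDer hP]

theorem dDer_mem_cDer (hP : G.IsInverse P) {D : Coeffs O ι} (hD : D ∈ G.cDer O) :
    dDer O D ∈ G.cDer O := by
  rw [mem_cDer_iff hP] at hD ⊢
  have h1 : ∀ n K, lastMul G.gram n (tens n (dDer O D)) K =
      O.d n (lastMul G.gram n (tens n D) K) := fun n K => by
    simp only [lastMul_apply, map_sum, map_smul, tens_dDer]
  intro n σ
  funext K
  rw [tact_apply, h1, h1, O.act_d, ← map_smul, ← tact_apply, hD]

theorem bilin_mem_of_hom {C K K' : Submodule k (Coeffs O ι)}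
    {f : Coeffs O ι →ₗ[k] Coeffs O ι →ₗ[k] Coeffs O ι}
    (hK : ∀ s x, x ∈ K → G.projDer O s x ∈ K) (hK' : ∀ s x, x ∈ K' → G.projDer O s x ∈ K')
    (h : ∀ s t D E, D ∈ K → E ∈ K' → G.projDer O s D = D → G.projDer O t E = E → f D E ∈ C)
    {D E : Coeffs O ι} (hD : D ∈ K) (hE : E ∈ K') : f D E ∈ C := by
  rw [← G.projDer_total D, ← G.projDer_total E]
  simp only [map_add, LinearMap.add_apply]
  have h' : ∀ s t, f (G.projDer O s D) (G.projDer O t E) ∈ C := fun s t =>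
    h s t _ _ (hK s D hD) (hK' t E hE) (G.projDer_self _ _) (G.projDer_self _ _)
  exact Submodule.add_mem _ (Submodule.add_mem _ (h' _ _) (h' _ _))
    (Submodule.add_mem _ (h' _ _) (h' _ _))

theorem commutator_mem_cDer [CharZero k] (hP : G.IsInverse P) {D E : Coeffs O ι}
    (hD : D ∈ G.cDer O) (hE : E ∈ G.cDer O) : G.commutator O D E ∈ G.cDer O :=
  bilin_mem_of_hom (fun s _ => projDer_mem_cDer hP s) (fun s _ => projDer_mem_cDer hP s)
    (fun _ _ _ _ hD hE hD' hE' => commutator_mem_cDer_of_hom hP hD' hE' hD hE) hD hE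

end GramData

/-! ## Derivations with at least two letters of positive weight -/

section Heavy

variable {k : Type u} [Field k] {O : CyclicDGOperad.{u, v} k} {ι : Type*} {q : ι → ZMod 2}
  (w : ι → ℕ)

/-- The tensor is supported on the words of total weight at least two. -/
def IsHeavy {n : ℕ} (T : Tens O ι n) : Prop := ∀ K, ∑ j, w (K j) < 2 → T K = 0

variable {w}

theorem IsHeavy.smul {n : ℕ} {T : Tens O ι n} (hT : IsHeavy w T) (c : k) : IsHeavy w (c • T) :=
  fun K hK => by rw [Pi.smul_apply, hT K hK, smul_zero]

theorem IsHeavy.add {n : ℕ} {T U : Tens O ι n} (hT : IsHeavy w T) (hU : IsHeavy w U) :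
    IsHeavy w (T + U) :=
  fun K hK => by rw [Pi.add_apply, hT K hK, hU K hK, add_zero]

theorem IsHeavy.sum {α : Type*} {s : Finset α} {n : ℕ} {T : α → Tens O ι n}
    (hT : ∀ a ∈ s, IsHeavy w (T a)) : IsHeavy w (∑ a ∈ s, T a) := fun K hK => by
  rw [Finset.sum_apply]
  exact Finset.sum_eq_zero fun a ha => hT a ha K hK

theorem IsHeavy.tact {n : ℕ} {T : Tens O ι n} (hT : IsHeavy w T) (σ : Equiv.Perm (Fin (n + 1))) :
    IsHeavy w (tact O q σ T) := fun K hK => by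
  rw [tact_apply, hT, map_zero, smul_zero]
  rwa [Equiv.sum_comp σ fun j => w (K j)]

theorem IsHeavy.avg {n : ℕ} {T : Tens O ι n} (hT : IsHeavy w T) : IsHeavy w (avg O q T) := by
  rw [avg_eq]
  exact (IsHeavy.sum fun σ _ => hT.tact _).smul _

theorem IsHeavy.lastMul [Fintype ι] {A : ι → ι → k} (hA : ∀ a b, A a b ≠ 0 → w a = w b) {n : ℕ}
    {T : Tens O ι n} (hT : IsHeavy w T) : IsHeavy w (lastMul A n T) := fun K hK => by
  rw [lastMul_apply]
  refine Finset.sum_eq_zero fun a _ => ?_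
  by_cases ha : A a (K (Fin.last n)) = 0
  · rw [ha, zero_smul]
  · rw [hT, smul_zero]
    refine lt_of_eq_of_lt (Finset.sum_congr rfl fun j _ => ?_) hK
    by_cases hj : j = Fin.last n
    · rw [hj, Function.update_self, hA _ _ ha]
    · rw [Function.update_of_ne hj]

theorem sum_weight_ow_iw {n m N : ℕ} (h : N + 1 = n + m) (i : Fin n) (b b' : ι)
    (K : Fin (N + 1) → ι) :
    (∑ j, w (ow h i b K j)) + ∑ u, w (iw h i b' K u) = (∑ x, w (K x)) + (w b + w b') := by
  have h1 : ∀ j, w (ow h i b K j) = (if j = i.castSucc then w b else 0) +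
      if j = i.castSucc then 0 else w (K (oIdx h i j)) := fun j => by
    unfold ow
    split_ifs <;> simp
  have h2 : ∀ j, w (iw h i b' K j) = (if j = Fin.last m then w b' else 0) +
      if j = Fin.last m then 0 else w (K (iIdx h i j)) := fun j => by
    unfold iw
    split_ifs <;> simp
  rw [sum_slots h i fun x => w (K x)]
  simp only [h1, h2, Finset.sum_add_distrib, Finset.sum_ite_eq', Finset.mem_univ, if_true]
  ring

/-- The words of the two factors have together the weight of the composite word plus that of the
contracted letters, at most $1+2$. So one of them has weight below two. -/
theorem IsHeavy.ecomp (hw : ∀ a, w a ≤ 1) {s : ZMod 2} {n m N : ℕ} {T : Tens O ι n}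
    {U : Tens O ι m} (hT : IsHeavy w T) (hU : IsHeavy w U) (h : N + 1 = n + m) (i : Fin n)
    (b b' : ι) : IsHeavy w (ecomp O q s h i b b' T U) := fun K hK => by
  have h1 := sum_weight_ow_iw (w := w) h i b b' K
  have h2 := hw b
  have h3 := hw b'
  rw [ecomp_apply]
  rcases lt_or_ge (∑ j, w (ow h i b K j)) 2 with h4 | h4
  · rw [hT _ h4, map_zero, map_zero, LinearMap.zero_apply, smul_zero]
  · rw [hU _ (by omega), map_zero, smul_zero]

end Heavy

namespace GramData

variable {k : Type u} [Field k] {O : CyclicDGOperad.{u, v} k} {ι : Type*} [Fintype ι]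
  [DecidableEq ι] {G : GramData k ι} {P : ι → ι → k}

variable (G O) in
/-- The cyclic derivations all of whose terms have total weight at least two. -/
noncomputable def heavyDer (w : ι → ℕ) : Submodule k (Coeffs O ι) where
  carrier := {D | D ∈ G.cDer O ∧ ∀ n, IsHeavy w (tens n D)}
  zero_mem' := ⟨Submodule.zero_mem _, fun _ _ _ => rfl⟩
  add_mem' := by
    rintro D E ⟨hD, hD'⟩ ⟨hE, hE'⟩
    exact ⟨Submodule.add_mem _ hD hE, fun n => by rw [map_add]; exact (hD' n).add (hE' n)⟩
  smul_mem' := by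
    rintro c D ⟨hD, hD'⟩
    exact ⟨Submodule.smul_mem _ c hD, fun n => by rw [map_smul]; exact (hD' n).smul c⟩

variable {w : ι → ℕ}

theorem projDer_mem_heavyDer (hP : G.IsInverse P) (t : ZMod 2) {D : Coeffs O ι}
    (hD : D ∈ G.heavyDer O w) : G.projDer O t D ∈ G.heavyDer O w :=
  ⟨projDer_mem_cDer hP t hD.1, fun n K hK => by rw [tens_projDer, hD.2 n K hK, map_zero]⟩

theorem isHeavy_compDer (hw : ∀ a, w a ≤ 1) {s t : ZMod 2} {D E : Coeffs O ι}
    (hE : G.projDer O t E = E) (hD' : ∀ n, IsHeavy w (tens n D))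
    (hE' : ∀ n, IsHeavy w (tens n E)) (N : ℕ) : IsHeavy w (tens N (G.compDer O s t D E)) := by
  rw [G.tens_compDer D hE]
  exact (IsHeavy.sum fun r _ => IsHeavy.sum fun l _ => IsHeavy.sum fun b _ =>
    (hE' _).ecomp hw (hD' _) _ _ _ _).avg

theorem commutator_mem_heavyDer [CharZero k] (hP : G.IsInverse P) (hw : ∀ a, w a ≤ 1)
    {D E : Coeffs O ι} (hD : D ∈ G.heavyDer O w) (hE : E ∈ G.heavyDer O w) :
    G.commutator O D E ∈ G.heavyDer O w := by
  refine bilin_mem_of_hom (fun s _ => projDer_mem_heavyDer hP s)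
    (fun s _ => projDer_mem_heavyDer hP s) (fun s t D E hD hE hD' hE' => ?_) hD hE
  refine ⟨commutator_mem_cDer hP hD.1 hE.1, fun n => ?_⟩
  rw [G.commutator_of_hom hD' hE', sub_eq_add_neg, ← neg_smul, map_add, map_smul]
  exact (isHeavy_compDer hw hE' hD.2 hE.2 n).add ((isHeavy_compDer hw hD' hE.2 hD.2 n).smul _)

theorem dDer_mem_heavyDer (hP : G.IsInverse P) {D : Coeffs O ι} (hD : D ∈ G.heavyDer O w) :
    dDer O D ∈ G.heavyDer O w :=
  ⟨dDer_mem_cDer hP hD.1, fun n K hK => by rw [tens_dDer, hD.2 n K hK, map_zero]⟩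

theorem isLieOn_heavyDer [CharZero k] (hP : G.IsInverse P) (hw : ∀ a, w a ≤ 1) {ξ : Coeffs O ι}
    (hξ : G.projDer O 1 ξ = ξ) (hξ' : ξ ∈ G.heavyDer O w)
    (hMC : dDer O ξ + (2 : k)⁻¹ • G.commutator O ξ ξ = 0) :
    (G.derSpace O ξ).IsLieOn (G.heavyDer O w) where
  proj_mem s x hx := projDer_mem_heavyDer hP s hx
  d_mem x hx := Submodule.add_mem _ (dDer_mem_heavyDer hP hx) (commutator_mem_heavyDer hP hw hξ' hx)
  br_mem x hx y hy := commutator_mem_heavyDer hP hw hx hy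
  d_d x hx := (isLieOn_der hξ hξ'.1.1 hMC).d_d x hx.1.1
  d_der p q x y hx hy := (isLieOn_der hξ hξ'.1.1 hMC).d_der p q x y hx.1.1 hy.1.1
  br_der p x hx hx' q r y z hy hz :=
    (isLieOn_der hξ hξ'.1.1 hMC).br_der p x hx.1.1 hx' q r y z hy.1.1 hz.1.1

end GramData
end CyclicOperadCE

/-! ### Insertion of a constant and its contraction by the multiplication -/

namespace CyclicOperadCE

section Homotopy

variable {k : Type u} [Field k] {O : CyclicDGOperad.{u, v} k} {ι : Type*} [DecidableEq ι]
  (q : ι → ZMod 2)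

/-! ## Insertion of a constant -/

/-- The tensor of arity zero with the coefficient `a` at the letter `c`. -/
def constTens (c : ι) (a : O.obj 0) : Tens O ι 0 := fun K => if K 0 = c then a else 0

/-- Insertion of the constant `a` in the first input, with the letter `c`. -/
noncomputable def insConst (c : ι) (a : O.obj 0) (n : ℕ) : Tens O ι (n + 1) →ₗ[k] Tens O ι n :=
  (ecomp O q 1 (n := n + 1) (m := 0) (N := n) rfl 0 c c).flip (constTens c a)

/-- The tensor of arity two with the coefficient `m` at the words `c b b` with `b` of positive
weight. -/
def multTens (w : ι → ℕ) (c : ι) (m : O.obj 2) : Tens O ι 2 := fun K =>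
  if K 0 = c ∧ 0 < w (K 1) ∧ K 1 = K 2 then m else 0

variable {q}

theorem isHomT_constTens {c : ι} (hc : q c = 1) {a : O.obj 0} (ha : a ∈ O.part 0 0) :
    IsHomT O q 1 (constTens c a) := by
  intro K
  rw [constTens]
  split_ifs with h
  · rw [Fin.sum_univ_one, h, hc]
    exact ha
  · exact Submodule.zero_mem _

theorem isHomT_multTens {w : ι → ℕ} {c : ι} (hc : q c = 1) {m : O.obj 2} (hm : m ∈ O.part 2 0) :
    IsHomT O q 1 (multTens w c m) := by
  intro K
  rw [multTens]
  split_ifs with h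
  · rw [Fin.sum_univ_three, h.1, h.2.2, hc, add_assoc, zmod_two_add_self]
    exact hm
  · exact Submodule.zero_mem _

theorem isHeavy_multTens {w : ι → ℕ} {c : ι} {m : O.obj 2} : IsHeavy w (multTens w c m) := by
  intro K hK
  rw [multTens, if_neg]
  rintro ⟨-, h1, h2⟩
  rw [Fin.sum_univ_three, ← h2] at hK
  omega

theorem ow_zero {n : ℕ} (c : ι) (K : Fin (n + 1) → ι) :
    ow (n := n + 1) (m := 0) (N := n) rfl 0 c K = (Fin.cons c K : Fin (n + 2) → ι) := by
  funext j
  induction j using Fin.cases with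
  | zero => exact if_pos rfl
  | succ j =>
    rw [Fin.cons_succ, ow, if_neg (show j.succ ≠ Fin.castSucc 0 from Fin.succ_ne_zero j)]
    congr 1

theorem insConst_apply (c : ι) (a : O.obj 0) {n : ℕ} (T : Tens O ι (n + 1)) (K : Fin (n + 1) → ι) :
    insConst q c a n T K = O.comp (n := n + 1) (m := 0) (N := n) rfl 0
      (O.signOp (n + 1) 1 (T (Fin.cons c K : Fin (n + 2) → ι))) a := by
  have h1 : iw (n := n + 1) (m := 0) (N := n) rfl 0 c K 0 = c := if_pos rfl
  rw [insConst, LinearMap.flip_apply, ecomp_apply, compExp_zero _ rfl, sgn_zero, one_smul, ow_zero,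
    constTens, if_pos h1]

theorem isPlug_extendFirst {n : ℕ} (ρ : Equiv.Perm (Fin (n + 1))) :
    IsPlug (n := n + 1) (m := 0) (N := n) rfl 0 0 (extendFirst ρ) 1 ρ where
  left := extendFirst_zero ρ
  right := rfl
  outer j hj := by
    obtain ⟨j, rfl⟩ := Fin.exists_succ_eq.2 (show j ≠ 0 from hj)
    have h : ∀ j : Fin (n + 1), oIdx (n := n + 1) (m := 0) (N := n) rfl 0 j.succ = j := fun j =>
      Fin.ext (by simp [oIdx, outerSlot])
    rw [h, extendFirst_succ, h]
  inner u hu := absurd (Subsingleton.elim (α := Fin 1) u (Fin.last 0)) hu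

/-- The constant occupies the first slot and has no inputs, so the permutations of the other slots
are carried over unchanged. -/
theorem insConst_tact (c : ι) (a : O.obj 0) {n : ℕ} (ρ : Equiv.Perm (Fin (n + 1)))
    (T : Tens O ι (n + 1)) :
    insConst q c a n (tact O q (extendFirst ρ) T) = tact O q ρ (insConst q c a n T) := by
  have := ecomp_equivariant O q 1 (isPlug_extendFirst ρ) c c T (constTens c a)
  rwa [tact_one] at this

theorem extendFirst_extendLast {n : ℕ} (σ : Equiv.Perm (Fin n)) :
    extendFirst (extendLast σ) (Fin.last (n + 1)) = Fin.last (n + 1) := by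
  rw [← Fin.succ_last, extendFirst_succ, extendLast_last]

theorem InputInv.insConst (c : ι) (a : O.obj 0) {n : ℕ} {T : Tens O ι (n + 1)}
    (hT : InputInv O q T) : InputInv O q (insConst q c a n T) := fun σ => by
  rw [← insConst_tact, hT.tact_eq (extendFirst_extendLast σ)]

theorem insConst_eq_zero (c : ι) (a : O.obj 0) {n : ℕ} {T : Tens O ι (n + 1)}
    {K : Fin (n + 1) → ι} (h : T (Fin.cons c K : Fin (n + 2) → ι) = 0) :
    insConst q c a n T K = 0 := by
  rw [insConst_apply, h, map_zero, map_zero, LinearMap.zero_apply]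

/-! ## The division by the weight -/

section Scale

variable (w : ι → ℕ)

/-- Multiplication of the coefficients by a function of the total weight. -/
def scale (f : ℕ → k) (n : ℕ) : Tens O ι n →ₗ[k] Tens O ι n where
  toFun T K := f (∑ j, w (K j)) • T K
  map_add' T U := by funext K; simp
  map_smul' c T := by funext K; simp [smul_comm c]

theorem scale_apply (f : ℕ → k) {n : ℕ} (T : Tens O ι n) (K : Fin (n + 1) → ι) :
    scale w f n T K = f (∑ j, w (K j)) • T K := rfl

theorem tact_scale (f : ℕ → k) {n : ℕ} (σ : Equiv.Perm (Fin (n + 1))) (T : Tens O ι n) :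
    tact O q σ (scale w f n T) = scale w f n (tact O q σ T) := by
  funext K
  rw [tact_apply, scale_apply, scale_apply, tact_apply, map_smul, smul_comm,
    Equiv.sum_comp σ fun j => w (K j)]

/-- The letter removed together with the constant has weight zero, so the total weight is preserved.
-/
theorem insConst_scale (f : ℕ → k) {c : ι} (hc : w c = 0) (a : O.obj 0) {n : ℕ}
    (T : Tens O ι (n + 1)) :
    insConst q c a n (scale w f (n + 1) T) = scale w f n (insConst q c a n T) := by
  funext K
  rw [insConst_apply, scale_apply, scale_apply, insConst_apply, Fin.sum_univ_succ, Fin.cons_zero, hc,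
    zero_add]
  simp only [Fin.cons_succ, map_smul, LinearMap.smul_apply]

variable {w}

theorem IsHeavy.scale (f : ℕ → k) {n : ℕ} {T : Tens O ι n} (hT : IsHeavy w T) :
    IsHeavy w (scale w f n T) := fun K hK => by rw [scale_apply, hT K hK, smul_zero]

theorem IsHomT.scale (f : ℕ → k) {n : ℕ} {t : ZMod 2} {T : Tens O ι n} (hT : IsHomT O q t T) :
    IsHomT O q t (scale w f n T) := fun K => Submodule.smul_mem _ _ (hT K)

end Scale

/-- Every one of the $n+1$ slots is moved to the first place by $n!$ permutations, so the weights of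
the first letters add up to $n!$ times the total weight. -/
theorem sum_tact_weight [CharZero k] {w : ι → ℕ} {n : ℕ} {T V : Tens O ι n} (hT : FullInv O q T)
    (hV : ∀ K, V K = (w (K 0) : k) • T K) (K : Fin (n + 1) → ι) :
    (∑ τ, tact O q τ V) K = ((n.factorial : k) * ((∑ j, w (K j) : ℕ) : k)) • T K := by
  have h1 : ∀ τ, tact O q τ V K = (w (K (τ 0)) : k) • T K := fun τ => by
    conv_rhs => rw [← hT τ]
    rw [tact_apply, tact_apply, hV, map_smul, smul_comm]
  rw [Finset.sum_apply, Finset.sum_congr rfl fun τ _ => h1 τ, ← Finset.sum_smul]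
  congr 1
  have h2 := sum_perm_inv_apply (fun j => (w (K j) : k)) (0 : Fin (n + 1))
  rw [← Equiv.sum_comp (Equiv.inv _)] at h2
  simp only [Equiv.inv_apply, inv_inv, nsmul_eq_mul, Nat.factorial_succ] at h2
  have h3 : ((n + 1 : ℕ) : k) ≠ 0 := by exact_mod_cast Nat.succ_ne_zero n
  apply mul_left_cancel₀ h3
  rw [h2]
  push_cast
  ring

end Homotopy
end CyclicOperadCE

namespace CyclicOperadCE
namespace GramData

/-! ## The contracting homotopy -/

variable {k : Type u} [Field k] {O : CyclicDGOperad.{u, v} k} {ι : Type*} [Fintype ι]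
  [DecidableEq ι] (G : GramData k ι) (w : ι → ℕ) (c : ι)

/-- Insertion in the first input of the product with the constant letter `c`. -/
noncomputable def insMult (m : O.obj 2) (n : ℕ) : Tens O ι (n + 1) →ₗ[k] Tens O ι (n + 2) :=
  (G.plug 1 (n := n + 1) (m := 2) (N := n + 2) rfl (Nat.succ_pos n)).flip (multTens w c m)

theorem insMult_apply (m : O.obj 2) (n : ℕ) (T : Tens O ι (n + 1)) :
    G.insMult w c m n T = ∑ b, ecomp O G.coordPar 1 (n := n + 1) (m := 2) (N := n + 2) rfl
      ⟨0, Nat.succ_pos n⟩ b b T (multTens w c m) := by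
  rw [insMult, LinearMap.flip_apply, plug_apply]

/-- The symmetrization of `insMult`, divided by the weight. -/
noncomputable def homotopy (m : O.obj 2) (n : ℕ) : Tens O ι (n + 1) →ₗ[k] Tens O ι (n + 2) :=
  scale w (fun N => (N : k)⁻¹) (n + 2) ∘ₗ
    ((((n + 2).factorial : k)⁻¹ • ∑ σ, tact O G.coordPar σ) ∘ₗ G.insMult w c m n)

theorem homotopy_apply (m : O.obj 2) (n : ℕ) (T : Tens O ι (n + 1)) :
    G.homotopy w c m n T = scale w (fun N => (N : k)⁻¹) (n + 2)
      (((n + 2).factorial : k)⁻¹ • ∑ σ, tact O G.coordPar σ (G.insMult w c m n T)) := by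
  simp [homotopy]

variable {G w c}

theorem fullInv_homotopy {m : O.obj 2} {n : ℕ} (T : Tens O ι (n + 1)) :
    FullInv O G.coordPar (G.homotopy w c m n T) := fun σ => by
  rw [homotopy_apply, tact_scale, map_smul, fullInv_sum_tact]

theorem isHeavy_homotopy (hw : ∀ a, w a ≤ 1) {m : O.obj 2} {n : ℕ} {T : Tens O ι (n + 1)}
    (hT : IsHeavy w T) : IsHeavy w (G.homotopy w c m n T) := by
  rw [homotopy_apply, insMult_apply]
  exact ((IsHeavy.sum fun σ _ => (IsHeavy.sum fun b _ =>
    hT.ecomp hw isHeavy_multTens _ _ _ _).tact _).smul _).scale _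

theorem isHomT_homotopy (hc : G.coordPar c = 1) {m : O.obj 2} (hm : m ∈ O.part 2 0) {n : ℕ}
    {t : ZMod 2} {T : Tens O ι (n + 1)} (hT : IsHomT O G.coordPar t T) :
    IsHomT O G.coordPar (t + 1) (G.homotopy w c m n T) := by
  rw [homotopy_apply, insMult_apply]
  exact ((IsHomT.sum _ fun σ _ => (IsHomT.sum _ fun b _ =>
    hT.ecomp (isHomT_multTens hc hm) _ _ rfl).tact _).smul _).scale _

/-- By associativity the constant may first be inserted into the multiplication, which then becomes
the identity. What is left of `multTens` is the indicator of a first letter of positive weight,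
equal to the weight since this is at most one. -/
theorem insConst_insMult (hw : ∀ a, w a ≤ 1) {m : O.obj 2} (hm : m ∈ O.part 2 0) {a : O.obj 0}
    (hma : O.comp (n := 2) (m := 0) (N := 1) rfl 0 m a = O.one) {n : ℕ} (T : Tens O ι (n + 1))
    (K : Fin (n + 2) → ι) :
    insConst G.coordPar c a (n + 1) (G.insMult w c m n T) K = (w (K 0) : k) • T K := by
  have h1 : ∀ L : Fin 2 → ι, insConst G.coordPar c a 1 (multTens w c m) L =
      if 0 < w (L 0) ∧ L 0 = L 1 then O.one else 0 := by
    intro L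
    rw [insConst_apply, multTens]
    by_cases hL : 0 < w (L 0) ∧ L 0 = L 1
    · rw [if_pos hL, if_pos ⟨rfl, hL⟩, O.signOp_of_mem 1 hm, mul_zero, sgn_zero, one_smul, hma]
    · rw [if_neg hL, if_neg (fun h => hL h.2), map_zero, map_zero, LinearMap.zero_apply]
  have h2 : ∀ b, insConst G.coordPar c a (n + 1) (ecomp O G.coordPar 1 (n := n + 1) (m := 2)
      (N := n + 2) rfl ⟨0, Nat.succ_pos n⟩ b b T (multTens w c m)) K =
      if 0 < w (K 0) ∧ K 0 = b then T K else 0 := by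
    intro b
    have e := ecomp_assoc (s := 1) (r := 1) (q := G.coordPar) (n := n + 1) (m := 2) (p := 0)
      (N₁ := n + 2) (N₂ := 1) (N := n + 1) rfl rfl rfl rfl (i := ⟨0, Nat.succ_pos n⟩) (j := 0)
      (l := 0) rfl rfl rfl b b c c T (multTens w c m) (constTens c a)
    have e2 : (1 : ZMod 2) + 1 = 0 := rfl
    refine (congrFun e K).trans ?_
    rw [e2, ecomp_apply, compExp_zero _ rfl, sgn_zero, one_smul, O.signOp_zero]
    have h3 := h1 (iw (n := n + 1) (m := 1) (N := n + 1) rfl ⟨0, Nat.succ_pos n⟩ b K)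
    have h4 : iw (n := n + 1) (m := 1) (N := n + 1) rfl ⟨0, Nat.succ_pos n⟩ b K 0 = K 0 := by
      rw [iw, if_neg (by decide)]
      congr 1
    have h5 : iw (n := n + 1) (m := 1) (N := n + 1) rfl ⟨0, Nat.succ_pos n⟩ b K 1 = b :=
      if_pos rfl
    rw [h4, h5] at h3
    refine (congrArg _ h3).trans ?_
    by_cases hb : 0 < w (K 0) ∧ K 0 = b
    · rw [if_pos hb, if_pos hb, O.comp_one]
      congr 1
      funext j
      induction j using Fin.cases with
      | zero => exact (if_pos rfl).trans hb.2.symm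
      | succ j =>
        rw [ow, if_neg (by rw [Fin.ext_iff]; simp)]
        congr 1
    · rw [if_neg hb, if_neg hb, map_zero]
  rw [insMult_apply, map_sum, Finset.sum_apply, Finset.sum_congr rfl fun b _ => h2 b]
  have h6 := hw (K 0)
  by_cases h : 0 < w (K 0)
  · obtain h7 : w (K 0) = 1 := by omega
    rw [h7, Nat.cast_one, one_smul]
    simp only [zero_lt_one, true_and, Finset.sum_ite_eq, Finset.mem_univ, if_true]
  · obtain h7 : w (K 0) = 0 := by omega
    simp [h7]

theorem insMult_eq_zero_of_weight {m : O.obj 2} {n : ℕ} (T : Tens O ι (n + 1))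
    {K : Fin (n + 3) → ι} (hK : w (K 1) = 0) : G.insMult w c m n T K = 0 := by
  rw [insMult_apply, Finset.sum_apply]
  refine Finset.sum_eq_zero fun b _ => ?_
  have h1 : iw (n := n + 1) (m := 2) (N := n + 2) rfl ⟨0, Nat.succ_pos n⟩ b K 1 = K 1 := by
    rw [iw, if_neg (by decide)]
    congr 1
  rw [ecomp_apply, multTens, if_neg, map_zero, smul_zero]
  rintro ⟨-, h, -⟩
  rw [h1, hK] at h
  exact h.false

/-- Here the constant would meet the second input of the multiplication, which only admits letters
of positive weight, whereas `c` has weight zero. -/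
theorem insConst_tact_insMult_one (hc : w c = 0) {m : O.obj 2} {a : O.obj 0} {n : ℕ}
    (T : Tens O ι (n + 1)) :
    insConst G.coordPar c a (n + 1) (tact O G.coordPar (Equiv.swap 1 0) (G.insMult w c m n T)) =
      0 := by
  funext K
  refine insConst_eq_zero c a ?_
  rw [tact_apply, insMult_eq_zero_of_weight, map_zero, smul_zero]
  rw [Equiv.swap_apply_left, Fin.cons_zero, hc]

/-- In arity one the constant would meet the output of `T`. Then `T` is evaluated on the letters
`b`, `c` of total weight at most one, where a heavy tensor vanishes; this is the point of requiring
weight two. -/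
theorem insConst_tact_insMult_last (hw : ∀ a, w a ≤ 1) (hc : w c = 0) {m : O.obj 2} {a : O.obj 0}
    {T : Tens O ι 1} (hT : IsHeavy w T) :
    insConst G.coordPar c a 1 (tact O G.coordPar (Equiv.swap 2 0) (G.insMult w c m 0 T)) = 0 := by
  have h1 : ∀ K : Fin 3 → ι, w (K 2) = 0 → G.insMult w c m 0 T K = 0 := by
    intro K hK
    rw [insMult_apply, Finset.sum_apply]
    refine Finset.sum_eq_zero fun b _ => ?_
    have h1 : ow (n := 1) (m := 2) (N := 2) rfl ⟨0, Nat.succ_pos 0⟩ b K 1 = K 2 := by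
      rw [ow, if_neg (by decide)]
      congr 1
    have h0 : ow (n := 1) (m := 2) (N := 2) rfl ⟨0, Nat.succ_pos 0⟩ b K 0 = b := if_pos rfl
    rw [ecomp_apply, hT, map_zero, map_zero, LinearMap.zero_apply, smul_zero]
    rw [Fin.sum_univ_two, h0, h1, hK]
    have := hw b
    omega
  funext K
  refine insConst_eq_zero c a ?_
  rw [tact_apply, h1, map_zero, smul_zero]
  rw [Equiv.swap_apply_left, Fin.cons_zero, hc]

/-- The constant and the product occupy different slots of `T`, so the two insertions are parallel.
They commute up to the sign $-1$, as both inserted tensors are odd. -/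
theorem exists_insConst_tact_insMult (hc : G.coordPar c = 1) {m : O.obj 2} (hm : m ∈ O.part 2 0)
    {a : O.obj 0} (ha : a ∈ O.part 0 0) {n : ℕ} {T : Tens O ι (n + 2)}
    (hT : FullInv O G.coordPar T) (j : Fin (n + 2)) :
    ∃ g : Equiv.Perm (Fin (n + 4)), g j.succ.succ = 0 ∧
      insConst G.coordPar c a (n + 2) (tact O G.coordPar g (G.insMult w c m (n + 1) T)) =
        -G.insMult w c m n (insConst G.coordPar c a (n + 1) T) := by
  -- The product is moved to the input `1` of `T` and the slot that receives the constant to the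
  -- input `0`, the position treated by `ecomp_comm`.
  obtain ⟨σ, hσ, hσj⟩ := exists_perm_two (n := n + 3) (a := 0) (b := j.succ) (c := 1) (d := 0)
    (Fin.succ_ne_zero j).symm (by simp [Fin.ext_iff])
  obtain ⟨ρ, H⟩ := exists_isPlug (n := n + 2) (m := 2) (N := n + 3) rfl ⟨0, by omega⟩ ⟨1, by omega⟩ σ
    (1 : Equiv.Perm (Fin 3)) hσ rfl
  refine ⟨ρ, ?_, ?_⟩
  · have h1 := H.outer j.succ (Fin.succ_ne_zero j)
    rw [hσj] at h1
    have h2 : oIdx (n := n + 2) (m := 2) (N := n + 3) rfl ⟨0, by omega⟩ j.succ = j.succ.succ :=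
      Fin.ext (by simp [oIdx, outerSlot])
    have h3 : oIdx (n := n + 2) (m := 2) (N := n + 3) rfl ⟨1, by omega⟩ 0 = 0 :=
      Fin.ext (by simp [oIdx, outerSlot])
    rw [← h2, h1, h3]
  · rw [insMult_apply, insMult_apply, map_sum, map_sum, ← Finset.sum_neg_distrib]
    refine Finset.sum_congr rfl fun b _ => ?_
    have e := ecomp_equivariant O G.coordPar 1 H b b T (multTens w c m)
    rw [hT, tact_one] at e
    have e2 := ecomp_comm (q := G.coordPar) (s := 1) (r := 1) (n := n + 2) (m := 0) (p := 2)
      (N₁ := n + 1) (N₂ := n + 3) (N := n + 2) rfl rfl rfl rfl (i := 0) (l := ⟨1, by omega⟩) (i' := 0)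
      (l' := ⟨0, by omega⟩) rfl rfl rfl rfl (b := c) (b' := c) (c := b) (c' := b) rfl rfl T
      (isHomT_constTens hc ha) (isHomT_multTens (w := w) hc hm)
    rw [mul_one, sgn_one, neg_smul, one_smul] at e2
    refine (congrArg _ e.symm).trans ?_
    exact ((congrArg Neg.neg e2).trans (neg_neg _)).symm

/-- The symmetrization is sorted by the slot which meets the constant. The first input of the
multiplication gives the total weight times `T`, its second input gives nothing, and each of the
$n+1$ slots of `T` gives $-R$; the factorials then cancel. -/
theorem insConst_homotopy_aux [CharZero k] (hw : ∀ a, w a ≤ 1) (hc : w c = 0)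
    {m : O.obj 2} (hm : m ∈ O.part 2 0) {a : O.obj 0}
    (hma : O.comp (n := 2) (m := 0) (N := 1) rfl 0 m a = O.one) {n : ℕ} {T : Tens O ι (n + 1)}
    (hT : FullInv O G.coordPar T) (hT' : IsHeavy w T) {R : Tens O ι (n + 1)}
    (hR : ∀ j : Fin (n + 1), ∃ g : Equiv.Perm (Fin (n + 3)), g j.succ.succ = 0 ∧
      insConst G.coordPar c a (n + 1) (tact O G.coordPar g (G.insMult w c m n T)) = -R) :
    ((n + 2 : ℕ) : k) • insConst G.coordPar c a (n + 1) (G.homotopy w c m n T) =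
      T - scale w (fun N => (N : k)⁻¹) (n + 1)
        ((n.factorial : k)⁻¹ • ∑ τ, tact O G.coordPar τ R) := by
  set Z := G.insMult w c m n T with hZ
  set V₀ := insConst G.coordPar c a (n + 1) Z with hV₀
  have hx : ∀ x : Fin (n + 3), ∃ g : Equiv.Perm (Fin (n + 3)), g x = 0 ∧
      insConst G.coordPar c a (n + 1) (tact O G.coordPar g Z) =
        (Fin.cons V₀ (Fin.cons 0 (fun _ => -R) : Fin (n + 2) → Tens O ι (n + 1)) :
          Fin (n + 3) → Tens O ι (n + 1)) x := by
    intro x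
    induction x using Fin.cases with
    | zero => exact ⟨1, rfl, by rw [tact_one]; rfl⟩
    | succ x =>
      induction x using Fin.cases with
      | zero => exact ⟨Equiv.swap 1 0, Equiv.swap_apply_left _ _, insConst_tact_insMult_one hc T⟩
      | succ x => exact hR x
  choose g hg hgV using hx
  have hsum : ∑ σ, insConst G.coordPar c a (n + 1) (tact O G.coordPar σ Z) =
      (∑ τ, tact O G.coordPar τ V₀) - ((n + 1 : ℕ) : k) • ∑ τ, tact O G.coordPar τ R := by
    rw [sum_perm_eq_sum_cosets 0 extendFirst extendFirst_injective extendFirst_zero g hg]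
    simp only [tact_mul, insConst_tact, hgV]
    rw [Fin.sum_univ_succ, Fin.sum_univ_succ]
    simp only [Fin.cons_zero, Fin.cons_succ, map_zero, Finset.sum_const_zero, zero_add, map_neg,
      Finset.sum_neg_distrib, Finset.sum_const, Finset.card_univ, Fintype.card_fin]
    rw [← sub_eq_add_neg, Nat.cast_smul_eq_nsmul]
  rw [homotopy_apply, insConst_scale w _ hc, map_smul, map_sum, hsum]
  funext K
  rw [Pi.smul_apply, scale_apply, Pi.smul_apply, Pi.sub_apply, Pi.sub_apply, scale_apply,
    Pi.smul_apply, Pi.smul_apply, sum_tact_weight hT (insConst_insMult hw hm hma T)]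
  generalize (∑ τ, tact O G.coordPar τ R) K = r
  have h1 : ((n.factorial : ℕ) : k) ≠ 0 := by exact_mod_cast Nat.factorial_ne_zero n
  have h2 : (n : k) + 1 ≠ 0 := by exact_mod_cast Nat.succ_ne_zero n
  have h3 : (n : k) + 2 ≠ 0 := by exact_mod_cast Nat.succ_ne_zero (n + 1)
  have h3' : (n : k) + 1 + 1 ≠ 0 := by exact_mod_cast Nat.succ_ne_zero (n + 1)
  simp only [Nat.factorial_succ, Nat.cast_mul, smul_sub, smul_smul]
  generalize hW : ∑ j, w (K j) = W
  -- On words of weight below two, including weight zero where the division is by zero, `T` vanishes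
  -- and the `R` terms agree as they stand.
  rcases lt_or_ge W 2 with hW2 | hW2
  · rw [hT' K (hW ▸ hW2), smul_zero, zero_sub, zero_sub]
    congr 2
    push_cast
    field_simp
    ring
  · have h4 : (W : k) ≠ 0 := by exact_mod_cast (by omega : W ≠ 0)
    congr 1
    · conv_rhs => rw [← one_smul k (T K)]
      congr 1
      push_cast
      field_simp
      ring
    · congr 1
      push_cast
      field_simp
      ring

theorem insConst_homotopy_one [CharZero k] (hw : ∀ a, w a ≤ 1) (hc : w c = 0)
    {m : O.obj 2} (hm : m ∈ O.part 2 0) {a : O.obj 0}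
    (hma : O.comp (n := 2) (m := 0) (N := 1) rfl 0 m a = O.one) {T : Tens O ι 1}
    (hT : FullInv O G.coordPar T) (hT' : IsHeavy w T) :
    ((2 : ℕ) : k) • insConst G.coordPar c a 1 (G.homotopy w c m 0 T) = T := by
  have := insConst_homotopy_aux hw hc hm hma hT hT' (R := 0) (fun j =>
    ⟨Equiv.swap 2 0, by rw [Subsingleton.elim (α := Fin 1) j 0]; exact Equiv.swap_apply_left _ _, by
      rw [neg_zero]; exact insConst_tact_insMult_last hw hc hT'⟩)
  simpa using this

theorem insConst_homotopy_add [CharZero k] (hw : ∀ a, w a ≤ 1) (hc : w c = 0)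
    (hcq : G.coordPar c = 1)
    {m : O.obj 2} (hm : m ∈ O.part 2 0) {a : O.obj 0} (ha : a ∈ O.part 0 0)
    (hma : O.comp (n := 2) (m := 0) (N := 1) rfl 0 m a = O.one) {n : ℕ} {T : Tens O ι (n + 2)}
    (hT : FullInv O G.coordPar T) (hT' : IsHeavy w T) :
    G.homotopy w c m n (((n + 2 : ℕ) : k) • insConst G.coordPar c a (n + 1) T) +
      ((n + 3 : ℕ) : k) • insConst G.coordPar c a (n + 2) (G.homotopy w c m (n + 1) T) = T := by
  have h := insConst_homotopy_aux hw hc hm hma hT hT'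
    (exists_insConst_tact_insMult (w := w) hcq hm ha hT)
  have h' : ((n + 3 : ℕ) : k) • insConst G.coordPar c a (n + 2) (G.homotopy w c m (n + 1) T) = _ := h
  have h3 : ((n + 2 : ℕ) : k) ≠ 0 := by exact_mod_cast Nat.succ_ne_zero (n + 1)
  have h4 : ((n + 2 : ℕ) : k) * ((n + 2).factorial : k)⁻¹ = ((n + 1).factorial : k)⁻¹ := by
    have h5 : ((n + 1).factorial : k) ≠ 0 := by exact_mod_cast Nat.factorial_ne_zero _
    rw [Nat.factorial_succ (n + 1)]
    push_cast at h3 ⊢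
    have h3' : (n : k) + 1 + 1 ≠ 0 := by exact_mod_cast Nat.succ_ne_zero (n + 1)
    field_simp
    ring
  rw [h', map_smul, homotopy_apply, ← map_smul (scale w _ _), smul_smul, h4, add_sub_cancel]

end GramData
end CyclicOperadCE

namespace CyclicOperadCE
namespace GramData

/-! ## Vanishing on the chains of heavy derivations -/

variable {k : Type u} [Field k] {O : CyclicDGOperad.{u, v} k} {ι : Type*} [Fintype ι]
  [DecidableEq ι] {G : GramData k ι}

theorem plug_constTens (c : ι) (a : O.obj 0) {n : ℕ} (T : Tens O ι (n + 1)) :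
    G.plug 1 (n := n + 1) (m := 0) (N := n) rfl (Nat.succ_pos n) T (constTens c a) =
      insConst G.coordPar c a n T := by
  rw [plug_apply, Finset.sum_eq_single c]
  · rfl
  · intro b _ hb
    funext K
    have h1 : iw (n := n + 1) (m := 0) (N := n) rfl ⟨0, Nat.succ_pos n⟩ b K 0 = b := if_pos rfl
    rw [ecomp_apply, constTens, if_neg (h1.trans_ne hb), map_zero, smul_zero]
    rfl
  · simp

/-- Only the composite in which `A` acts on the values of `D` survives, since derivations kill
constants. The factor counts the inputs of the component of arity $N+1$ of `D`, which are all
equivalent. -/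
theorem tens_commutator_constTens_of_hom [CharZero k] {c : ι} (hc : G.coordPar c = 1) {a : O.obj 0}
    (ha : a ∈ O.part 0 0) {t : ZMod 2} {D : Coeffs O ι} (hD : D ∈ G.der O)
    (hD' : G.projDer O t D = D) (N : ℕ) :
    tens N (G.commutator O (single O 0 (constTens c a)) D) =
      ((N + 1 : ℕ) : k) • insConst G.coordPar c a N (tens (N + 1) D) := by
  have hA := isHomT_constTens (q := G.coordPar) hc ha
  rw [G.commutator_of_hom (G.projDer_single hA) hD', G.compDer_single_zero D hA, smul_zero, sub_zero,
    ← sub_eq_zero]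
  refine map_eq_zero_of_single (Y := Tens O ι N) (c := 2) (fun M => if N < M then ⊥ else ⊤) ?_
    (f := tens N ∘ₗ G.compDer O 1 t (single O 0 (constTens c a)) -
      ((N + 1 : ℕ) : k) • (insConst G.coordPar c a N ∘ₗ tens (N + 1))) ?_ ?_
  · intro y hy
    have := hy (N + 1)
    rwa [if_pos (Nat.lt_succ_self N), Submodule.mem_bot] at this
  · intro M E hE
    split_ifs with hN
    · have h1 := (mem_fil_iff _ _).1 (G.compDer_fil O 1 t (M + 1) (single O 0 (constTens c a)) E
        (Or.inr hE)) N (by omega)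
      have h2 := (mem_fil_iff _ _).1 hE (N + 1) (by omega)
      rw [Submodule.mem_bot, LinearMap.sub_apply, LinearMap.smul_apply, LinearMap.comp_apply,
        LinearMap.comp_apply, h1, h2, map_zero, smul_zero, sub_zero]
    · exact Submodule.mem_top
  · intro n
    have hT := G.isHomT_tens hD' n
    rw [LinearMap.sub_apply, LinearMap.smul_apply, LinearMap.comp_apply, LinearMap.comp_apply]
    cases n with
    | zero =>
      rw [G.compDer_single_zero _ hT, tens_single_of_ne (Nat.succ_ne_zero N), map_zero, map_zero,
        smul_zero, sub_zero]
    | succ n =>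
      have hi := (G.mem_der_iff D).1 hD (n + 1)
      rw [G.compDer_single (n := n + 1) (m := 0) (N := n) rfl (Nat.succ_pos n) hT hi, plug_constTens,
        (hi.insConst c a).avg_eq]
      by_cases hN : N = n
      · subst hN
        rw [tens_single_self, tens_single_self, sub_self]
      · rw [tens_single_of_ne hN, tens_single_of_ne (by omega), map_zero, smul_zero, sub_zero]

theorem tens_commutator_constTens [CharZero k] {c : ι} (hc : G.coordPar c = 1) {a : O.obj 0}
    (ha : a ∈ O.part 0 0) {D : Coeffs O ι} (hD : D ∈ G.der O) (N : ℕ) :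
    tens N (G.commutator O (single O 0 (constTens c a)) D) =
      ((N + 1 : ℕ) : k) • insConst G.coordPar c a N (tens (N + 1) D) := by
  have h := fun t => tens_commutator_constTens_of_hom hc ha (G.projDer_mem_der t hD)
    (G.projDer_self t D) N
  rw [← G.projDer_total D, map_add, map_add, h, h, map_add, map_add, smul_add]

variable {P : ι → ι → k} {w : ι → ℕ} {c : ι}

theorem insConst_lastMul (A : ι → ι → k) (a : O.obj 0) {n : ℕ} (T : Tens O ι (n + 1)) :
    insConst G.coordPar c a n (lastMul A (n + 1) T) =
      lastMul A n (insConst G.coordPar c a n T) := by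
  rw [insConst, LinearMap.flip_apply, LinearMap.flip_apply, lastMul_ecomp]

variable (G P w c) in
/-- The components of the contracting homotopy. -/
noncomputable def contractionTens (m : O.obj 2) : (n : ℕ) → Coeffs O ι →ₗ[k] Tens O ι n
  -- The homotopy raises the arity by one and heavy derivations have no component of arity zero, so
  -- nothing arrives in arities `0` and `1`.
  | 0 => 0
  | 1 => 0
  | n + 2 => -(lastMul P (n + 2) ∘ₗ G.homotopy w c m n ∘ₗ lastMul G.gram (n + 1) ∘ₗ tens (n + 1))

variable (G P w c) in
/-- A contracting homotopy for the bracket with a constant. -/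
noncomputable def contraction (m : O.obj 2) : Coeffs O ι →ₗ[k] Coeffs O ι :=
  ofTens O ∘ₗ LinearMap.pi (contractionTens G P w c m)

theorem tens_contraction (m : O.obj 2) (n : ℕ) (D : Coeffs O ι) :
    tens n (contraction G P w c m D) = contractionTens G P w c m n D := by
  rw [contraction, LinearMap.comp_apply, tens_ofTens, LinearMap.pi_apply]

theorem contractionTens_add_two (m : O.obj 2) (n : ℕ) (D : Coeffs O ι) :
    contractionTens G P w c m (n + 2) D =
      -lastMul P (n + 2) (G.homotopy w c m n (lastMul G.gram (n + 1) (tens (n + 1) D))) := rfl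

theorem contraction_fil (m : O.obj 2) (M : ℕ) (D : Coeffs O ι)
    (hD : D ∈ GramData.fil ι O (M + 1)) : contraction G P w c m D ∈ GramData.fil ι O M := by
  rw [mem_fil_iff] at hD ⊢
  intro n hn
  rw [tens_contraction]
  match n, hn with
  | 0, _ => rfl
  | 1, _ => rfl
  | n + 2, hn =>
    rw [contractionTens_add_two, hD (n + 1) (by omega), map_zero, map_zero, map_zero, neg_zero]

theorem projDer_contraction (hP : G.IsInverse P) (hc : G.coordPar c = 1) {m : O.obj 2}
    (hm : m ∈ O.part 2 0) {t : ZMod 2} {D : Coeffs O ι} (hD : G.projDer O t D = D) :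
    G.projDer O (t + 1) (contraction G P w c m D) = contraction G P w c m D := by
  refine G.projDer_of_isHomT fun n => ?_
  rw [tens_contraction]
  match n with
  | 0 => exact fun K => Submodule.zero_mem _
  | 1 => exact fun K => Submodule.zero_mem _
  | n + 2 =>
    have := (isHomT_homotopy (w := w) hc hm
      ((G.isHomT_tens hD (n + 1)).lastMul hP.gram_coordPar)).lastMul hP.inv_coordPar
    exact fun K => Submodule.neg_mem _ (this K)

theorem contraction_mem_heavyDer (hP : G.IsInverse P) (hw : ∀ a, w a ≤ 1)
    (hwG : ∀ a b, G.gram a b ≠ 0 → w a = w b) (hwP : ∀ a b, P a b ≠ 0 → w a = w b) {m : O.obj 2}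
    {D : Coeffs O ι} (hD : D ∈ G.heavyDer O w) : contraction G P w c m D ∈ G.heavyDer O w := by
  refine ⟨(mem_cDer_iff hP _).2 fun n => ?_, fun n => ?_⟩ <;> rw [tens_contraction]
  · match n with
    | 0 => exact fun σ => by rw [show contractionTens G P w c m 0 D = 0 from rfl, map_zero, map_zero]
    | 1 => exact fun σ => by rw [show contractionTens G P w c m 1 D = 0 from rfl, map_zero, map_zero]
    | n + 2 =>
      rw [contractionTens_add_two, map_neg, hP.lower_raise, ← neg_one_smul k]
      exact (fullInv_homotopy _).smul _
  · match n with
    | 0 => exact fun _ _ => rfl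
    | 1 => exact fun _ _ => rfl
    | n + 2 =>
      rw [contractionTens_add_two, ← neg_one_smul k]
      exact ((isHeavy_homotopy hw ((hD.2 (n + 1)).lastMul hwG)).lastMul hwP).smul _

/-- The right-hand side is `-D` because the abstract argument uses $Q_2(A,-)=-[A,-]$. In each arity
the statement is one of the identities for `homotopy`, with the output lowered before and raised
after. -/
theorem contraction_commutator [CharZero k] (hP : G.IsInverse P) (hw : ∀ a, w a ≤ 1)
    (hwG : ∀ a b, G.gram a b ≠ 0 → w a = w b) (hwP : ∀ a b, P a b ≠ 0 → w a = w b)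
    (hc : w c = 0) (hcq : G.coordPar c = 1) {m : O.obj 2} (hm : m ∈ O.part 2 0) {a : O.obj 0}
    (ha : a ∈ O.part 0 0) (hma : O.comp (n := 2) (m := 0) (N := 1) rfl 0 m a = O.one)
    {D : Coeffs O ι} (hD : D ∈ G.heavyDer O w) :
    contraction G P w c m (G.commutator O (single O 0 (constTens c a)) D) +
      G.commutator O (single O 0 (constTens c a)) (contraction G P w c m D) = -D := by
  have hT := (mem_cDer_iff hP D).1 hD.1
  have hT' := fun n => (hD.2 n).lastMul hwG
  have hE := contraction_mem_heavyDer (c := c) (m := m) hP hw hwG hwP hD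
  refine coeffs_ext fun n => ?_
  rw [map_add, map_neg, tens_contraction, tens_commutator_constTens hcq ha hE.1.1, tens_contraction]
  match n with
  | 0 =>
    -- A word of arity zero has a single letter, of weight at most one.
    have h0 : tens 0 D = 0 := by
      funext K
      refine hD.2 0 K ?_
      rw [Fin.sum_univ_one]
      exact (hw _).trans_lt one_lt_two
    rw [h0]
    change (0 : Tens O ι 0) + _ • insConst _ _ _ _ 0 = _
    rw [map_zero, smul_zero, add_zero, neg_zero]
  | 1 =>
    change (0 : Tens O ι 1) + _ = _
    rw [contractionTens_add_two, map_neg, insConst_lastMul, smul_neg, ← map_smul, zero_add]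
    refine congrArg Neg.neg ((congrArg _ ?_).trans (hP.raise_lower (tens 1 D)))
    exact insConst_homotopy_one hw hc hm hma (hT 1) (hT' 1)
  | n + 2 =>
    rw [contractionTens_add_two, contractionTens_add_two, map_neg, insConst_lastMul, smul_neg,
      ← map_smul (lastMul P (n + 2)), tens_commutator_constTens hcq ha hD.1.1, map_smul (lastMul _ _),
      ← insConst_lastMul, ← neg_add, ← map_add]
    refine congrArg Neg.neg ((congrArg _ ?_).trans (hP.raise_lower (tens (n + 2) D)))
    exact insConst_homotopy_add hw hc hcq hm ha hma (hT (n + 2)) (hT' (n + 2))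

/-- In arity zero there is a single slot, hence no condition of cyclicity. -/
theorem single_constTens_mem_cDer (hP : G.IsInverse P) (a : O.obj 0) :
    single O 0 (constTens c a) ∈ G.cDer O := by
  refine single_mem_cDer hP fun σ => ?_
  rw [show σ = 1 from Equiv.ext fun x => Subsingleton.elim (α := Fin 1) _ _, tact_one]

/-- The null-homotopy applied to the heavy derivations, with the filling chain in all cyclic
derivations: `A` has weight zero and lies only in the latter. -/
theorem exists_boundary_eq_of_heavy [CharZero k] (hP : G.IsInverse P) (hw : ∀ a, w a ≤ 1)
    (hwG : ∀ a b, G.gram a b ≠ 0 → w a = w b) (hwP : ∀ a b, P a b ≠ 0 → w a = w b)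
    (hc : w c = 0) (hcq : G.coordPar c = 1) {m : O.obj 2} (hm : m ∈ O.part 2 0) {a : O.obj 0}
    (ha : a ∈ O.part 0 0) (hma : O.comp (n := 2) (m := 0) (N := 1) rfl 0 m a = O.one)
    (hda : O.d 0 a = 0) {ξ : Coeffs O ι} (hξ : G.projDer O 1 ξ = ξ) (hξ' : ξ ∈ G.heavyDer O w)
    (hMC : dDer O ξ + (2 : k)⁻¹ • G.commutator O ξ ξ = 0)
    (hξc : G.commutator O (single O 0 (constTens c a)) ξ = 0) {z : (G.derSpace O ξ).Chain}
    (hz : z ∈ (G.derSpace O ξ).chainsOn (G.heavyDer O w)) (hz0 : z 0 = 0)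
    (hdz : (G.derSpace O ξ).boundary z = 0)
    (hAz : (G.derSpace O ξ).coderC
      ((G.derSpace O ξ).shiftBr (single O 0 (constTens c a))) (FormalSpace.shiftBr_fil _) z = 0) :
    ∃ y ∈ (G.derSpace O ξ).reducedChainsOn (G.cDer O), (G.derSpace O ξ).boundary y = z := by
  have hA : G.projDer O 1 (single O 0 (constTens c a)) = single O 0 (constTens c a) :=
    G.projDer_single (isHomT_constTens hcq ha)
  have hAc : single O 0 (constTens c a) ∈ G.cDer O := single_constTens_mem_cDer hP a
  generalize hAdef : single O 0 (constTens c a) = A at hA hAc hξc hAz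
  have hS := isSuper_derSpace hξ
  have hL := isLieOn_der hξ hξ'.1.1 hMC
  have hA' : (G.derSpace O ξ).proj (0 + 1) A = A := hA
  have hKder : ∀ x ∈ G.heavyDer O w, x ∈ G.der O := fun x hx => hx.1.1
  have hdA : (G.derSpace O ξ).d A = 0 := by
    change dDer O A + G.commutator O ξ A = 0
    rw [G.commutator_symm hA hξ, hξc, smul_zero, neg_zero, add_zero, ← hAdef]
    refine coeffs_ext fun n => ?_
    funext K
    rw [tens_dDer, map_zero]
    cases n with
    | zero =>
      rw [tens_single_self, constTens]
      split_ifs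
      · exact hda
      · exact map_zero _
    | succ n => rw [tens_single_of_ne (Nat.succ_ne_zero n)]; exact map_zero _
  have hAA : (G.derSpace O ξ).br A A = 0 := by
    change G.commutator O A A = 0
    refine coeffs_ext fun n => ?_
    conv_lhs => rw [← hAdef]
    rw [tens_commutator_constTens hcq ha (hAdef ▸ hAc.1), tens_single_of_ne (Nat.succ_ne_zero n),
      map_zero, smul_zero, map_zero]
  have hsh : ∀ y, (G.derSpace O ξ).shiftBr A y = -G.commutator O A y := fun y => by
    rw [FormalSpace.shiftBr_of_hom (L := G.derSpace O ξ) hA, sgn_one, neg_one_smul]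
    rfl
  refine FormalSpace.exists_boundary_eq hS hA (isLieOn_heavyDer hP hw hξ hξ' hMC)
    (fun x hx => hx.1) hAc hdA hAA
    (fun p q x y hx hy => hL.br_der 0 A hAc.1 hA' p q x y (hKder x hx) (hKder y hy)) ?_
    (S := contraction G P w c m) (contraction_fil m) (fun t D hD => projDer_contraction hP hcq hm hD)
    (fun D hD => contraction_mem_heavyDer hP hw hwG hwP hD) (fun D hD => ?_) z hz hz0 hdz hAz
  · have h1 : ∀ q y, y ∈ G.der O → G.projDer O q y = y →
        (G.derSpace O ξ).d ((G.derSpace O ξ).shiftBr A y) +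
          (G.derSpace O ξ).shiftBr A ((G.derSpace O ξ).d y) = 0 := fun q y hy hq => by
      have := hL.d_der 0 (q + 1) A y hAc.1 hy hA' (by
        have e : q + 1 + 1 = q := by rw [add_assoc]; exact add_zero q
        rw [e]; exact hq)
      rw [this, hdA, map_zero, LinearMap.zero_apply, zero_add, mul_zero, sgn_zero, one_smul, sgn_one,
        neg_one_smul, neg_add_cancel]
    intro x hx
    have h2 := fun s => h1 s _ (G.projDer_mem_der s (hKder x hx)) (G.projDer_self s x)
    rw [← G.projDer_total x]
    simp only [map_add]
    rw [add_add_add_comm, h2, h2, add_zero]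
  · rw [hsh, hsh, map_neg, ← neg_add, ← hAdef,
      contraction_commutator hP hw hwG hwP hc hcq hm ha hma hD, neg_neg]

end GramData
end CyclicOperadCE

namespace CyclicOperadCE
namespace CyclicDGOperad

/-! ## The constant of a weakly unital multiplication -/

variable {k : Type u} [Field k] {O : CyclicDGOperad.{u, v} k}

theorem eq_zero_of_mem_part {n : ℕ} {x : O.obj n} (h0 : x ∈ O.part n 0) (h1 : x ∈ O.part n 1) :
    x = 0 := by
  have e0 := O.proj_of_mem (t := 0) h0
  have e1 := O.proj_of_mem (t := 0) h1
  rw [if_pos rfl] at e0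
  rw [if_neg (by decide)] at e1
  rw [← e0, e1]

theorem eq_zero_of_mem_span_one {x : O.obj 1} (h : x ∈ Submodule.span k {O.one})
    (h1 : x ∈ O.part 1 1) : x = 0 := by
  refine eq_zero_of_mem_part ?_ h1
  exact (Submodule.span_singleton_le_iff_mem _ _).2 O.one_mem h

theorem comp_swap_inputs (m : O.obj 2) (a : O.obj 0) (i : Fin 2) :
    O.comp (n := 2) (m := 0) (N := 1) rfl (Equiv.swap 0 1 i) (O.act 2 (Equiv.swap 0 1) m) a =
      O.comp (n := 2) (m := 0) (N := 1) rfl i m a := by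
  have h := O.comp_act (n := 2) (m := 0) (N := 1) rfl i (Equiv.swap 0 1 i) (Equiv.swap 0 1) 1 1
    (by revert i; decide) rfl (by
      have key : ∀ (i : Fin 2) (j : Fin 3), j ≠ i.castSucc →
          outerSlot i 0 j = outerSlot (Equiv.swap 0 1 i : Fin 2) 0 (Equiv.swap 0 1 j : Fin 3) := by
        decide
      intro j hj x hx
      rw [← key i j hj]
      exact hx)
    (fun j hj => absurd (Subsingleton.elim (α := Fin 1) j (Fin.last 0)) hj) m a
  simpa using h

/-- Parity allows only the even part of `a` to contribute, and it is rescaled. The result is closed: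
$m(a,da)$ equals $da$ if `a` is plugged in first, while plugging in `da` first gives an odd multiple
of the even `Id`, that is, zero. -/
theorem exists_const_of_comp_ne_zero {m : O.obj 2} (hm : m ∈ O.part 2 0)
    (hspan : ∀ (i : Fin 2) (a : O.obj 0),
      O.comp (n := 2) (m := 0) (N := 1) rfl i m a ∈ Submodule.span k {O.one}) {a : O.obj 0}
    (ha : O.comp (n := 2) (m := 0) (N := 1) rfl 0 m a ≠ 0) :
    ∃ a' ∈ O.part 0 0, O.comp (n := 2) (m := 0) (N := 1) rfl 0 m a' = O.one ∧ O.d 0 a' = 0 := by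
  have hodd : ∀ i, ∀ b ∈ O.part 0 1, O.comp (n := 2) (m := 0) (N := 1) rfl i m b = 0 :=
    fun i b hb => eq_zero_of_mem_span_one (hspan i b) (by
      have := O.comp_mem (n := 2) (m := 0) (N := 1) rfl i 0 1 m b hm hb
      rwa [zero_add] at this)
  have ha' : O.comp (n := 2) (m := 0) (N := 1) rfl 0 m (O.proj 0 0 a) =
      O.comp (n := 2) (m := 0) (N := 1) rfl 0 m a := by
    conv_rhs => rw [← O.proj_total a, map_add, hodd 0 _ (O.proj_mem _ _), add_zero]
  obtain ⟨c, hc⟩ := Submodule.mem_span_singleton.1 (hspan 0 a)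
  have hc0 : c ≠ 0 := fun h => ha (by rw [← hc, h, zero_smul])
  have h1 : c⁻¹ • O.proj 0 0 a ∈ O.part 0 0 := Submodule.smul_mem _ _ (O.proj_mem _ _)
  have h2 : O.comp (n := 2) (m := 0) (N := 1) rfl 0 m (c⁻¹ • O.proj 0 0 a) = O.one := by
    rw [map_smul, ha', ← hc, smul_smul, inv_mul_cancel₀ hc0, one_smul]
  refine ⟨_, h1, h2, ?_⟩
  generalize c⁻¹ • O.proj 0 0 a = a' at h1 h2
  have hd : O.d 0 a' ∈ O.part 0 1 := O.d_mem 0 0 a' h1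
  have := O.comp_comm (n := 2) (m := 0) (r := 0) (N₁ := 1) (N₂ := 1) (N := 0) rfl rfl rfl rfl 0 1 0 0
    (by decide) rfl rfl 0 1 m a' (O.d 0 a') h1 hd
  rwa [h2, O.one_comp, hodd 1 _ hd, map_zero, LinearMap.zero_apply, smul_zero] at this

theorem IsWeaklyUnital.exists_const {m : O.obj 2} (hm : m ∈ O.part 2 0) (h : O.IsWeaklyUnital m) :
    ∃ m' ∈ O.part 2 0, ∃ a ∈ O.part 0 0,
      O.comp (n := 2) (m := 0) (N := 1) rfl 0 m' a = O.one ∧ O.d 0 a = 0 := by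
  obtain ⟨i, a, ha⟩ := h.ne_zero
  have hi : i = 0 ∨ i = 1 := by clear ha; revert i; decide
  rcases hi with rfl | rfl
  · exact ⟨m, hm, exists_const_of_comp_ne_zero hm h.mem_span ha⟩
  · have hs : ∀ i : Fin 2, Equiv.swap 0 1 (Equiv.swap 0 1 i) = i := fun i =>
      Equiv.swap_apply_self _ _ i
    -- If only the second input is known to be nonzero, the multiplication is replaced by its
    -- opposite.
    refine ⟨_, O.act_mem 2 0 (Equiv.swap 0 1) m hm,
      exists_const_of_comp_ne_zero (O.act_mem 2 0 _ m hm) (fun i b => ?_) (a := a) ?_⟩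
    · rw [← hs i, comp_swap_inputs]
      exact h.mem_span _ b
    · rwa [← comp_swap_inputs m a 1] at ha

end CyclicDGOperad
end CyclicOperadCE

namespace CyclicOperadCE

/-! ## Gram matrices of inner product spaces -/

namespace InnerProductSuperspace.HomogeneousBasis

variable {k : Type u} [Field k] {V : Type*} [AddCommGroup V] [Module k V]
  {A : InnerProductSuperspace k V} {ι : Type*} [Fintype ι] [DecidableEq ι] (e : A.HomogeneousBasis ι)

theorem isInverse_gramData :
    e.gramData.IsInverse fun a b => (LinearMap.BilinForm.toMatrix e.basis A.form)⁻¹ a b := by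
  have hdet : IsUnit (LinearMap.BilinForm.toMatrix e.basis A.form).det :=
    isUnit_iff_ne_zero.2 ((LinearMap.BilinForm.nondegenerate_iff_det_ne_zero e.basis).1
      A.nondegenerate)
  have hgram : ∀ a b, e.gramData.gram a b = LinearMap.BilinForm.toMatrix e.basis A.form a b :=
    fun a b => (LinearMap.BilinForm.toMatrix_apply _ _ _ _).symm
  refine ⟨fun a b h => ?_, fun a b => ?_, fun a b => ?_, fun a b => ?_⟩
  · by_contra hab
    exact h (A.form_even _ _ hab _ (e.basis_mem a) _ (e.basis_mem b))
  · exact A.form_symm _ _ _ (e.basis_mem a) _ (e.basis_mem b)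
  · simp only [hgram]
    rw [← Matrix.mul_apply, Matrix.mul_nonsing_inv _ hdet, Matrix.one_apply]
  · simp only [hgram]
    rw [← Matrix.mul_apply, Matrix.nonsing_inv_mul _ hdet, Matrix.one_apply]

theorem exists_par_eq_zero (h : A.part 0 ≠ ⊥) : ∃ a, e.par a = 0 := by
  by_contra! hne
  refine h (disjoint_self.1 ?_)
  have h01 : Disjoint (A.part 0) (A.part 1) :=
    A.isInternal.submodule_iSupIndep.pairwiseDisjoint (by decide)
  refine h01.mono_right ?_
  have htop : A.part 1 = ⊤ := by
    rw [eq_top_iff, ← e.basis.span_eq, Submodule.span_le]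
    rintro _ ⟨a, rfl⟩
    have h1 : ∀ s : ZMod 2, s ≠ 0 → s = 1 := by decide
    rw [SetLike.mem_coe, ← h1 _ (hne a)]
    exact e.basis_mem a
  rw [htop]
  exact le_top

end InnerProductSuperspace.HomogeneousBasis

/-- Block diagonal matrices. -/
def blockSum {k : Type*} [Zero k] {ι κ : Type*} (P : ι → ι → k) (Q : κ → κ → k) :
    ι ⊕ κ → ι ⊕ κ → k :=
  Sum.elim (fun a => Sum.elim (fun b => P a b) fun _ => 0)
    (fun a => Sum.elim (fun _ => 0) fun b => Q a b)

theorem blockSum_mul {k : Type*} [Semiring k] {ι κ : Type*} [Fintype ι] [Fintype κ] [DecidableEq ι]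
    [DecidableEq κ] {P P' : ι → ι → k} {Q Q' : κ → κ → k}
    (hP : ∀ a b, ∑ c, P a c * P' c b = if a = b then 1 else 0)
    (hQ : ∀ a b, ∑ c, Q a c * Q' c b = if a = b then 1 else 0) (a b : ι ⊕ κ) :
    ∑ c, blockSum P Q a c * blockSum P' Q' c b = if a = b then 1 else 0 := by
  rw [Fintype.sum_sum_type]
  rcases a with a | a <;> rcases b with b | b <;> simp [blockSum, hP, hQ]

theorem eq_of_blockSum_ne_zero {k : Type*} [Zero k] {ι κ α : Type*} {P : ι → ι → k} {Q : κ → κ → k}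
    {f : ι → α} {g : κ → α} (hP : ∀ a b, P a b ≠ 0 → f a = f b) (hQ : ∀ a b, Q a b ≠ 0 → g a = g b)
    (a b : ι ⊕ κ) (h : blockSum P Q a b ≠ 0) : Sum.elim f g a = Sum.elim f g b := by
  rcases a with a | a <;> rcases b with b | b
  · exact hP a b h
  · exact absurd rfl h
  · exact absurd rfl h
  · exact hQ a b h

theorem GramData.IsInverse.sum {k : Type u} [Field k] {ι κ : Type*} [Fintype ι] [Fintype κ]
    [DecidableEq ι] [DecidableEq κ] {G : GramData k ι} {H : GramData k κ} {P : ι → ι → k}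
    {Q : κ → κ → k} (hP : G.IsInverse P) (hQ : H.IsInverse Q) :
    (G.sum H).IsInverse (blockSum P Q) where
  even := eq_of_blockSum_ne_zero hP.even hQ.even
  symm a b := by
    rcases a with a | a <;> rcases b with b | b
    · exact hP.symm a b
    · exact (mul_zero _).symm
    · exact (mul_zero _).symm
    · exact hQ.symm a b
  mul_inv := blockSum_mul hP.mul_inv hQ.mul_inv
  inv_mul := blockSum_mul hP.inv_mul hQ.inv_mul

end CyclicOperadCE

namespace CyclicOperadCE

/-! ## Extension of tensors by zero -/

section ExtTens

variable {k : Type u} [Field k] {O : CyclicDGOperad.{u, v} k} {ι : Type*} [Fintype ι]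
  [DecidableEq ι] {κ : Type*} [DecidableEq κ]

variable (κ) in
/-- Extension of a tensor by zero to the words with letters in `κ`. -/
def extTens (n : ℕ) : Tens O ι n →ₗ[k] Tens O (ι ⊕ κ) n where
  toFun T K := ∑ K' : Fin (n + 1) → ι, if (fun j => Sum.inl (K' j)) = K then T K' else 0
  map_add' T U := by
    funext K
    simp only [Pi.add_apply, ← Finset.sum_add_distrib]
    exact Finset.sum_congr rfl fun K' _ => by split_ifs <;> simp
  map_smul' c T := by
    funext K
    simp only [Pi.smul_apply, Finset.smul_sum, RingHom.id_apply]
    exact Finset.sum_congr rfl fun K' _ => by split_ifs <;> simp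

theorem sum_ite_inl {M : Type*} [AddCommMonoid M] {n : ℕ} (f : (Fin n → ι) → M) (K : Fin n → ι) :
    (∑ K' : Fin n → ι, if (fun j => (Sum.inl (K' j) : ι ⊕ κ)) = fun j => Sum.inl (K j) then f K'
      else 0) = f K := by
  rw [Finset.sum_eq_single K, if_pos rfl]
  · intro K' _ h
    exact if_neg fun e => h (funext fun j => Sum.inl_injective (congrFun e j))
  · simp

theorem sum_ite_inr {M : Type*} [AddCommMonoid M] {n : ℕ} (f : (Fin n → ι) → M) {K : Fin n → ι ⊕ κ}
    {j : Fin n} {c : κ} (hj : K j = Sum.inr c) :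
    (∑ K' : Fin n → ι, if (fun j => Sum.inl (K' j)) = K then f K' else 0) = 0 := by
  refine Finset.sum_eq_zero fun K' _ => if_neg fun e => ?_
  rw [← e] at hj
  exact Sum.inl_ne_inr hj

theorem extTens_inl {n : ℕ} (T : Tens O ι n) (K : Fin (n + 1) → ι) :
    extTens κ n T (fun j => Sum.inl (K j)) = T K := sum_ite_inl _ _

theorem extTens_inr {n : ℕ} (T : Tens O ι n) {K : Fin (n + 1) → ι ⊕ κ} {j : Fin (n + 1)} {c : κ}
    (hj : K j = Sum.inr c) : extTens κ n T K = 0 := sum_ite_inr _ hj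

theorem word_cases {n : ℕ} (K : Fin n → ι ⊕ κ) :
    (∃ K' : Fin n → ι, K = fun j => Sum.inl (K' j)) ∨ ∃ j c, K j = Sum.inr c := by
  by_cases h : ∃ j c, K j = Sum.inr c
  · exact Or.inr h
  · left
    have h1 : ∀ j, ∃ a, K j = Sum.inl a := fun j => by
      rcases hK : K j with a | c
      · exact ⟨a, rfl⟩
      · exact absurd ⟨j, c, hK⟩ h
    choose K' hK' using h1
    exact ⟨K', funext hK'⟩

theorem eq_extTens {n : ℕ} {T : Tens O ι n} {U : Tens O (ι ⊕ κ) n}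
    (h : ∀ K, U (fun j => Sum.inl (K j)) = T K) (h' : ∀ K j c, K j = Sum.inr c → U K = 0) :
    U = extTens κ n T := by
  funext K
  rcases word_cases K with ⟨K', rfl⟩ | ⟨j, c, hj⟩
  · rw [h, extTens_inl]
  · rw [h' K j c hj, extTens_inr T hj]

theorem tens_extend (n : ℕ) (D : Coeffs O ι) :
    tens n (GramData.extend O κ D) = extTens κ n (tens n D) := by
  refine eq_extTens (fun K => ?_) fun K j c hj => ?_
  · exact sum_ite_inl (κ := κ) (fun K' => D n (K (Fin.last n)) K') fun j => K j.castSucc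
  · rw [tens_apply]
    induction j using Fin.lastCases with
    | last => rw [hj]; rfl
    | cast j =>
      rcases hK : K (Fin.last n) with a | a
      · exact sum_ite_inr _ hj
      · rfl

theorem tact_extTens {q : ι ⊕ κ → ZMod 2} {n : ℕ} (σ : Equiv.Perm (Fin (n + 1))) (T : Tens O ι n) :
    tact O q σ (extTens κ n T) = extTens κ n (tact O (fun a => q (Sum.inl a)) σ T) := by
  refine eq_extTens (fun K => ?_) fun K j c hj => ?_
  · rw [tact_apply, tact_apply]
    exact congrArg (fun x => _ • O.act n σ x) (extTens_inl T fun j => K (σ j))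
  · rw [tact_apply, extTens_inr (j := σ⁻¹ j) (c := c) T, map_zero, smul_zero]
    simpa using hj

theorem avg_extTens {q : ι ⊕ κ → ZMod 2} {n : ℕ} (T : Tens O ι n) :
    avg O q (extTens κ n T) = extTens κ n (avg O (fun a => q (Sum.inl a)) T) := by
  rw [avg_eq, avg_eq, map_smul, map_sum]
  simp only [tact_extTens]

theorem ecomp_extTens_inl {q : ι ⊕ κ → ZMod 2} (s : ZMod 2) {n m N : ℕ} (h : N + 1 = n + m)
    (i : Fin n) (b b' : ι) (T : Tens O ι n) (U : Tens O ι m) :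
    ecomp O q s h i (Sum.inl b) (Sum.inl b') (extTens κ n T) (extTens κ m U) =
      extTens κ N (ecomp O (fun a => q (Sum.inl a)) s h i b b' T U) := by
  refine eq_extTens (fun K => ?_) fun K x c hx => ?_
  · have h1 : ow h i (Sum.inl b : ι ⊕ κ) (fun j => Sum.inl (K j)) =
        fun j => Sum.inl (ow h i b K j) := by
      funext j
      unfold ow
      split_ifs <;> rfl
    have h2 : iw h i (Sum.inl b' : ι ⊕ κ) (fun j => Sum.inl (K j)) =
        fun j => Sum.inl (iw h i b' K j) := by
      funext j
      unfold iw
      split_ifs <;> rfl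
    rw [ecomp_apply, ecomp_apply, h1, h2, extTens_inl, extTens_inl]
    rfl
  · rw [ecomp_apply]
    rcases slot_cases h i x with ⟨j, hj, rfl⟩ | ⟨j, hj, rfl⟩
    · rw [extTens_inr (j := j) (c := c) T, map_zero, map_zero, LinearMap.zero_apply, smul_zero]
      rw [ow, if_neg hj, hx]
    · rw [extTens_inr (j := j) (c := c) U, map_zero, smul_zero]
      rw [iw, if_neg hj, hx]

theorem ecomp_extTens_inr {q : ι ⊕ κ → ZMod 2} (s : ZMod 2) {n m N : ℕ} (h : N + 1 = n + m)
    (i : Fin n) (c : κ) (b' : ι ⊕ κ) (T : Tens O ι n) (U : Tens O (ι ⊕ κ) m) :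
    ecomp O q s h i (Sum.inr c) b' (extTens κ n T) U = 0 := by
  funext K
  rw [ecomp_apply, extTens_inr (j := i.castSucc) (c := c) T, map_zero, map_zero,
    LinearMap.zero_apply, smul_zero]
  · rfl
  · rw [ow, if_pos rfl]

/-- A contraction over letters of $W$ vanishes because the first factor does not contain them. Hence
extension by zero respects compositions, and with them brackets. -/
theorem sum_ecomp_extTens [Fintype κ] {q : ι ⊕ κ → ZMod 2} (s : ZMod 2) {n m N : ℕ}
    (h : N + 1 = n + m) (i : Fin n) (T : Tens O ι n) (U : Tens O ι m) :
    ∑ b, ecomp O q s h i b b (extTens κ n T) (extTens κ m U) =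
      extTens κ N (∑ b, ecomp O (fun a => q (Sum.inl a)) s h i b b T U) := by
  rw [Fintype.sum_sum_type, map_sum]
  simp only [ecomp_extTens_inl, ecomp_extTens_inr, Finset.sum_const_zero, add_zero]

theorem lastMul_extTens [Fintype κ] (A : ι → ι → k) (B : κ → κ → k) {n : ℕ} (T : Tens O ι n) :
    lastMul (blockSum A B) n (extTens κ n T) = extTens κ n (lastMul A n T) := by
  refine eq_extTens (fun K => ?_) fun K j c hj => ?_
  · rw [lastMul_apply, lastMul_apply, Fintype.sum_sum_type]
    have h1 : ∀ a : ι, Function.update (fun j => (Sum.inl (K j) : ι ⊕ κ)) (Fin.last n) (Sum.inl a) =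
        fun j => Sum.inl (Function.update K (Fin.last n) a j) := by
      intro a
      funext j
      by_cases hj : j = Fin.last n
      · subst hj
        rw [Function.update_self, Function.update_self]
      · rw [Function.update_of_ne hj, Function.update_of_ne hj]
    simp only [h1, extTens_inl]
    rw [Finset.sum_eq_zero (s := (Finset.univ : Finset κ)), add_zero]
    · rfl
    · exact fun a _ => zero_smul _ _
  · rw [lastMul_apply]
    refine Finset.sum_eq_zero fun a _ => ?_
    by_cases hl : j = Fin.last n
    · subst hl
      rcases a with a | a
      · rw [hj]
        exact zero_smul _ _
      · rw [extTens_inr (j := Fin.last n) (c := a) T, smul_zero]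
        rw [Function.update_self]
    · rw [extTens_inr (j := j) (c := c) T, smul_zero]
      rw [Function.update_of_ne hl, hj]

end ExtTens

namespace GramData

variable {k : Type u} [Field k] {O : CyclicDGOperad.{u, v} k} {ι : Type*} [Fintype ι]
  [DecidableEq ι] {κ : Type*} [Fintype κ] [DecidableEq κ] (G : GramData k ι) (H : GramData k κ)

theorem projDer_extend (s : ZMod 2) (D : Coeffs O ι) :
    (G.sum H).projDer O s (extend O κ D) = extend O κ (G.projDer O s D) :=
  ((G.extendHom O H 0).proj_comm s D).symm

theorem compDer_extend {s t : ZMod 2} (D : Coeffs O ι) {E : Coeffs O ι}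
    (hE : G.projDer O t E = E) :
    (G.sum H).compDer O s t (extend O κ D) (extend O κ E) = extend O κ (G.compDer O s t D E) := by
  refine coeffs_ext fun N => ?_
  rw [tens_extend, (G.sum H).tens_compDer _ (by rw [projDer_extend, hE]), G.tens_compDer D hE]
  simp only [tens_extend, sum_ecomp_extTens, ← map_sum, avg_extTens]
  rfl

theorem commutator_extend (D E : Coeffs O ι) :
    (G.sum H).commutator O (extend O κ D) (extend O κ E) = extend O κ (G.commutator O D E) := by
  simp only [commutator_apply, projDer_extend, G.compDer_extend H _ (G.projDer_self _ _), map_sum,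
    map_sub, map_smul]

theorem dDer_extend (D : Coeffs O ι) : dDer O (extend O κ D) = extend O κ (dDer O D) := by
  refine coeffs_ext fun n => ?_
  rw [tens_extend]
  refine eq_extTens (fun K => ?_) fun K j c hj => ?_
  · rw [tens_dDer, tens_extend, extTens_inl, tens_dDer]
  · rw [tens_dDer, tens_extend, extTens_inr _ hj, map_zero]

variable {G H}

theorem extend_mem_cDer {P : ι → ι → k} {Q : κ → κ → k} (hP : G.IsInverse P) (hQ : H.IsInverse Q)
    {D : Coeffs O ι} (hD : D ∈ G.cDer O) : extend O κ D ∈ (G.sum H).cDer O := by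
  rw [mem_cDer_iff hP] at hD
  rw [mem_cDer_iff (hP.sum hQ)]
  intro n σ
  have h1 : lastMul (G.sum H).gram n (tens n (extend O κ D)) =
      extTens κ n (lastMul G.gram n (tens n D)) := by
    rw [tens_extend]
    exact lastMul_extTens _ _ _
  rw [h1, tact_extTens]
  exact congrArg _ (hD n σ)

/-- A term of arity $n$ has $n+1$ letters, all from $V$ and of weight one. Only constants are light,
and these are excluded. -/
theorem extend_mem_heavyDer {P : ι → ι → k} {Q : κ → κ → k} (hP : G.IsInverse P)
    (hQ : H.IsInverse Q) {D : Coeffs O ι} (hD : D ∈ G.cDer₀ O) :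
    extend O κ D ∈ (G.sum H).heavyDer O (Sum.elim (fun _ => 1) fun _ => 0) := by
  refine ⟨extend_mem_cDer hP hQ hD.1, fun n K hK => ?_⟩
  rw [tens_extend]
  rcases word_cases K with ⟨K', rfl⟩ | ⟨j, c, hj⟩
  · simp only [Sum.elim_inl, Finset.sum_const, Finset.card_univ, Fintype.card_fin, smul_eq_mul,
      mul_one] at hK
    obtain rfl : n = 0 := by omega
    rw [extTens_inl, tens_apply, hD.2]
    rfl
  · exact extTens_inr _ hj

/-- The constant can only be inserted for the letter `c`, which does not occur in a derivation
extended by zero. -/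
theorem commutator_constTens_extend [CharZero k] {c : κ} (hc : H.coordPar c = 1) {a : O.obj 0}
    (ha : a ∈ O.part 0 0) {D : Coeffs O ι} (hD : extend O κ D ∈ (G.sum H).der O) :
    (G.sum H).commutator O (single O 0 (constTens (Sum.inr c) a)) (extend O κ D) = 0 := by
  refine coeffs_ext fun n => ?_
  rw [tens_commutator_constTens (G := G.sum H) (c := Sum.inr c) hc ha hD, tens_extend, map_zero]
  refine (congrArg _ (funext fun K => insConst_eq_zero _ _ ?_)).trans (smul_zero _)
  exact extTens_inr (j := 0) (c := c) _ rfl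

theorem projDer_mem_cDer₀ {P : ι → ι → k} (hP : G.IsInverse P) (t : ZMod 2) {D : Coeffs O ι}
    (hD : D ∈ G.cDer₀ O) : G.projDer O t D ∈ G.cDer₀ O := by
  refine ⟨projDer_mem_cDer hP t hD.1, ?_⟩
  funext a K
  change O.proj 0 _ (D 0 a K) = 0
  rw [hD.2]
  exact map_zero _

end GramData

/-! ## Functoriality of the chains -/

namespace FormalHom

variable {k : Type u} [Field k] {X Y : Type*} [AddCommGroup X] [Module k X] [AddCommGroup Y]
  [Module k Y] {L : FormalSpace k X} {L' : FormalSpace k Y} (f : FormalHom L L')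

theorem coe_pullback {n : ℕ} (ω : L'.cochain n) :
    (f.pullback n ω : FormalSpace.Form k X n) =
      (ω : FormalSpace.Form k Y n).compLinearMap fun _ => f.toLin := rfl

theorem push_apply (z : L.Chain) (n : ℕ) (ω : L'.cochain n) :
    f.push z n ω = z n (f.pullback n ω) := rfl

theorem permute_compLinearMap {n : ℕ} (σ : Equiv.Perm (Fin n)) (ω : FormalSpace.Form k Y n) :
    L.permute σ (ω.compLinearMap fun _ => f.toLin) =
      (L'.permute σ ω).compLinearMap fun _ => f.toLin := by
  ext x
  rw [MultilinearMap.compLinearMap_apply, FormalSpace.permute_apply, FormalSpace.permute_apply]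
  simp only [MultilinearMap.compLinearMap_apply, f.proj_comm]

theorem symm_compLinearMap {n : ℕ} (ω : FormalSpace.Form k Y n) :
    L.symm n (ω.compLinearMap fun _ => f.toLin) =
      (L'.symm n ω).compLinearMap fun _ => f.toLin := by
  ext x
  simp [FormalSpace.symm, permute_compLinearMap]

theorem pullback_dI (hd : ∀ x, f.toLin (L.d x) = L'.d (f.toLin x)) {n : ℕ} (ω : L'.cochain n) :
    L.dI n (f.pullback n ω) = f.pullback n (L'.dI n ω) := by
  apply Subtype.ext
  rw [FormalSpace.coe_dI, coe_pullback, coe_pullback, FormalSpace.coe_dI]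
  cases n with
  | zero => rfl
  | succ n =>
    have h1 : FormalSpace.insMap L.d n
        ((ω : FormalSpace.Form k Y (n + 1)).compLinearMap fun _ => f.toLin) =
        (FormalSpace.insMap L'.d n (ω : FormalSpace.Form k Y (n + 1))).compLinearMap
          fun _ => f.toLin := by
      ext x
      rw [FormalSpace.insMap_apply, MultilinearMap.compLinearMap_apply,
        MultilinearMap.compLinearMap_apply, FormalSpace.insMap_apply, ← hd]
      congr 1
      funext j
      induction j using Fin.cases <;> rfl
    change (n.factorial : k)⁻¹ • L.symm (n + 1) (FormalSpace.insMap L.d n _) = _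
    rw [h1, symm_compLinearMap]
    rfl

theorem shiftBr_map (hbr : ∀ x y, f.toLin (L.br x y) = L'.br (f.toLin x) (f.toLin y)) (x y : X) :
    f.toLin (L.shiftBr x y) = L'.shiftBr (f.toLin x) (f.toLin y) := by
  rw [FormalSpace.shiftBr_apply, FormalSpace.shiftBr_apply, map_sum]
  simp only [map_smul, hbr, f.proj_comm]

theorem pullback_dCE (hbr : ∀ x y, f.toLin (L.br x y) = L'.br (f.toLin x) (f.toLin y)) {n : ℕ}
    (ω : L'.cochain n) : L.dCE n (f.pullback n ω) = f.pullback (n + 1) (L'.dCE n ω) := by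
  apply Subtype.ext
  rw [FormalSpace.coe_dCE, coe_pullback, coe_pullback, FormalSpace.coe_dCE]
  cases n with
  | zero => rfl
  | succ n =>
    have h1 : L.insBr n ((ω : FormalSpace.Form k Y (n + 1)).compLinearMap fun _ => f.toLin) =
        (L'.insBr n (ω : FormalSpace.Form k Y (n + 1))).compLinearMap fun _ => f.toLin := by
      ext x
      rw [FormalSpace.insBr_apply, MultilinearMap.compLinearMap_apply,
        MultilinearMap.compLinearMap_apply, FormalSpace.insBr_apply, ← f.shiftBr_map hbr]
      congr 1
      funext j
      induction j using Fin.cases <;> rfl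
    change ((2 : k) * n.factorial)⁻¹ • L.symm (n + 2) (L.insBr n _) = _
    rw [h1, symm_compLinearMap]
    rfl

theorem boundary_push (hd : ∀ x, f.toLin (L.d x) = L'.d (f.toLin x))
    (hbr : ∀ x y, f.toLin (L.br x y) = L'.br (f.toLin x) (f.toLin y)) (z : L.Chain) :
    L'.boundary (f.push z) = f.push (L.boundary z) := by
  funext n
  ext ω
  rw [FormalSpace.boundary_apply, push_apply, push_apply, push_apply, FormalSpace.boundary_apply,
    f.pullback_dI hd, f.pullback_dCE hbr]

theorem push_mem_chainsOn {S : Submodule k X} {S' : Submodule k Y} (h : ∀ x ∈ S, f.toLin x ∈ S')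
    {z : L.Chain} (hz : z ∈ L.chainsOn S) : f.push z ∈ L'.chainsOn S' := fun n ω hω =>
  hz n _ fun x hx => hω _ fun j => h _ (hx j)

/-- A pushed-forward chain only sees cochains on the image of `S`, where `g` and hence every
derivation extending it vanishes. -/
theorem coderC_push_eq_zero {S : Submodule k X} (hS : ∀ s x, x ∈ S → L.proj s x ∈ S) {g : Y →ₗ[k] Y}
    (hg : ∀ M y, y ∈ L'.fil (M + 1) → g y ∈ L'.fil M) (hgS : ∀ x ∈ S, g (f.toLin x) = 0)
    {z : L.Chain} (hz : z ∈ L.chainsOn S) : L'.coderC g hg (f.push z) = 0 := by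
  funext n
  ext ω
  rw [FormalSpace.coderC_apply, push_apply]
  refine hz n _ fun x hx => ?_
  rw [coe_pullback, MultilinearMap.compLinearMap_apply, FormalSpace.coe_derC]
  refine FormalSpace.derOp_apply_of_map_eq_zero (K := S.map f.toLin) ?_ ?_ _
    fun i => Submodule.mem_map_of_mem (hx i)
  · rintro s _ ⟨x, hx, rfl⟩
    rw [← f.proj_comm]
    exact Submodule.mem_map_of_mem (hS s x hx)
  · rintro _ ⟨x, hx, rfl⟩
    exact hgS x hx

end FormalHom
end CyclicOperadCE

/-! ### The null-homotopy for $V\oplus W$ -/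

theorem claim5p5 {k : Type u} [Field k] [CharZero k]
    -- a cyclic dg operad with an even weakly unital multiplication
    (O : CyclicOperadCE.CyclicDGOperad.{u, v} k) (m₂ : O.obj 2) (hm₂_even : m₂ ∈ O.part 2 0)
    (hm₂ : O.IsWeaklyUnital m₂)
    -- inner product spaces `V` and `W` with homogeneous bases, `W₀ ≠ 0`
    {V : Type*} [AddCommGroup V] [Module k V] (A : CyclicOperadCE.InnerProductSuperspace k V)
    {W : Type*} [AddCommGroup W] [Module k W] (B : CyclicOperadCE.InnerProductSuperspace k W)
    (hW : B.part 0 ≠ ⊥)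
    {ι : Type*} [Fintype ι] [DecidableEq ι] (e : A.HomogeneousBasis ι)
    {κ : Type*} [Fintype κ] [DecidableEq κ] (f : B.HomogeneousBasis κ)
    -- the structure of an uncurved cyclic `C(O)`-algebra on `V` (possibly zero)
    (S : e.gramData.UncurvedCyclicAlgebra O)
    -- a cycle in the reduced chains of the cyclic derivations without constant term
    (z : (e.gramData.derSpace O S.ξ).Chain)
    (hz : z ∈ (e.gramData.derSpace O S.ξ).reducedChainsOn (e.gramData.cDer₀ O))
    (hz_cycle : (e.gramData.derSpace O S.ξ).boundary z = 0) :
    -- its image is the boundary of a reduced chain of the cyclic derivations for `V ⊕ W`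
    ∃ y ∈ ((e.gramData.sum f.gramData).derSpace O
        (CyclicOperadCE.GramData.extend O κ S.ξ)).reducedChainsOn
          ((e.gramData.sum f.gramData).cDer O),
      ((e.gramData.sum f.gramData).derSpace O
        (CyclicOperadCE.GramData.extend O κ S.ξ)).boundary y =
      (e.gramData.extendHom O f.gramData S.ξ).push z := by
  have hP := e.isInverse_gramData
  have hQ := f.isInverse_gramData
  -- An even vector of $W$ has an odd coordinate function, so the derivation sending it to the even
  -- constant `a` is odd and its shift can be raised to powers.
  obtain ⟨c, hc⟩ := f.exists_par_eq_zero hW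
  obtain ⟨m, hm, a, ha, hma, hda⟩ := hm₂.exists_const hm₂_even
  have hcq : f.gramData.coordPar c = 1 := by
    rw [CyclicOperadCE.GramData.coordPar]
    exact (congrArg (· + 1) hc).trans (zero_add 1)
  have hext : ∀ D ∈ e.gramData.cDer₀ O, CyclicOperadCE.GramData.extend O κ D ∈
      (e.gramData.sum f.gramData).heavyDer O (Sum.elim (fun _ => 1) fun _ => 0) :=
    fun D hD => CyclicOperadCE.GramData.extend_mem_heavyDer hP hQ hD
  have hbr := e.gramData.commutator_extend (O := O) f.gramData
  have hd := CyclicOperadCE.GramData.dDer_extend (O := O) (ι := ι) (κ := κ)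
  have hA : ∀ D ∈ e.gramData.cDer₀ O, (e.gramData.sum f.gramData).commutator O
      (CyclicOperadCE.single O 0 (CyclicOperadCE.constTens (Sum.inr c) a))
      (CyclicOperadCE.GramData.extend O κ D) = 0 := fun D hD =>
    CyclicOperadCE.GramData.commutator_constTens_extend hcq ha (hext D hD).1.1
  have hA1 : (e.gramData.sum f.gramData).projDer O 1
      (CyclicOperadCE.single O 0 (CyclicOperadCE.constTens (Sum.inr c) a)) = _ :=
    CyclicOperadCE.GramData.projDer_single _ (CyclicOperadCE.isHomT_constTens (c := Sum.inr c) hcq ha)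
  -- Weight one on $V$ and zero on $W$; the Gram matrix and its inverse are block diagonal, so they
  -- only pair letters of equal weight.
  refine CyclicOperadCE.GramData.exists_boundary_eq_of_heavy (hP.sum hQ)
    (w := Sum.elim (fun _ => 1) fun _ => 0) (c := Sum.inr c) ?_
    (CyclicOperadCE.eq_of_blockSum_ne_zero (fun _ _ _ => rfl) fun _ _ _ => rfl)
    (CyclicOperadCE.eq_of_blockSum_ne_zero (fun _ _ _ => rfl) fun _ _ _ => rfl)
    rfl hcq hm ha hma hda ?_ (hext _ S.mem) ?_ (hA _ S.mem)
    (CyclicOperadCE.FormalHom.push_mem_chainsOn _ hext hz.1) ?_ ?_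
    (CyclicOperadCE.FormalHom.coderC_push_eq_zero _
      (fun s D hD => CyclicOperadCE.GramData.projDer_mem_cDer₀ hP s hD) _ (fun D hD => ?_) hz.1)
  · rintro (_ | _) <;> simp
  · rw [CyclicOperadCE.GramData.projDer_extend, S.odd]
  · rw [hd, hbr, ← map_smul, ← map_add, S.maurerCartan, map_zero]
  · ext ω
    exact LinearMap.congr_fun hz.2 _
  · rw [CyclicOperadCE.FormalHom.boundary_push _ (fun D => ?_) fun D E => (hbr D E).symm,
      hz_cycle, map_zero]
    exact (map_add _ _ _).trans (congrArg₂ _ (hd D).symm (hbr S.ξ D).symm)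
  · rw [CyclicOperadCE.FormalSpace.shiftBr_of_hom (L := (e.gramData.sum f.gramData).derSpace O _) hA1]
    exact (congrArg _ (hA D hD)).trans (smul_zero _)
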